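/- **Setting.** Let $d\ge 2$, let $\square\subset\mathbb R^d$ be a bounded convex polyhedron, and let $(x_i,y_i)$, $i=1,\dots,N$, be data with $x_i\in\square$ and $y_i\in\mathbb R$. For a convex polyhedron $K$ and a pair $d_1<d_2$ of dimensions let $\Pi_{d_1,d_2}(K)$ be the projection of $K$ onto these two dimensions and $PE$ the perimeter of a convex polygon (twice the length for a segment, $0$ for a point). *Cuts.* Given regions $K_1,\dots,K_l$, a cut $(k,(d_1,d_2),\theta,u)$ is sampled as follows: $(k,(d_1,d_2))$ is chosen with probability proportional to $PE(\Pi_{d_1,d_2}(K_k))$; $\theta\in(0,\pi]$ has density proportional to the length of the segment $l(\theta)$ onto which $\Pi_{d_1,d_2}(K_k)$ is projected in direction $\theta$; $u$ is uniform on $l(\theta)$. The cutting hyperplane is parallel to all other dimensions and passes, in the dimensions $(d_1,d_2)$, through $u$ orthogonally to $l(\theta)$; it splits the $k$-th leaf into its two open sides. The waiting time for the cut is exponential with rate $\sum_k\sum_{d_1<d_2}PE(\Pi_{d_1,d_2}(K_k))$ (no cut if this rate is $0$), and the process starts from the single leaf $\square$ and stops at the budget $\tau$. *Two schemes.* In the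 full scheme the regions are the leaves $\square^{(1)},\dots,\square^{(l)}$ themselves; in the hull scheme they are the convex hulls $\triangle^{(k)}$ of the data points in $\square^{(k)}$. In both schemes every leaf, including the root, has a mean parameter with prior $N(0,v)$, $v>0$, independently, and $g(z;\boxplus,\mu)$ is the mean parameter of the leaf that contains $z$. To restrict a tree to the hulls means to keep only the cuts whose hyperplane meets the convex hull of the data in the leaf that is cut (with their times, naming a leaf by its data), and the value of $g$ at the data points. *Sampler.* The model is $y_i=\sum_{j=1}^m g(x_i;\boxplus^{(j)},\mu^{(j)})+\epsilon_i$ with independent $\epsilon_i\sim N(0,\sigma^2)$ and prior $\sigma^2\sim\mathrm{IGamma}(3/2,\lambda)$, $\lambda>0$. Let $0=\tau_0<\tau_1<\dots<\tau_{S+1}=\tau$. One iteration of the MCMC algorithm samples $\sigma^2\sim\mathrm{IGamma}\big(\tfrac{3+N}2,\lambda+\tfrac12\sum_i(y_i-\sum_jg(x_i;\boxplus^{(j)},\mu^{(j)}))^2\big)$ and then updates each tree in turn by conditional sequential Monte Carlo with at least two particles and the segments $(\tau_s,\tau_{s+1}]$, $s=0,\dots,S$. The conditional particle is the current tree up to time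 $\tau_{s+1}$. Every other particle is extended through the segment by the cut process of the chosen scheme, with the mean parameter of each new leaf sampled from its Gaussian posterior given the residuals (labels minus the contributions of the other trees) of the data in that leaf; in the first segment it starts from the uncut domain with a root mean sampled likewise. The weight of a particle is the product of prior density over posterior density of the mean parameters created in the segment, times the ratio of the likelihoods at the end and at the beginning of the segment (in the first segment, the likelihood at its end), computed from the current $\sigma^2$ and residuals. Between segments, ancestors of the non-conditional particles are resampled independently according to the normalized weights, and at the end one particle is drawn according to them. An equilibrium distribution is an invariant probability distribution of this Markov chain. **Proposition.** 1. Given the current leaves $\square^{(1)},\dots,\square^{(l)}$ of any tree, at least one of which contains two distinct data points, the law of the cut of the full scheme, conditioned on its hyperplane meeting $\triangle^{(k)}$ where $k$ is the leaf that is cut, is the law of the cut of the hull scheme (and both schemes give probability laws). 2. For every budget $\tau>0$, the restriction to the hulls of the tree of the full scheme with its mean parameters has the same probability law as that of the tree of the hull scheme. In the hull scheme the restriction almost surely drops no cut. 3. For each of the two schemes the MCMC algorithm has exactly one equilibrium distribution, and the two equilibrium distributions are identical after restriction to the hulls, that is, they give the same joint law to $\sigma^2$ and to the restrictions of the $m$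 trees to the hulls. Under the equilibrium distribution of the hull scheme the restriction almost surely drops no cut. -/

import Mathlib

open MeasureTheory ProbabilityTheory
open scoped NNReal ENNReal

noncomputable section

namespace BSP

/-! ### Polyhedra, planar projections and perimeters -/

/-- Points of `ℝ^d`. -/
abbrev Pt (d : ℕ) := Fin d → ℝ

/-- The Euclidean plane. -/
abbrev Plane := EuclideanSpace ℝ (Fin 2)

/-- Unordered pairs `d₁ < d₂` of dimensions. -/
abbrev Pair (d : ℕ) := {e : Fin d × Fin d // e.1 < e.2}

/-- A bounded convex polyhedron: the convex hull of finitely many points. -/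
def IsPolyhedron {d : ℕ} (P : Set (Pt d)) : Prop :=
  ∃ V : Finset (Pt d), P = convexHull ℝ (V : Set (Pt d))

/-- The projection onto the two dimensions of `e`. -/
def proj {d : ℕ} (e : Pair d) (K : Set (Pt d)) : Set Plane :=
  (fun z : Pt d => (!₂[z e.1.1, z e.1.2] : Plane)) '' K

/-- The unit vector at angle `θ`. -/
def dir (θ : ℝ) : Plane := !₂[Real.cos θ, Real.sin θ]

/-- The face of (the closure of) a planar set with outer normal at angle `φ`. For a polygon it is
an edge or a vertex. -/
def face (K : Set Plane) (φ : ℝ) : Set Plane :=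
  {z | z ∈ closure K ∧ ∀ w ∈ closure K, inner ℝ w (dir φ) ≤ inner ℝ z (dir φ)}

/-- The perimeter of a convex polygon: the sum of the lengths of its edges, indexed by their outer
normals. A segment is a polygon with two coinciding edges, one for each of its two unit normals, so
it has twice its length as perimeter; a point has perimeter `0`. -/
def perimeter (K : Set Plane) : ℝ :=
  ∑ᶠ φ ∈ Set.Ico (0 : ℝ) (2 * Real.pi), Metric.diam (face K φ)

/-! ### The law of one cut -/

/-- The segment `l(θ)` onto which `K` is projected in the direction `θ`, in the coordinate
`r ↦ r (cos θ, sin θ)` of the line through the origin in that direction. -/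
def segment (K : Set Plane) (θ : ℝ) : Set ℝ :=
  (fun z : Plane => inner ℝ z (dir θ)) '' K

/-- The law of `(θ, r)`: the angle `θ ∈ (0, π]` has a density proportional to the length of
`l(θ)`, and given `θ` the position `u = r (cos θ, sin θ)` is uniform on `l(θ)`. -/
def lineLaw (K : Set Plane) : Measure (ℝ × ℝ) :=
  (volume : Measure (ℝ × ℝ)).withDensity fun q =>
    (Set.Ioc (0 : ℝ) Real.pi).indicator
        (fun θ => volume (segment K θ) / ∫⁻ η in Set.Ioc (0 : ℝ) Real.pi, volume (segment K η)) q.1 *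
      (segment K q.1).indicator (fun _ => (volume (segment K q.1))⁻¹) q.2

/-- A cut `((d₁, d₂), θ, r)`. It stands for the hyperplane
`x_{d₁} cos θ + x_{d₂} sin θ = r`, which is parallel to all other dimensions, and which meets the
plane of the dimensions `(d₁, d₂)` in the line through `u = r (cos θ, sin θ)` orthogonal to the
direction `θ`. -/
abbrev Cut (d : ℕ) := Pair d × (ℝ × ℝ)

/-- The linear form of a cut. -/
def Cut.form {d : ℕ} (c : Cut d) (z : Pt d) : ℝ :=
  z c.1.1.1 * Real.cos c.2.1 + z c.1.1.2 * Real.sin c.2.1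

/-- The open half-space on one side of a cut. -/
def Cut.below {d : ℕ} (c : Cut d) : Set (Pt d) := {z | c.form z < c.2.2}

/-- The open half-space on the other side of a cut. -/
def Cut.above {d : ℕ} (c : Cut d) : Set (Pt d) := {z | c.2.2 < c.form z}

/-- The hyperplane of the cut meets `K`. -/
def Cut.Meets {d : ℕ} (c : Cut d) (K : Set (Pt d)) : Prop := ∃ z ∈ K, c.form z = c.2.2

/-- The sum over all pairs of dimensions of the perimeters of the projections. -/
def totalPerimeter {d : ℕ} (K : Set (Pt d)) : ℝ := ∑ e : Pair d, perimeter (proj e K)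

/-- The rate of the next cut of one of the listed regions. -/
def rate {d : ℕ} (R : List (Set (Pt d))) : ℝ := (R.map totalPerimeter).sum

/-- The law of the next cut `(k, (d₁, d₂), θ, r)` of the listed regions: the index `k` and the
pair of dimensions are chosen in proportion to the perimeters of the projections, and then the line
is sampled on the chosen projection. -/
def cutLaw {d : ℕ} (R : List (Set (Pt d))) : Measure (ℕ × Cut d) :=
  ∑ k : Fin R.length, ∑ e : Pair d,
    ENNReal.ofReal (perimeter (proj e (R.get k)) / rate R) •
      (lineLaw (proj e (R.get k))).map fun q => ((k : ℕ), (e, q))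

/-! ### Trees -/

/-- A cutting event `(k, cut, time, (a, b))`: at the given time the `k`-th leaf is cut; the child
below the cut gets the mean parameter `a` and replaces the `k`-th leaf, the child above the cut gets
the mean parameter `b` and is appended to the list of leaves. -/
abbrev Event (d : ℕ) := ℕ × Cut d × ℝ × (ℝ × ℝ)

/-- The Borel structure on lists: a list is its length together with its entries. -/
instance instMeasurableSpaceList {α : Type*} [MeasurableSpace α] : MeasurableSpace (List α) :=
  MeasurableSpace.comap (fun l => (⟨l.length, l.get⟩ : Σ n : ℕ, Fin n → α)) inferInstance

/-- A BSP-tree with mean parameters: the mean parameter of the root and the list of all cutting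
events, the most recent one first. -/
abbrev Tree (d : ℕ) := ℝ × List (Event d)

variable {d N : ℕ}

/-- The current leaves (cells of the partition of `P`) with their mean parameters, given the root
mean `a₀` and the events. -/
def leavesOf (P : Set (Pt d)) (a₀ : ℝ) : List (Event d) → List (Set (Pt d) × ℝ)
  | [] => [(P, a₀)]
  | (k, c, _, (a, b)) :: es =>
      let L := leavesOf P a₀ es
      if h : k < L.length then
        L.set k ((L.get ⟨k, h⟩).1 ∩ c.below, a) ++ [((L.get ⟨k, h⟩).1 ∩ c.above, b)]
      else L

/-- The leaves of a tree. -/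
def leaves (P : Set (Pt d)) (T : Tree d) : List (Set (Pt d) × ℝ) := leavesOf P T.1 T.2

/-- The `k`-th leaf cell. -/
def cell (P : Set (Pt d)) (T : Tree d) (k : ℕ) : Set (Pt d) := ((leaves P T).map Prod.fst).getD k ∅

open scoped Classical in
/-- The indices of the data points in `C`. -/
def dataIn (x : Fin N → Pt d) (C : Set (Pt d)) : Finset (Fin N) := {i | x i ∈ C}

/-- The convex hull of the data points in `C`. -/
def dataHull (x : Fin N → Pt d) (C : Set (Pt d)) : Set (Pt d) := convexHull ℝ (Set.range x ∩ C)

/-- The two ways of generating cuts: on the full polyhedra, or on the convex hulls of the data. -/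
inductive Scheme
  | full
  | hull

/-- The region on which the cut of a leaf `C` is generated. -/
def Scheme.region (x : Fin N → Pt d) : Scheme → Set (Pt d) → Set (Pt d)
  | .full, C => C
  | .hull, C => dataHull x C

/-- The regions of all leaves of a tree. -/
def regions (s : Scheme) (P : Set (Pt d)) (x : Fin N → Pt d) (T : Tree d) : List (Set (Pt d)) :=
  (leaves P T).map fun l => s.region x l.1

open scoped Classical in
/-- The value `g(x; tree)`: the mean parameter of the leaf that contains `z`. -/
def treeValue (P : Set (Pt d)) (T : Tree d) (z : Pt d) : ℝ :=
  ((leaves P T).map fun l => if z ∈ l.1 then l.2 else 0).sum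

open scoped Classical in
/-- The tree up to time `t`. -/
def upTo (T : Tree d) (t : ℝ) : Tree d := (T.1, T.2.filter fun ev => ev.2.2.1 ≤ t)

/-! ### The law of the generative process

Waiting times are exponential with the current rate. The mean parameter of a new leaf which contains
the data with indices in `S` has the law `ν S`. -/

/-- The tree `T` at time `t₀` is continued until time `t₁`; this is the part of its law at time
`t₁` on which exactly the given number of cuts happen in between. -/
def growExactly (s : Scheme) (P : Set (Pt d)) (x : Fin N → Pt d) (ν : Finset (Fin N) → Measure ℝ)
    (t₁ : ℝ) : ℕ → Tree d → ℝ → Measure (Tree d)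
  | 0, T, t₀ => (1 - expMeasure (rate (regions s P x T)) (Set.Iic (t₁ - t₀))) • Measure.dirac T
  | n + 1, T, t₀ =>
      ((expMeasure (rate (regions s P x T))).restrict (Set.Iic (t₁ - t₀))).bind fun w =>
        (cutLaw (regions s P x T)).bind fun kc =>
          ((ν (dataIn x (cell P T kc.1 ∩ kc.2.below))).prod
              (ν (dataIn x (cell P T kc.1 ∩ kc.2.above)))).bind fun ab =>
            growExactly s P x ν t₁ n (T.1, (kc.1, kc.2, t₀ + w, ab) :: T.2) (t₀ + w)

/-- The law at time `t₁` of the process which is at the tree `T` at time `t₀`. -/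
def grow (s : Scheme) (P : Set (Pt d)) (x : Fin N → Pt d) (ν : Finset (Fin N) → Measure ℝ)
    (T : Tree d) (t₀ t₁ : ℝ) : Measure (Tree d) :=
  Measure.sum fun n => growExactly s P x ν t₁ n T t₀

/-- The law at time `t₁` of the process started at time `0` from the uncut domain. -/
def growRoot (s : Scheme) (P : Set (Pt d)) (x : Fin N → Pt d) (ν : Finset (Fin N) → Measure ℝ)
    (t₁ : ℝ) : Measure (Tree d) :=
  (ν (dataIn x P)).bind fun a₀ => grow s P x ν (a₀, []) 0 t₁

/-- The prior on BSP-trees with budget `τ` and mean parameters that are i.i.d. `N(0, v)`. -/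
def treePrior (s : Scheme) (P : Set (Pt d)) (x : Fin N → Pt d) (v : ℝ≥0) (τ : ℝ) :
    Measure (Tree d) :=
  growRoot s P x (fun _ => gaussianReal 0 v) τ

/-! ### Restriction to the convex hulls of the data -/

open scoped Classical in
/-- The cuts that meet the convex hull of the data in the leaf they cut; such a leaf is named by
its data, and each cut is kept with its time. -/
def hullCuts (P : Set (Pt d)) (x : Fin N → Pt d) (a₀ : ℝ) :
    List (Event d) → List (Finset (Fin N) × Cut d × ℝ)
  | [] => []
  | (k, c, t, _) :: es =>
      if c.Meets (dataHull x (cell P (a₀, es) k)) then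
        (dataIn x (cell P (a₀, es) k), c, t) :: hullCuts P x a₀ es
      else hullCuts P x a₀ es

/-- A tree seen on the convex hulls of the data only: the cuts that meet these hulls, and at every
data point the mean parameter of its leaf. -/
abbrev HullTree (d N : ℕ) := List (Finset (Fin N) × Cut d × ℝ) × (Fin N → ℝ)

/-- The restriction of a tree to the convex hulls of the data. -/
def restrictToHulls (P : Set (Pt d)) (x : Fin N → Pt d) (T : Tree d) : HullTree d N :=
  (hullCuts P x T.1 T.2, fun i => treeValue P T (x i))

/-! ### The conditional sequential Monte Carlo sampler for one tree

Here `R i` is the label `y i` minus the contributions of the other trees, `σ2` is the observation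
variance, and `v` is the prior variance of the mean parameters. -/

/-- The variance of the posterior of the mean parameter of a leaf with data `S`. -/
def postVar (v : ℝ≥0) (σ2 : ℝ) (S : Finset (Fin N)) : ℝ := ((v : ℝ)⁻¹ + S.card / σ2)⁻¹

/-- The mean of the posterior of the mean parameter of a leaf with data `S`. -/
def postMean (v : ℝ≥0) (σ2 : ℝ) (R : Fin N → ℝ) (S : Finset (Fin N)) : ℝ :=
  postVar v σ2 S * ((∑ i ∈ S, R i) / σ2)

/-- The posterior of the mean parameter of a leaf with data `S`. -/
def postLaw (v : ℝ≥0) (σ2 : ℝ) (R : Fin N → ℝ) (S : Finset (Fin N)) : Measure ℝ :=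
  gaussianReal (postMean v σ2 R S) (postVar v σ2 S).toNNReal

/-- The prior density over the posterior density of the mean parameter `a` of a leaf with
data `S`. -/
def priorOverPost (v : ℝ≥0) (σ2 : ℝ) (R : Fin N → ℝ) (S : Finset (Fin N)) (a : ℝ) : ℝ :=
  gaussianPDFReal 0 v a / gaussianPDFReal (postMean v σ2 R S) (postVar v σ2 S).toNNReal a

open scoped Classical in
/-- The product of the ratios prior over posterior of all mean parameters that were created by
events after time `t`. -/
def newMeansRatio (P : Set (Pt d)) (x : Fin N → Pt d) (v : ℝ≥0) (σ2 : ℝ) (R : Fin N → ℝ) (t : ℝ)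
    (a₀ : ℝ) : List (Event d) → ℝ
  | [] => 1
  | (k, c, u, (a, b)) :: es =>
      (if t < u then
        priorOverPost v σ2 R (dataIn x (cell P (a₀, es) k ∩ c.below)) a *
          priorOverPost v σ2 R (dataIn x (cell P (a₀, es) k ∩ c.above)) b
      else 1) * newMeansRatio P x v σ2 R t a₀ es

/-- The Gaussian likelihood of the residuals `R`. -/
def likelihood (P : Set (Pt d)) (x : Fin N → Pt d) (σ2 : ℝ) (R : Fin N → ℝ) (T : Tree d) : ℝ :=
  ∏ i, gaussianPDFReal (treeValue P T (x i)) σ2.toNNReal (R i)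

/-- The weight of a particle at the end of the segment `(t j, t (j + 1)]` of the time line. In the
first segment the root mean is new as well, and there is no earlier likelihood to divide by. -/
def weight (P : Set (Pt d)) (x : Fin N → Pt d) (v : ℝ≥0) (t : ℕ → ℝ) (σ2 : ℝ) (R : Fin N → ℝ) :
    ℕ → Tree d → ℝ
  | 0, T =>
      priorOverPost v σ2 R (dataIn x P) T.1 * newMeansRatio P x v σ2 R (t 0) T.1 T.2 *
        likelihood P x σ2 R T
  | j + 1, T =>
      newMeansRatio P x v σ2 R (t (j + 1)) T.1 T.2 *
        likelihood P x σ2 R T / likelihood P x σ2 R (upTo T (t (j + 1)))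

/-- The normalized weights of the particles `0, …, Q`. -/
def normWeight {Q : ℕ} (P : Set (Pt d)) (x : Fin N → Pt d) (v : ℝ≥0) (t : ℕ → ℝ) (σ2 : ℝ)
    (R : Fin N → ℝ) (j : ℕ) (z : Fin (Q + 1) → Tree d) (n : Fin (Q + 1)) : ℝ≥0∞ :=
  ENNReal.ofReal (weight P x v t σ2 R j (z n) / ∑ n', weight P x v t σ2 R j (z n'))

/-- The law of the particles `0, …, Q` at the end of the segment `(t j, t (j + 1)]`. Particle `0`
is the conditional particle `T₀`; every other one is grown from an ancestor that is sampled
according to the normalized weights of the preceding segment. -/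
def particles (s : Scheme) (P : Set (Pt d)) (x : Fin N → Pt d) (v : ℝ≥0) (t : ℕ → ℝ) (Q : ℕ)
    (σ2 : ℝ) (R : Fin N → ℝ) (T₀ : Tree d) : ℕ → Measure (Fin (Q + 1) → Tree d)
  | 0 => Measure.pi fun n =>
      if n = 0 then Measure.dirac (upTo T₀ (t 1)) else growRoot s P x (postLaw v σ2 R) (t 1)
  | j + 1 => (particles s P x v t Q σ2 R T₀ j).bind fun z => Measure.pi fun n =>
      if n = 0 then Measure.dirac (upTo T₀ (t (j + 2))) else
        ∑ n', normWeight P x v t σ2 R j z n' •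
          grow s P x (postLaw v σ2 R) (z n') (t (j + 1)) (t (j + 2))

/-- The law of the tree returned by the sampler with the segments `0, …, S`, given that the tree of
the preceding iteration is `T₀`. -/
def csmc (s : Scheme) (P : Set (Pt d)) (x : Fin N → Pt d) (v : ℝ≥0) (t : ℕ → ℝ) (Q S : ℕ)
    (σ2 : ℝ) (R : Fin N → ℝ) (T₀ : Tree d) : Measure (Tree d) :=
  (particles s P x v t Q σ2 R T₀ S).bind fun z =>
    ∑ n, normWeight P x v t σ2 R S z n • Measure.dirac (z n)

/-! ### The Markov chain for the forest -/

/-- A state of the chain: the observation variance and `m` trees with their mean parameters. -/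
abbrev State (d m : ℕ) := ℝ × (Fin m → Tree d)

variable {m : ℕ}

/-- The inverse Gamma law with shape `a` and scale `b`. -/
def invGamma (a b : ℝ) : Measure ℝ := (gammaMeasure a b).map fun z => z⁻¹

/-- Sampling the observation variance from its full conditional law. -/
def varianceStep (P : Set (Pt d)) (x : Fin N → Pt d) (y : Fin N → ℝ) (lam : ℝ) (st : State d m) :
    Measure (State d m) :=
  (invGamma ((3 + N) / 2)
      (lam + (∑ i, (y i - ∑ j, treeValue P (st.2 j) (x i)) ^ 2) / 2)).map fun σ2 => (σ2, st.2)

/-- Updating the `j`-th tree. -/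
def treeStep (s : Scheme) (P : Set (Pt d)) (x : Fin N → Pt d) (y : Fin N → ℝ) (v : ℝ≥0)
    (t : ℕ → ℝ) (Q S : ℕ) (j : Fin m) (st : State d m) : Measure (State d m) :=
  (csmc s P x v t Q S st.1
      (fun i => y i - ∑ j' ∈ Finset.univ.erase j, treeValue P (st.2 j') (x i)) (st.2 j)).map
    fun T => (st.1, Function.update st.2 j T)

/-- One iteration of the chain: first the variance, and then all the trees one after the other. -/
def sweep (s : Scheme) (P : Set (Pt d)) (x : Fin N → Pt d) (y : Fin N → ℝ) (v : ℝ≥0) (lam : ℝ)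
    (t : ℕ → ℝ) (Q S : ℕ) (st : State d m) : Measure (State d m) :=
  (List.finRange m).foldl (fun μ j => μ.bind (treeStep s P x y v t Q S j))
    (varianceStep P x y lam st)

/-- The equilibrium distributions of a chain with transition law `K`. -/
def IsEquilibrium {E : Type*} [MeasurableSpace E] (K : E → Measure E) (π : Measure E) : Prop :=
  IsProbabilityMeasure π ∧ π.bind K = π

/-- The restriction of a state to the convex hulls of the data. -/
def restrictState (P : Set (Pt d)) (x : Fin N → Pt d) (st : State d m) :
    ℝ × (Fin m → HullTree d N) :=
  (st.1, fun j => restrictToHulls P x (st.2 j))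

end BSP

end

/-!
**Cuts.** By Cauchy's formula, the perimeter of a convex polygon is the integral of its widths over
all directions. Hence the perimeter times the law of the cutting line is the Lebesgue measure
`dθ du` on the lines that hit the polygon (`smul_lineLaw`), and, up to normalization, the law of a
cut is the sum over the leaves of the measures `hitMeasure` of their regions. For a hull inside a
leaf, the measure of the hull is the restriction of the measure of the leaf to the cuts that meet
the hull (`hitMeasure_restrict`, `cutIntensity_restrict`), which is the statement about one cut
(`cond_cutLaw`).

**Trees.** The growth of a tree is a jump process with intensity `cutIntensity`, and the expectation
of a bounded function of the final tree is the only bounded solution of a renewal equation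
(`lintegral_grow_unique`). Up to the mean parameters, a cut that misses the hull changes nothing on
the hulls; so in the full scheme the cuts that count are those of the hull scheme, and the others are
further ticks of an exponential clock, which leave the solution of the renewal equation unchanged
(`renewal_thinning`). Such a cut gives a new mean parameter to the data of the leaf, but this does
not change their joint law, because resampling all mean parameters from the prior does not change
the law of the tree; given the cuts, the values on the blocks of data that the leaves contain are
then i.i.d. (`lintegral_resample_values`). Together these give `map_restrictToHulls_growRoot`.

**Sampler.** The equilibrium distribution is the posterior distribution, normalized prior times
likelihood. The update of the variance preserves it because the inverse Gamma prior is conjugate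
(`lintegral_gaussian_invGamma`). For the update of a tree, the weights turn the law of the proposals
into the law with density the likelihood with respect to the prior (`lintegral_target_eq_weight`).
If the conditional particle has this law, then the joint law of all particles is an exchangeable law
reweighted by the weight of one particle (`exchangeable_extendedLaw`, `lintegral_target_particles`),
so that the particle may be replaced by one drawn according to the weights (`lintegral_target_csmc`).

The equilibrium distribution is unique because, from every state, an iteration reaches all forests
without cuts: one nonzero measure is absolutely continuous with respect to all transition laws
(`absolutelyContinuous_sweep`, `IsEquilibrium.unique`). Finally, the likelihood depends on a forest
only through its restriction to the hulls, so the equality of the restricted priors carries over to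
the posteriors (`map_restrictState_posterior`).
-/

namespace BSP

/-! ### Measurability of functions of lists -/

section Lists

variable {α β γ : Type*} [MeasurableSpace α] [MeasurableSpace β] [MeasurableSpace γ]

theorem measurable_ofFn (n : ℕ) : Measurable (fun u : Fin n → α => List.ofFn u) := by
  refine measurable_comap_iff.2 ?_
  have h : (fun l : List α => (⟨l.length, l.get⟩ : Σ n : ℕ, Fin n → α)) ∘
      (fun u : Fin n → α => List.ofFn u) =
      fun u => ⟨n, u⟩ := by
    funext u
    exact (List.equivSigmaTuple (α := α)).right_inv ⟨n, u⟩
  rw [h]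
  refine Measurable.of_le_map ?_
  exact iInf_le _ n

/-- The lists of each fixed length form a measurable piece of the space of lists, so measurability
can be checked length by length. -/
theorem measurable_of_ofFn {f : List α → β}
    (h : ∀ n, Measurable (fun u : Fin n → α => f (List.ofFn u))) : Measurable f := by
  have : f = (fun s : Σ n : ℕ, Fin n → α => f (List.ofFn s.2)) ∘
      (fun l : List α => (⟨l.length, l.get⟩ : Σ n : ℕ, Fin n → α)) := by
    funext l
    simp
  rw [this]
  refine Measurable.comp ?_ (comap_measurable _)
  intro s hs
  rw [MeasurableSpace.measurableSet_iInf]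
  intro n
  exact h n hs

theorem measurable_list_length : Measurable (fun l : List α => l.length) :=
  measurable_of_ofFn fun n => by simp

theorem measurable_list_getD [Inhabited α] (k : ℕ) :
    Measurable (fun l : List α => l.getD k default) := by
  refine measurable_of_ofFn fun n => ?_
  by_cases hk : k < n
  · have : (fun u : Fin n → α => (List.ofFn u).getD k default) = fun u => u ⟨k, hk⟩ := by
      funext u
      simp [List.getD_eq_getElem?_getD, hk]
    rw [this]
    exact measurable_pi_apply _
  · have : (fun u : Fin n → α => (List.ofFn u).getD k default) = fun _ => default := by
      funext u
      simp [List.getD_eq_getElem?_getD, hk]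
    rw [this]
    exact measurable_const

theorem measurable_prod_of_ofFn {f : γ × List α → β}
    (h : ∀ n, Measurable (fun p : γ × (Fin n → α) => f (p.1, List.ofFn p.2))) :
    Measurable f := by
  rcases isEmpty_or_nonempty α with hα | ⟨⟨a⟩⟩
  · have : f = (fun p : γ × (Fin 0 → α) => f (p.1, List.ofFn p.2)) ∘
        (fun p : γ × List α => (p.1, Fin.elim0)) := by
      funext ⟨c, l⟩
      cases l with
      | nil => simp
      | cons b l => exact hα.elim b
    rw [this]
    exact (h 0).comp (measurable_fst.prodMk measurable_const)
  · let : Inhabited α := ⟨a⟩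
    intro s hs
    have : f ⁻¹' s = ⋃ n : ℕ, ((fun p : γ × List α => p.2.length) ⁻¹' {n}) ∩
        ((fun p : γ × List α => f (p.1, List.ofFn fun i : Fin n => p.2.getD i default)) ⁻¹' s) := by
      ext ⟨c, l⟩
      have key : (List.ofFn fun i : Fin l.length => l.getD (i : ℕ) default) = l := by
        apply List.ext_getElem <;> simp [List.getD_eq_getElem?_getD]
      simp only [Set.mem_preimage, Set.mem_iUnion, Set.mem_inter_iff, Set.mem_singleton_iff]
      constructor
      · intro hm
        exact ⟨l.length, rfl, by rw [key]; exact hm⟩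
      · rintro ⟨n, rfl, hm⟩
        rwa [key] at hm
    rw [this]
    refine MeasurableSet.iUnion fun n => ?_
    refine MeasurableSet.inter ((measurable_list_length.comp measurable_snd) (by measurability)) ?_
    exact ((h n).comp (measurable_fst.prodMk (measurable_pi_lambda _ fun i =>
      (measurable_list_getD (i : ℕ)).comp measurable_snd))) hs

theorem measurable_cons : Measurable (fun p : α × List α => p.1 :: p.2) := by
  refine measurable_prod_of_ofFn fun n => ?_
  have : (fun p : α × (Fin n → α) => p.1 :: List.ofFn p.2) =
      (fun u : Fin (n + 1) → α => List.ofFn u) ∘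
        fun p : α × (Fin n → α) => (Fin.cons p.1 p.2 : Fin (n + 1) → α) := by
    funext p
    simp [List.ofFn_succ]
  rw [this]
  refine (measurable_ofFn _).comp (measurable_pi_lambda _ fun i => ?_)
  refine Fin.cases ?_ (fun j => ?_) i
  · simpa using measurable_fst
  · simp only [Fin.cons_succ]
    fun_prop

/-- A function that is defined by recursion on a list, with a measurable recursion step, is
measurable. -/
theorem measurable_list_rec {f : γ → List α → β} (h0 : Measurable fun c => f c [])
    {g : γ × α × List α × β → β} (hg : Measurable g)
    (h : ∀ c a l, f c (a :: l) = g (c, a, l, f c l)) :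
    Measurable (fun p : γ × List α => f p.1 p.2) := by
  refine measurable_prod_of_ofFn fun n => ?_
  induction n with
  | zero =>
    simp only [List.ofFn_zero]
    exact h0.comp measurable_fst
  | succ n ih =>
    have e : (fun p : γ × (Fin (n + 1) → α) => f p.1 (List.ofFn p.2)) = fun p =>
        g (p.1, p.2 0, List.ofFn (fun i : Fin n => p.2 i.succ),
          f p.1 (List.ofFn (fun i : Fin n => p.2 i.succ))) := by
      funext p
      rw [List.ofFn_succ, h]
    have ht : Measurable fun p : γ × (Fin (n + 1) → α) => fun i : Fin n => p.2 i.succ :=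
      measurable_pi_lambda _ fun i => (measurable_pi_apply _).comp measurable_snd
    rw [e]
    exact hg.comp (measurable_fst.prodMk (((measurable_pi_apply 0).comp measurable_snd).prodMk
      (((measurable_ofFn n).comp ht).prodMk (ih.comp (measurable_fst.prodMk ht)))))

end Lists

/-! ### Families of measures that depend measurably on a parameter -/

section Params

variable {A B C : Type*} [MeasurableSpace A] [MeasurableSpace B] [MeasurableSpace C]

/-- The bound on the masses makes the family a finite kernel. -/
theorem measurable_lintegral_param {μ : A → Measure B} (hμ : Measurable μ)
    (h1 : ∀ a, μ a Set.univ ≤ 1) {f : A × B → ℝ≥0∞} (hf : Measurable f) :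
    Measurable fun a => ∫⁻ b, f (a, b) ∂μ a := by
  let κ : Kernel A B := ⟨μ, hμ⟩
  have : IsFiniteKernel κ := ⟨⟨1, ENNReal.one_lt_top, h1⟩⟩
  exact Measurable.lintegral_kernel_prod_right' (κ := κ) hf

theorem measurable_bind_param {μ : A → Measure B} (hμ : Measurable μ)
    (h1 : ∀ a, μ a Set.univ ≤ 1) {κ : A × B → Measure C} (hκ : Measurable κ) :
    Measurable fun a => (μ a).bind fun b => κ (a, b) := by
  refine Measure.measurable_of_measurable_coe _ fun s hs => ?_
  have : (fun a => ((μ a).bind fun b => κ (a, b)) s) = fun a => ∫⁻ b, κ (a, b) s ∂μ a := by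
    funext a
    exact Measure.bind_apply hs (hκ.comp measurable_prodMk_left).aemeasurable
  rw [this]
  exact measurable_lintegral_param hμ h1 ((Measure.measurable_coe hs).comp hκ)

theorem measurable_map_param {μ : A → Measure B} (hμ : Measurable μ)
    (h1 : ∀ a, μ a Set.univ ≤ 1) {f : A × B → C} (hf : Measurable f) :
    Measurable fun a => (μ a).map fun b => f (a, b) := by
  have h := measurable_bind_param hμ h1 (Measure.measurable_dirac.comp hf)
  have e : (fun a => (μ a).map fun b => f (a, b)) =
      fun a => (μ a).bind fun b => (Measure.dirac ∘ f) (a, b) := by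
    funext a
    exact (Measure.bind_dirac_eq_map _ (hf.comp measurable_prodMk_left)).symm
  rw [e]; exact h

theorem measurable_smul_param {c : A → ℝ≥0∞} (hc : Measurable c) {μ : A → Measure B}
    (hμ : Measurable μ) : Measurable fun a => c a • μ a :=
  Measure.measurable_of_measurable_coe _ fun s hs => by
    simp only [Measure.smul_apply, smul_eq_mul]
    exact hc.mul ((Measure.measurable_coe hs).comp hμ)

theorem measurable_sum_param {ι : Type*} [Countable ι] {μ : ι → A → Measure B}
    (hμ : ∀ i, Measurable (μ i)) : Measurable fun a => Measure.sum fun i => μ i a :=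
  Measure.measurable_of_measurable_coe _ fun s hs => by
    simpa [Measure.sum_apply _ hs] using
      Measurable.tsum fun i => (Measure.measurable_coe hs).comp (hμ i)

theorem measurable_finset_sum_param {ι : Type*} (u : Finset ι) {μ : ι → A → Measure B}
    (hμ : ∀ i, Measurable (μ i)) : Measurable fun a => ∑ i ∈ u, μ i a :=
  Measure.measurable_of_measurable_coe _ fun s hs => by
    simpa [Measure.finsetSum_apply] using
      Finset.measurable_fun_sum u fun i _ => (Measure.measurable_coe hs).comp (hμ i)

theorem measurable_prod_param {μ : A → Measure B} {ν : A → Measure C} (hμ : Measurable μ)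
    (hν : Measurable ν) (h1 : ∀ a, IsProbabilityMeasure (μ a))
    (h2 : ∀ a, IsProbabilityMeasure (ν a)) :
    Measurable fun a => (μ a).prod (ν a) := by
  let κ : Kernel A B := ⟨μ, hμ⟩
  let η : Kernel A C := ⟨ν, hν⟩
  have : IsMarkovKernel κ := ⟨h1⟩
  have : IsMarkovKernel η := ⟨h2⟩
  have : (fun a => (μ a).prod (ν a)) = fun a => (κ ×ₖ η) a := by
    funext a
    rw [Kernel.prod_apply]; rfl
  rw [this]
  exact (κ ×ₖ η).measurable

theorem measurable_pi_param {ι : Type*} [Fintype ι] {μ : ι → A → Measure B}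
    (hμ : ∀ i, Measurable (μ i)) (h1 : ∀ i a, μ i a Set.univ ≤ 1) :
    Measurable fun a => Measure.pi fun i => μ i a := by
  have : ∀ i a, IsFiniteMeasure (μ i a) := fun i a => ⟨(h1 i a).trans_lt ENNReal.one_lt_top⟩
  refine Measurable.measure_of_isPiSystem generateFrom_pi.symm
    (isPiSystem_pi (α := fun _ : ι => B)) ?_ ?_
  · rintro _ ⟨s, hs, rfl⟩
    simp only [Measure.pi_pi]
    exact Finset.measurable_fun_prod _ fun i _ =>
      (Measure.measurable_coe (hs i (Set.mem_univ i))).comp (hμ i)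
  · simp only [Measure.pi_univ]
    exact Finset.measurable_fun_prod _ fun i _ =>
      (Measure.measurable_coe MeasurableSet.univ).comp (hμ i)

theorem measurable_update_param {ι : Type*} [DecidableEq ι] (j : ι) :
    Measurable fun p : (ι → B) × B => Function.update p.1 j p.2 := by
  refine measurable_pi_lambda _ fun i => ?_
  by_cases h : i = j
  · subst h; simpa using measurable_snd
  · simp only [Function.update_of_ne h]
    fun_prop

/-- Resampling one coordinate of a product law changes the law of this coordinate only. -/
theorem map_update_pi_eq {ι : Type*} [Fintype ι] [DecidableEq ι] (μ : ι → Measure B)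
    [∀ i, IsProbabilityMeasure (μ i)] (j : ι) (α : Measure B) [IsProbabilityMeasure α] :
    ((Measure.pi μ).prod α).map (fun p => Function.update p.1 j p.2) =
      Measure.pi (Function.update μ j α) := by
  have hm := measurable_update_param (B := B) j
  have : ∀ i, IsProbabilityMeasure (Function.update μ j α i) := by
    intro i
    by_cases hi : i = j
    · subst hi; rw [Function.update_self]; infer_instance
    · rw [Function.update_of_ne hi]; infer_instance
  refine (Measure.pi_eq fun s hs => ?_).symm
  rw [Measure.map_apply hm (MeasurableSet.univ_pi hs)]
  have e : (fun p : (ι → B) × B => Function.update p.1 j p.2) ⁻¹' Set.univ.pi s =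
      (Set.univ.pi (Function.update s j Set.univ)) ×ˢ s j := by
    ext ⟨p, b⟩
    simp only [Set.mem_preimage, Set.mem_univ_pi, Set.mem_prod]
    constructor
    · intro h
      refine ⟨fun i => ?_, by simpa using h j⟩
      by_cases hi : i = j
      · subst hi; simp
      · simpa [Function.update_of_ne hi] using h i
    · rintro ⟨h1, h2⟩ i
      by_cases hi : i = j
      · subst hi; simpa using h2
      · simpa [Function.update_of_ne hi] using h1 i
  rw [e, Measure.prod_prod, Measure.pi_pi, ← Finset.prod_erase_mul _ _ (Finset.mem_univ j),
    ← Finset.prod_erase_mul _ _ (Finset.mem_univ j)]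
  simp only [Function.update_self, measure_univ, mul_one]
  congr 1
  refine Finset.prod_congr rfl fun i hi => ?_
  rw [Function.update_of_ne (Finset.ne_of_mem_erase hi),
    Function.update_of_ne (Finset.ne_of_mem_erase hi)]

theorem map_update_pi {ι : Type*} [Fintype ι] [DecidableEq ι] (μ : ι → Measure B)
    [∀ i, IsProbabilityMeasure (μ i)] (j : ι) :
    ((Measure.pi μ).prod (μ j)).map (fun p => Function.update p.1 j p.2) = Measure.pi μ := by
  rw [map_update_pi_eq, Function.update_eq_self]

theorem map_comp_perm_pi {ι : Type*} [Fintype ι] (μ : Measure B) [IsFiniteMeasure μ]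
    (e : Equiv.Perm ι) :
    (Measure.pi fun _ : ι => μ).map (fun z i => z (e i)) = Measure.pi fun _ : ι => μ := by
  have hm : Measurable fun (z : ι → B) i => z (e i) :=
    measurable_pi_lambda _ fun i => measurable_pi_apply _
  refine (Measure.pi_eq fun s hs => ?_).symm
  rw [Measure.map_apply hm (MeasurableSet.univ_pi hs)]
  have : (fun (z : ι → B) i => z (e i)) ⁻¹' Set.univ.pi s =
      Set.univ.pi fun i => s (e.symm i) := by
    ext z
    simp only [Set.mem_preimage, Set.mem_univ_pi]
    exact ⟨fun h i => by simpa using h (e.symm i), fun h i => by simpa using h (e i)⟩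
  rw [this, Measure.pi_pi]
  exact Equiv.prod_comp e.symm fun i => μ (s i)

end Params

/-! ### Uniqueness of the equilibrium distribution -/

/-- A chain for which one nonzero measure is absolutely continuous with respect to all transition
laws has at most one equilibrium distribution: the positive and the negative part of the difference
of two such distributions would be invariant and mutually singular. -/
theorem IsEquilibrium.unique {E : Type*} [MeasurableSpace E] {K : E → Measure E}
    (hK : Measurable K) (h1 : ∀ a, K a Set.univ ≤ 1) {ρ : Measure E} (hρ : ρ ≠ 0)
    (hac : ∀ a, ρ ≪ K a) {μ ν : Measure E} (hμ : IsEquilibrium K μ) (hν : IsEquilibrium K ν) :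
    μ = ν := by
  have := hμ.1
  have := hν.1
  have hle : ∀ μ ν : Measure E, IsEquilibrium K μ → IsEquilibrium K ν → μ ≤ (μ - ν) + ν := by
    intro μ ν hμ hν
    have := hμ.1
    have := hν.1
    -- Subtraction of measures is explicit on each side of a Hahn decomposition.
    obtain ⟨s, hs⟩ := exists_isHahnDecomposition μ ν
    have hsc := hs.compl
    have r1 : μ.restrict s ≤ ((μ - ν) + ν).restrict s := by
      rw [Measure.restrict_add]
      exact hs.le_on.trans (Measure.le_add_left le_rfl)
    have r2 : μ.restrict sᶜ ≤ ((μ - ν) + ν).restrict sᶜ := by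
      rw [Measure.restrict_add,
        Measure.restrict_sub_eq_restrict_sub_restrict hs.measurableSet.compl,
        Measure.sub_add_cancel_of_le hsc.le_on]
    calc μ = μ.restrict s + μ.restrict sᶜ :=
          (Measure.restrict_add_restrict_compl hs.measurableSet).symm
      _ ≤ ((μ - ν) + ν).restrict s + ((μ - ν) + ν).restrict sᶜ := add_le_add r1 r2
      _ = _ := Measure.restrict_add_restrict_compl hs.measurableSet
  have hbadd : ∀ α β : Measure E, (α + β).bind K = α.bind K + β.bind K := by
    intro α β
    refine Measure.ext fun s hs => ?_
    rw [Measure.add_apply, Measure.bind_apply hs hK.aemeasurable,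
      Measure.bind_apply hs hK.aemeasurable, Measure.bind_apply hs hK.aemeasurable,
      lintegral_add_measure]
  have hbmono : ∀ α β : Measure E, α ≤ β → α.bind K ≤ β.bind K := by
    intro α β h
    refine Measure.le_iff.2 fun s hs => ?_
    rw [Measure.bind_apply hs hK.aemeasurable, Measure.bind_apply hs hK.aemeasurable]
    exact lintegral_mono' h le_rfl
  have key : ∀ μ ν : Measure E, IsEquilibrium K μ → IsEquilibrium K ν → μ - ν ≠ 0 →
      ρ ≪ μ - ν := by
    intro μ ν hμ hν h0
    have := hμ.1
    have := hν.1
    have : IsFiniteMeasure (μ - ν) := isFiniteMeasure_of_le μ Measure.sub_le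
    have hinv : (μ - ν).bind K = μ - ν := by
      have h2 : μ - ν ≤ (μ - ν).bind K := by
        refine Measure.sub_le_of_le_add ?_
        have := hbmono _ _ (hle μ ν hμ hν)
        rwa [hbadd, hμ.2, hν.2] at this
      refine (Measure.eq_of_le_of_measure_univ_eq h2 (le_antisymm (h2 _) ?_)).symm
      rw [Measure.bind_apply MeasurableSet.univ hK.aemeasurable]
      calc ∫⁻ a, K a Set.univ ∂(μ - ν) ≤ ∫⁻ _, 1 ∂(μ - ν) := lintegral_mono h1
        _ = _ := by simp
    refine Measure.AbsolutelyContinuous.mk fun s hs hz => ?_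
    rw [← hinv, Measure.bind_apply hs hK.aemeasurable,
      lintegral_eq_zero_iff (by exact (Measure.measurable_coe hs).comp hK)] at hz
    have : (ae (μ - ν)).NeBot := ae_neBot.2 h0
    obtain ⟨a, ha⟩ := hz.exists
    exact hac a ha
  by_cases h0 : μ - ν = 0
  · have h2 := hle μ ν hμ hν
    rw [h0, zero_add] at h2
    exact Measure.eq_of_le_of_measure_univ_eq h2 (by simp)
  by_cases h0' : ν - μ = 0
  · have h2 := hle ν μ hν hμ
    rw [h0', zero_add] at h2
    exact (Measure.eq_of_le_of_measure_univ_eq h2 (by simp)).symm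
  have hs : (μ - ν).MutuallySingular (ν - μ) := Measure.mutually_singular_measure_sub
  obtain ⟨s, _, hs1, hs2⟩ := hs
  exact absurd (Measure.measure_univ_eq_zero.1 (le_antisymm (by
    rw [← Set.union_compl_self s]
    refine (measure_union_le _ _).trans ?_
    rw [key μ ν hμ hν h0 hs1, key ν μ hν hμ h0' hs2, add_zero]) bot_le)) hρ

/-! ### Cauchy's formula for the perimeter of a polygon -/

section Cauchy

open Filter Topology

/-- The coordinate of a point of the plane in the direction `φ`. -/
noncomputable def coord (z : Plane) (φ : ℝ) : ℝ := z 0 * Real.cos φ + z 1 * Real.sin φ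

/-- The coordinate of a point of the plane in the direction `φ + π / 2`, which is the derivative
of `coord z` at `φ`. -/
noncomputable def coord' (z : Plane) (φ : ℝ) : ℝ := -(z 0 * Real.sin φ) + z 1 * Real.cos φ

theorem inner_dir (z : Plane) (φ : ℝ) : inner ℝ z (dir φ) = coord z φ := by
  simp [dir, coord, PiLp.inner_apply, Fin.sum_univ_two, mul_comm]

theorem hasDerivAt_coord (z : Plane) (φ : ℝ) : HasDerivAt (coord z) (coord' z φ) φ := by
  have h := ((Real.hasDerivAt_cos φ).const_mul (z 0)).add ((Real.hasDerivAt_sin φ).const_mul (z 1))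
  exact HasDerivAt.congr_deriv (f := coord z) h (by simp [coord'])

theorem hasDerivAt_coord' (z : Plane) (φ : ℝ) : HasDerivAt (coord' z) (-coord z φ) φ := by
  have h := ((Real.hasDerivAt_sin φ).const_mul (z 0)).neg.add
    ((Real.hasDerivAt_cos φ).const_mul (z 1))
  exact HasDerivAt.congr_deriv (f := coord' z) h (by simp [coord]; ring)

theorem continuous_coord (z : Plane) : Continuous (coord z) :=
  continuous_iff_continuousAt.2 fun φ => (hasDerivAt_coord z φ).continuousAt

theorem integral_coord (z : Plane) (a b : ℝ) :
    ∫ φ in a..b, coord z φ = coord' z a - coord' z b := by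
  have h := intervalIntegral.integral_eq_sub_of_hasDerivAt
    (f := fun φ => -coord' z φ) (f' := coord z) (a := a) (b := b)
    (fun φ _ => HasDerivAt.congr_deriv (hasDerivAt_coord' z φ).neg (neg_neg _))
    ((continuous_coord z).intervalIntegrable a b)
  rw [h]; ring

theorem coord_eq_of_eq {z w : Plane} {φ : ℝ} (h : coord z φ = coord w φ)
    (h' : coord' z φ = coord' w φ) : z = w := by
  have h2 := Real.sin_sq_add_cos_sq φ
  simp only [coord, coord'] at h h'
  ext i
  fin_cases i
  · simp only [Fin.zero_eta]
    linear_combination Real.cos φ * h - Real.sin φ * h' + (w 0 - z 0) * h2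
  · simp only [Fin.mk_one]
    linear_combination Real.sin φ * h + Real.cos φ * h' + (w 1 - z 1) * h2

theorem dist_eq_of_coord_eq {z w : Plane} {φ : ℝ} (h : coord z φ = coord w φ) :
    dist z w = |coord' z φ - coord' w φ| := by
  have h2 := Real.sin_sq_add_cos_sq φ
  simp only [coord, coord'] at h ⊢
  rw [EuclideanSpace.dist_eq, Fin.sum_univ_two, Real.dist_eq, Real.dist_eq, sq_abs, sq_abs,
    ← Real.sqrt_sq_eq_abs]
  congr 1
  linear_combination (-(z 0 - w 0) ^ 2 - (z 1 - w 1) ^ 2) * h2 +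
    ((z 0 - w 0) * Real.cos φ + (z 1 - w 1) * Real.sin φ) * h

theorem coord_sum (V : Finset Plane) (w : Plane → ℝ) (φ : ℝ) :
    coord (∑ y ∈ V, w y • y) φ = ∑ y ∈ V, w y * coord y φ := by
  simp [coord, mul_add, Finset.sum_add_distrib, Finset.sum_mul, mul_assoc]

theorem coord'_sum (V : Finset Plane) (w : Plane → ℝ) (φ : ℝ) :
    coord' (∑ y ∈ V, w y • y) φ = ∑ y ∈ V, w y * coord' y φ := by
  simp [coord', mul_add, Finset.sum_add_distrib, Finset.sum_mul, mul_assoc]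

variable {V : Finset Plane} (hV : V.Nonempty)

/-- The support function of a finite set of points. -/
noncomputable def supp (φ : ℝ) : ℝ := V.sup' hV fun v => coord v φ

theorem coord_le_supp {v : Plane} (hv : v ∈ V) (φ : ℝ) : coord v φ ≤ supp hV φ :=
  Finset.le_sup' (fun v => coord v φ) hv

theorem exists_coord_eq_supp (φ : ℝ) : ∃ v ∈ V, coord v φ = supp hV φ := by
  obtain ⟨v, hv, h⟩ := Finset.exists_mem_eq_sup' hV fun v => coord v φ
  exact ⟨v, hv, h.symm⟩

theorem continuous_supp : Continuous (supp hV) :=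
  Continuous.finset_sup'_apply hV fun v _ => continuous_coord v

open scoped Classical in
/-- The points at which the coordinate in the direction `φ` is maximal. -/
noncomputable def tops (φ : ℝ) : Finset Plane := V.filter fun v => coord v φ = supp hV φ

theorem tops_nonempty (φ : ℝ) : (tops hV φ).Nonempty := by
  obtain ⟨v, hv, h⟩ := exists_coord_eq_supp hV φ
  exact ⟨v, by simp [tops, hv, h]⟩

/-- The right derivative of the support function. -/
noncomputable def suppR (φ : ℝ) : ℝ := (tops hV φ).sup' (tops_nonempty hV φ) fun v => coord' v φ

/-- The left derivative of the support function. -/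
noncomputable def suppL (φ : ℝ) : ℝ := (tops hV φ).inf' (tops_nonempty hV φ) fun v => coord' v φ

theorem mem_tops {φ : ℝ} {v : Plane} : v ∈ tops hV φ ↔ v ∈ V ∧ coord v φ = supp hV φ := by
  simp [tops]

theorem tops_eq_singleton {φ : ℝ} {v : Plane} (hv : v ∈ V)
    (h : ∀ w ∈ V, w ≠ v → coord w φ < coord v φ) :
    supp hV φ = coord v φ ∧ suppR hV φ = coord' v φ ∧ suppL hV φ = coord' v φ := by
  have h1 : supp hV φ = coord v φ := by
    refine le_antisymm (Finset.sup'_le _ _ fun w hw => ?_) (coord_le_supp hV hv φ)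
    by_cases e : w = v
    · rw [e]
    · exact (h w hw e).le
  have h2 : ∀ w, w ∈ tops hV φ ↔ w = v := by
    intro w
    rw [mem_tops, h1]
    refine ⟨fun hw => ?_, fun hw => by rw [hw]; exact ⟨hv, rfl⟩⟩
    by_contra e
    exact (h w hw.1 e).ne hw.2
  refine ⟨h1, le_antisymm ?_ ?_, le_antisymm ?_ ?_⟩
  · exact Finset.sup'_le _ _ fun w hw => by rw [(h2 w).1 hw]
  · exact Finset.le_sup' (fun w => coord' w φ) ((h2 v).2 rfl)
  · exact Finset.inf'_le (fun w => coord' w φ) ((h2 v).2 rfl)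
  · exact Finset.le_inf' _ _ fun w hw => by rw [(h2 w).1 hw]

/-- Just to the right of each angle a single point is on top: among the points on top at the angle
itself, it is the one with the largest derivative. -/
theorem eventually_right (t : ℝ) : ∃ v ∈ V, coord v t = supp hV t ∧ coord' v t = suppR hV t ∧
    ∀ᶠ s in 𝓝[>] t, ∀ w ∈ V, w ≠ v → coord w s < coord v s := by
  obtain ⟨v, hv, h⟩ := Finset.exists_mem_eq_sup' (tops_nonempty hV t) fun v => coord' v t
  obtain ⟨hvV, hvt⟩ := (mem_tops hV).1 hv
  refine ⟨v, hvV, hvt, h.symm, ?_⟩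
  rw [Finset.eventually_all]
  intro w hw
  rw [eventually_imp_distrib_left]
  intro hne
  rcases (coord_le_supp hV hw t).lt_or_eq with hlt | heq
  · rw [← hvt] at hlt
    exact nhdsWithin_le_nhds ((continuous_coord w).continuousAt.eventually_lt
      (continuous_coord v).continuousAt hlt)
  · have hle : coord' w t ≤ coord' v t := by
      refine (Finset.le_sup' (fun v => coord' v t) ((mem_tops hV).2 ⟨hw, heq⟩)).trans h.le
    have hlt : coord' w t < coord' v t :=
      lt_of_le_of_ne hle fun e => hne (coord_eq_of_eq (heq.trans hvt.symm) e)
    have hd := (hasDerivAt_coord v t).sub (hasDerivAt_coord w t)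
    have hs := (hasDerivAt_iff_tendsto_slope.1 hd).eventually (lt_mem_nhds (sub_pos.2 hlt))
    have hs' : ∀ᶠ s in 𝓝[>] t, 0 < slope (coord v - coord w) t s :=
      (nhdsWithin_mono t fun s hs => ne_of_gt hs) hs
    filter_upwards [hs', self_mem_nhdsWithin] with s h1 h2
    have h2' : 0 < s - t := sub_pos.2 h2
    rw [slope_def_field, div_pos_iff_of_pos_right h2'] at h1
    simp only [Pi.sub_apply] at h1
    linarith [heq.trans hvt.symm]

/-- Just to the left of each angle a single point is on top: among the points on top at the angle
itself, it is the one with the smallest derivative. -/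
theorem eventually_left (t : ℝ) : ∃ v ∈ V, coord v t = supp hV t ∧ coord' v t = suppL hV t ∧
    ∀ᶠ s in 𝓝[<] t, ∀ w ∈ V, w ≠ v → coord w s < coord v s := by
  obtain ⟨v, hv, h⟩ := Finset.exists_mem_eq_inf' (tops_nonempty hV t) fun v => coord' v t
  obtain ⟨hvV, hvt⟩ := (mem_tops hV).1 hv
  refine ⟨v, hvV, hvt, h.symm, ?_⟩
  rw [Finset.eventually_all]
  intro w hw
  rw [eventually_imp_distrib_left]
  intro hne
  rcases (coord_le_supp hV hw t).lt_or_eq with hlt | heq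
  · rw [← hvt] at hlt
    exact nhdsWithin_le_nhds ((continuous_coord w).continuousAt.eventually_lt
      (continuous_coord v).continuousAt hlt)
  · have hle : coord' v t ≤ coord' w t :=
      h.ge.trans (Finset.inf'_le (fun v => coord' v t) ((mem_tops hV).2 ⟨hw, heq⟩))
    have hlt : coord' v t < coord' w t :=
      lt_of_le_of_ne hle fun e => hne (coord_eq_of_eq (heq.trans hvt.symm) e.symm)
    have hd := (hasDerivAt_coord w t).sub (hasDerivAt_coord v t)
    have hs := (hasDerivAt_iff_tendsto_slope.1 hd).eventually (lt_mem_nhds (sub_pos.2 hlt))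
    have hs' : ∀ᶠ s in 𝓝[<] t, 0 < slope (coord w - coord v) t s :=
      (nhdsWithin_mono t fun s hs => ne_of_lt hs) hs
    filter_upwards [hs', self_mem_nhdsWithin] with s h1 h2
    have h2' : s - t < 0 := sub_neg.2 h2
    rw [slope_def_field, div_pos_iff] at h1
    simp only [Pi.sub_apply] at h1
    rcases h1 with h1 | h1
    · linarith
    · linarith [heq.trans hvt.symm]

/-- The length of the face with outer normal at angle `φ` is the jump of the derivative of the
support function. -/
theorem diam_face {K : Set Plane} (hK : closure K = convexHull ℝ (V : Set Plane)) (φ : ℝ) :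
    Metric.diam (face K φ) = suppR hV φ - suppL hV φ := by
  have hle : ∀ z ∈ convexHull ℝ (V : Set Plane), coord z φ ≤ supp hV φ := by
    intro z hz
    obtain ⟨w, hw, hw1, rfl⟩ := Finset.mem_convexHull'.1 hz
    rw [coord_sum]
    calc ∑ y ∈ V, w y * coord y φ ≤ ∑ y ∈ V, w y * supp hV φ :=
          Finset.sum_le_sum fun y hy => mul_le_mul_of_nonneg_left (coord_le_supp hV hy φ) (hw y hy)
      _ = supp hV φ := by rw [← Finset.sum_mul, hw1, one_mul]
  have hface : ∀ z, z ∈ face K φ ↔ z ∈ convexHull ℝ (V : Set Plane) ∧ coord z φ = supp hV φ := by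
    intro z
    simp only [face, Set.mem_ofPred_eq, hK, inner_dir]
    refine and_congr_right fun hz => ⟨fun h => le_antisymm (hle z hz) ?_, fun h w hw => ?_⟩
    · obtain ⟨v, hv, e⟩ := exists_coord_eq_supp hV φ
      rw [← e]
      exact h v (subset_convexHull ℝ _ hv)
    · rw [h]; exact hle w hw
  have hb : ∀ z ∈ face K φ, coord' z φ ≤ suppR hV φ ∧ suppL hV φ ≤ coord' z φ := by
    intro z hz
    obtain ⟨hz, h⟩ := (hface z).1 hz
    obtain ⟨w, hw, hw1, rfl⟩ := Finset.mem_convexHull'.1 hz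
    rw [coord_sum] at h
    have h0 : ∑ y ∈ V, w y * (supp hV φ - coord y φ) = 0 := by
      simp only [mul_sub, Finset.sum_sub_distrib, ← Finset.sum_mul, hw1, one_mul, h, sub_self]
    have h0' := (Finset.sum_eq_zero_iff_of_nonneg fun y hy =>
      mul_nonneg (hw y hy) (sub_nonneg.2 (coord_le_supp hV hy φ))).1 h0
    have hor : ∀ y ∈ V, w y = 0 ∨ y ∈ tops hV φ := by
      intro y hy
      rcases mul_eq_zero.1 (h0' y hy) with e | e
      · exact Or.inl e
      · exact Or.inr ((mem_tops hV).2 ⟨hy, (sub_eq_zero.1 e).symm⟩)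
    rw [coord'_sum]
    constructor
    · calc ∑ y ∈ V, w y * coord' y φ ≤ ∑ y ∈ V, w y * suppR hV φ := by
            refine Finset.sum_le_sum fun y hy => ?_
            rcases hor y hy with e | e
            · simp [e]
            · exact mul_le_mul_of_nonneg_left (Finset.le_sup' (fun v => coord' v φ) e) (hw y hy)
        _ = suppR hV φ := by rw [← Finset.sum_mul, hw1, one_mul]
    · calc suppL hV φ = ∑ y ∈ V, w y * suppL hV φ := by rw [← Finset.sum_mul, hw1, one_mul]
        _ ≤ ∑ y ∈ V, w y * coord' y φ := by
            refine Finset.sum_le_sum fun y hy => ?_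
            rcases hor y hy with e | e
            · simp [e]
            · exact mul_le_mul_of_nonneg_left (Finset.inf'_le (fun v => coord' v φ) e) (hw y hy)
  obtain ⟨a, ha, ha'⟩ := Finset.exists_mem_eq_sup' (tops_nonempty hV φ) fun v => coord' v φ
  obtain ⟨b, hb1, hb'⟩ := Finset.exists_mem_eq_inf' (tops_nonempty hV φ) fun v => coord' v φ
  have haf : a ∈ face K φ := (hface a).2
    ⟨subset_convexHull ℝ _ ((mem_tops hV).1 ha).1, ((mem_tops hV).1 ha).2⟩
  have hbf : b ∈ face K φ := (hface b).2
    ⟨subset_convexHull ℝ _ ((mem_tops hV).1 hb1).1, ((mem_tops hV).1 hb1).2⟩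
  have hdist : ∀ z ∈ face K φ, ∀ w ∈ face K φ, dist z w = |coord' z φ - coord' w φ| :=
    fun z hz w hw => dist_eq_of_coord_eq (((hface z).1 hz).2.trans ((hface w).1 hw).2.symm)
  have hLR : suppL hV φ ≤ suppR hV φ := (hb a haf).2.trans (hb a haf).1
  have hdle : ∀ z ∈ face K φ, ∀ w ∈ face K φ, dist z w ≤ suppR hV φ - suppL hV φ := by
    intro z hz w hw
    rw [hdist z hz w hw, abs_le]
    constructor <;> linarith [hb z hz, hb w hw]
  refine le_antisymm (Metric.diam_le_of_forall_dist_le (sub_nonneg.2 hLR) hdle) ?_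
  have h1 : suppR hV φ = coord' a φ := ha'
  have h2 : suppL hV φ = coord' b φ := hb'
  calc suppR hV φ - suppL hV φ = coord' a φ - coord' b φ := by rw [h1, h2]
    _ ≤ |coord' a φ - coord' b φ| := le_abs_self _
    _ = dist a b := (hdist a haf b hbf).symm
    _ ≤ _ := Metric.dist_le_diam_of_mem (Metric.isBounded_iff.2 ⟨_, fun x hx y hy => hdle x hx y hy⟩)
          haf hbf

/-- The jumps of the derivative of the support function do not accumulate, because on either side of
each angle a single point is on top. -/
theorem finite_jumps (a b : ℝ) : {φ ∈ Set.Icc a b | suppR hV φ - suppL hV φ ≠ 0}.Finite := by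
  by_contra hinf
  obtain ⟨t, -, ht⟩ := Set.Infinite.exists_accPt_of_subset_isCompact hinf isCompact_Icc
    (Set.sep_subset _ _)
  rw [accPt_iff_frequently_nhdsNE] at ht
  refine ht ?_
  obtain ⟨v, hv, -, -, hR⟩ := eventually_right hV t
  obtain ⟨v', hv', -, -, hL⟩ := eventually_left hV t
  rw [← Set.Iio_union_Ioi, nhdsWithin_union, eventually_sup]
  constructor
  · filter_upwards [hL] with s hs hmem
    have := tops_eq_singleton hV hv' hs
    exact hmem.2 (by rw [this.2.1, this.2.2, sub_self])
  · filter_upwards [hR] with s hs hmem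
    have := tops_eq_singleton hV hv hs
    exact hmem.2 (by rw [this.2.1, this.2.2, sub_self])

/-- The second derivative of the support function is minus the support function, apart from the
jumps of its first derivative. -/
theorem integral_supp (S : Finset ℝ)
    (hS : ∀ φ, φ ∈ S ↔ φ ∈ Set.Icc (-1) 8 ∧ suppR hV φ - suppL hV φ ≠ 0) :
    ∫ φ in (0 : ℝ)..(2 * Real.pi), supp hV φ =
      ∑ φ ∈ S with φ ∈ Set.Ico (0 : ℝ) (2 * Real.pi), (suppR hV φ - suppL hV φ) := by
  set D : ℝ → ℝ := fun φ => suppR hV φ - suppL hV φ with hD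
  set F : ℝ → ℝ := fun t => (∫ φ in (0 : ℝ)..t, supp hV φ) + suppL hV t -
    ∑ φ ∈ S with φ < t, D φ with hF
  -- `F` is constant near each `t`: a single point is on top on either side, and there the integral
  -- of its coordinate is minus the increment of the derivative.  The set `S` of jumps is taken on a
  -- neighbourhood of `[0, 2π]`, so that the end points need no special treatment.
  have hint : ∀ a b, IntervalIntegrable (supp hV) volume a b :=
    fun a b => (continuous_supp hV).intervalIntegrable a b
  have hmem : ∀ (t : ℝ) (u : ℝ) (v : Plane), coord v t = supp hV t →
      (∀ s, s ∈ Set.uIoc t u → s ≠ u → supp hV s = coord v s) →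
      ∫ φ in t..u, supp hV φ = coord' v t - coord' v u := by
    intro t u v _ h
    rw [← integral_coord]
    refine intervalIntegral.integral_congr_ae ?_
    have : ∀ᵐ s : ℝ, s ≠ u := by simp [ae_iff]
    filter_upwards [this] with s hs hs'
    exact h s hs' hs
  have hright : ∀ t ∈ Set.Icc (0 : ℝ) 7, ∀ᶠ s in 𝓝[>] t, F s = F t := by
    intro t ht
    obtain ⟨v, hv, hvt, hv't, hR⟩ := eventually_right hV t
    have hsum : ∀ᶠ s in 𝓝[>] t, ∀ φ ∈ S, (φ < s ↔ φ ≤ t) := by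
      rw [Finset.eventually_all]
      intro φ _
      rcases le_or_gt φ t with h | h
      · filter_upwards [self_mem_nhdsWithin] with s hs
        exact ⟨fun _ => h, fun _ => h.trans_lt hs⟩
      · filter_upwards [nhdsWithin_le_nhds (Iio_mem_nhds h)] with s hs
        exact ⟨fun h' => absurd h' (not_lt.2 (le_of_lt hs)), fun h' => absurd h (not_lt.2 h')⟩
    obtain ⟨u, hu, hR'⟩ := mem_nhdsGT_iff_exists_Ioo_subset.1 hR
    filter_upwards [hR, hsum, Ioo_mem_nhdsGT hu] with s hs hss hsu
    have h1 : ∫ φ in t..s, supp hV φ = coord' v t - coord' v s := by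
      refine hmem t s v hvt fun r hr hne => ?_
      rw [Set.uIoc_of_le hsu.1.le] at hr
      exact (tops_eq_singleton hV hv (hR' ⟨hr.1, hr.2.trans_lt hsu.2⟩)).1
    have h2 : ∑ φ ∈ S with φ < s, D φ = ∑ φ ∈ S with φ < t, D φ + D t := by
      have e1 : S.filter (· < s) = S.filter (· ≤ t) :=
        Finset.filter_congr hss
      rw [e1]
      by_cases htS : t ∈ S
      · have e2 : S.filter (· ≤ t) = insert t (S.filter (· < t)) := by
          ext φ
          simp only [Finset.mem_filter, Finset.mem_insert, le_iff_lt_or_eq]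
          constructor
          · rintro ⟨h, h' | h'⟩
            · exact Or.inr ⟨h, h'⟩
            · exact Or.inl h'
          · rintro (h | h)
            · exact ⟨h ▸ htS, Or.inr h⟩
            · exact ⟨h.1, Or.inl h.2⟩
        rw [e2, Finset.sum_insert (by simp), add_comm]
      · have e2 : S.filter (· ≤ t) = S.filter (· < t) := by
          refine Finset.filter_congr fun φ hφ => ?_
          exact ⟨fun h => lt_of_le_of_ne h fun e => htS (e ▸ hφ), le_of_lt⟩
        have : D t = 0 := by
          by_contra h
          exact htS ((hS t).2 ⟨⟨by linarith [ht.1], by linarith [ht.2]⟩, h⟩)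
        rw [e2, this, add_zero]
    have h3 := (tops_eq_singleton hV hv hs).2.2
    simp only [hF]
    rw [h2, h3, ← intervalIntegral.integral_add_adjacent_intervals (hint 0 t) (hint t s), h1, hv't]
    simp only [hD]; ring
  have hleft : ∀ t ∈ Set.Icc (0 : ℝ) 7, ∀ᶠ s in 𝓝[<] t, F s = F t := by
    intro t ht
    obtain ⟨v, hv, hvt, hv't, hL⟩ := eventually_left hV t
    have hsum : ∀ᶠ s in 𝓝[<] t, ∀ φ ∈ S, (φ < s ↔ φ < t) := by
      rw [Finset.eventually_all]
      intro φ _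
      rcases lt_or_ge φ t with h | h
      · filter_upwards [nhdsWithin_le_nhds (Ioi_mem_nhds h)] with s hs
        exact ⟨fun _ => h, fun _ => hs⟩
      · filter_upwards [self_mem_nhdsWithin] with s hs
        exact ⟨fun h' => absurd (h'.trans hs) (not_lt.2 h), fun h' => absurd h' (not_lt.2 h)⟩
    obtain ⟨u, hu, hL'⟩ := mem_nhdsLT_iff_exists_Ioo_subset.1 hL
    filter_upwards [hL, hsum, Ioo_mem_nhdsLT hu] with s hs hss hsu
    have h1 : ∫ φ in s..t, supp hV φ = coord' v s - coord' v t := by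
      refine hmem s t v (tops_eq_singleton hV hv hs).1.symm fun r hr hne => ?_
      rw [Set.uIoc_of_le hsu.2.le] at hr
      exact (tops_eq_singleton hV hv (hL' ⟨hsu.1.trans hr.1, lt_of_le_of_ne hr.2 hne⟩)).1
    have e1 : S.filter (· < s) = S.filter (· < t) := Finset.filter_congr hss
    have h3 := (tops_eq_singleton hV hv hs).2.2
    simp only [hF]
    rw [e1, h3, ← hv't, ← intervalIntegral.integral_add_adjacent_intervals (hint 0 s) (hint s t), h1]
    ring
  have hpi : 2 * Real.pi ≤ 7 := by linarith [Real.pi_lt_d2]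
  have hconst : F (2 * Real.pi) = F 0 := by
    have hsub : ∀ t ∈ Set.Icc (0 : ℝ) (2 * Real.pi), t ∈ Set.Icc (0 : ℝ) 7 :=
      fun t ht => ⟨ht.1, ht.2.trans hpi⟩
    refine constant_of_has_deriv_right_zero (f := F) (a := 0) (b := 2 * Real.pi) ?_ ?_ _
      ⟨by positivity, le_rfl⟩
    · intro t ht
      refine ContinuousAt.continuousWithinAt ?_
      rw [continuousAt_iff_continuous_left'_right']
      exact ⟨tendsto_const_nhds.congr' ((hleft t (hsub t ht)).mono fun s h => h.symm),
        tendsto_const_nhds.congr' ((hright t (hsub t ht)).mono fun s h => h.symm)⟩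
    · intro t ht
      refine HasDerivWithinAt.Ici_of_Ioi ?_
      exact (hasDerivWithinAt_const t _ (F t)).congr_of_eventuallyEq
        (hright t (hsub t ⟨ht.1, ht.2.le⟩)) rfl
  have hper : suppL hV (2 * Real.pi) = suppL hV 0 := by
    have h1 : ∀ v : Plane, coord v (2 * Real.pi) = coord v 0 := fun v => by simp [coord]
    have h2 : ∀ v : Plane, coord' v (2 * Real.pi) = coord' v 0 := fun v => by simp [coord']
    have h3 : supp hV (2 * Real.pi) = supp hV 0 := by simp only [supp, h1]
    have h4 : tops hV (2 * Real.pi) = tops hV 0 := by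
      ext v; rw [mem_tops, mem_tops, h1, h3]
    exact Finset.inf'_congr _ h4 fun v _ => h2 v
  have hfil : ∑ φ ∈ S with φ < 2 * Real.pi, D φ = ∑ φ ∈ S with φ < 0, D φ +
      ∑ φ ∈ S with φ ∈ Set.Ico (0 : ℝ) (2 * Real.pi), D φ := by
    rw [← Finset.sum_union]
    · refine Finset.sum_congr ?_ fun _ _ => rfl
      ext φ
      simp only [Finset.mem_filter, Finset.mem_union, Set.mem_Ico]
      have : 0 < 2 * Real.pi := by positivity
      constructor
      · rintro ⟨h, h'⟩
        rcases lt_or_ge φ 0 with h0 | h0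
        · exact Or.inl ⟨h, h0⟩
        · exact Or.inr ⟨h, h0, h'⟩
      · rintro (h | h)
        · exact ⟨h.1, h.2.trans this⟩
        · exact ⟨h.1, h.2.2⟩
    · rw [Finset.disjoint_filter]
      intro φ _ h h'
      exact absurd h (not_lt.2 h'.1)
  simp only [hF, intervalIntegral.integral_same, hper, hfil] at hconst
  linarith

/-- The width of a convex set in a direction is the sum of the values of the support function in this
direction and in the opposite one. -/
theorem volume_segment {K : Set Plane} (hc : Convex ℝ K)
    (hK : closure K = convexHull ℝ (V : Set Plane)) (θ : ℝ) :
    volume (segment K θ) = ENNReal.ofReal (supp hV θ + supp hV (θ + Real.pi)) := by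
  have hlin : ∃ f : Plane →ₗ[ℝ] ℝ, ∀ z, f z = coord z θ :=
    ⟨(innerₗ Plane).flip (dir θ), fun z => by simp [← inner_dir, real_inner_comm]⟩
  obtain ⟨f, hf⟩ := hlin
  have hcf : Continuous f := f.continuous_of_finiteDimensional
  have hseg : segment K θ = f '' K := by
    ext r; simp [segment, inner_dir, hf]
  have hconv : Convex ℝ (f '' K) := hc.linear_image f
  have hcomp : IsCompact (closure K) := by
    rw [hK]; exact (Finset.finite_toSet V).isCompact_convexHull (𝕜 := ℝ)
  have hneg : ∀ v : Plane, coord v (θ + Real.pi) = -coord v θ := fun v => by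
    simp [coord]; ring
  have hcl : closure (f '' K) = Set.Icc (-supp hV (θ + Real.pi)) (supp hV θ) := by
    rw [← image_closure_of_isCompact hcomp hcf.continuousOn, hK, f.image_convexHull]
    apply Set.Subset.antisymm
    · refine convexHull_min ?_ (convex_Icc _ _)
      rintro _ ⟨v, hv, rfl⟩
      rw [hf]
      have := coord_le_supp hV hv (θ + Real.pi)
      rw [hneg] at this
      exact ⟨by linarith, coord_le_supp hV hv θ⟩
    · obtain ⟨a, ha, ha'⟩ := exists_coord_eq_supp hV θ
      obtain ⟨b, hb, hb'⟩ := exists_coord_eq_supp hV (θ + Real.pi)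
      rw [hneg] at hb'
      have h1 : supp hV θ ∈ convexHull ℝ (f '' (V : Set Plane)) :=
        subset_convexHull ℝ _ ⟨a, ha, by rw [hf, ha']⟩
      have h2 : -supp hV (θ + Real.pi) ∈ convexHull ℝ (f '' (V : Set Plane)) :=
        subset_convexHull ℝ _ ⟨b, hb, by rw [hf, ← hb', neg_neg]⟩
      exact (convex_convexHull ℝ _).ordConnected.out h2 h1
  have hvol : volume (f '' K) = volume (closure (f '' K)) := by
    refine le_antisymm (measure_mono subset_closure) ?_
    calc volume (closure (f '' K)) ≤ volume (f '' K ∪ frontier (f '' K)) :=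
          measure_mono (by rw [← closure_eq_self_union_frontier])
      _ ≤ volume (f '' K) + volume (frontier (f '' K)) := measure_union_le _ _
      _ = volume (f '' K) := by rw [hconv.addHaar_frontier volume, add_zero]
  rw [hseg, hvol, hcl, Real.volume_Icc]
  congr 1; ring

end Cauchy

/-- Cauchy's formula: the perimeter of a polygon is the integral of its widths. -/
theorem lintegral_volume_segment {K : Set Plane} (hc : Convex ℝ K) {V : Finset Plane}
    (hK : closure K = convexHull ℝ (V : Set Plane)) :
    ∫⁻ θ in Set.Ioc (0 : ℝ) Real.pi, volume (segment K θ) = ENNReal.ofReal (perimeter K) := by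
  rcases V.eq_empty_or_nonempty with rfl | hV
  · have hK0 : K = ∅ := by
      rw [← closure_empty_iff, hK]; simp
    subst hK0
    simp [segment, perimeter, face]
  have hper : perimeter K = ∫ φ in (0 : ℝ)..(2 * Real.pi), supp hV φ := by
    have hfin := finite_jumps hV (-1) 8
    rw [integral_supp hV hfin.toFinset (fun φ => by simp), perimeter]
    simp only [diam_face hV hK]
    rw [finsum_mem_eq_sum_of_inter_support_eq]
    ext φ
    simp only [Set.mem_inter_iff, Set.mem_Ico, Function.mem_support, Finset.coe_filter,
      Set.Finite.mem_toFinset, Set.mem_ofPred_eq, Set.mem_Icc]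
    have := Real.pi_lt_d2
    constructor
    · rintro ⟨⟨h1, h2⟩, h3⟩
      exact ⟨⟨⟨⟨by linarith, by linarith⟩, h3⟩, h1, h2⟩, h3⟩
    · rintro ⟨⟨_, h1⟩, h3⟩
      exact ⟨h1, h3⟩
  have hcont := continuous_supp hV
  have hadd : ∫ φ in (0 : ℝ)..(2 * Real.pi), supp hV φ =
      ∫ φ in (0 : ℝ)..Real.pi, (supp hV φ + supp hV (φ + Real.pi)) := by
    rw [intervalIntegral.integral_add (hcont.intervalIntegrable _ _)
      ((show Continuous fun φ => supp hV (φ + Real.pi) from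
        hcont.comp (continuous_add_const _)).intervalIntegrable _ _),
      intervalIntegral.integral_comp_add_right (fun φ => supp hV φ),
      zero_add, ← two_mul, intervalIntegral.integral_add_adjacent_intervals
        (hcont.intervalIntegrable _ _) (hcont.intervalIntegrable _ _)]
  have hnn : ∀ θ, 0 ≤ supp hV θ + supp hV (θ + Real.pi) := by
    intro θ
    obtain ⟨v, hv⟩ := hV
    have h1 := coord_le_supp ⟨v, hv⟩ hv θ
    have h2 := coord_le_supp ⟨v, hv⟩ hv (θ + Real.pi)
    have : coord v (θ + Real.pi) = -coord v θ := by simp [coord]; ring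
    linarith
  rw [hper, hadd, intervalIntegral.integral_of_le Real.pi_pos.le,
    ofReal_integral_eq_lintegral_ofReal]
  · exact lintegral_congr fun θ => volume_segment hV hc hK θ
  · exact ((hcont.add (hcont.comp (continuous_add_const _))).integrableOn_Icc).mono_set
      Set.Ioc_subset_Icc_self
  · exact Filter.Eventually.of_forall hnn

/-! ### Polyhedra cut by half-spaces -/

section Halfspaces

variable {E : Type*} [NormedAddCommGroup E] [NormedSpace ℝ E] [FiniteDimensional ℝ E]

/-- A polytope cut by a closed half-space is a polytope. -/
theorem exists_convexHull_eq_inter (V : Finset E) (f : E →ₗ[ℝ] ℝ) (r : ℝ) :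
    ∃ F : Finset E, convexHull ℝ (V : Set E) ∩ {z | f z ≤ r} = convexHull ℝ (F : Set E) := by
  classical
  let c : E × E → E := fun p => p.1 + ((r - f p.1) / (f p.2 - f p.1)) • (p.2 - p.1)
  let L : Finset E := V.filter fun v => f v ≤ r
  let H : Finset E := V.filter fun v => r < f v
  refine ⟨L ∪ (L ×ˢ H).image c, Set.Subset.antisymm ?_ (convexHull_min ?_ ?_)⟩
  · rintro z ⟨hz, hzr⟩
    by_contra hzF
    obtain ⟨g, M, hg, hgz⟩ := geometric_hahn_banach_closed_point (convex_convexHull ℝ _)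
      (((L ∪ (L ×ˢ H).image c).finite_toSet.isCompact_convexHull (𝕜 := ℝ)).isClosed) hzF
    have hgF : ∀ v ∈ L ∪ (L ×ˢ H).image c, g v < M :=
      fun v hv => hg v (subset_convexHull ℝ _ hv)
    -- a slope `lam ≥ 0` for which `g + lam (r - f) ≤ M` on all vertices
    obtain ⟨lam, hlam, hbd⟩ : ∃ lam : ℝ, 0 ≤ lam ∧ ∀ v ∈ V, g v + lam * (r - f v) ≤ M := by
      by_cases hH : ∃ w ∈ H, M < g w
      · obtain ⟨w, hw, hwmax⟩ := Finset.exists_max_image H (fun w => (g w - M) / (f w - r))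
          (by obtain ⟨w, hw, -⟩ := hH; exact ⟨w, hw⟩)
        have hHr : ∀ w ∈ H, 0 < f w - r := fun w hw => sub_pos.2 (Finset.mem_filter.1 hw).2
        have hpos : 0 ≤ (g w - M) / (f w - r) := by
          obtain ⟨u, hu, huM⟩ := hH
          exact (div_nonneg (sub_nonneg.2 huM.le) (hHr u hu).le).trans (hwmax u hu)
        refine ⟨_, hpos, fun v hv => ?_⟩
        rcases le_or_gt (f v) r with hvr | hvr
        · have hvL : v ∈ L := Finset.mem_filter.2 ⟨hv, hvr⟩
          have hc := hgF (c (v, w)) (Finset.mem_union_right _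
            (Finset.mem_image_of_mem c (Finset.mk_mem_product hvL hw)))
          have hd : 0 < f w - f v := by linarith [hHr w hw]
          simp only [c, map_add, map_smul, map_sub, smul_eq_mul] at hc
          have hr := hHr w hw
          rw [div_mul_eq_mul_div, ← sub_nonneg]
          have h1 : 0 ≤ (M - g v) * (f w - f v) - (r - f v) * (g w - g v) := by
            have : (g v + (r - f v) / (f w - f v) * (g w - g v)) * (f w - f v) ≤
                M * (f w - f v) := mul_le_mul_of_nonneg_right hc.le hd.le
            have e : (g v + (r - f v) / (f w - f v) * (g w - g v)) * (f w - f v) =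
                g v * (f w - f v) + (r - f v) * (g w - g v) := by field_simp
            linarith
          have h2 : M - (g v + (g w - M) * (r - f v) / (f w - r)) =
              ((M - g v) * (f w - f v) - (r - f v) * (g w - g v)) / (f w - r) := by
            field_simp; ring
          rw [h2]
          exact div_nonneg h1 hr.le
        · have hvH : v ∈ H := Finset.mem_filter.2 ⟨hv, hvr⟩
          have h1 := hwmax v hvH
          have hr := hHr v hvH
          rw [div_le_iff₀ hr] at h1
          linarith
      · push Not at hH
        refine ⟨0, le_rfl, fun v hv => ?_⟩
        rw [zero_mul, add_zero]
        rcases le_or_gt (f v) r with hvr | hvr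
        · exact (hgF v (Finset.mem_union_left _ (Finset.mem_filter.2 ⟨hv, hvr⟩))).le
        · exact hH v (Finset.mem_filter.2 ⟨hv, hvr⟩)
    have hcv : Convex ℝ {v : E | g v + lam * (r - f v) ≤ M} := by
      have : {v : E | g v + lam * (r - f v) ≤ M} =
          {v : E | ((g : E →ₗ[ℝ] ℝ) - lam • f) v ≤ M - lam * r} := by
        ext v
        simp only [Set.mem_ofPred_eq, LinearMap.sub_apply, ContinuousLinearMap.coe_coe,
          LinearMap.smul_apply, smul_eq_mul]
        constructor <;> intro h <;> linarith
      rw [this]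
      exact convex_halfSpace_le ((g : E →ₗ[ℝ] ℝ) - lam • f).isLinear _
    have hzM : g z + lam * (r - f z) ≤ M := convexHull_min (fun v hv => hbd v hv) hcv hz
    have : 0 ≤ lam * (r - f z) := mul_nonneg hlam (sub_nonneg.2 hzr)
    linarith
  · intro z hz
    rcases Finset.mem_union.1 hz with hz | hz
    · obtain ⟨h1, h2⟩ := Finset.mem_filter.1 hz
      exact ⟨subset_convexHull ℝ _ h1, h2⟩
    · obtain ⟨⟨v, w⟩, hp, rfl⟩ := Finset.mem_image.1 hz
      obtain ⟨hv, hw⟩ := Finset.mem_product.1 hp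
      obtain ⟨hv1, hv2⟩ := Finset.mem_filter.1 hv
      obtain ⟨hw1, hw2⟩ := Finset.mem_filter.1 hw
      simp only at hv1 hv2 hw1 hw2
      have hd : 0 < f w - f v := by linarith
      refine ⟨?_, ?_⟩
      · refine (convex_convexHull ℝ _).add_smul_sub_mem (subset_convexHull ℝ _ hv1)
          (subset_convexHull ℝ _ hw1) ⟨div_nonneg (by linarith) hd.le, ?_⟩
        rw [div_le_one hd]; linarith
      · have : f (c (v, w)) = r := by
          simp only [c, map_add, map_smul, map_sub, smul_eq_mul]
          field_simp; ring
        exact this.le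
  · exact (convex_convexHull ℝ _).inter (convex_halfSpace_le f.isLinear _)

theorem closure_inter_halfspace {K : Set E} (hK : Convex ℝ K) (f : E →ₗ[ℝ] ℝ) (r : ℝ)
    (hne : (K ∩ {z | f z < r}).Nonempty) :
    closure (K ∩ {z | f z < r}) = closure K ∩ {z | f z ≤ r} := by
  have hf : Continuous f := f.continuous_of_finiteDimensional
  have hopen : IsOpen {z | f z < r} := isOpen_lt hf continuous_const
  apply Set.Subset.antisymm
  · refine closure_minimal ?_ (isClosed_closure.inter (isClosed_le hf continuous_const))
    exact fun z hz => ⟨subset_closure hz.1, (show f z < r from hz.2).le⟩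
  · rintro z ⟨hz, hzr⟩
    obtain ⟨w, hw, hwr⟩ := hne
    have hsub : openSegment ℝ z w ⊆ closure (K ∩ {z | f z < r}) := by
      intro u hu
      have h1 : u ∈ closure K := hK.closure.openSegment_subset hz (subset_closure hw) hu
      have h2 : f u < r := by
        obtain ⟨a, b, ha, hb, hab, rfl⟩ := hu
        simp only [map_add, map_smul, smul_eq_mul]
        have h3 : a * f z ≤ a * r := mul_le_mul_of_nonneg_left hzr ha.le
        have h4 : b * f w < b * r := mul_lt_mul_of_pos_left hwr hb
        calc a * f z + b * f w < a * r + b * r := by linarith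
          _ = r := by rw [← add_mul, hab, one_mul]
      rw [Set.inter_comm]
      exact hopen.inter_closure ⟨h2, h1⟩
    have h3 := closure_minimal hsub isClosed_closure
    rw [closure_openSegment] at h3
    exact h3 (left_mem_segment ℝ z w)

/-- Convex sets whose closure is a polytope, and which are countable unions of compact sets: the
polytopes and their intersections with finitely many open half-spaces. -/
structure IsPolytopal (K : Set E) : Prop where
  convex : Convex ℝ K
  sigmaCompact : IsSigmaCompact K
  exists_finset : ∃ V : Finset E, closure K = convexHull ℝ (V : Set E)

theorem isPolytopal_convexHull (V : Set E) (hV : V.Finite) : IsPolytopal (convexHull ℝ V) where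
  convex := convex_convexHull ℝ V
  sigmaCompact := (hV.isCompact_convexHull (𝕜 := ℝ)).isSigmaCompact
  exists_finset := ⟨hV.toFinset, by
    rw [(hV.isCompact_convexHull (𝕜 := ℝ)).isClosed.closure_eq, hV.coe_toFinset]⟩

theorem IsPolytopal.inter_lt {K : Set E} (hK : IsPolytopal K) (f : E →ₗ[ℝ] ℝ) (r : ℝ) :
    IsPolytopal (K ∩ {z | f z < r}) where
  convex := hK.convex.inter (convex_halfSpace_lt f.isLinear r)
  sigmaCompact := by
    obtain ⟨C, hC, hCK⟩ := hK.sigmaCompact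
    obtain ⟨F, hF, -, hFU, -⟩ := (isOpen_lt (f.continuous_of_finiteDimensional)
      (continuous_const (y := r))).exists_iUnion_isClosed
    rw [← hCK, ← hFU, Set.iUnion_inter]
    refine isSigmaCompact_iUnion _ fun i => ?_
    rw [Set.inter_iUnion]
    exact isSigmaCompact_iUnion_of_isCompact _ fun n => (hC i).inter_right (hF n)
  exists_finset := by
    classical
    rcases (K ∩ {z | f z < r}).eq_empty_or_nonempty with h | h
    · exact ⟨∅, by rw [h]; simp⟩
    · obtain ⟨V, hV⟩ := hK.exists_finset
      rw [closure_inter_halfspace hK.convex f r h, hV]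
      exact exists_convexHull_eq_inter V f r

theorem IsPolytopal.image {F : Type*} [NormedAddCommGroup F] [NormedSpace ℝ F]
    [FiniteDimensional ℝ F] {K : Set E} (hK : IsPolytopal K) (f : E →ₗ[ℝ] F) :
    IsPolytopal (f '' K) where
  convex := hK.convex.linear_image f
  sigmaCompact := hK.sigmaCompact.image f.continuous_of_finiteDimensional
  exists_finset := by
    classical
    obtain ⟨V, hV⟩ := hK.exists_finset
    refine ⟨V.image f, ?_⟩
    rw [← image_closure_of_isCompact _ f.continuous_of_finiteDimensional.continuousOn, hV,
      f.image_convexHull, Finset.coe_image]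
    rw [hV]
    exact V.finite_toSet.isCompact_convexHull (𝕜 := ℝ)

end Halfspaces

/-! ### The lines that hit a region -/

section Lines

variable {d : ℕ}

/-- The projection onto two dimensions as a linear map. -/
noncomputable def projLin (e : Pair d) : Pt d →ₗ[ℝ] Plane where
  toFun z := !₂[z e.1.1, z e.1.2]
  map_add' z w := by ext i; fin_cases i <;> simp
  map_smul' a z := by ext i; fin_cases i <;> simp

theorem proj_eq_image (e : Pair d) (K : Set (Pt d)) : proj e K = projLin e '' K := rfl

theorem form_eq_coord (e : Pair d) (q : ℝ × ℝ) (z : Pt d) :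
    Cut.form (e, q) z = coord (projLin e z) q.1 := by
  simp [Cut.form, coord, projLin]

/-- The form of a cut as a linear map. -/
noncomputable def formLin (c : Cut d) : Pt d →ₗ[ℝ] ℝ where
  toFun := c.form
  map_add' z w := by simp only [Cut.form, Pi.add_apply]; ring
  map_smul' a z := by simp only [Cut.form, Pi.smul_apply, smul_eq_mul, RingHom.id_apply]; ring

theorem measurable_form (z : Pt d) : Measurable fun c : Cut d => c.form z := by
  refine measurable_from_prod_countable_right fun e => ?_
  simp only [Cut.form]
  fun_prop

/-- The lines that have points of (the projection of) `K` strictly on both sides. -/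
def crossSet (e : Pair d) (K : Set (Pt d)) : Set (ℝ × ℝ) :=
  {q | q.1 ∈ Set.Ioc 0 Real.pi ∧ (∃ z ∈ K, Cut.form (e, q) z < q.2) ∧
    ∃ z ∈ K, q.2 < Cut.form (e, q) z}

/-- The lines that meet (the projection of) `K`. -/
def meetSet (e : Pair d) (K : Set (Pt d)) : Set (ℝ × ℝ) :=
  {q | q.1 ∈ Set.Ioc 0 Real.pi ∧ Cut.Meets (e, q) K}

theorem mem_segment_proj (e : Pair d) (K : Set (Pt d)) (q : ℝ × ℝ) :
    q.2 ∈ segment (proj e K) q.1 ↔ Cut.Meets (e, q) K := by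
  simp only [segment, proj_eq_image, Set.image_image, Set.mem_image, Cut.Meets, inner_dir,
    form_eq_coord]

theorem measurableSet_crossSet (e : Pair d) (K : Set (Pt d)) : MeasurableSet (crossSet e K) := by
  have hc : ∀ z : Pt d, Continuous fun q : ℝ × ℝ => Cut.form (e, q) z := fun z => by
    simp only [Cut.form]; fun_prop
  have h1 : IsOpen {q : ℝ × ℝ | ∃ z ∈ K, Cut.form (e, q) z < q.2} := by
    have : {q : ℝ × ℝ | ∃ z ∈ K, Cut.form (e, q) z < q.2} =
        ⋃ z ∈ K, {q : ℝ × ℝ | Cut.form (e, q) z < q.2} := by ext; simp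
    rw [this]
    exact isOpen_biUnion fun z _ => isOpen_lt (hc z) continuous_snd
  have h2 : IsOpen {q : ℝ × ℝ | ∃ z ∈ K, q.2 < Cut.form (e, q) z} := by
    have : {q : ℝ × ℝ | ∃ z ∈ K, q.2 < Cut.form (e, q) z} =
        ⋃ z ∈ K, {q : ℝ × ℝ | q.2 < Cut.form (e, q) z} := by ext; simp
    rw [this]
    exact isOpen_biUnion fun z _ => isOpen_lt continuous_snd (hc z)
  exact (measurable_fst measurableSet_Ioc).inter (h1.measurableSet.inter h2.measurableSet)

theorem measurableSet_meets {K : Set (Pt d)} (hK : IsSigmaCompact K) (e : Pair d) :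
    MeasurableSet {q : ℝ × ℝ | Cut.Meets (e, q) K} := by
  obtain ⟨C, hC, rfl⟩ := hK
  have : {q : ℝ × ℝ | Cut.Meets (e, q) (⋃ n, C n)} = ⋃ n, {q : ℝ × ℝ | Cut.Meets (e, q) (C n)} := by
    ext q
    simp only [Cut.Meets, Set.mem_iUnion, Set.mem_ofPred_eq]
    exact ⟨fun ⟨z, ⟨n, hz⟩, h⟩ => ⟨n, z, hz, h⟩, fun ⟨n, z, hz, h⟩ => ⟨z, ⟨n, hz⟩, h⟩⟩
  rw [this]
  refine MeasurableSet.iUnion fun n => IsClosed.measurableSet ?_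
  have h1 : {q : ℝ × ℝ | Cut.Meets (e, q) (C n)} =
      Prod.fst '' {p : (ℝ × ℝ) × C n | Cut.form (e, p.1) p.2 = p.1.2} := by
    ext q
    simp [Cut.Meets]
  have : CompactSpace (C n) := isCompact_iff_compactSpace.1 (hC n)
  rw [h1]
  refine isClosedMap_fst_of_compactSpace _ (isClosed_eq ?_ (by fun_prop))
  have h2 : ∀ i : Fin d, Continuous fun p : (ℝ × ℝ) × C n => (p.2 : Pt d) i := fun i =>
    (continuous_apply i).comp (continuous_subtype_val.comp continuous_snd)
  simp only [Cut.form]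
  exact ((h2 _).mul (by fun_prop)).add ((h2 _).mul (by fun_prop))

theorem measurableSet_meetSet {K : Set (Pt d)} (hK : IsSigmaCompact K) (e : Pair d) :
    MeasurableSet (meetSet e K) :=
  (measurable_fst measurableSet_Ioc).inter (measurableSet_meets hK e)

theorem crossSet_subset_meetSet {K : Set (Pt d)} (hK : Convex ℝ K) (e : Pair d) :
    crossSet e K ⊆ meetSet e K := by
  rintro q ⟨hq, ⟨z, hz, hz'⟩, w, hw, hw'⟩
  refine ⟨hq, ?_⟩
  have h : (formLin (e, q) '' K).OrdConnected := (hK.linear_image (formLin (e, q))).ordConnected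
  obtain ⟨u, hu, hu'⟩ := h.out ⟨z, hz, rfl⟩ ⟨w, hw, rfl⟩ ⟨hz'.le, hw'.le⟩
  exact ⟨u, hu, hu'⟩

theorem volume_meetSet_diff_crossSet {K : Set (Pt d)} (hK : IsSigmaCompact K) (e : Pair d) :
    volume (meetSet e K \ crossSet e K) = 0 := by
  rw [Measure.volume_eq_prod, Measure.measure_prod_null
    ((measurableSet_meetSet hK e).diff (measurableSet_crossSet e K))]
  refine Filter.Eventually.of_forall fun θ => ?_
  set s := Prod.mk θ ⁻¹' (meetSet e K \ crossSet e K)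
  -- at most the two ends of the segment are left
  have hs : ∀ r ∈ s, (∀ z ∈ K, r ≤ Cut.form (e, (θ, (0 : ℝ))) z) ∨
      (∀ z ∈ K, Cut.form (e, (θ, (0 : ℝ))) z ≤ r) := by
    rintro r ⟨⟨h1, h2⟩, h3⟩
    by_contra hcon
    push Not at hcon
    exact h3 ⟨h1, hcon.1, hcon.2⟩
  have hm : ∀ r ∈ s, ∃ z ∈ K, Cut.form (e, (θ, (0 : ℝ))) z = r := fun r hr => hr.1.2
  have hA : {r ∈ s | ∀ z ∈ K, r ≤ Cut.form (e, (θ, (0 : ℝ))) z}.Subsingleton := by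
    intro r hr r' hr'
    obtain ⟨z, hz, e1⟩ := hm r hr.1
    obtain ⟨z', hz', e2⟩ := hm r' hr'.1
    exact le_antisymm (e2 ▸ hr.2 z' hz') (e1 ▸ hr'.2 z hz)
  have hB : {r ∈ s | ∀ z ∈ K, Cut.form (e, (θ, (0 : ℝ))) z ≤ r}.Subsingleton := by
    intro r hr r' hr'
    obtain ⟨z, hz, e1⟩ := hm r hr.1
    obtain ⟨z', hz', e2⟩ := hm r' hr'.1
    exact le_antisymm (e1 ▸ hr'.2 z hz) (e2 ▸ hr.2 z' hz')
  refine measure_mono_null (t := {r ∈ s | ∀ z ∈ K, r ≤ Cut.form (e, (θ, (0 : ℝ))) z} ∪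
    {r ∈ s | ∀ z ∈ K, Cut.form (e, (θ, (0 : ℝ))) z ≤ r}) ?_ ?_
  · intro r hr
    rcases hs r hr with h | h
    · exact Or.inl ⟨hr, h⟩
    · exact Or.inr ⟨hr, h⟩
  · exact measure_union_null (hA.measure_zero _) (hB.measure_zero _)

theorem ae_eq_crossSet {K : Set (Pt d)} (hK : IsPolytopal K) (e : Pair d) :
    meetSet e K =ᵐ[volume] crossSet e K := by
  rw [ae_eq_set]
  refine ⟨volume_meetSet_diff_crossSet hK.sigmaCompact e, ?_⟩
  rw [Set.sdiff_eq_empty.2 (crossSet_subset_meetSet hK.convex e), measure_empty]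

theorem volume_meetSet {K : Set (Pt d)} (hK : IsPolytopal K) (e : Pair d) :
    volume (meetSet e K) = ENNReal.ofReal (perimeter (proj e K)) := by
  have hP := hK.image (projLin e)
  obtain ⟨V, hV⟩ := hP.exists_finset
  rw [proj_eq_image, ← lintegral_volume_segment hP.convex hV, Measure.volume_eq_prod,
    Measure.prod_apply (measurableSet_meetSet hK.sigmaCompact e),
    ← lintegral_indicator measurableSet_Ioc]
  refine lintegral_congr fun θ => ?_
  by_cases h : θ ∈ Set.Ioc 0 Real.pi
  · rw [Set.indicator_of_mem h]
    congr 1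
    ext r
    simp only [Set.mem_preimage, meetSet, Set.mem_ofPred_eq, h, true_and]
    exact (mem_segment_proj e K (θ, r)).symm
  · rw [Set.indicator_of_notMem h]
    have : Prod.mk θ ⁻¹' meetSet e K = ∅ := by
      ext r; simp only [Set.mem_preimage, meetSet, Set.mem_ofPred_eq, h, false_and, Set.mem_empty_iff_false]
    rw [this, measure_empty]

theorem volume_crossSet {K : Set (Pt d)} (hK : IsPolytopal K) (e : Pair d) :
    volume (crossSet e K) = ENNReal.ofReal (perimeter (proj e K)) := by
  rw [← volume_meetSet hK e, measure_congr (ae_eq_crossSet hK e)]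

/-- The law of a random line that hits `K` is the normalized Lebesgue measure on the set of the
lines that hit `K`. -/
theorem smul_lineLaw {K : Set (Pt d)} (hK : IsPolytopal K) (e : Pair d) :
    ENNReal.ofReal (perimeter (proj e K)) • lineLaw (proj e K) =
      volume.restrict (crossSet e K) := by
  rw [Measure.restrict_congr_set (ae_eq_crossSet hK e).symm]
  set W := ENNReal.ofReal (perimeter (proj e K)) with hW
  have hWint : ∫⁻ η in Set.Ioc (0 : ℝ) Real.pi, volume (segment (proj e K) η) = W := by
    have hP := hK.image (projLin e)
    obtain ⟨V, hV⟩ := hP.exists_finset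
    exact lintegral_volume_segment hP.convex hV
  by_cases hW0 : W = 0
  · rw [hW0, zero_smul, eq_comm, Measure.restrict_eq_zero, volume_meetSet hK e, ← hW, hW0]
  have hms := measurableSet_meetSet hK.sigmaCompact e
  have hsec : ∀ θ ∈ Set.Ioc (0 : ℝ) Real.pi,
      Prod.mk θ ⁻¹' meetSet e K = segment (proj e K) θ := by
    intro θ hθ
    ext r
    simp only [Set.mem_preimage, meetSet, Set.mem_ofPred_eq, hθ, true_and]
    exact (mem_segment_proj e K (θ, r)).symm
  rw [lineLaw, hWint, ← withDensity_smul' _ _ (by simp [hW]), ← withDensity_indicator_one hms]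
  refine withDensity_congr_ae ?_
  set Z : Set (ℝ × ℝ) := {q | q ∈ meetSet e K ∧ volume (Prod.mk q.1 ⁻¹' meetSet e K) = 0}
  have hZm : MeasurableSet Z := hms.inter
    ((measurable_measure_prodMk_left hms).comp measurable_fst (measurableSet_singleton 0))
  have hZ : volume Z = 0 := by
    rw [Measure.volume_eq_prod, Measure.measure_prod_null hZm]
    refine Filter.Eventually.of_forall fun θ => ?_
    by_cases h : volume (Prod.mk θ ⁻¹' meetSet e K) = 0
    · exact measure_mono_null (fun r hr => hr.1) h
    · have : Prod.mk θ ⁻¹' Z = ∅ := by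
        ext r; simp [Z, h]
      simp [this]
  have hZ' : ∀ᵐ q : ℝ × ℝ, q ∉ Z := measure_eq_zero_iff_ae_notMem.1 hZ
  have hfin : ∀ θ, volume (segment (proj e K) θ) ≠ ∞ := by
    have hP := hK.image (projLin e)
    obtain ⟨V, hV⟩ := hP.exists_finset
    intro θ
    rcases V.eq_empty_or_nonempty with rfl | hne
    · have hK0 : proj e K = ∅ := by
        rw [← closure_empty_iff, proj_eq_image, hV]; simp
      simp [hK0, segment]
    · rw [proj_eq_image, volume_segment hne hP.convex hV]
      exact ENNReal.ofReal_ne_top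
  filter_upwards [hZ'] with q hq
  simp only [Pi.smul_apply, smul_eq_mul]
  by_cases hqm : q ∈ meetSet e K
  · have h1 : q.1 ∈ Set.Ioc 0 Real.pi := hqm.1
    have h2 : q.2 ∈ segment (proj e K) q.1 := (mem_segment_proj e K q).2 hqm.2
    have h3 : volume (segment (proj e K) q.1) ≠ 0 := by
      rw [← hsec q.1 h1]
      exact fun h => hq ⟨hqm, h⟩
    rw [Set.indicator_of_mem h1, Set.indicator_of_mem h2, Set.indicator_of_mem hqm, Pi.one_apply,
      ← mul_assoc, ENNReal.mul_div_cancel hW0 (by simp [hW]),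
      ENNReal.mul_inv_cancel h3 (hfin _)]
  · rw [Set.indicator_of_notMem hqm]
    by_cases h1 : q.1 ∈ Set.Ioc 0 Real.pi
    · have h2 : q.2 ∉ segment (proj e K) q.1 :=
        fun h => hqm ⟨h1, (mem_segment_proj e K q).1 h⟩
      rw [Set.indicator_of_notMem h2, mul_zero, mul_zero]
    · rw [Set.indicator_of_notMem h1, zero_mul, mul_zero]

/-- The intensity of the cuts of a region: Lebesgue measure on the lines that hit its
projections. -/
noncomputable def hitMeasure (K : Set (Pt d)) : Measure (Cut d) :=
  ∑ e : Pair d, (volume.restrict (crossSet e K)).map fun q => (e, q)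

theorem measurable_mkCut (e : Pair d) : Measurable fun q : ℝ × ℝ => ((e, q) : Cut d) :=
  measurable_prodMk_left

theorem perimeter_nonneg (K : Set Plane) : 0 ≤ perimeter K :=
  finsum_nonneg fun _ => finsum_nonneg fun _ => Metric.diam_nonneg

theorem totalPerimeter_nonneg (K : Set (Pt d)) : 0 ≤ totalPerimeter K :=
  Finset.sum_nonneg fun _ _ => perimeter_nonneg _

theorem hitMeasure_apply (K : Set (Pt d)) {A : Set (Cut d)} (hA : MeasurableSet A) :
    hitMeasure K A = ∑ e : Pair d, volume ((Prod.mk e ⁻¹' A) ∩ crossSet e K) := by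
  rw [hitMeasure, Measure.finsetSum_apply]
  refine Finset.sum_congr rfl fun e _ => ?_
  rw [Measure.map_apply (measurable_mkCut e) hA, Measure.restrict_apply (measurable_mkCut e hA)]

theorem hitMeasure_univ {K : Set (Pt d)} (hK : IsPolytopal K) :
    hitMeasure K Set.univ = ENNReal.ofReal (totalPerimeter K) := by
  rw [hitMeasure_apply K MeasurableSet.univ, totalPerimeter,
    ENNReal.ofReal_sum_of_nonneg fun _ _ => perimeter_nonneg _]
  refine Finset.sum_congr rfl fun e _ => ?_
  rw [Set.preimage_univ, Set.univ_inter, volume_crossSet hK]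

theorem crossSet_mono (e : Pair d) {K L : Set (Pt d)} (h : K ⊆ L) : crossSet e K ⊆ crossSet e L :=
  fun _ ⟨h1, ⟨z, hz, hz'⟩, w, hw, hw'⟩ => ⟨h1, ⟨z, h hz, hz'⟩, w, h hw, hw'⟩

@[simp] theorem hitMeasure_empty : hitMeasure (∅ : Set (Pt d)) = 0 := by
  have : ∀ e : Pair d, crossSet e (∅ : Set (Pt d)) = ∅ := fun e => by ext; simp [crossSet]
  simp [hitMeasure, this]

theorem totalPerimeter_mono {K L : Set (Pt d)} (hK : IsPolytopal K) (hL : IsPolytopal L)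
    (h : K ⊆ L) : totalPerimeter K ≤ totalPerimeter L := by
  rw [← ENNReal.ofReal_le_ofReal_iff (totalPerimeter_nonneg L), ← hitMeasure_univ hK,
    ← hitMeasure_univ hL, hitMeasure_apply _ MeasurableSet.univ,
    hitMeasure_apply _ MeasurableSet.univ]
  exact Finset.sum_le_sum fun e _ => measure_mono (Set.inter_subset_inter_right _
    (crossSet_mono e h))

theorem measurableSet_cut_meets {K : Set (Pt d)} (hK : IsSigmaCompact K) :
    MeasurableSet {c : Cut d | c.Meets K} := by
  have : {c : Cut d | c.Meets K} =
      ⋃ e : Pair d, (Prod.fst ⁻¹' {e}) ∩ Prod.snd ⁻¹' {q : ℝ × ℝ | Cut.Meets (e, q) K} := by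
    ext ⟨e, q⟩
    simp
  rw [this]
  exact MeasurableSet.iUnion fun e => (measurable_fst (measurableSet_singleton e)).inter
    (measurable_snd (measurableSet_meets hK e))

/-- Among the lines that hit a region, those that meet a smaller region have the intensity of the
smaller region. -/
theorem hitMeasure_restrict {C H : Set (Pt d)} (hH : IsPolytopal H) (h : H ⊆ C) :
    (hitMeasure C).restrict {c | c.Meets H} = hitMeasure H := by
  refine Measure.ext fun A hA => ?_
  have hmeas := measurableSet_cut_meets hH.sigmaCompact
  rw [Measure.restrict_apply hA, hitMeasure_apply _ (hA.inter hmeas), hitMeasure_apply _ hA]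
  refine Finset.sum_congr rfl fun e _ => ?_
  refine le_antisymm ?_ (measure_mono ?_)
  · calc _ ≤ volume ((Prod.mk e ⁻¹' A) ∩ meetSet e H) :=
          measure_mono fun q hq => ⟨hq.1.1, hq.2.1, hq.1.2⟩
      _ = _ := measure_congr ((Filter.EventuallyEq.rfl).inter (ae_eq_crossSet hH e))
  · exact fun q hq => ⟨⟨hq.1, (crossSet_subset_meetSet hH.convex e hq.2).2⟩,
      crossSet_mono e h hq.2⟩

theorem ae_hitMeasure_meets {K : Set (Pt d)} (hK : IsPolytopal K) :
    ∀ᵐ c ∂hitMeasure K, c.Meets K := by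
  have h := hitMeasure_restrict hK (le_refl K)
  rw [← h]
  have hmeas := measurableSet_cut_meets hK.sigmaCompact
  exact ae_restrict_mem hmeas

theorem totalPerimeter_pos {K : Set (Pt d)} (hd : 2 ≤ d) (hK : IsPolytopal K) {z w : Pt d}
    (hz : z ∈ K) (hw : w ∈ K) (hne : z ≠ w) : 0 < totalPerimeter K := by
  obtain ⟨i, hi⟩ := Function.ne_iff.1 hne
  -- a pair of dimensions which contains `i`, and an angle at which the two points differ
  obtain ⟨e, φ, hφ, hd'⟩ : ∃ (e : Pair d) (φ : ℝ), φ ∈ closure (Set.Ioo 0 Real.pi) ∧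
      coord (projLin e z) φ ≠ coord (projLin e w) φ := by
    rw [closure_Ioo Real.pi_pos.ne]
    have hpi := Real.pi_pos
    by_cases h0 : (i : ℕ) = 0
    · refine ⟨⟨(i, ⟨1, hd⟩), by rw [Fin.lt_def]; simp [h0]⟩, Real.pi, ⟨hpi.le, le_rfl⟩, ?_⟩
      simpa [coord, projLin] using hi
    · refine ⟨⟨(⟨0, by omega⟩, i), by rw [Fin.lt_def]; simp; omega⟩, Real.pi / 2,
        ⟨by linarith, by linarith⟩, ?_⟩
      simpa [coord, projLin] using hi
  have hpos : 0 < perimeter (proj e K) := by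
    rw [← ENNReal.ofReal_pos, ← volume_crossSet hK]
    have hopen : IsOpen {q : ℝ × ℝ | q.1 ∈ Set.Ioo 0 Real.pi ∧
        ((coord (projLin e z) q.1 < q.2 ∧ q.2 < coord (projLin e w) q.1) ∨
        (coord (projLin e w) q.1 < q.2 ∧ q.2 < coord (projLin e z) q.1))} := by
      have h1 : ∀ u : Plane, Continuous fun q : ℝ × ℝ => coord u q.1 :=
        fun u => (continuous_coord u).comp continuous_fst
      refine (isOpen_Ioo.preimage continuous_fst).inter (IsOpen.union ?_ ?_)
      · exact (isOpen_lt (h1 _) continuous_snd).inter (isOpen_lt continuous_snd (h1 _))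
      · exact (isOpen_lt (h1 _) continuous_snd).inter (isOpen_lt continuous_snd (h1 _))
    refine (hopen.measure_pos volume ?_).trans_le (measure_mono ?_)
    · have hU : IsOpen {θ | coord (projLin e z) θ ≠ coord (projLin e w) θ} :=
        isOpen_ne_fun (continuous_coord _) (continuous_coord _)
      obtain ⟨θ, hθ1, hθ2⟩ := mem_closure_iff.1 hφ _ hU hd'
      rcases lt_or_gt_of_ne hθ1 with h | h
      · obtain ⟨r, hr⟩ := exists_between h
        exact ⟨(θ, r), hθ2, Or.inl hr⟩
      · obtain ⟨r, hr⟩ := exists_between h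
        exact ⟨(θ, r), hθ2, Or.inr hr⟩
    · rintro q ⟨h1, h2⟩
      refine ⟨⟨h1.1, h1.2.le⟩, ?_⟩
      simp only [form_eq_coord]
      rcases h2 with h2 | h2
      · exact ⟨⟨z, hz, h2.1⟩, w, hw, h2.2⟩
      · exact ⟨⟨w, hw, h2.1⟩, z, hz, h2.2⟩
  exact hpos.trans_le (Finset.single_le_sum (f := fun e => perimeter (proj e K))
    (fun _ _ => perimeter_nonneg _) (Finset.mem_univ e))

end Lines

/-! ### Leaves and cells of a tree -/

section Cells

variable {d N : ℕ} {P : Set (Pt d)}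

/-- The number of leaves that a list of events produces. -/
def numLeaves : List (Event d) → ℕ
  | [] => 1
  | ev :: es => if ev.1 < numLeaves es then numLeaves es + 1 else numLeaves es

/-- The cell with index `k`, as a function of the events only. -/
def cellOf (P : Set (Pt d)) (es : List (Event d)) (k : ℕ) : Set (Pt d) := cell P (0, es) k

/-- The mean parameter of the `k`-th leaf. -/
noncomputable def leafMean (P : Set (Pt d)) (T : Tree d) (k : ℕ) : ℝ :=
  ((leaves P T).map Prod.snd).getD k 0

theorem length_leavesOf (a₀ : ℝ) (es : List (Event d)) :
    (leavesOf P a₀ es).length = numLeaves es := by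
  induction es with
  | nil => rfl
  | cons ev es ih =>
    obtain ⟨k, c, t, a, b⟩ := ev
    simp only [leavesOf, numLeaves]
    rw [← ih]
    split_ifs <;> simp

theorem length_leaves (T : Tree d) : (leaves P T).length = numLeaves T.2 := length_leavesOf _ _

theorem one_le_numLeaves (es : List (Event d)) : 1 ≤ numLeaves es := by
  induction es with
  | nil => simp [numLeaves]
  | cons ev es ih =>
    simp only [numLeaves]
    split_ifs <;> omega

theorem leavesOf_getD_cons (a₀ : ℝ) (ev : Event d) (es : List (Event d)) (h : ev.1 < numLeaves es)
    (k : ℕ) :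
    (leavesOf P a₀ (ev :: es)).getD k (∅, 0) =
      if k = ev.1 then
        (((leavesOf P a₀ es).getD ev.1 (∅, 0)).1 ∩ ev.2.1.below, ev.2.2.2.1)
      else if k = numLeaves es then
        (((leavesOf P a₀ es).getD ev.1 (∅, 0)).1 ∩ ev.2.1.above, ev.2.2.2.2)
      else (leavesOf P a₀ es).getD k (∅, 0) := by
  obtain ⟨j, c, t, a, b⟩ := ev
  simp only at h ⊢
  have hl := length_leavesOf (P := P) a₀ es
  have hj : j < (leavesOf P a₀ es).length := by rw [hl]; exact h
  simp only [leavesOf]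
  rw [dif_pos hj, ← hl]
  simp only [List.getD_eq_getElem?_getD, List.getElem?_append, List.length_set, List.getElem?_set]
  by_cases hk : k < (leavesOf P a₀ es).length
  · rw [if_pos hk]
    by_cases hkj : k = j
    · subst hkj
      simp [hk]
    · rw [if_neg (Ne.symm hkj), if_neg hkj, if_neg hk.ne]
  · rw [if_neg hk]
    have hkj : k ≠ j := by omega
    rw [if_neg hkj]
    by_cases hkl : k = (leavesOf P a₀ es).length
    · subst hkl
      simp [hj]
    · rw [if_neg hkl]
      have h1 : k - (leavesOf P a₀ es).length ≠ 0 := by omega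
      rw [List.getElem?_eq_none (by simp; omega), List.getElem?_eq_none (by omega)]

theorem leavesOf_cons_of_not (a₀ : ℝ) (ev : Event d) (es : List (Event d))
    (h : ¬ ev.1 < numLeaves es) : leavesOf P a₀ (ev :: es) = leavesOf P a₀ es := by
  obtain ⟨j, c, t, a, b⟩ := ev
  rw [← length_leavesOf (P := P) a₀] at h
  simp only [leavesOf]
  rw [dif_neg h]

theorem cell_eq_getD (T : Tree d) (k : ℕ) : cell P T k = ((leaves P T).getD k (∅, 0)).1 := by
  simp only [cell, List.getD_eq_getElem?_getD, List.getElem?_map]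
  cases (leaves P T)[k]? <;> simp

theorem leafMean_eq_getD (T : Tree d) (k : ℕ) :
    leafMean P T k = ((leaves P T).getD k (∅, 0)).2 := by
  simp only [leafMean, List.getD_eq_getElem?_getD, List.getElem?_map]
  cases (leaves P T)[k]? <;> simp

theorem cell_cons (a₀ : ℝ) (ev : Event d) (es : List (Event d)) (k : ℕ) :
    cell P (a₀, ev :: es) k = if ev.1 < numLeaves es then
      (if k = ev.1 then cell P (a₀, es) ev.1 ∩ ev.2.1.below
      else if k = numLeaves es then cell P (a₀, es) ev.1 ∩ ev.2.1.above
      else cell P (a₀, es) k) else cell P (a₀, es) k := by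
  simp only [cell_eq_getD, leaves]
  split_ifs with h h1 h2
  · rw [leavesOf_getD_cons a₀ ev es h, if_pos h1]
  · rw [leavesOf_getD_cons a₀ ev es h, if_neg h1, if_pos h2]
  · rw [leavesOf_getD_cons a₀ ev es h, if_neg h1, if_neg h2]
  · rw [leavesOf_cons_of_not a₀ ev es h]

theorem leafMean_cons (a₀ : ℝ) (ev : Event d) (es : List (Event d)) (k : ℕ) :
    leafMean P (a₀, ev :: es) k = if ev.1 < numLeaves es then
      (if k = ev.1 then ev.2.2.2.1
      else if k = numLeaves es then ev.2.2.2.2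
      else leafMean P (a₀, es) k) else leafMean P (a₀, es) k := by
  simp only [leafMean_eq_getD, leaves]
  split_ifs with h h1 h2
  · rw [leavesOf_getD_cons a₀ ev es h, if_pos h1]
  · rw [leavesOf_getD_cons a₀ ev es h, if_neg h1, if_pos h2]
  · rw [leavesOf_getD_cons a₀ ev es h, if_neg h1, if_neg h2]
  · rw [leavesOf_cons_of_not a₀ ev es h]

theorem cell_nil (a₀ : ℝ) (k : ℕ) : cell P (a₀, []) k = if k = 0 then P else ∅ := by
  cases k <;> simp [cell, leaves, leavesOf]

theorem leafMean_nil (a₀ : ℝ) (k : ℕ) : leafMean P (a₀, []) k = if k = 0 then a₀ else 0 := by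
  cases k <;> simp [leafMean, leaves, leavesOf]

theorem cell_of_le {T : Tree d} {k : ℕ} (h : numLeaves T.2 ≤ k) : cell P T k = ∅ := by
  rw [cell_eq_getD, List.getD_eq_default]
  rw [length_leaves]; exact h

theorem lt_numLeaves_of_mem {T : Tree d} {k : ℕ} {z : Pt d} (h : z ∈ cell P T k) :
    k < numLeaves T.2 := by
  by_contra hk
  rw [cell_of_le (not_lt.1 hk)] at h
  exact h

/-- The cells do not depend on the root mean. -/
theorem cell_eq_cellOf (T : Tree d) (k : ℕ) : cell P T k = cellOf P T.2 k := by
  obtain ⟨a₀, es⟩ := T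
  simp only [cellOf]
  induction es generalizing k with
  | nil => rw [cell_nil, cell_nil]
  | cons ev es ih => rw [cell_cons, cell_cons, ih, ih]

theorem cellOf_nil (k : ℕ) : cellOf P ([] : List (Event d)) k = if k = 0 then P else ∅ :=
  cell_nil 0 k

theorem cellOf_cons (ev : Event d) (es : List (Event d)) (k : ℕ) :
    cellOf P (ev :: es) k = if ev.1 < numLeaves es then
      (if k = ev.1 then cellOf P es ev.1 ∩ ev.2.1.below
      else if k = numLeaves es then cellOf P es ev.1 ∩ ev.2.1.above
      else cellOf P es k) else cellOf P es k := cell_cons 0 ev es k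

/-- Different leaves are disjoint. -/
theorem cellOf_unique {es : List (Event d)} {k k' : ℕ} {z : Pt d} (h : z ∈ cellOf P es k)
    (h' : z ∈ cellOf P es k') : k = k' := by
  induction es generalizing k k' with
  | nil =>
    rw [cellOf_nil] at h h'
    split_ifs at h h' with h1 h2
    · rw [h1, h2]
    all_goals simp_all
  | cons ev es ih =>
    rw [cellOf_cons] at h h'
    have hba : z ∈ ev.2.1.below → z ∈ ev.2.1.above → False := fun h1 h2 =>
      lt_asymm (show ev.2.1.form z < ev.2.1.2.2 from h1) (show ev.2.1.2.2 < ev.2.1.form z from h2)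
    split_ifs at h h' with h0 h1 h2 h3 h4 h5 h6 h7
    · rw [h1, h2]
    · exact absurd h'.2 fun h'' => hba h.2 h''
    · exact absurd (ih h.1 h') fun e => h2 e.symm
    · exact absurd h'.2 fun h'' => hba h'' h.2
    · rw [h4, h6]
    · exact absurd (ih h.1 h') fun e => h5 e.symm
    · exact absurd (ih h'.1 h) fun e => h1 e.symm
    · exact absurd (ih h'.1 h) fun e => h1 e.symm
    · exact ih h h'
    · exact ih h h'

open scoped Classical in
theorem treeValue_eq_sum (T : Tree d) (z : Pt d) : treeValue P T z =
    ∑ k ∈ Finset.range (numLeaves T.2), if z ∈ cell P T k then leafMean P T k else 0 := by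
  rw [treeValue, ← length_leaves (P := P), ← List.sum_range_succ_aux]
  · simp only [cell_eq_getD, leafMean_eq_getD]
  where
  List.sum_range_succ_aux {T : Tree d} {z : Pt d} :
      (∑ k ∈ Finset.range (leaves P T).length, if z ∈ ((leaves P T).getD k (∅, 0)).1 then
        ((leaves P T).getD k (∅, 0)).2 else 0) =
      ((leaves P T).map fun l => if z ∈ l.1 then l.2 else 0).sum := by
    generalize leaves P T = L
    induction L with
    | nil => simp
    | cons l L ih =>
      rw [List.length_cons, Finset.sum_range_succ', List.map_cons, List.sum_cons, ← ih, add_comm]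
      simp

theorem treeValue_of_mem {T : Tree d} {k : ℕ} {z : Pt d} (h : z ∈ cell P T k) :
    treeValue P T z = leafMean P T k := by
  classical
  rw [treeValue_eq_sum, Finset.sum_eq_single k]
  · rw [if_pos h]
  · intro k' _ hne
    rw [if_neg]
    intro h'
    rw [cell_eq_cellOf] at h h'
    exact hne (cellOf_unique h' h)
  · intro hk
    exact absurd (Finset.mem_range.2 (lt_numLeaves_of_mem h)) hk

theorem treeValue_of_notMem {T : Tree d} {z : Pt d} (h : ∀ k, z ∉ cell P T k) :
    treeValue P T z = 0 := by
  classical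
  rw [treeValue_eq_sum]
  exact Finset.sum_eq_zero fun k _ => if_neg (h k)

/-- A leaf is a polytope cut by open half-spaces, and it is relatively open. -/
structure IsCellOf (P C : Set (Pt d)) : Prop where
  polytopal : IsPolytopal C
  exists_open : ∃ O, IsOpen O ∧ C = P ∩ O

theorem IsPolyhedron.isPolytopal (hP : IsPolyhedron P) : IsPolytopal P := by
  obtain ⟨V, rfl⟩ := hP
  exact isPolytopal_convexHull _ V.finite_toSet

theorem IsCellOf.below {C : Set (Pt d)} (hC : IsCellOf P C) (c : Cut d) :
    IsCellOf P (C ∩ c.below) where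
  polytopal := hC.polytopal.inter_lt (formLin c) c.2.2
  exists_open := by
    obtain ⟨O, hO, rfl⟩ := hC.exists_open
    exact ⟨O ∩ c.below, hO.inter (isOpen_lt (formLin c).continuous_of_finiteDimensional
      continuous_const), Set.inter_assoc _ _ _⟩

theorem IsCellOf.above {C : Set (Pt d)} (hC : IsCellOf P C) (c : Cut d) :
    IsCellOf P (C ∩ c.above) where
  polytopal := by
    have h := hC.polytopal.inter_lt (-formLin c) (-c.2.2)
    have e : {z | (-formLin c) z < -c.2.2} = c.above := by
      ext z
      simp only [Set.mem_ofPred_eq, LinearMap.neg_apply, neg_lt_neg_iff]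
      rfl
    rwa [e] at h
  exists_open := by
    obtain ⟨O, hO, rfl⟩ := hC.exists_open
    exact ⟨O ∩ c.above, hO.inter (isOpen_lt continuous_const
      (formLin c).continuous_of_finiteDimensional), Set.inter_assoc _ _ _⟩

theorem isCellOf_empty : IsCellOf P (∅ : Set (Pt d)) where
  polytopal := by simpa using isPolytopal_convexHull (∅ : Set (Pt d)) Set.finite_empty
  exists_open := ⟨∅, isOpen_empty, by simp⟩

theorem isCellOf_cellOf (hP : IsPolyhedron P) (es : List (Event d)) (k : ℕ) :
    IsCellOf P (cellOf P es k) := by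
  induction es generalizing k with
  | nil =>
    rw [cellOf_nil]
    split_ifs
    · exact ⟨hP.isPolytopal, Set.univ, isOpen_univ, by simp⟩
    · exact isCellOf_empty
  | cons ev es ih =>
    rw [cellOf_cons]
    split_ifs
    · exact (ih _).below _
    · exact (ih _).above _
    · exact ih _
    · exact ih _

theorem isCellOf_cell (hP : IsPolyhedron P) (T : Tree d) (k : ℕ) : IsCellOf P (cell P T k) := by
  rw [cell_eq_cellOf]; exact isCellOf_cellOf hP _ _

theorem IsCellOf.subset {C : Set (Pt d)} (hC : IsCellOf P C) : C ⊆ P := by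
  obtain ⟨O, -, rfl⟩ := hC.exists_open
  exact Set.inter_subset_left

variable (x : Fin N → Pt d)

theorem isPolytopal_dataHull (C : Set (Pt d)) : IsPolytopal (dataHull x C) :=
  isPolytopal_convexHull _ ((Set.finite_range x).inter_of_left C)

theorem dataHull_subset {C : Set (Pt d)} (hC : Convex ℝ C) : dataHull x C ⊆ C :=
  convexHull_min Set.inter_subset_right hC

theorem IsCellOf.isPolytopal_region {C : Set (Pt d)} (hC : IsCellOf P C) (s : Scheme) :
    IsPolytopal (s.region x C) := by
  cases s
  · exact hC.polytopal
  · exact isPolytopal_dataHull x C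

theorem IsCellOf.region_subset {C : Set (Pt d)} (hC : IsCellOf P C) (s : Scheme) :
    s.region x C ⊆ C := by
  cases s
  · exact subset_rfl
  · exact dataHull_subset x hC.polytopal.convex

theorem region_empty (s : Scheme) : s.region x ∅ = ∅ := by
  cases s <;> simp [Scheme.region, dataHull]

theorem mem_dataIn (C : Set (Pt d)) (i : Fin N) : i ∈ dataIn x C ↔ x i ∈ C := by
  simp [dataIn]

theorem range_inter_eq (C : Set (Pt d)) : Set.range x ∩ C = x '' (dataIn x C : Set (Fin N)) := by
  ext z
  constructor
  · rintro ⟨⟨i, rfl⟩, h⟩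
    exact ⟨i, (mem_dataIn x C i).2 h, rfl⟩
  · rintro ⟨i, h, rfl⟩
    exact ⟨⟨i, rfl⟩, (mem_dataIn x C i).1 h⟩

/-- The convex hull of the data with indices in `S`. -/
def hullOf (x : Fin N → Pt d) (S : Finset (Fin N)) : Set (Pt d) :=
  convexHull ℝ (x '' (S : Set (Fin N)))

theorem dataHull_eq (C : Set (Pt d)) : dataHull x C = hullOf x (dataIn x C) := by
  rw [dataHull, range_inter_eq, hullOf]

theorem isPolytopal_hullOf (S : Finset (Fin N)) : IsPolytopal (hullOf x S) :=
  isPolytopal_convexHull _ (S.finite_toSet.image x)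

end Cells

/-! ### The law of a cut is the normalized intensity of cuts -/

section CutLaw

variable {d N : ℕ} {P : Set (Pt d)} (x : Fin N → Pt d)

/-- The intensity of the cuts of the leaves of a tree. -/
noncomputable def cutIntensity (s : Scheme) (P : Set (Pt d)) (x : Fin N → Pt d) (T : Tree d) :
    Measure (ℕ × Cut d) :=
  Measure.sum fun k => (hitMeasure (s.region x (cell P T k))).map (Prod.mk k)

theorem cutIntensity_eq_sum (s : Scheme) (T : Tree d) : cutIntensity s P x T =
    ∑ k ∈ Finset.range (numLeaves T.2),
      (hitMeasure (s.region x (cell P T k))).map (Prod.mk k) := by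
  refine Measure.ext fun A hA => ?_
  rw [cutIntensity, Measure.sum_apply _ hA, Measure.finsetSum_apply]
  refine tsum_eq_sum fun k hk => ?_
  rw [cell_of_le (by simpa using hk), region_empty]
  simp

theorem length_regions (s : Scheme) (T : Tree d) :
    (regions s P x T).length = numLeaves T.2 := by
  rw [regions, List.length_map, length_leaves]

theorem regions_get (s : Scheme) (T : Tree d) (k : Fin (regions s P x T).length) :
    (regions s P x T).get k = s.region x (cell P T k) := by
  have hk : (k : ℕ) < (leaves P T).length :=
    k.2.trans_eq (List.length_map _)
  rw [cell_eq_getD, List.getD_eq_getElem _ _ hk]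
  exact List.getElem_map (fun l : Set (Pt d) × ℝ => s.region x l.1)

theorem rate_regions (s : Scheme) (T : Tree d) : rate (regions s P x T) =
    ∑ k ∈ Finset.range (numLeaves T.2), totalPerimeter (s.region x (cell P T k)) := by
  have h : (regions s P x T).map totalPerimeter =
      List.ofFn fun k : Fin (regions s P x T).length =>
        totalPerimeter ((regions s P x T).get k) := by
    apply List.ext_getElem <;> simp
  rw [rate, h, List.sum_ofFn]
  simp only [regions_get]
  rw [← length_regions x s T (P := P)]
  exact Fin.sum_univ_eq_sum_range (fun k => totalPerimeter (s.region x (cell P T k))) _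

theorem rate_nonneg (s : Scheme) (T : Tree d) : 0 ≤ rate (regions s P x T) := by
  rw [rate_regions]
  exact Finset.sum_nonneg fun _ _ => totalPerimeter_nonneg _

theorem rate_le (hP : IsPolyhedron P) (s : Scheme) (T : Tree d) :
    rate (regions s P x T) ≤ numLeaves T.2 * totalPerimeter P := by
  rw [rate_regions]
  calc _ ≤ ∑ _k ∈ Finset.range (numLeaves T.2), totalPerimeter P :=
        Finset.sum_le_sum fun k _ => by
          have hC := isCellOf_cell hP T k
          exact totalPerimeter_mono (hC.isPolytopal_region x s) hP.isPolytopal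
            ((hC.region_subset x s).trans hC.subset)
    _ = _ := by simp

theorem cutIntensity_univ (hP : IsPolyhedron P) (s : Scheme) (T : Tree d) :
    cutIntensity s P x T Set.univ = ENNReal.ofReal (rate (regions s P x T)) := by
  rw [cutIntensity_eq_sum, Measure.finsetSum_apply, rate_regions,
    ENNReal.ofReal_sum_of_nonneg fun _ _ => totalPerimeter_nonneg _]
  refine Finset.sum_congr rfl fun k _ => ?_
  rw [Measure.map_apply measurable_prodMk_left MeasurableSet.univ, Set.preimage_univ,
    hitMeasure_univ ((isCellOf_cell hP T k).isPolytopal_region x s)]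

theorem cutLaw_regions (hP : IsPolyhedron P) (s : Scheme) (T : Tree d) :
    cutLaw (regions s P x T) =
      (ENNReal.ofReal (rate (regions s P x T)))⁻¹ • cutIntensity s P x T := by
  have hr := rate_nonneg (P := P) x s T
  have hterm : ∀ (k : Fin (regions s P x T).length) (e : Pair d),
      ENNReal.ofReal (perimeter (proj e ((regions s P x T).get k)) / rate (regions s P x T)) •
        (lineLaw (proj e ((regions s P x T).get k))).map (fun q => ((k : ℕ), (e, q))) =
      (ENNReal.ofReal (rate (regions s P x T)))⁻¹ •
        ((volume.restrict (crossSet e (s.region x (cell P T k)))).map fun q => (e, q)).map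
          (Prod.mk (k : ℕ)) := by
    intro k e
    rw [regions_get, Measure.map_map measurable_prodMk_left (measurable_mkCut e)]
    have hpoly := (isCellOf_cell hP T k).isPolytopal_region x s
    rw [← smul_lineLaw hpoly, Measure.map_smul, smul_smul]
    rcases hr.eq_or_lt with h0 | hpos
    · have : perimeter (proj e (s.region x (cell P T k))) = 0 := by
        refine le_antisymm ?_ (perimeter_nonneg _)
        have hk : (k : ℕ) ∈ Finset.range (numLeaves T.2) := by
          rw [Finset.mem_range, ← length_regions x s T (P := P)]; exact k.2
        calc perimeter (proj e (s.region x (cell P T k)))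
            ≤ totalPerimeter (s.region x (cell P T k)) :=
              Finset.single_le_sum (f := fun e => perimeter (proj e (s.region x (cell P T k))))
                (fun _ _ => perimeter_nonneg _) (Finset.mem_univ e)
          _ ≤ rate (regions s P x T) := by
              rw [rate_regions]
              exact Finset.single_le_sum
                (f := fun k => totalPerimeter (s.region x (cell P T k)))
                (fun _ _ => totalPerimeter_nonneg _) hk
          _ = 0 := h0.symm
      simp [this]
    · rw [ENNReal.ofReal_div_of_pos hpos, div_eq_mul_inv, mul_comm]
      rfl
  have hsum : ∀ k : Fin (regions s P x T).length,
      ∑ e : Pair d, ((volume.restrict (crossSet e (s.region x (cell P T k)))).map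
        fun q => (e, q)).map (Prod.mk (k : ℕ)) =
      (hitMeasure (s.region x (cell P T k))).map (Prod.mk (k : ℕ)) := by
    intro k
    rw [hitMeasure, Measure.map_finset_sum (by fun_prop)]
  rw [cutLaw]
  simp only [hterm]
  simp only [← Finset.smul_sum, hsum]
  rw [cutIntensity_eq_sum, ← length_regions x s T (P := P)]
  congr 1
  exact Fin.sum_univ_eq_sum_range
    (fun k => (hitMeasure (s.region x (cell P T k))).map (Prod.mk k)) _

theorem isProbabilityMeasure_cutLaw (hP : IsPolyhedron P) (s : Scheme) (T : Tree d)
    (h : 0 < rate (regions s P x T)) : IsProbabilityMeasure (cutLaw (regions s P x T)) := by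
  refine ⟨?_⟩
  rw [cutLaw_regions x hP, Measure.smul_apply, cutIntensity_univ x hP, smul_eq_mul,
    ENNReal.inv_mul_cancel (by simpa using h) ENNReal.ofReal_ne_top]

theorem cutLaw_univ_le (hP : IsPolyhedron P) (s : Scheme) (T : Tree d) :
    cutLaw (regions s P x T) Set.univ ≤ 1 := by
  rw [cutLaw_regions x hP, Measure.smul_apply, cutIntensity_univ x hP, smul_eq_mul, mul_comm]
  exact ENNReal.mul_inv_le_one _

theorem measurableSet_meets_dataHull (T : Tree d) :
    MeasurableSet {kc : ℕ × Cut d | kc.2.Meets (dataHull x (cell P T kc.1))} := by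
  have : {kc : ℕ × Cut d | kc.2.Meets (dataHull x (cell P T kc.1))} =
      ⋃ k : ℕ, (Prod.fst ⁻¹' {k}) ∩ Prod.snd ⁻¹' {c | c.Meets (dataHull x (cell P T k))} := by
    ext ⟨k, c⟩
    simp
  rw [this]
  exact MeasurableSet.iUnion fun k => (measurable_fst (measurableSet_singleton k)).inter
    (measurable_snd (measurableSet_cut_meets (isPolytopal_dataHull x _).sigmaCompact))

/-- Among the cuts of the leaves, those that meet the convex hull of the data in the leaf have the
intensity of the cuts of the hulls. -/
theorem cutIntensity_restrict (hP : IsPolyhedron P) (s : Scheme) (T : Tree d) :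
    (cutIntensity s P x T).restrict {kc | kc.2.Meets (dataHull x (cell P T kc.1))} =
      cutIntensity .hull P x T := by
  have hm := measurableSet_meets_dataHull (P := P) x T
  have key : ∀ k, (hitMeasure (s.region x (cell P T k))).restrict
      {c | c.Meets (dataHull x (cell P T k))} = hitMeasure (dataHull x (cell P T k)) := by
    intro k
    have hsub : dataHull x (cell P T k) ⊆ s.region x (cell P T k) := by
      cases s
      · exact dataHull_subset x (isCellOf_cell hP T k).polytopal.convex
      · exact Set.Subset.refl _
    exact hitMeasure_restrict (isPolytopal_dataHull x _) hsub
  rw [cutIntensity, cutIntensity, Measure.restrict_sum _ hm]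
  refine congrArg Measure.sum (funext fun k => ?_)
  rw [Measure.restrict_map measurable_prodMk_left hm]
  exact congrArg (Measure.map (Prod.mk k)) (key k)

/-- The cut of the full scheme, conditioned on meeting the convex hull of the data in the leaf that
is cut, has the law of the cut of the hull scheme. -/
theorem cond_cutLaw (hP : IsPolyhedron P) (T : Tree d)
    (hf : 0 < rate (regions .full P x T)) :
    ProbabilityTheory.cond (cutLaw (regions .full P x T))
        {kc | kc.2.Meets (dataHull x (cell P T kc.1))} = cutLaw (regions .hull P x T) := by
  obtain ⟨rf, hrf⟩ : ∃ rf, rf = ENNReal.ofReal (rate (regions .full P x T)) := ⟨_, rfl⟩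
  have h0 : rf ≠ 0 := by rw [hrf]; simpa using hf
  have ht : rf ≠ ∞ := by rw [hrf]; exact ENNReal.ofReal_ne_top
  have hrest : (cutLaw (regions .full P x T)).restrict
      {kc | kc.2.Meets (dataHull x (cell P T kc.1))} = rf⁻¹ • cutIntensity .hull P x T := by
    rw [cutLaw_regions x hP, ← hrf, Measure.restrict_smul, cutIntensity_restrict x hP]
  rw [ProbabilityTheory.cond, hrest]
  have : cutLaw (regions .full P x T) {kc | kc.2.Meets (dataHull x (cell P T kc.1))} =
      rf⁻¹ * ENNReal.ofReal (rate (regions .hull P x T)) := by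
    rw [← Measure.restrict_apply_univ, hrest, Measure.smul_apply, cutIntensity_univ x hP,
      smul_eq_mul]
  rw [this, smul_smul, cutLaw_regions x hP, ENNReal.mul_inv (Or.inr ENNReal.ofReal_ne_top)
    (Or.inl (ENNReal.inv_ne_top.2 h0)), inv_inv, mul_right_comm, ENNReal.mul_inv_cancel h0 ht, one_mul]

theorem rate_pos (hd : 2 ≤ d) (hP : IsPolyhedron P) (s : Scheme) (T : Tree d)
    (h : ∃ l ∈ leaves P T, ∃ i j, x i ∈ l.1 ∧ x j ∈ l.1 ∧ x i ≠ x j) :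
    0 < rate (regions s P x T) := by
  obtain ⟨l, hl, i, j, hi, hj, hne⟩ := h
  obtain ⟨k, hk, rfl⟩ := List.getElem_of_mem hl
  have e : cell P T k = (leaves P T)[k].1 := by
    rw [cell_eq_getD, List.getD_eq_getElem _ _ hk]
  rw [← e] at hi hj
  have hdata : ∀ i, x i ∈ cell P T k → x i ∈ s.region x (cell P T k) := by
    intro i hi
    cases s
    · exact hi
    · exact subset_convexHull ℝ _ ⟨Set.mem_range_self i, hi⟩
  rw [rate_regions]
  refine (totalPerimeter_pos hd ((isCellOf_cell hP T k).isPolytopal_region x s) (hdata i hi)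
    (hdata j hj) hne).trans_le ?_
  exact Finset.single_le_sum (f := fun k => totalPerimeter (s.region x (cell P T k)))
    (fun _ _ => totalPerimeter_nonneg _)
    (Finset.mem_range.2 (by rw [← length_leaves (P := P)]; exact hk))

end CutLaw

/-! ### Measurability of the functionals of a tree -/

section Functionals

attribute [local irreducible] cell leafMean treeValue dataIn hullOf

variable {d N : ℕ} {P : Set (Pt d)}

theorem measurable_eval_nat {β : Type*} [MeasurableSpace β] :
    Measurable fun p : (ℕ → β) × ℕ => p.1 p.2 :=
  measurable_from_prod_countable_left fun k => measurable_pi_apply k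

theorem measurable_list_rec' {α β : Type*} [MeasurableSpace α] [MeasurableSpace β]
    {f : List α → β} {g : α × List α × β → β} (hg : Measurable g)
    (h : ∀ a l, f (a :: l) = g (a, l, f l)) : Measurable f :=
  (measurable_list_rec (γ := Unit) (f := fun _ l => f l) measurable_const
    (g := fun p => g p.2) (hg.comp measurable_snd) fun _ a l => h a l).comp
    (measurable_const.prodMk measurable_id : Measurable fun l : List α => ((), l))

theorem measurable_numLeaves : Measurable (numLeaves : List (Event d) → ℕ) := by
  refine measurable_list_rec'
    (g := fun p => if p.1.1 < p.2.2 then p.2.2 + 1 else p.2.2) ?_ fun _ _ => rfl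
  exact Measurable.ite (measurableSet_lt (by fun_prop) (by fun_prop)) (by fun_prop) (by fun_prop)

theorem measurable_mem_cellOf (z : Pt d) :
    Measurable fun p : List (Event d) × ℕ => z ∈ cellOf P p.1 p.2 := by
  have h : Measurable fun es : List (Event d) => (fun k => z ∈ cellOf P es k, numLeaves es) := by
    refine measurable_list_rec' (g := fun p : Event d × List (Event d) × (ℕ → Prop) × ℕ =>
      (fun k => if p.1.1 < p.2.2.2 then
        (if k = p.1.1 then p.2.2.1 p.1.1 ∧ p.1.2.1.form z < p.1.2.1.2.2
        else if k = p.2.2.2 then p.2.2.1 p.1.1 ∧ p.1.2.1.2.2 < p.1.2.1.form z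
        else p.2.2.1 k) else p.2.2.1 k,
      if p.1.1 < p.2.2.2 then p.2.2.2 + 1 else p.2.2.2)) ?_ ?_
    · have hev : Measurable fun p : Event d × List (Event d) × (ℕ → Prop) × ℕ =>
          p.2.2.1 p.1.1 := measurable_eval_nat.comp
        (f := fun p : Event d × List (Event d) × (ℕ → Prop) × ℕ => (p.2.2.1, p.1.1)) (by fun_prop)
      have hform : Measurable fun p : Event d × List (Event d) × (ℕ → Prop) × ℕ =>
          p.1.2.1.form z := (measurable_form z).comp
        (f := fun p : Event d × List (Event d) × (ℕ → Prop) × ℕ => p.1.2.1) (by fun_prop)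
      have hlt : MeasurableSet {p : Event d × List (Event d) × (ℕ → Prop) × ℕ |
          p.1.1 < p.2.2.2} := measurableSet_lt (by fun_prop) (by fun_prop)
      refine Measurable.prodMk (measurable_pi_lambda _ fun k => ?_) ?_
      · have hk : Measurable fun p : Event d × List (Event d) × (ℕ → Prop) × ℕ =>
            p.2.2.1 k := by fun_prop
        refine Measurable.ite hlt (Measurable.ite ?_ ?_ (Measurable.ite ?_ ?_ hk)) hk
        · exact measurableSet_eq_fun (by fun_prop) (by fun_prop)
        · exact hev.and (measurableSet_setOfPred.1 (measurableSet_lt hform (by fun_prop)))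
        · exact measurableSet_eq_fun (by fun_prop) (by fun_prop)
        · exact hev.and (measurableSet_setOfPred.1 (measurableSet_lt (by fun_prop) hform))
      · exact Measurable.ite hlt (by fun_prop) (by fun_prop)
    · intro ev es
      refine Prod.ext (funext fun k => ?_) rfl
      simp only [cellOf_cons]
      split_ifs <;> rfl
  exact measurable_eval_nat.comp
    (((measurable_fst.comp h).comp measurable_fst).prodMk measurable_snd)

theorem measurable_mem_cell (z : Pt d) :
    Measurable fun p : Tree d × ℕ => z ∈ cell P p.1 p.2 := by
  simp only [cell_eq_cellOf]
  exact (measurable_mem_cellOf z).comp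
    ((measurable_snd.comp measurable_fst).prodMk measurable_snd)

theorem measurable_leafMean : Measurable fun p : Tree d × ℕ => leafMean P p.1 p.2 := by
  have h := measurable_list_rec (γ := ℝ) (α := Event d) (β := (ℕ → ℝ) × ℕ)
    (f := fun a₀ es => (fun k => leafMean P (a₀, es) k, numLeaves es)) ?_
    (g := fun p => (fun k => if p.2.1.1 < p.2.2.2.2 then
        (if k = p.2.1.1 then p.2.1.2.2.2.1
        else if k = p.2.2.2.2 then p.2.1.2.2.2.2
        else p.2.2.2.1 k) else p.2.2.2.1 k,
      if p.2.1.1 < p.2.2.2.2 then p.2.2.2.2 + 1 else p.2.2.2.2)) ?_ ?_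
  · exact measurable_eval_nat.comp
      (((measurable_fst.comp h).comp measurable_fst).prodMk measurable_snd)
  · refine Measurable.prodMk (measurable_pi_lambda _ fun k => ?_) measurable_const
    simp only [leafMean_nil]
    split_ifs <;> fun_prop
  · have hlt : MeasurableSet {p : ℝ × Event d × List (Event d) × (ℕ → ℝ) × ℕ |
        p.2.1.1 < p.2.2.2.2} := measurableSet_lt (by fun_prop) (by fun_prop)
    refine Measurable.prodMk (measurable_pi_lambda _ fun k => ?_) ?_
    · have hk : Measurable fun p : ℝ × Event d × List (Event d) × (ℕ → ℝ) × ℕ =>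
          p.2.2.2.1 k := by fun_prop
      refine Measurable.ite hlt (Measurable.ite ?_ (by fun_prop)
        (Measurable.ite ?_ (by fun_prop) hk)) hk
      · exact measurableSet_eq_fun (by fun_prop) (by fun_prop)
      · exact measurableSet_eq_fun (by fun_prop) (by fun_prop)
    · exact Measurable.ite hlt (by fun_prop) (by fun_prop)
  · intro a₀ ev es
    refine Prod.ext (funext fun k => ?_) rfl
    simp only [leafMean_cons]

theorem measurable_treeValue (z : Pt d) : Measurable fun T : Tree d => treeValue P T z := by
  classical
  have h : ∀ n : ℕ, Measurable fun T : Tree d =>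
      ∑ k ∈ Finset.range n, if z ∈ cell P T k then leafMean P T k else 0 := by
    refine fun n => Finset.measurable_fun_sum _ fun k _ => Measurable.ite ?_ ?_ measurable_const
    · exact measurableSet_setOfPred.2 ((measurable_mem_cell (P := P) z).comp
        (measurable_prodMk_right (y := k)))
    · exact (measurable_leafMean (P := P)).comp (measurable_prodMk_right (y := k))
  have h' := measurable_from_prod_countable_left (f := fun p : Tree d × ℕ =>
    ∑ k ∈ Finset.range p.2, if z ∈ cell P p.1 k then leafMean P p.1 k else 0) h
  have e : (fun T : Tree d => treeValue P T z) = fun T =>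
      ∑ k ∈ Finset.range (numLeaves T.2), if z ∈ cell P T k then leafMean P T k else 0 :=
    funext fun T => treeValue_eq_sum T z
  rw [e]
  exact h'.comp (f := fun T : Tree d => (T, numLeaves T.2))
    (measurable_id.prodMk (measurable_numLeaves.comp measurable_snd))

variable (x : Fin N → Pt d)

theorem measurable_dataIn_cell : Measurable fun p : Tree d × ℕ => dataIn x (cell P p.1 p.2) := by
  refine measurable_finset_iff.2 fun i => ?_
  simp only [mem_dataIn]
  exact measurable_mem_cell (x i)

theorem measurable_dataIn_below :
    Measurable fun p : Tree d × ℕ × Cut d => dataIn x (cell P p.1 p.2.1 ∩ p.2.2.below) := by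
  refine measurable_finset_iff.2 fun i => ?_
  simp only [mem_dataIn, Set.mem_inter_iff]
  refine ((measurable_mem_cell (x i)).comp (by fun_prop :
    Measurable fun p : Tree d × ℕ × Cut d => (p.1, p.2.1))).and ?_
  exact measurableSet_setOfPred.1
    (measurableSet_lt ((measurable_form (x i)).comp (by fun_prop)) (by fun_prop))

theorem measurable_dataIn_above :
    Measurable fun p : Tree d × ℕ × Cut d => dataIn x (cell P p.1 p.2.1 ∩ p.2.2.above) := by
  refine measurable_finset_iff.2 fun i => ?_
  simp only [mem_dataIn, Set.mem_inter_iff]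
  refine ((measurable_mem_cell (x i)).comp (by fun_prop :
    Measurable fun p : Tree d × ℕ × Cut d => (p.1, p.2.1))).and ?_
  exact measurableSet_setOfPred.1
    (measurableSet_lt (by fun_prop) ((measurable_form (x i)).comp (by fun_prop)))

/-- The lines that hit the region of a leaf can be recognized by countably many points. -/
theorem exists_countable_crossSet (P : Set (Pt d)) (s : Scheme) : ∃ D : Set (Pt d), D.Countable ∧
    ∀ C, IsCellOf P C → ∀ e, crossSet e (s.region x C) = crossSet e (D ∩ C) := by
  have hcont : ∀ c : Cut d, Continuous c.form :=
    fun c => (formLin c).continuous_of_finiteDimensional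
  cases s with
  | full =>
    obtain ⟨D, hDP, hD, hPD⟩ :=
      (TopologicalSpace.IsSeparable.of_separableSpace P).exists_countable_dense_subset
    refine ⟨D, hD, fun C hC e => ?_⟩
    obtain ⟨O, hO, rfl⟩ := hC.exists_open
    refine Set.Subset.antisymm ?_ (crossSet_mono e Set.inter_subset_right)
    have key : ∀ U : Set (Pt d), IsOpen U → (∃ z ∈ P ∩ O, z ∈ U) → ∃ z ∈ D ∩ (P ∩ O), z ∈ U := by
      rintro U hU ⟨z, hz, hzU⟩
      obtain ⟨w, hw, hwD⟩ := mem_closure_iff.1 (hPD hz.1) _ (hO.inter hU) ⟨hz.2, hzU⟩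
      exact ⟨w, ⟨hwD, hDP hwD, hw.1⟩, hw.2⟩
    rintro q ⟨h1, h2, h3⟩
    exact ⟨h1, key {z | Cut.form (e, q) z < q.2} (isOpen_lt (hcont _) continuous_const) h2,
      key {z | q.2 < Cut.form (e, q) z} (isOpen_lt continuous_const (hcont _)) h3⟩
  | hull =>
    refine ⟨Set.range x, Set.countable_range x, fun C _ e => ?_⟩
    refine Set.Subset.antisymm ?_ (crossSet_mono e (subset_convexHull ℝ _))
    rintro q ⟨h1, ⟨z, hz, hz'⟩, w, hw, hw'⟩
    refine ⟨h1, ?_, ?_⟩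
    · by_contra hcon
      push Not at hcon
      exact absurd hz' (not_lt.2 (convexHull_min (t := {z | q.2 ≤ Cut.form (e, q) z}) hcon
        (convex_halfSpace_ge (formLin (e, q)).isLinear _) hz))
    · by_contra hcon
      push Not at hcon
      exact absurd hw' (not_lt.2 (convexHull_min (t := {z | Cut.form (e, q) z ≤ q.2}) hcon
        (convex_halfSpace_le (formLin (e, q)).isLinear _) hw))

theorem measurableSet_crossSet_region (hP : IsPolyhedron P) (s : Scheme) (k : ℕ) (e : Pair d) :
    MeasurableSet {p : Tree d × (ℝ × ℝ) | p.2 ∈ crossSet e (s.region x (cell P p.1 k))} := by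
  obtain ⟨D, hD, h⟩ := exists_countable_crossSet x P s
  have hset : {p : Tree d × (ℝ × ℝ) | p.2 ∈ crossSet e (s.region x (cell P p.1 k))} =
      {p | p.2.1 ∈ Set.Ioc 0 Real.pi} ∩
      ((⋃ z ∈ D, {p | z ∈ cell P p.1 k} ∩ {p | Cut.form (e, p.2) z < p.2.2}) ∩
      (⋃ z ∈ D, {p | z ∈ cell P p.1 k} ∩ {p | p.2.2 < Cut.form (e, p.2) z})) := by
    ext ⟨T, q⟩
    simp only [Set.mem_ofPred_eq, h _ (isCellOf_cell hP T k) e]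
    simp only [crossSet, Set.mem_ofPred_eq, Set.mem_inter_iff, Set.mem_iUnion, exists_prop,
      and_assoc]
  have hcell : ∀ z, MeasurableSet {p : Tree d × (ℝ × ℝ) | z ∈ cell P p.1 k} := fun z =>
    measurableSet_setOfPred.2 ((measurable_mem_cell z).comp (by fun_prop :
      Measurable fun p : Tree d × (ℝ × ℝ) => (p.1, k)))
  have hform : ∀ z, Measurable fun p : Tree d × (ℝ × ℝ) => Cut.form (e, p.2) z := fun z =>
    (measurable_form z).comp (by fun_prop)
  rw [hset]
  refine MeasurableSet.inter ((measurable_fst.comp measurable_snd) measurableSet_Ioc)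
    (MeasurableSet.inter ?_ ?_)
  · exact MeasurableSet.biUnion hD fun z _ =>
      (hcell z).inter (measurableSet_lt (hform z) (by fun_prop))
  · exact MeasurableSet.biUnion hD fun z _ =>
      (hcell z).inter (measurableSet_lt (by fun_prop) (hform z))

theorem measurable_cutIntensity (hP : IsPolyhedron P) (s : Scheme) :
    Measurable fun T : Tree d => cutIntensity s P x T := by
  refine measurable_sum_param fun k => ?_
  refine Measure.measurable_of_measurable_coe _ fun A hA => ?_
  have hA' : MeasurableSet (Prod.mk k ⁻¹' A) := measurable_prodMk_left hA
  simp only [Measure.map_apply measurable_prodMk_left hA, hitMeasure_apply _ hA']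
  refine Finset.measurable_fun_sum _ fun e _ => ?_
  have hm : MeasurableSet {p : Tree d × (ℝ × ℝ) | p.2 ∈ Prod.mk e ⁻¹' (Prod.mk k ⁻¹' A) ∧
      p.2 ∈ crossSet e (s.region x (cell P p.1 k))} :=
    (measurable_snd (measurable_prodMk_left hA')).inter
      (measurableSet_crossSet_region x hP s k e)
  exact measurable_measure_prodMk_left hm

theorem measurable_rate (hP : IsPolyhedron P) (s : Scheme) :
    Measurable fun T : Tree d => rate (regions s P x T) := by
  have e : (fun T : Tree d => rate (regions s P x T)) =
      fun T => (cutIntensity s P x T Set.univ).toReal := by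
    funext T
    rw [cutIntensity_univ x hP, ENNReal.toReal_ofReal (rate_nonneg x s T)]
  rw [e]
  exact ((Measure.measurable_coe MeasurableSet.univ).comp
    (measurable_cutIntensity x hP s)).ennreal_toReal

theorem measurable_cutLaw (hP : IsPolyhedron P) (s : Scheme) :
    Measurable fun T : Tree d => cutLaw (regions s P x T) := by
  simp only [cutLaw_regions x hP]
  exact measurable_smul_param ((measurable_rate x hP s).ennreal_ofReal.inv)
    (measurable_cutIntensity x hP s)

theorem measurable_meets_hullOf :
    Measurable fun p : Finset (Fin N) × Cut d => p.2.Meets (hullOf x p.1) :=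
  measurable_from_prod_countable_right fun S => measurableSet_setOfPred.1
    (measurableSet_cut_meets (isPolytopal_hullOf x S).sigmaCompact)

theorem measurable_hullCuts : Measurable fun T : Tree d => hullCuts P x T.1 T.2 := by
  classical
  have hS : Measurable fun p : ℝ × Event d × List (Event d) × List (Finset (Fin N) × Cut d × ℝ) =>
      dataIn x (cell P (p.1, p.2.2.1) p.2.1.1) :=
    (measurable_dataIn_cell (P := P) x).comp
      (f := fun p : ℝ × Event d × List (Event d) × List (Finset (Fin N) × Cut d × ℝ) =>
        (((p.1, p.2.2.1) : Tree d), p.2.1.1)) (by fun_prop)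
  have hSc : Measurable fun p : ℝ × Event d × List (Event d) ×
      List (Finset (Fin N) × Cut d × ℝ) =>
      (dataIn x (cell P (p.1, p.2.2.1) p.2.1.1), p.2.1.2.1) := hS.prodMk (by fun_prop)
  have hcons : Measurable fun p : ℝ × Event d × List (Event d) ×
      List (Finset (Fin N) × Cut d × ℝ) =>
      ((dataIn x (cell P (p.1, p.2.2.1) p.2.1.1), p.2.1.2.1, p.2.1.2.2.1), p.2.2.2) :=
    (hS.prodMk (by fun_prop)).prodMk (by fun_prop)
  refine measurable_list_rec (f := fun a₀ es => hullCuts P x a₀ es) measurable_const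
    (g := fun p => if p.2.1.2.1.Meets (hullOf x (dataIn x (cell P (p.1, p.2.2.1) p.2.1.1))) then
      (dataIn x (cell P (p.1, p.2.2.1) p.2.1.1), p.2.1.2.1, p.2.1.2.2.1) :: p.2.2.2
      else p.2.2.2) ?_ ?_
  · refine Measurable.ite ?_ ?_ (by fun_prop)
    · exact measurableSet_setOfPred.2 ((measurable_meets_hullOf x).comp hSc)
    · exact measurable_cons.comp hcons
  · intro a₀ ev es
    simp only [hullCuts, dataHull_eq]

theorem measurable_restrictToHulls : Measurable (restrictToHulls (d := d) P x) :=
  (measurable_hullCuts x).prodMk (measurable_pi_lambda _ fun i => measurable_treeValue (x i))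

theorem measurable_upTo (t : ℝ) : Measurable fun T : Tree d => upTo T t := by
  classical
  have h : Measurable fun es : List (Event d) => es.filter fun ev => decide (ev.2.2.1 ≤ t) := by
    refine measurable_list_rec' (g := fun p : Event d × List (Event d) × List (Event d) =>
      if p.1.2.2.1 ≤ t then p.1 :: p.2.2 else p.2.2) ?_ ?_
    · exact Measurable.ite (measurableSet_le (by fun_prop) (by fun_prop))
        (measurable_cons.comp (f := fun p : Event d × List (Event d) × List (Event d) =>
          (p.1, p.2.2)) (by fun_prop)) (by fun_prop)
    · intro ev es
      simp only [List.filter_cons, decide_eq_true_eq]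
  have h2 : Measurable fun T : Tree d =>
      (T.1, T.2.filter fun ev => decide (ev.2.2.1 ≤ t)) :=
    measurable_fst.prodMk (h.comp measurable_snd)
  convert h2 using 2
  simp only [upTo]

/-! ### Measurability of waiting times, posteriors and weights -/

theorem measurable_expMeasure : Measurable expMeasure := by
  refine Measure.measurable_of_measurable_coe _ fun s hs => ?_
  simp only [expMeasure, gammaMeasure, withDensity_apply _ hs]
  have h : Measurable fun p : ℝ × ℝ => gammaPDF 1 p.1 p.2 := by
    simp only [gammaPDF, gammaPDFReal]
    refine Measurable.ennreal_ofReal (Measurable.ite ?_ ?_ measurable_const)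
    · exact measurableSet_le measurable_const measurable_snd
    · fun_prop
  exact h.lintegral_prod_right'

/-- At rate `0` the exponential law degenerates to the zero measure, so that a tree whose rate of
cuts is `0` is never cut. -/
theorem expMeasure_zero : expMeasure 0 = 0 := by
  have h : gammaPDF 1 0 = 0 := by
    funext z
    simp [gammaPDF, gammaPDFReal]
  rw [expMeasure, gammaMeasure, h, withDensity_zero]

theorem expMeasure_univ_le {r : ℝ} (hr : 0 ≤ r) : expMeasure r Set.univ ≤ 1 := by
  rcases hr.eq_or_lt with rfl | h
  · simp [expMeasure_zero]
  · have := isProbabilityMeasure_expMeasure h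
    exact prob_le_one

theorem measurable_postVar (S : Finset (Fin N)) (v : ℝ≥0) :
    Measurable fun σ2 : ℝ => postVar v σ2 S := by
  unfold postVar; fun_prop

theorem measurable_postMean (S : Finset (Fin N)) (v : ℝ≥0) :
    Measurable fun p : ℝ × (Fin N → ℝ) => postMean v p.1 p.2 S := by
  have h : Measurable fun p : ℝ × (Fin N → ℝ) => postVar v p.1 S :=
    (measurable_postVar S v).comp measurable_fst
  unfold postMean
  exact h.mul (by fun_prop)

theorem measurable_postLaw (S : Finset (Fin N)) (v : ℝ≥0) :
    Measurable fun p : ℝ × (Fin N → ℝ) => postLaw v p.1 p.2 S := by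
  have h : Measurable fun p : ℝ × (Fin N → ℝ) => postVar v p.1 S :=
    (measurable_postVar S v).comp measurable_fst
  exact measurable_gaussianReal.comp ((measurable_postMean S v).prodMk h.real_toNNReal)

theorem measurable_priorOverPost (v : ℝ≥0) :
    Measurable fun p : Finset (Fin N) × ((ℝ × (Fin N → ℝ)) × ℝ) =>
      priorOverPost v p.2.1.1 p.2.1.2 p.1 p.2.2 := by
  refine measurable_from_prod_countable_right fun S => ?_
  have h : Measurable fun p : ℝ × (Fin N → ℝ) => postVar v p.1 S :=
    (measurable_postVar S v).comp measurable_fst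
  have h2 : Measurable fun p : (ℝ × (Fin N → ℝ)) × ℝ =>
      (postMean v p.1.1 p.1.2 S, (postVar v p.1.1 S).toNNReal, p.2) :=
    ((measurable_postMean S v).comp measurable_fst).prodMk
      ((h.real_toNNReal.comp measurable_fst).prodMk measurable_snd)
  exact ((measurable_gaussianPDFReal 0 v).comp measurable_snd).div
    (measurable_uncurry_gaussianPDFReal.comp h2)

attribute [local irreducible] priorOverPost

theorem measurable_newMeansRatio (v : ℝ≥0) (t : ℝ) :
    Measurable fun p : (ℝ × (Fin N → ℝ)) × Tree d =>
      newMeansRatio P x v p.1.1 p.1.2 t p.2.1 p.2.2 := by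
  classical
  have hcell : Measurable fun p : ((ℝ × (Fin N → ℝ)) × ℝ) × Event d × List (Event d) × ℝ =>
      (((p.1.2, p.2.2.1), p.2.1.1, p.2.1.2.1) : Tree d × ℕ × Cut d) := by fun_prop
  have hb : Measurable fun p : ((ℝ × (Fin N → ℝ)) × ℝ) × Event d × List (Event d) × ℝ =>
      priorOverPost v p.1.1.1 p.1.1.2
        (dataIn x (cell P (p.1.2, p.2.2.1) p.2.1.1 ∩ p.2.1.2.1.below)) p.2.1.2.2.2.1 := by
    have h1 : Measurable fun p : ((ℝ × (Fin N → ℝ)) × ℝ) × Event d × List (Event d) × ℝ =>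
        dataIn x (cell P (p.1.2, p.2.2.1) p.2.1.1 ∩ p.2.1.2.1.below) :=
      (measurable_dataIn_below (P := P) x).comp hcell
    have h2 : Measurable fun p : ((ℝ × (Fin N → ℝ)) × ℝ) × Event d × List (Event d) × ℝ =>
        (dataIn x (cell P (p.1.2, p.2.2.1) p.2.1.1 ∩ p.2.1.2.1.below), p.1.1, p.2.1.2.2.2.1) :=
      h1.prodMk (by fun_prop)
    exact (measurable_priorOverPost v).comp h2
  have ha : Measurable fun p : ((ℝ × (Fin N → ℝ)) × ℝ) × Event d × List (Event d) × ℝ =>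
      priorOverPost v p.1.1.1 p.1.1.2
        (dataIn x (cell P (p.1.2, p.2.2.1) p.2.1.1 ∩ p.2.1.2.1.above)) p.2.1.2.2.2.2 := by
    have h1 : Measurable fun p : ((ℝ × (Fin N → ℝ)) × ℝ) × Event d × List (Event d) × ℝ =>
        dataIn x (cell P (p.1.2, p.2.2.1) p.2.1.1 ∩ p.2.1.2.1.above) :=
      (measurable_dataIn_above (P := P) x).comp hcell
    have h2 : Measurable fun p : ((ℝ × (Fin N → ℝ)) × ℝ) × Event d × List (Event d) × ℝ =>
        (dataIn x (cell P (p.1.2, p.2.2.1) p.2.1.1 ∩ p.2.1.2.1.above), p.1.1, p.2.1.2.2.2.2) :=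
      h1.prodMk (by fun_prop)
    exact (measurable_priorOverPost v).comp h2
  have h := measurable_list_rec (γ := (ℝ × (Fin N → ℝ)) × ℝ)
    (f := fun c es => newMeansRatio P x v c.1.1 c.1.2 t c.2 es) measurable_const
    (g := fun p => (if t < p.2.1.2.2.1 then
        priorOverPost v p.1.1.1 p.1.1.2
          (dataIn x (cell P (p.1.2, p.2.2.1) p.2.1.1 ∩ p.2.1.2.1.below)) p.2.1.2.2.2.1 *
        priorOverPost v p.1.1.1 p.1.1.2
          (dataIn x (cell P (p.1.2, p.2.2.1) p.2.1.1 ∩ p.2.1.2.1.above)) p.2.1.2.2.2.2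
      else 1) * p.2.2.2) ?_ ?_
  · exact h.comp (f := fun p : (ℝ × (Fin N → ℝ)) × Tree d => ((p.1, p.2.1), p.2.2)) (by fun_prop)
  · exact (Measurable.ite (measurableSet_lt (by fun_prop) (by fun_prop)) (hb.mul ha)
      measurable_const).mul (by fun_prop)
  · intro c ev es
    simp only [newMeansRatio]

theorem measurable_likelihood :
    Measurable fun p : (ℝ × (Fin N → ℝ)) × Tree d => likelihood P x p.1.1 p.1.2 p.2 := by
  refine Finset.measurable_fun_prod _ fun i _ => ?_
  have h : Measurable fun p : (ℝ × (Fin N → ℝ)) × Tree d =>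
      (treeValue P p.2 (x i), p.1.1.toNNReal, p.1.2 i) :=
    ((measurable_treeValue (P := P) (x i)).comp measurable_snd).prodMk (by fun_prop)
  exact measurable_uncurry_gaussianPDFReal.comp h

theorem measurable_weight (v : ℝ≥0) (t : ℕ → ℝ) (j : ℕ) :
    Measurable fun p : (ℝ × (Fin N → ℝ)) × Tree d => weight P x v t p.1.1 p.1.2 j p.2 := by
  cases j with
  | zero =>
    simp only [weight]
    have h2 : Measurable fun p : (ℝ × (Fin N → ℝ)) × Tree d => (dataIn x P, p.1, p.2.1) := by
      fun_prop
    exact (((measurable_priorOverPost v).comp h2).mul (measurable_newMeansRatio x v (t 0))).mul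
      (measurable_likelihood x)
  | succ j =>
    simp only [weight]
    refine ((measurable_newMeansRatio x v (t (j + 1))).mul (measurable_likelihood x)).div ?_
    exact (measurable_likelihood (P := P) x).comp
      (f := fun p : (ℝ × (Fin N → ℝ)) × Tree d => (p.1, upTo p.2 (t (j + 1))))
      (measurable_fst.prodMk ((measurable_upTo (t (j + 1))).comp measurable_snd))

end Functionals

/-! ### Exponential waiting times -/

section Waiting

theorem lintegral_expMeasure {r : ℝ} (hr : 0 ≤ r) {h : ℝ → ℝ≥0∞} (hh : Measurable h) :
    ∫⁻ u, h u ∂expMeasure r =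
      ∫⁻ u in Set.Ioi 0, ENNReal.ofReal (r * Real.exp (-(r * u))) * h u := by
  rcases hr.eq_or_lt with rfl | hpos
  · simp [expMeasure_zero]
  have hm : Measurable (gammaPDF 1 r) := (measurable_gammaPDFReal 1 r).ennreal_ofReal
  rw [expMeasure, gammaMeasure, lintegral_withDensity_eq_lintegral_mul _ hm hh,
    ← lintegral_indicator measurableSet_Ioi]
  refine lintegral_congr_ae ?_
  have h0 : ∀ᵐ u : ℝ, u ≠ 0 := by simp [ae_iff]
  filter_upwards [h0] with u hu
  by_cases h1 : 0 < u
  · rw [Set.indicator_of_mem (by exact h1), Pi.mul_apply, gammaPDF_of_nonneg h1.le]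
    simp
  · have h2 : u < 0 := lt_of_le_of_ne (not_lt.1 h1) hu
    rw [Set.indicator_of_notMem (by exact h1), Pi.mul_apply, gammaPDF_of_neg h2, zero_mul]

theorem setLIntegral_expMeasure {r : ℝ} (hr : 0 ≤ r) {h : ℝ → ℝ≥0∞} (hh : Measurable h) (a : ℝ) :
    ∫⁻ u in Set.Iic a, h u ∂expMeasure r =
      ∫⁻ u in Set.Ioc 0 a, ENNReal.ofReal (r * Real.exp (-(r * u))) * h u := by
  rw [← lintegral_indicator measurableSet_Iic,
    lintegral_expMeasure hr (hh.indicator measurableSet_Iic), ← Set.Ioi_inter_Iic,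
    Set.inter_comm, ← Measure.restrict_restrict measurableSet_Iic,
    ← lintegral_indicator measurableSet_Iic]
  refine lintegral_congr fun u => ?_
  by_cases hu : u ∈ Set.Iic a
  · rw [Set.indicator_of_mem hu, Set.indicator_of_mem hu]
  · rw [Set.indicator_of_notMem hu, Set.indicator_of_notMem hu, mul_zero]

theorem one_sub_expMeasure_Iic {r : ℝ} (hr : 0 ≤ r) {a : ℝ} (ha : 0 ≤ a) :
    1 - expMeasure r (Set.Iic a) = ENNReal.ofReal (Real.exp (-(r * a))) := by
  rcases hr.eq_or_lt with rfl | hpos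
  · simp [expMeasure_zero]
  have := isProbabilityMeasure_expMeasure hpos
  have h1 := cdf_expMeasure_eq hpos a
  rw [if_pos ha, cdf_eq_real] at h1
  have h2 : expMeasure r (Set.Iic a) = ENNReal.ofReal (1 - Real.exp (-(r * a))) := by
    rw [← h1, measureReal_def, ENNReal.ofReal_toReal (measure_ne_top _ _)]
  rw [h2, ← ENNReal.ofReal_one, ← ENNReal.ofReal_sub]
  · congr 1; ring
  · rw [sub_nonneg, Real.exp_le_one_iff]
    nlinarith

theorem expMeasure_Iic_of_neg {r : ℝ} (hr : 0 ≤ r) {a : ℝ} (ha : a < 0) :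
    (expMeasure r).restrict (Set.Iic a) = 0 := by
  rw [Measure.restrict_eq_zero, ← lintegral_indicator_one measurableSet_Iic,
    lintegral_indicator measurableSet_Iic, setLIntegral_expMeasure hr measurable_one,
    Set.Ioc_eq_empty (by linarith)]
  simp

/-- The Laplace transform of the exponential law. -/
theorem lintegral_exp_expMeasure {r C : ℝ} (hr : 0 < r) (hC : 0 ≤ C) :
    ∫⁻ u, ENNReal.ofReal (Real.exp (-(C * u))) ∂expMeasure r = ENNReal.ofReal (r / (r + C)) := by
  have hrC : 0 < r + C := by linarith
  have hm : Measurable fun u : ℝ => ENNReal.ofReal (Real.exp (-(C * u))) := by fun_prop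
  rw [lintegral_expMeasure hr.le hm]
  have h1 : ∫⁻ _u : ℝ, (1 : ℝ≥0∞) ∂expMeasure (r + C) = 1 := by
    have := isProbabilityMeasure_expMeasure hrC
    simp
  rw [lintegral_expMeasure hrC.le measurable_const] at h1
  calc _ = ∫⁻ u in Set.Ioi 0, ENNReal.ofReal (r / (r + C)) *
        (ENNReal.ofReal ((r + C) * Real.exp (-((r + C) * u))) * 1) := by
        refine lintegral_congr fun u => ?_
        rw [mul_one, ← ENNReal.ofReal_mul (by positivity), ← ENNReal.ofReal_mul (by positivity)]
        congr 1
        have : Real.exp (-((r + C) * u)) = Real.exp (-(r * u)) * Real.exp (-(C * u)) := by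
          rw [← Real.exp_add]; congr 1; ring
        rw [this]
        field_simp
    _ = _ := by
        rw [lintegral_const_mul _ (by fun_prop), h1, mul_one]

end Waiting

/-! ### The growth of a tree -/

section Grow

variable {d N : ℕ} {P : Set (Pt d)} {x : Fin N → Pt d} {s : Scheme}

/-- The tree `T` after one more cut. -/
def nextTree (T : Tree d) (kc : ℕ × Cut d) (t : ℝ) (ab : ℝ × ℝ) : Tree d :=
  (T.1, (kc.1, kc.2, t, ab) :: T.2)

/-- The law of the mean parameters of the two leaves that a cut creates. -/
noncomputable def childLaw (P : Set (Pt d)) (x : Fin N → Pt d) (ν : Finset (Fin N) → Measure ℝ)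
    (T : Tree d) (kc : ℕ × Cut d) : Measure (ℝ × ℝ) :=
  (ν (dataIn x (cell P T kc.1 ∩ kc.2.below))).prod (ν (dataIn x (cell P T kc.1 ∩ kc.2.above)))

theorem growExactly_succ (ν : Finset (Fin N) → Measure ℝ) (t₁ : ℝ) (n : ℕ) (T : Tree d) (t₀ : ℝ) :
    growExactly s P x ν t₁ (n + 1) T t₀ =
      ((expMeasure (rate (regions s P x T))).restrict (Set.Iic (t₁ - t₀))).bind fun w =>
        (cutLaw (regions s P x T)).bind fun kc => (childLaw P x ν T kc).bind fun ab =>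
          growExactly s P x ν t₁ n (nextTree T kc (t₀ + w) ab) (t₀ + w) := rfl

theorem measurable_nextTree :
    Measurable fun p : Tree d × (ℕ × Cut d) × ℝ × (ℝ × ℝ) =>
      nextTree p.1 p.2.1 p.2.2.1 p.2.2.2 := by
  refine (measurable_fst.comp measurable_fst).prodMk ?_
  exact measurable_cons.comp (f := fun p : Tree d × (ℕ × Cut d) × ℝ × (ℝ × ℝ) =>
    (((p.2.1.1, p.2.1.2, p.2.2.1, p.2.2.2) : Event d), p.1.2)) (by fun_prop)

attribute [local irreducible] cell dataIn rate cutLaw cutIntensity regions nextTree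

variable {A : Type*} [MeasurableSpace A] {ν : A → Finset (Fin N) → Measure ℝ}

theorem isProbabilityMeasure_childLaw {ν : Finset (Fin N) → Measure ℝ}
    (hν1 : ∀ S, IsProbabilityMeasure (ν S)) (T : Tree d) (kc : ℕ × Cut d) :
    IsProbabilityMeasure (childLaw P x ν T kc) := by
  have := hν1
  unfold childLaw
  infer_instance

theorem measurable_childLaw (hν : ∀ S, Measurable fun a => ν a S)
    (hν1 : ∀ a S, IsProbabilityMeasure (ν a S)) :
    Measurable fun p : A × Tree d × (ℕ × Cut d) => childLaw P x (ν p.1) p.2.1 p.2.2 := by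
  have h : Measurable fun p : A × Finset (Fin N) => ν p.1 p.2 :=
    measurable_from_prod_countable_left fun S => hν S
  have hb : Measurable fun p : A × Tree d × (ℕ × Cut d) =>
      (p.1, dataIn x (cell P p.2.1 p.2.2.1 ∩ p.2.2.2.below)) :=
    measurable_fst.prodMk ((measurable_dataIn_below (P := P) x).comp measurable_snd)
  have ha : Measurable fun p : A × Tree d × (ℕ × Cut d) =>
      (p.1, dataIn x (cell P p.2.1 p.2.2.1 ∩ p.2.2.2.above)) :=
    measurable_fst.prodMk ((measurable_dataIn_above (P := P) x).comp measurable_snd)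
  exact measurable_prod_param (h.comp hb) (h.comp ha) (fun _ => hν1 _ _) (fun _ => hν1 _ _)

theorem measurable_waiting (hP : IsPolyhedron P) (t₁ : ℝ) :
    Measurable fun p : Tree d × ℝ =>
      (expMeasure (rate (regions s P x p.1))).restrict (Set.Iic (t₁ - p.2)) := by
  have hE : Measurable fun p : Tree d × ℝ => expMeasure (rate (regions s P x p.1)) :=
    measurable_expMeasure.comp ((measurable_rate (P := P) x hP s).comp measurable_fst)
  refine Measure.measurable_of_measurable_coe _ fun u hu => ?_
  have h1 : MeasurableSet {q : (Tree d × ℝ) × ℝ | q.2 ≤ t₁ - q.1.2} := by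
    have ha : Measurable fun q : (Tree d × ℝ) × ℝ => t₁ - q.1.2 :=
      (measurable_snd.comp measurable_fst).const_sub t₁
    exact measurableSet_le measurable_snd ha
  have hS : MeasurableSet {q : (Tree d × ℝ) × ℝ | q.2 ∈ u ∧ q.2 ≤ t₁ - q.1.2} :=
    (measurable_snd hu).inter h1
  have := measurable_lintegral_param hE (fun p => expMeasure_univ_le (rate_nonneg x s p.1))
    (f := fun q => Set.indicator {q : (Tree d × ℝ) × ℝ | q.2 ∈ u ∧ q.2 ≤ t₁ - q.1.2}
      (fun _ => 1) q) (measurable_const.indicator hS)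
  convert this using 2 with p
  rw [Measure.restrict_apply hu, ← lintegral_indicator_one (hu.inter measurableSet_Iic)]
  rfl

theorem measurable_growExactly (hP : IsPolyhedron P) (hν : ∀ S, Measurable fun a => ν a S)
    (hν1 : ∀ a S, IsProbabilityMeasure (ν a S)) (t₁ : ℝ) (n : ℕ) :
    Measurable fun p : A × Tree d × ℝ => growExactly s P x (ν p.1) t₁ n p.2.1 p.2.2 := by
  induction n with
  | zero =>
    simp only [growExactly]
    refine measurable_smul_param ?_ (Measure.measurable_dirac.comp (by fun_prop))
    have h : Measurable fun p : A × Tree d × ℝ =>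
        (expMeasure (rate (regions s P x p.2.1))).restrict (Set.Iic (t₁ - p.2.2)) Set.univ :=
      (Measure.measurable_coe MeasurableSet.univ).comp
        ((measurable_waiting (x := x) (s := s) hP t₁).comp measurable_snd)
    simp only [Measure.restrict_apply_univ] at h
    exact measurable_const.sub h
  | succ n ih =>
    simp only [growExactly_succ]
    refine measurable_bind_param (μ := fun p : A × Tree d × ℝ =>
      (expMeasure (rate (regions s P x p.2.1))).restrict (Set.Iic (t₁ - p.2.2)))
      (κ := fun q : (A × Tree d × ℝ) × ℝ => (cutLaw (regions s P x q.1.2.1)).bind fun kc =>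
        (childLaw P x (ν q.1.1) q.1.2.1 kc).bind fun ab =>
          growExactly s P x (ν q.1.1) t₁ n (nextTree q.1.2.1 kc (q.1.2.2 + q.2) ab)
            (q.1.2.2 + q.2))
      ((measurable_waiting hP t₁).comp measurable_snd) (fun p => ?_) ?_
    · exact (Measure.restrict_apply_le _ _).trans (expMeasure_univ_le (rate_nonneg x s p.2.1))
    refine measurable_bind_param (μ := fun q : (A × Tree d × ℝ) × ℝ =>
      cutLaw (regions s P x q.1.2.1))
      (κ := fun q : ((A × Tree d × ℝ) × ℝ) × (ℕ × Cut d) =>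
        (childLaw P x (ν q.1.1.1) q.1.1.2.1 q.2).bind fun ab =>
          growExactly s P x (ν q.1.1.1) t₁ n (nextTree q.1.1.2.1 q.2 (q.1.1.2.2 + q.1.2) ab)
            (q.1.1.2.2 + q.1.2))
      ((measurable_cutLaw x hP s).comp (by fun_prop)) (fun q => cutLaw_univ_le x hP s _) ?_
    have hc : Measurable fun q : ((A × Tree d × ℝ) × ℝ) × (ℕ × Cut d) =>
        childLaw P x (ν q.1.1.1) q.1.1.2.1 q.2 :=
      (measurable_childLaw hν hν1).comp
        (f := fun q : ((A × Tree d × ℝ) × ℝ) × (ℕ × Cut d) => (q.1.1.1, q.1.1.2.1, q.2))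
        (by fun_prop)
    refine measurable_bind_param hc
      (κ := fun q : (((A × Tree d × ℝ) × ℝ) × (ℕ × Cut d)) × (ℝ × ℝ) =>
          growExactly s P x (ν q.1.1.1.1) t₁ n
            (nextTree q.1.1.1.2.1 q.1.2 (q.1.1.1.2.2 + q.1.1.2) q.2) (q.1.1.1.2.2 + q.1.1.2))
      (fun q => ?_) ?_
    · have := isProbabilityMeasure_childLaw (P := P) (x := x) (hν1 q.1.1.1) q.1.1.2.1 q.2
      exact prob_le_one
    · have hn : Measurable fun q : (((A × Tree d × ℝ) × ℝ) × (ℕ × Cut d)) × (ℝ × ℝ) =>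
          nextTree q.1.1.1.2.1 q.1.2 (q.1.1.1.2.2 + q.1.1.2) q.2 :=
        measurable_nextTree.comp
          (f := fun q : (((A × Tree d × ℝ) × ℝ) × (ℕ × Cut d)) × (ℝ × ℝ) =>
            (q.1.1.1.2.1, q.1.2, q.1.1.1.2.2 + q.1.1.2, q.2)) (by fun_prop)
      have h2 : Measurable fun q : (((A × Tree d × ℝ) × ℝ) × (ℕ × Cut d)) × (ℝ × ℝ) =>
          (q.1.1.1.1, nextTree q.1.1.1.2.1 q.1.2 (q.1.1.1.2.2 + q.1.1.2) q.2,
            q.1.1.1.2.2 + q.1.1.2) := Measurable.prodMk (by fun_prop) (hn.prodMk (by fun_prop))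
      exact ih.comp h2

theorem measurable_grow (hP : IsPolyhedron P) (hν : ∀ S, Measurable fun a => ν a S)
    (hν1 : ∀ a S, IsProbabilityMeasure (ν a S)) (t₁ : ℝ) :
    Measurable fun p : A × Tree d × ℝ => grow s P x (ν p.1) p.2.1 p.2.2 t₁ :=
  measurable_sum_param fun n => measurable_growExactly hP hν hν1 t₁ n

variable {μ : Finset (Fin N) → Measure ℝ}

theorem measurable_growExactly_right (hP : IsPolyhedron P) (hμ : ∀ S, IsProbabilityMeasure (μ S))
    (t₁ : ℝ) (n : ℕ) :
    Measurable fun p : Tree d × ℝ => growExactly s P x μ t₁ n p.1 p.2 :=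
  (measurable_growExactly (A := Unit) (ν := fun _ => μ) hP (fun _ => measurable_const)
    (fun _ => hμ) t₁ n).comp (measurable_const (a := ()) |>.prodMk measurable_id)

theorem measurable_grow_right (hP : IsPolyhedron P) (hμ : ∀ S, IsProbabilityMeasure (μ S))
    (t₁ : ℝ) : Measurable fun p : Tree d × ℝ => grow s P x μ p.1 p.2 t₁ :=
  measurable_sum_param fun n => measurable_growExactly_right hP hμ t₁ n

theorem measurable_childLaw_right (hμ : ∀ S, IsProbabilityMeasure (μ S)) :
    Measurable fun p : Tree d × (ℕ × Cut d) => childLaw P x μ p.1 p.2 :=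
  (measurable_childLaw (A := Unit) (ν := fun _ => μ) (fun _ => measurable_const)
    (fun _ => hμ)).comp (measurable_const (a := ()) |>.prodMk measurable_id)

/-- The integral of `g` with respect to the intensity of the jumps of the growing tree `T` at
time `t`. -/
noncomputable def jump (s : Scheme) (P : Set (Pt d)) (x : Fin N → Pt d)
    (μ : Finset (Fin N) → Measure ℝ) (g : Tree d → ℝ≥0∞) (T : Tree d) (t : ℝ) : ℝ≥0∞ :=
  ∫⁻ kc, ∫⁻ ab, g (nextTree T kc t ab) ∂childLaw P x μ T kc ∂cutIntensity s P x T

theorem rate_smul_cutLaw (hP : IsPolyhedron P) (T : Tree d) :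
    ENNReal.ofReal (rate (regions s P x T)) • cutLaw (regions s P x T) =
      cutIntensity s P x T := by
  rw [cutLaw_regions x hP, smul_smul]
  by_cases h : ENNReal.ofReal (rate (regions s P x T)) = 0
  · have h2 := cutIntensity_univ x hP s T
    rw [h, Measure.measure_univ_eq_zero] at h2
    rw [h2, smul_zero]
  · rw [ENNReal.mul_inv_cancel h ENNReal.ofReal_ne_top, one_smul]

theorem measurable_nextTree' (T : Tree d) (t : ℝ) :
    Measurable fun p : (ℕ × Cut d) × (ℝ × ℝ) => nextTree T p.1 t p.2 :=
  measurable_nextTree.comp (f := fun p : (ℕ × Cut d) × (ℝ × ℝ) => (T, p.1, t, p.2)) (by fun_prop)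

theorem jump_eq (hP : IsPolyhedron P) (g : Tree d → ℝ≥0∞) (T : Tree d) (t : ℝ) :
    jump s P x μ g T t = ENNReal.ofReal (rate (regions s P x T)) *
      ∫⁻ kc, ∫⁻ ab, g (nextTree T kc t ab) ∂childLaw P x μ T kc ∂cutLaw (regions s P x T) := by
  rw [jump, ← rate_smul_cutLaw hP, lintegral_smul_measure, smul_eq_mul]

theorem measurable_child_integral (hμ : ∀ S, IsProbabilityMeasure (μ S)) {g : Tree d × ℝ → ℝ≥0∞}
    (hg : Measurable g) : Measurable fun p : (Tree d × ℝ) × (ℕ × Cut d) =>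
      ∫⁻ ab, g (nextTree p.1.1 p.2 p.1.2 ab, p.1.2) ∂childLaw P x μ p.1.1 p.2 := by
  have hc : Measurable fun p : (Tree d × ℝ) × (ℕ × Cut d) => childLaw P x μ p.1.1 p.2 :=
    (measurable_childLaw_right hμ).comp
      (f := fun p : (Tree d × ℝ) × (ℕ × Cut d) => (p.1.1, p.2)) (by fun_prop)
  refine measurable_lintegral_param hc (fun p => ?_)
    (f := fun q : ((Tree d × ℝ) × (ℕ × Cut d)) × (ℝ × ℝ) =>
      g (nextTree q.1.1.1 q.1.2 q.1.1.2 q.2, q.1.1.2)) ?_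
  · have := isProbabilityMeasure_childLaw (P := P) (x := x) hμ p.1.1 p.2
    exact prob_le_one
  · have hn : Measurable fun q : ((Tree d × ℝ) × (ℕ × Cut d)) × (ℝ × ℝ) =>
        nextTree q.1.1.1 q.1.2 q.1.1.2 q.2 :=
      measurable_nextTree.comp (f := fun q : ((Tree d × ℝ) × (ℕ × Cut d)) × (ℝ × ℝ) =>
        (q.1.1.1, q.1.2, q.1.1.2, q.2)) (by fun_prop)
    exact hg.comp (hn.prodMk (by fun_prop))

theorem measurable_jumpLaw (hP : IsPolyhedron P) (hμ : ∀ S, IsProbabilityMeasure (μ S))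
    {g : Tree d × ℝ → ℝ≥0∞} (hg : Measurable g) : Measurable fun p : Tree d × ℝ =>
      ∫⁻ kc, ∫⁻ ab, g (nextTree p.1 kc p.2 ab, p.2) ∂childLaw P x μ p.1 kc
        ∂cutLaw (regions s P x p.1) := by
  have hc : Measurable fun p : Tree d × ℝ => cutLaw (regions s P x p.1) :=
    (measurable_cutLaw x hP s).comp measurable_fst
  exact measurable_lintegral_param hc (fun p => cutLaw_univ_le x hP s p.1)
    (measurable_child_integral hμ hg)

theorem measurable_jump (hP : IsPolyhedron P) (hμ : ∀ S, IsProbabilityMeasure (μ S))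
    {g : Tree d × ℝ → ℝ≥0∞} (hg : Measurable g) :
    Measurable fun p : Tree d × ℝ => jump s P x μ (fun T' => g (T', p.2)) p.1 p.2 := by
  simp only [jump_eq hP]
  exact ((measurable_rate x hP s).comp measurable_fst).ennreal_ofReal.mul
    (measurable_jumpLaw hP hμ hg)

theorem lintegral_growExactly_zero {f : Tree d → ℝ≥0∞} (hf : Measurable f) {t₀ t₁ : ℝ}
    (ht : t₀ ≤ t₁) (T : Tree d) : ∫⁻ T', f T' ∂growExactly s P x μ t₁ 0 T t₀ =
      ENNReal.ofReal (Real.exp (-(rate (regions s P x T) * (t₁ - t₀)))) * f T := by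
  rw [growExactly, lintegral_smul_measure, lintegral_dirac' _ hf,
    one_sub_expMeasure_Iic (rate_nonneg x s T) (sub_nonneg.2 ht), smul_eq_mul]

attribute [local irreducible] growExactly childLaw

/-- In the law of the next cut and its time, the rate in the density of the waiting time cancels the
normalization of the law of the cut. -/
theorem lintegral_growExactly_succ (hP : IsPolyhedron P) (hμ : ∀ S, IsProbabilityMeasure (μ S))
    {f : Tree d → ℝ≥0∞} (hf : Measurable f) (t₁ : ℝ) (n : ℕ) (T : Tree d) (t₀ : ℝ) :
    ∫⁻ T', f T' ∂growExactly s P x μ t₁ (n + 1) T t₀ =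
      ∫⁻ u in Set.Ioc 0 (t₁ - t₀), ENNReal.ofReal (Real.exp (-(rate (regions s P x T) * u))) *
        jump s P x μ (fun T' => ∫⁻ T'', f T'' ∂growExactly s P x μ t₁ n T' (t₀ + u)) T
          (t₀ + u) := by
  have hG := measurable_growExactly_right (x := x) (s := s) hP hμ t₁ n
  have hg : Measurable fun p : Tree d × ℝ => ∫⁻ T'', f T'' ∂growExactly s P x μ t₁ n p.1 p.2 :=
    (Measure.measurable_lintegral hf).comp hG
  -- measurability of the three nested kernels
  have k3 : Measurable fun q : (ℝ × (ℕ × Cut d)) × (ℝ × ℝ) =>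
      growExactly s P x μ t₁ n (nextTree T q.1.2 (t₀ + q.1.1) q.2) (t₀ + q.1.1) := by
    have hn : Measurable fun q : (ℝ × (ℕ × Cut d)) × (ℝ × ℝ) =>
        nextTree T q.1.2 (t₀ + q.1.1) q.2 := measurable_nextTree.comp
      (f := fun q : (ℝ × (ℕ × Cut d)) × (ℝ × ℝ) => (T, q.1.2, t₀ + q.1.1, q.2)) (by fun_prop)
    exact hG.comp (hn.prodMk (by fun_prop))
  have k2 : Measurable fun q : ℝ × (ℕ × Cut d) => (childLaw P x μ T q.2).bind fun ab =>
      growExactly s P x μ t₁ n (nextTree T q.2 (t₀ + q.1) ab) (t₀ + q.1) := by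
    refine measurable_bind_param (μ := fun q : ℝ × (ℕ × Cut d) => childLaw P x μ T q.2)
      (κ := fun q : (ℝ × (ℕ × Cut d)) × (ℝ × ℝ) =>
        growExactly s P x μ t₁ n (nextTree T q.1.2 (t₀ + q.1.1) q.2) (t₀ + q.1.1))
      ((measurable_childLaw_right hμ).comp
        (f := fun q : ℝ × (ℕ × Cut d) => (T, q.2)) (by fun_prop)) (fun q => ?_) k3
    have := isProbabilityMeasure_childLaw (P := P) (x := x) hμ T q.2
    exact prob_le_one
  have k1 : Measurable fun u : ℝ => (cutLaw (regions s P x T)).bind fun kc =>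
      (childLaw P x μ T kc).bind fun ab =>
        growExactly s P x μ t₁ n (nextTree T kc (t₀ + u) ab) (t₀ + u) :=
    measurable_bind_param (μ := fun _ : ℝ => cutLaw (regions s P x T))
      (κ := fun q : ℝ × (ℕ × Cut d) => (childLaw P x μ T q.2).bind fun ab =>
        growExactly s P x μ t₁ n (nextTree T q.2 (t₀ + q.1) ab) (t₀ + q.1)) measurable_const
      (fun _ => cutLaw_univ_le x hP s T) k2
  rw [growExactly_succ, Measure.lintegral_bind k1.aemeasurable hf.aemeasurable]
  have e : ∀ u, ∫⁻ T', f T' ∂((cutLaw (regions s P x T)).bind fun kc =>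
      (childLaw P x μ T kc).bind fun ab =>
        growExactly s P x μ t₁ n (nextTree T kc (t₀ + u) ab) (t₀ + u)) =
      ∫⁻ kc, ∫⁻ ab, ∫⁻ T'', f T'' ∂growExactly s P x μ t₁ n (nextTree T kc (t₀ + u) ab) (t₀ + u)
        ∂childLaw P x μ T kc ∂cutLaw (regions s P x T) := by
    intro u
    have k2' : Measurable fun kc : ℕ × Cut d => (childLaw P x μ T kc).bind fun ab =>
        growExactly s P x μ t₁ n (nextTree T kc (t₀ + u) ab) (t₀ + u) :=
      k2.comp (f := fun kc : ℕ × Cut d => (u, kc)) measurable_prodMk_left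
    refine (Measure.lintegral_bind k2'.aemeasurable hf.aemeasurable).trans ?_
    refine lintegral_congr fun kc => ?_
    have k3' : Measurable fun ab : ℝ × ℝ =>
        growExactly s P x μ t₁ n (nextTree T kc (t₀ + u) ab) (t₀ + u) :=
      k3.comp (f := fun ab : ℝ × ℝ => ((u, kc), ab)) measurable_prodMk_left
    exact Measure.lintegral_bind k3'.aemeasurable hf.aemeasurable
  simp only [e]
  have hm : Measurable fun u : ℝ => ∫⁻ kc, ∫⁻ ab, ∫⁻ T'', f T''
      ∂growExactly s P x μ t₁ n (nextTree T kc (t₀ + u) ab) (t₀ + u)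
        ∂childLaw P x μ T kc ∂cutLaw (regions s P x T) :=
    (measurable_jumpLaw (s := s) hP hμ hg).comp
      (f := fun u : ℝ => (T, t₀ + u)) (by fun_prop)
  rw [setLIntegral_expMeasure (rate_nonneg x s T) hm]
  refine lintegral_congr fun u => ?_
  rw [jump_eq hP, mul_comm (rate (regions s P x T)), ENNReal.ofReal_mul (Real.exp_nonneg _),
    mul_assoc]

theorem lintegral_grow (f : Tree d → ℝ≥0∞) (T : Tree d) (t₀ t₁ : ℝ) :
    ∫⁻ T', f T' ∂grow s P x μ T t₀ t₁ = ∑' n, ∫⁻ T', f T' ∂growExactly s P x μ t₁ n T t₀ := by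
  rw [grow, lintegral_sum_measure]

end Grow

/-! ### The renewal equation -/

section Renewal

variable {d N : ℕ} {P : Set (Pt d)} {x : Fin N → Pt d} {s : Scheme}
  {μ : Finset (Fin N) → Measure ℝ}

attribute [local irreducible] cell dataIn rate cutLaw cutIntensity regions nextTree childLaw
  growExactly

theorem measurable_child_integral_right (hμ : ∀ S, IsProbabilityMeasure (μ S))
    {g : Tree d → ℝ≥0∞} (hg : Measurable g) (T : Tree d) (t : ℝ) :
    Measurable fun kc : ℕ × Cut d => ∫⁻ ab, g (nextTree T kc t ab) ∂childLaw P x μ T kc :=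
  (measurable_child_integral (P := P) (x := x) hμ (g := fun p : Tree d × ℝ => g p.1)
    (hg.comp measurable_fst)).comp (f := fun kc : ℕ × Cut d => ((T, t), kc)) measurable_prodMk_left

theorem jump_mono {g g' : Tree d → ℝ≥0∞} {T : Tree d} {t : ℝ}
    (h : ∀ kc ab, g (nextTree T kc t ab) ≤ g' (nextTree T kc t ab)) :
    jump s P x μ g T t ≤ jump s P x μ g' T t :=
  lintegral_mono fun kc => lintegral_mono fun ab => h kc ab

theorem jump_add (hμ : ∀ S, IsProbabilityMeasure (μ S)) {g g' : Tree d → ℝ≥0∞}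
    (hg : Measurable g) (T : Tree d) (t : ℝ) :
    jump s P x μ (fun T' => g T' + g' T') T t = jump s P x μ g T t + jump s P x μ g' T t := by
  unfold jump
  rw [← lintegral_add_left (measurable_child_integral_right hμ hg T t)]
  refine lintegral_congr fun kc => ?_
  exact lintegral_add_left (hg.comp ((measurable_nextTree' T t).comp
    (f := fun ab : ℝ × ℝ => (kc, ab)) measurable_prodMk_left)) _

theorem jump_tsum (hμ : ∀ S, IsProbabilityMeasure (μ S)) {g : ℕ → Tree d → ℝ≥0∞}
    (hg : ∀ n, Measurable (g n)) (T : Tree d) (t : ℝ) :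
    jump s P x μ (fun T' => ∑' n, g n T') T t = ∑' n, jump s P x μ (g n) T t := by
  unfold jump
  rw [← lintegral_tsum fun n => (measurable_child_integral_right hμ (hg n) T t).aemeasurable]
  refine lintegral_congr fun kc => ?_
  exact lintegral_tsum fun n => ((hg n).comp ((measurable_nextTree' T t).comp
    (f := fun ab : ℝ × ℝ => (kc, ab)) measurable_prodMk_left)).aemeasurable

theorem jump_const_mul (hμ : ∀ S, IsProbabilityMeasure (μ S)) {g : Tree d → ℝ≥0∞}
    (hg : Measurable g) (b : ℝ≥0∞) (T : Tree d) (t : ℝ) :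
    jump s P x μ (fun T' => b * g T') T t = b * jump s P x μ g T t := by
  unfold jump
  rw [← lintegral_const_mul _ (measurable_child_integral_right hμ hg T t)]
  refine lintegral_congr fun kc => ?_
  exact lintegral_const_mul _ (hg.comp ((measurable_nextTree' T t).comp
    (f := fun ab : ℝ × ℝ => (kc, ab)) measurable_prodMk_left))

theorem jump_const (hP : IsPolyhedron P) (hμ : ∀ S, IsProbabilityMeasure (μ S)) (b : ℝ≥0∞)
    (T : Tree d) (t : ℝ) :
    jump s P x μ (fun _ => b) T t = ENNReal.ofReal (rate (regions s P x T)) * b := by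
  have h : ∀ kc, ∫⁻ _ab : ℝ × ℝ, b ∂childLaw P x μ T kc = b := fun kc => by
    have := isProbabilityMeasure_childLaw (P := P) (x := x) hμ T kc
    simp
  simp only [jump, h, lintegral_const, cutIntensity_univ x hP]
  rw [mul_comm]

/-- The expectation, at the tree `T` and time `t₀`, of `f` if no jump occurs before `t₁`, and of
`w` right after the first jump otherwise. -/
noncomputable def renewal (s : Scheme) (P : Set (Pt d)) (x : Fin N → Pt d)
    (μ : Finset (Fin N) → Measure ℝ) (f : Tree d → ℝ≥0∞) (w : Tree d × ℝ → ℝ≥0∞) (t₁ : ℝ)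
    (T : Tree d) (t₀ : ℝ) : ℝ≥0∞ :=
  ENNReal.ofReal (Real.exp (-(rate (regions s P x T) * (t₁ - t₀)))) * f T +
    ∫⁻ u in Set.Ioc 0 (t₁ - t₀), ENNReal.ofReal (Real.exp (-(rate (regions s P x T) * u))) *
      jump s P x μ (fun T' => w (T', t₀ + u)) T (t₀ + u)

theorem measurable_renewal_integrand (hP : IsPolyhedron P) (hμ : ∀ S, IsProbabilityMeasure (μ S))
    {w : Tree d × ℝ → ℝ≥0∞} (hw : Measurable w) (T : Tree d) (t₀ : ℝ) :
    Measurable fun u : ℝ => ENNReal.ofReal (Real.exp (-(rate (regions s P x T) * u))) *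
      jump s P x μ (fun T' => w (T', t₀ + u)) T (t₀ + u) := by
  have h : Measurable fun u : ℝ => jump s P x μ (fun T' => w (T', t₀ + u)) T (t₀ + u) :=
    (measurable_jump (x := x) (s := s) hP hμ hw).comp
      (f := fun u : ℝ => (T, t₀ + u)) (by fun_prop)
  exact Measurable.mul (by fun_prop) h

theorem renewal_mono {f : Tree d → ℝ≥0∞} {w w' : Tree d × ℝ → ℝ≥0∞} {t₁ t₀ : ℝ} {T : Tree d}
    (h : ∀ T' t, t ≤ t₁ → w (T', t) ≤ w' (T', t)) :
    renewal s P x μ f w t₁ T t₀ ≤ renewal s P x μ f w' t₁ T t₀ := by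
  unfold renewal
  refine add_le_add le_rfl (setLIntegral_mono' measurableSet_Ioc fun u hu => ?_)
  refine mul_le_mul_right ?_ _
  exact jump_mono fun kc ab => h _ _ (by linarith [hu.2])

/-- The expectation of `f` on the event that at most `n` cuts happen. -/
noncomputable def partialGrow (s : Scheme) (P : Set (Pt d)) (x : Fin N → Pt d)
    (μ : Finset (Fin N) → Measure ℝ) (f : Tree d → ℝ≥0∞) (t₁ : ℝ) (n : ℕ) (p : Tree d × ℝ) :
    ℝ≥0∞ :=
  ∑ k ∈ Finset.range n, ∫⁻ T', f T' ∂growExactly s P x μ t₁ k p.1 p.2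

theorem measurable_lintegral_growExactly (hP : IsPolyhedron P)
    (hμ : ∀ S, IsProbabilityMeasure (μ S)) {f : Tree d → ℝ≥0∞} (hf : Measurable f) (t₁ : ℝ)
    (n : ℕ) : Measurable fun p : Tree d × ℝ => ∫⁻ T', f T' ∂growExactly s P x μ t₁ n p.1 p.2 :=
  (Measure.measurable_lintegral hf).comp (measurable_growExactly_right hP hμ t₁ n)

theorem measurable_lintegral_grow (hP : IsPolyhedron P)
    (hμ : ∀ S, IsProbabilityMeasure (μ S)) {f : Tree d → ℝ≥0∞} (hf : Measurable f) (t₁ : ℝ) :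
    Measurable fun p : Tree d × ℝ => ∫⁻ T', f T' ∂grow s P x μ p.1 p.2 t₁ :=
  (Measure.measurable_lintegral hf).comp (measurable_grow_right hP hμ t₁)

theorem measurable_partialGrow (hP : IsPolyhedron P) (hμ : ∀ S, IsProbabilityMeasure (μ S))
    {f : Tree d → ℝ≥0∞} (hf : Measurable f) (t₁ : ℝ) (n : ℕ) :
    Measurable (partialGrow s P x μ f t₁ n) := by
  unfold partialGrow
  exact Finset.measurable_sum _ fun k _ => measurable_lintegral_growExactly hP hμ hf t₁ k

theorem renewal_add (hP : IsPolyhedron P) (hμ : ∀ S, IsProbabilityMeasure (μ S))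
    {f : Tree d → ℝ≥0∞} {w w' : Tree d × ℝ → ℝ≥0∞} (hw : Measurable w) {t₁ t₀ : ℝ}
    {T : Tree d} : renewal s P x μ f (fun p => w p + w' p) t₁ T t₀ =
      renewal s P x μ f w t₁ T t₀ +
        ∫⁻ u in Set.Ioc 0 (t₁ - t₀), ENNReal.ofReal (Real.exp (-(rate (regions s P x T) * u))) *
          jump s P x μ (fun T' => w' (T', t₀ + u)) T (t₀ + u) := by
  unfold renewal
  rw [add_assoc, ← lintegral_add_left (measurable_renewal_integrand hP hμ hw T t₀)]
  congr 1
  refine lintegral_congr fun u => ?_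
  rw [← mul_add, ← jump_add (g := fun T' => w (T', t₀ + u)) hμ (hw.comp measurable_prodMk_right)]

theorem partialGrow_succ (hP : IsPolyhedron P) (hμ : ∀ S, IsProbabilityMeasure (μ S))
    {f : Tree d → ℝ≥0∞} (hf : Measurable f) {t₀ t₁ : ℝ} (ht : t₀ ≤ t₁) (n : ℕ) (T : Tree d) :
    partialGrow s P x μ f t₁ (n + 1) (T, t₀) =
      renewal s P x μ f (partialGrow s P x μ f t₁ n) t₁ T t₀ := by
  induction n with
  | zero => simp [partialGrow, renewal, jump, lintegral_growExactly_zero hf ht]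
  | succ n ih =>
    have h1 : partialGrow s P x μ f t₁ (n + 1) = fun p => partialGrow s P x μ f t₁ n p +
        ∫⁻ T', f T' ∂growExactly s P x μ t₁ n p.1 p.2 := by
      ext p
      exact Finset.sum_range_succ _ _
    have h2 : partialGrow s P x μ f t₁ (n + 1 + 1) (T, t₀) =
        partialGrow s P x μ f t₁ (n + 1) (T, t₀) +
          ∫⁻ T', f T' ∂growExactly s P x μ t₁ (n + 1) T t₀ := Finset.sum_range_succ _ _
    rw [h2, ih, h1, renewal_add hP hμ (measurable_partialGrow hP hμ hf t₁ n),
      lintegral_growExactly_succ hP hμ hf]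

theorem iSup_partialGrow (f : Tree d → ℝ≥0∞) (t₁ : ℝ) (T : Tree d) (t₀ : ℝ) :
    ∫⁻ T', f T' ∂grow s P x μ T t₀ t₁ = ⨆ n, partialGrow s P x μ f t₁ n (T, t₀) := by
  rw [lintegral_grow, ENNReal.tsum_eq_iSup_nat]
  rfl

/-- The renewal equation: the process starts afresh at its first jump. -/
theorem lintegral_grow_eq_renewal (hP : IsPolyhedron P) (hμ : ∀ S, IsProbabilityMeasure (μ S))
    {f : Tree d → ℝ≥0∞} (hf : Measurable f) {t₀ t₁ : ℝ} (ht : t₀ ≤ t₁) (T : Tree d) :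
    ∫⁻ T', f T' ∂grow s P x μ T t₀ t₁ =
      renewal s P x μ f (fun p => ∫⁻ T', f T' ∂grow s P x μ p.1 p.2 t₁) t₁ T t₀ := by
  have h1 : ∀ n, Measurable fun p : Tree d × ℝ => ∫⁻ T', f T' ∂growExactly s P x μ t₁ n p.1 p.2 :=
    measurable_lintegral_growExactly hP hμ hf t₁
  rw [lintegral_grow, tsum_eq_zero_add' ENNReal.summable, lintegral_growExactly_zero hf ht,
    renewal]
  congr 1
  simp only [lintegral_growExactly_succ hP hμ hf]
  rw [← lintegral_tsum fun n => (measurable_renewal_integrand hP hμ (h1 n) T t₀).aemeasurable]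
  refine lintegral_congr fun u => ?_
  rw [ENNReal.tsum_mul_left]
  congr 1
  simp only [lintegral_grow]
  exact (jump_tsum hμ (fun n => (h1 n).comp measurable_prodMk_right) T _).symm

theorem lintegral_grow_le_of_renewal (hP : IsPolyhedron P) (hμ : ∀ S, IsProbabilityMeasure (μ S))
    {f : Tree d → ℝ≥0∞} (hf : Measurable f) {w : Tree d × ℝ → ℝ≥0∞} {t₁ : ℝ}
    (h : ∀ T t₀, t₀ ≤ t₁ → renewal s P x μ f w t₁ T t₀ ≤ w (T, t₀)) (T : Tree d) {t₀ : ℝ}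
    (ht : t₀ ≤ t₁) : ∫⁻ T', f T' ∂grow s P x μ T t₀ t₁ ≤ w (T, t₀) := by
  rw [iSup_partialGrow]
  refine iSup_le fun n => ?_
  induction n generalizing T t₀ with
  | zero => simp [partialGrow]
  | succ n ih =>
    rw [partialGrow_succ hP hμ hf ht]
    exact (renewal_mono fun T' t ht' => ih T' ht').trans (h T t₀ ht)

theorem numLeaves_nextTree_le (T : Tree d) (kc : ℕ × Cut d) (t : ℝ) (ab : ℝ × ℝ) :
    numLeaves (nextTree T kc t ab).2 ≤ numLeaves T.2 + 1 := by
  unfold nextTree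
  simp only [numLeaves]
  split_ifs <;> omega

/-- The number of leaves grows at most by one at each jump while the rate is at most linear in it;
hence infinitely many cuts do not happen, and a bounded solution of the renewal equation cannot
exceed the expectation. -/
theorem le_partialGrow_add (hP : IsPolyhedron P) (hμ : ∀ S, IsProbabilityMeasure (μ S))
    {f : Tree d → ℝ≥0∞} (hf : Measurable f) {w : Tree d × ℝ → ℝ≥0∞} {t₁ : ℝ} (hw1 : ∀ p, w p ≤ 1)
    (h : ∀ T t₀, t₀ ≤ t₁ → w (T, t₀) ≤ renewal s P x μ f w t₁ T t₀) (n : ℕ) (T : Tree d) {t₀ : ℝ}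
    (ht : t₀ ≤ t₁) : w (T, t₀) ≤ partialGrow s P x μ f t₁ n (T, t₀) +
      ENNReal.ofReal (numLeaves T.2 / (numLeaves T.2 + n) *
        Real.exp (totalPerimeter P * (t₁ - t₀))) := by
  have hC : 0 ≤ totalPerimeter P := totalPerimeter_nonneg P
  set C := totalPerimeter P
  induction n generalizing T t₀ with
  | zero =>
    have h1 : (0 : ℝ) < numLeaves T.2 := by exact_mod_cast one_le_numLeaves T.2
    refine (hw1 _).trans (le_add_left ?_)
    rw [Nat.cast_zero, add_zero, div_self h1.ne', one_mul, ← ENNReal.ofReal_one]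
    exact ENNReal.ofReal_le_ofReal (Real.one_le_exp (mul_nonneg hC (by linarith)))
  | succ n ih =>
    have hl : (0 : ℝ) < numLeaves T.2 := by exact_mod_cast one_le_numLeaves T.2
    have hr := rate_le (x := x) hP s T
    have hr0 := rate_nonneg (P := P) x s T
    set r := rate (regions s P x T) with hr_def
    set l : ℝ := ((numLeaves T.2 : ℕ) : ℝ) with hl_def
    have hE : 0 < Real.exp (C * (t₁ - t₀)) := Real.exp_pos _
    rw [partialGrow_succ hP hμ hf ht]
    have h2 := (h T t₀ ht).trans (renewal_mono (w' := fun p => partialGrow s P x μ f t₁ n p +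
      ENNReal.ofReal (numLeaves p.1.2 / (numLeaves p.1.2 + n) *
        Real.exp (C * (t₁ - p.2)))) fun T' t ht' => ih T' ht')
    rw [renewal_add hP hμ (measurable_partialGrow hP hμ hf t₁ n)] at h2
    refine h2.trans ?_
    refine add_le_add le_rfl ?_
    calc _ ≤ ∫⁻ u in Set.Ioc 0 (t₁ - t₀), ENNReal.ofReal (r * Real.exp (-(r * u))) *
          (ENNReal.ofReal ((l + 1) / (l + 1 + n) * Real.exp (C * (t₁ - t₀))) *
            ENNReal.ofReal (Real.exp (-(C * u)))) := by
          refine setLIntegral_mono' measurableSet_Ioc fun u hu => ?_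
          rw [ENNReal.ofReal_mul hr0, mul_comm (ENNReal.ofReal r), mul_assoc]
          refine mul_le_mul_right ?_ _
          rw [← jump_const hP hμ]
          refine jump_mono fun kc ab => ?_
          rw [← ENNReal.ofReal_mul (by positivity), mul_assoc, ← Real.exp_add]
          refine ENNReal.ofReal_le_ofReal ?_
          have e : C * (t₁ - (t₀ + u)) = C * (t₁ - t₀) + -(C * u) := by ring
          rw [e]
          refine mul_le_mul_of_nonneg_right ?_ (Real.exp_nonneg _)
          have h3 : (numLeaves (nextTree T kc (t₀ + u) ab).2 : ℝ) ≤ l + 1 := by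
            rw [hl_def]
            exact_mod_cast numLeaves_nextTree_le T kc (t₀ + u) ab
          have h4 : (0 : ℝ) < numLeaves (nextTree T kc (t₀ + u) ab).2 := by
            exact_mod_cast one_le_numLeaves _
          have h5 : (0 : ℝ) ≤ n := Nat.cast_nonneg n
          rw [div_le_div_iff₀ (by positivity) (by positivity)]
          nlinarith
      _ ≤ ENNReal.ofReal ((l + 1) / (l + 1 + n) * Real.exp (C * (t₁ - t₀))) *
            ∫⁻ u, ENNReal.ofReal (Real.exp (-(C * u))) ∂expMeasure r := by
          rw [← lintegral_const_mul _ (by fun_prop), ← setLIntegral_expMeasure hr0 (by fun_prop)]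
          exact setLIntegral_le_lintegral _ _
      _ ≤ _ := by
          rcases hr0.eq_or_lt with h0 | hpos
          · rw [← h0, expMeasure_zero]; simp
          · rw [lintegral_exp_expMeasure hpos hC, ← ENNReal.ofReal_mul (by positivity)]
            refine ENNReal.ofReal_le_ofReal ?_
            push_cast
            have h6 : (l + 1) * (r / (r + C)) ≤ l := by
              rw [← mul_div_assoc, div_le_iff₀ (by positivity)]
              nlinarith
            calc _ = ((l + 1) * (r / (r + C))) * (Real.exp (C * (t₁ - t₀)) / (l + 1 + n)) := by
                  ring
              _ ≤ l * (Real.exp (C * (t₁ - t₀)) / (l + 1 + n)) := by gcongr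
              _ = _ := by rw [add_right_comm, add_assoc]; ring

theorem le_lintegral_grow_of_renewal (hP : IsPolyhedron P) (hμ : ∀ S, IsProbabilityMeasure (μ S))
    {f : Tree d → ℝ≥0∞} (hf : Measurable f) {w : Tree d × ℝ → ℝ≥0∞} {t₁ : ℝ} (hw1 : ∀ p, w p ≤ 1)
    (h : ∀ T t₀, t₀ ≤ t₁ → w (T, t₀) ≤ renewal s P x μ f w t₁ T t₀) (T : Tree d) {t₀ : ℝ}
    (ht : t₀ ≤ t₁) : w (T, t₀) ≤ ∫⁻ T', f T' ∂grow s P x μ T t₀ t₁ := by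
  have h1 : Filter.Tendsto (fun n : ℕ => ∫⁻ T', f T' ∂grow s P x μ T t₀ t₁ +
      ENNReal.ofReal (numLeaves T.2 / (numLeaves T.2 + n) *
        Real.exp (totalPerimeter P * (t₁ - t₀)))) Filter.atTop
      (nhds (∫⁻ T', f T' ∂grow s P x μ T t₀ t₁ + ENNReal.ofReal
        (0 * Real.exp (totalPerimeter P * (t₁ - t₀))))) := by
    refine Filter.Tendsto.const_add _ (ENNReal.tendsto_ofReal (Filter.Tendsto.mul_const _ ?_))
    exact tendsto_const_nhds.div_atTop
      (Filter.tendsto_atTop_add_const_left _ _ tendsto_natCast_atTop_atTop)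
  rw [zero_mul, ENNReal.ofReal_zero, add_zero] at h1
  refine ge_of_tendsto' h1 fun n => (le_partialGrow_add hP hμ hf hw1 h n T ht).trans ?_
  gcongr
  rw [iSup_partialGrow]
  exact le_iSup (fun n => partialGrow s P x μ f t₁ n (T, t₀)) n

/-- A bounded solution of the renewal equation is the expectation at time `t₁`. -/
theorem lintegral_grow_unique (hP : IsPolyhedron P) (hμ : ∀ S, IsProbabilityMeasure (μ S))
    {f : Tree d → ℝ≥0∞} (hf : Measurable f) {w : Tree d × ℝ → ℝ≥0∞} {t₁ : ℝ} (hw1 : ∀ p, w p ≤ 1)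
    (h : ∀ T t₀, t₀ ≤ t₁ → w (T, t₀) = renewal s P x μ f w t₁ T t₀) (T : Tree d) {t₀ : ℝ}
    (ht : t₀ ≤ t₁) : ∫⁻ T', f T' ∂grow s P x μ T t₀ t₁ = w (T, t₀) :=
  le_antisymm (lintegral_grow_le_of_renewal hP hμ hf (fun T t₀ h0 => (h T t₀ h0).ge) T ht)
    (le_lintegral_grow_of_renewal hP hμ hf hw1 (fun T t₀ h0 => (h T t₀ h0).le) T ht)

theorem lintegral_Ioc_exp {r a : ℝ} (hr : 0 ≤ r) (ha : 0 ≤ a) :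
    ENNReal.ofReal (Real.exp (-(r * a))) +
      ∫⁻ u in Set.Ioc 0 a, ENNReal.ofReal (Real.exp (-(r * u))) * ENNReal.ofReal r = 1 := by
  have h1 := setLIntegral_expMeasure hr (h := fun _ => 1) measurable_const a
  simp only [lintegral_const, Measure.restrict_apply_univ, one_mul, mul_one] at h1
  have h2 : ∫⁻ u in Set.Ioc 0 a, ENNReal.ofReal (Real.exp (-(r * u))) * ENNReal.ofReal r =
      ∫⁻ u in Set.Ioc 0 a, ENNReal.ofReal (r * Real.exp (-(r * u))) := by
    refine lintegral_congr fun u => ?_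
    rw [← ENNReal.ofReal_mul (Real.exp_nonneg _), mul_comm (Real.exp _)]
  rw [h2, ← h1, ← one_sub_expMeasure_Iic hr ha]
  exact tsub_add_cancel_of_le ((measure_mono (Set.subset_univ _)).trans (expMeasure_univ_le hr))

theorem isProbabilityMeasure_grow (hP : IsPolyhedron P) (hμ : ∀ S, IsProbabilityMeasure (μ S))
    (T : Tree d) {t₀ t₁ : ℝ} (ht : t₀ ≤ t₁) : IsProbabilityMeasure (grow s P x μ T t₀ t₁) := by
  constructor
  have h := lintegral_grow_unique (x := x) (s := s) hP hμ (f := fun _ => 1) (w := fun _ => 1)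
    (t₁ := t₁) measurable_const (fun _ => le_rfl) (fun T t₀ h0 => ?_) T ht
  · simpa using h
  · simp only [renewal, jump_const hP hμ, mul_one]
    exact (lintegral_Ioc_exp (rate_nonneg x s T) (by linarith)).symm

theorem growExactly_of_lt (T : Tree d) {t₀ t₁ : ℝ} (ht : t₁ < t₀) (n : ℕ) :
    growExactly s P x μ t₁ n T t₀ = if n = 0 then Measure.dirac T else 0 := by
  have h := expMeasure_Iic_of_neg (rate_nonneg (P := P) x s T) (a := t₁ - t₀) (by linarith)
  rcases n with _ | n
  · have h2 : expMeasure (rate (regions s P x T)) (Set.Iic (t₁ - t₀)) = 0 :=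
      Measure.restrict_eq_zero.1 h
    simp [growExactly, h2]
  · rw [growExactly_succ, h]
    simp

/-- The process before its starting time is put at its initial tree. -/
theorem grow_of_lt (T : Tree d) {t₀ t₁ : ℝ} (ht : t₁ < t₀) :
    grow s P x μ T t₀ t₁ = Measure.dirac T := by
  refine Measure.ext fun A hA => ?_
  rw [grow, Measure.sum_apply _ hA]
  simp only [growExactly_of_lt T ht]
  rw [tsum_eq_single 0 (by intro n hn; simp [hn])]
  simp

theorem isProbabilityMeasure_grow' (hP : IsPolyhedron P) (hμ : ∀ S, IsProbabilityMeasure (μ S))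
    (T : Tree d) (t₀ t₁ : ℝ) : IsProbabilityMeasure (grow s P x μ T t₀ t₁) := by
  rcases le_or_gt t₀ t₁ with h | h
  · exact isProbabilityMeasure_grow hP hμ T h
  · rw [grow_of_lt T h]; infer_instance

end Renewal

/-! ### The Markov property, invariants of the growth, and the change of the mean parameters -/

section Markov

variable {d N : ℕ} {P : Set (Pt d)} {x : Fin N → Pt d} {s : Scheme}
  {μ : Finset (Fin N) → Measure ℝ}

instance {α : Type*} [MeasurableSpace α] [MeasurableSingletonClass α] :
    MeasurableSingletonClass (List α) := by
  constructor
  intro l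
  rcases isEmpty_or_nonempty α with h | ⟨⟨a⟩⟩
  · have : ({l} : Set (List α)) = Set.univ :=
      Set.eq_univ_of_forall fun l' => Subsingleton.elim l' l
    rw [this]
    exact MeasurableSet.univ
  · let _ : Inhabited α := ⟨a⟩
    have : ({l} : Set (List α)) = {l' | l'.length = l.length} ∩
        ⋂ k : ℕ, {l' | l'.getD k default = l.getD k default} := by
      ext l'
      simp only [Set.mem_singleton_iff, Set.mem_inter_iff, Set.mem_iInter, Set.mem_ofPred_eq]
      constructor
      · rintro rfl
        exact ⟨rfl, fun _ => rfl⟩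
      · rintro ⟨h1, h2⟩
        refine List.ext_getElem h1 fun k hk hk' => ?_
        have := h2 k
        rwa [List.getD_eq_getElem _ _ hk, List.getD_eq_getElem _ _ hk'] at this
    rw [this]
    refine (measurable_list_length (measurableSet_singleton l.length)).inter
      (MeasurableSet.iInter fun k => ?_)
    exact measurable_list_getD k (measurableSet_singleton (l.getD k default))

attribute [local irreducible] cell dataIn rate cutLaw cutIntensity regions childLaw growExactly

theorem setLIntegral_Ioc_add {h : ℝ → ℝ≥0∞} (a b : ℝ) :
    ∫⁻ u in Set.Ioc 0 b, h (a + u) = ∫⁻ u in Set.Ioc a (a + b), h u := by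
  have h1 := (measurePreserving_add_left volume a).setLIntegral_comp_preimage_emb
    (measurableEmbedding_addLeft a) h (Set.Ioc a (a + b))
  rw [← h1]
  congr 2
  ext u
  simp

/-- The renewal equation of the process until `t₂`, seen at an earlier time `t₁`: by the lack of
memory of the waiting times, the expected value at `t₁` takes the place of the final value. -/
theorem renewal_markov (hP : IsPolyhedron P) (hμ : ∀ S, IsProbabilityMeasure (μ S))
    {f : Tree d → ℝ≥0∞} {w : Tree d × ℝ → ℝ≥0∞} (hw : Measurable w) {t₂ : ℝ}
    (h : ∀ T t₀, t₀ ≤ t₂ → w (T, t₀) = renewal s P x μ f w t₂ T t₀) {t₀ t₁ : ℝ} (h01 : t₀ ≤ t₁)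
    (h12 : t₁ ≤ t₂) (T : Tree d) :
    w (T, t₀) = renewal s P x μ (fun T' => w (T', t₁)) w t₁ T t₀ := by
  have hm := measurable_renewal_integrand (x := x) (s := s) hP hμ hw T t₀
  have hm1 := measurable_renewal_integrand (x := x) (s := s) hP hμ hw T t₁
  rw [h T t₀ (h01.trans h12), renewal, renewal, h T t₁ h12, renewal]
  set r := rate (regions s P x T)
  have hsplit : Set.Ioc 0 (t₂ - t₀) = Set.Ioc 0 (t₁ - t₀) ∪ Set.Ioc (t₁ - t₀) (t₂ - t₀) :=
    (Set.Ioc_union_Ioc_eq_Ioc (by linarith) (by linarith)).symm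
  have hdisj : Disjoint (Set.Ioc 0 (t₁ - t₀)) (Set.Ioc (t₁ - t₀) (t₂ - t₀)) :=
    Set.Ioc_disjoint_Ioc_of_le le_rfl
  rw [hsplit, lintegral_union measurableSet_Ioc hdisj]
  have e2 : t₂ - t₀ = (t₁ - t₀) + (t₂ - t₁) := by ring
  rw [e2, ← setLIntegral_Ioc_add]
  have e3 : ∀ u, Real.exp (-(r * ((t₁ - t₀) + u))) =
      Real.exp (-(r * (t₁ - t₀))) * Real.exp (-(r * u)) := by
    intro u
    rw [← Real.exp_add]; congr 1; ring
  have e4 : ∀ u, t₀ + (t₁ - t₀ + u) = t₁ + u := by intro u; ring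
  simp only [e3, e4, ENNReal.ofReal_mul (Real.exp_nonneg _), mul_assoc]
  rw [lintegral_const_mul _ hm1]
  ring

/-- The Markov property. -/
theorem grow_bind_grow (hP : IsPolyhedron P) (hμ : ∀ S, IsProbabilityMeasure (μ S)) {t₀ t₁ t₂ : ℝ}
    (h01 : t₀ ≤ t₁) (h12 : t₁ ≤ t₂) (T : Tree d) :
    (grow s P x μ T t₀ t₁).bind (fun T' => grow s P x μ T' t₁ t₂) = grow s P x μ T t₀ t₂ := by
  have hk : Measurable fun T' : Tree d => grow s P x μ T' t₁ t₂ :=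
    (measurable_grow_right (x := x) (s := s) hP hμ t₂).comp
      (f := fun T' : Tree d => (T', t₁)) measurable_prodMk_right
  refine Measure.ext fun A hA => ?_
  have hf : Measurable (A.indicator (1 : Tree d → ℝ≥0∞)) := measurable_one.indicator hA
  have hw := measurable_lintegral_grow (x := x) (s := s) hP hμ hf t₂
  rw [Measure.bind_apply hA hk.aemeasurable, ← lintegral_indicator_one hA]
  simp only [← lintegral_indicator_one hA]
  have hone : ∀ p : Tree d × ℝ, ∫⁻ T', A.indicator 1 T' ∂grow s P x μ p.1 p.2 t₂ ≤ 1 := by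
    intro p
    have := isProbabilityMeasure_grow' (x := x) (s := s) hP hμ p.1 p.2 t₂
    rw [lintegral_indicator_one hA]
    exact prob_le_one
  exact lintegral_grow_unique (x := x) (s := s) hP hμ
    (f := fun T' => ∫⁻ T'', A.indicator 1 T'' ∂grow s P x μ T' t₁ t₂)
    (w := fun p : Tree d × ℝ => ∫⁻ T'', A.indicator 1 T'' ∂grow s P x μ p.1 p.2 t₂)
    (hw.comp (f := fun T' : Tree d => (T', t₁)) measurable_prodMk_right) hone
    (fun T' t ht => renewal_markov hP hμ hw
      (fun T'' t' ht' => lintegral_grow_eq_renewal hP hμ hf ht' T'') ht h12 T') T h01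

/-- A measurable property which is kept by almost all jumps holds almost surely. -/
theorem ae_grow_of_jump (hP : IsPolyhedron P) (hμ : ∀ S, IsProbabilityMeasure (μ S))
    {Q : Set (Tree d)} (hQ : MeasurableSet Q) {t₀ t₁ : ℝ} (ht : t₀ ≤ t₁)
    (hstep : ∀ T ∈ Q, ∀ t, t₀ < t → t ≤ t₁ →
      ∀ᵐ kc ∂cutIntensity s P x T, ∀ ab, nextTree T kc t ab ∈ Q) {T : Tree d} (hT : T ∈ Q) :
    ∀ᵐ T' ∂grow s P x μ T t₀ t₁, T' ∈ Q := by
  have hf : Measurable (Qᶜ.indicator (1 : Tree d → ℝ≥0∞)) := measurable_one.indicator hQ.compl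
  have h : ∫⁻ T', Qᶜ.indicator 1 T' ∂grow s P x μ T t₀ t₁ ≤ 0 := by
    rw [iSup_partialGrow]
    refine iSup_le fun n => ?_
    have key : ∀ n, ∀ T ∈ Q, ∀ t, t₀ ≤ t → t ≤ t₁ →
        partialGrow s P x μ (Qᶜ.indicator 1) t₁ n (T, t) = 0 := by
      intro n
      induction n with
      | zero => intros; simp [partialGrow]
      | succ n ih =>
        intro T hT t h0 h1
        rw [partialGrow_succ hP hμ hf h1, renewal]
        have : Qᶜ.indicator (1 : Tree d → ℝ≥0∞) T = 0 :=
          Set.indicator_of_notMem (fun h : T ∉ Q => h hT) _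
        rw [this, mul_zero, zero_add]
        refine (setLIntegral_congr_fun measurableSet_Ioc fun u hu => ?_).trans lintegral_zero
        have hj : jump s P x μ (fun T' => partialGrow s P x μ (Qᶜ.indicator 1) t₁ n (T', t + u))
            T (t + u) = 0 := by
          unfold jump
          refine (lintegral_congr_ae ?_).trans lintegral_zero
          filter_upwards [hstep T hT (t + u) (by linarith [hu.1]) (by linarith [hu.2])] with kc hkc
          refine (lintegral_congr fun ab => ?_).trans lintegral_zero
          exact ih _ (hkc ab) _ (by linarith [hu.1]) (by linarith [hu.2])
        simp only [hj, mul_zero]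
    exact (key n T hT t₀ le_rfl ht).le
  rw [lintegral_indicator_one hQ.compl, nonpos_iff_eq_zero] at h
  exact h

theorem upTo_nextTree_of_lt (T : Tree d) (kc : ℕ × Cut d) {t t' : ℝ} (ab : ℝ × ℝ) (h : t < t') :
    upTo (nextTree T kc t' ab) t = upTo T t := by
  simp [upTo, nextTree, not_le.2 h]

/-- The growth does not change the past. -/
theorem ae_grow_upTo_eq (hP : IsPolyhedron P) (hμ : ∀ S, IsProbabilityMeasure (μ S))
    {t t₀ t₁ : ℝ} (h : t ≤ t₀) (ht : t₀ ≤ t₁) (T : Tree d) :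
    ∀ᵐ T' ∂grow s P x μ T t₀ t₁, upTo T' t = upTo T t := by
  refine ae_grow_of_jump hP hμ (Q := {T' | upTo T' t = upTo T t})
    (measurable_upTo t (measurableSet_singleton (upTo T t))) ht ?_ rfl
  intro T' hT' t' h0 _
  refine Filter.Eventually.of_forall fun kc ab => ?_
  rw [Set.mem_ofPred_eq, upTo_nextTree_of_lt _ _ _ (h.trans_lt h0)]
  exact hT'

theorem upTo_eq_self_iff (T : Tree d) (t : ℝ) : upTo T t = T ↔ ∀ ev ∈ T.2, ev.2.2.1 ≤ t := by
  obtain ⟨a, es⟩ := T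
  simp [upTo, Prod.ext_iff, List.filter_eq_self]

theorem measurableSet_upTo_eq_self (t : ℝ) : MeasurableSet {T : Tree d | upTo T t = T} := by
  have h : {T : Tree d | upTo T t = T} =
      (fun T : Tree d => ((upTo T t).2.length, T.2.length)) ⁻¹' {q | q.1 = q.2} := by
    ext T
    rw [Set.mem_ofPred_eq, upTo_eq_self_iff, Set.mem_preimage, Set.mem_ofPred_eq]
    simp only [upTo, List.length_filter_eq_length_iff, decide_eq_true_eq]
  rw [h]
  refine Measurable.prodMk (measurable_list_length.comp ((measurable_snd).comp (measurable_upTo t)))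
    (measurable_list_length.comp measurable_snd) (Set.to_countable _).measurableSet

/-- All cuts happen before the final time. -/
theorem ae_grow_upTo_eq_self (hP : IsPolyhedron P) (hμ : ∀ S, IsProbabilityMeasure (μ S))
    {t₀ t₁ : ℝ} (ht : t₀ ≤ t₁) {T : Tree d} (hT : upTo T t₁ = T) :
    ∀ᵐ T' ∂grow s P x μ T t₀ t₁, upTo T' t₁ = T' := by
  refine ae_grow_of_jump hP hμ (measurableSet_upTo_eq_self t₁) ht ?_ hT
  intro T' hT' t' _ h1
  refine Filter.Eventually.of_forall fun kc ab => ?_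
  rw [Set.mem_ofPred_eq, upTo_eq_self_iff] at hT' ⊢
  intro ev hev
  rcases List.mem_cons.1 hev with rfl | h
  · exact h1
  · exact hT' ev h

theorem ae_cutIntensity_hull_meets (T : Tree d) :
    ∀ᵐ kc ∂cutIntensity .hull P x T, kc.2.Meets (dataHull x (cell P T kc.1)) := by
  unfold cutIntensity
  rw [Measure.ae_sum_iff' (measurableSet_meets_dataHull x T)]
  intro k
  rw [ae_map_iff measurable_prodMk_left.aemeasurable (measurableSet_meets_dataHull x T)]
  exact ae_hitMeasure_meets (isPolytopal_dataHull x _)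

theorem hullCuts_nextTree_of_meets {T : Tree d} {kc : ℕ × Cut d} (t : ℝ) (ab : ℝ × ℝ)
    (h : kc.2.Meets (dataHull x (cell P T kc.1))) :
    hullCuts P x (nextTree T kc t ab).1 (nextTree T kc t ab).2 =
      (dataIn x (cell P T kc.1), kc.2, t) :: hullCuts P x T.1 T.2 :=
  if_pos h

theorem hullCuts_nextTree_of_not_meets {T : Tree d} {kc : ℕ × Cut d} (t : ℝ) (ab : ℝ × ℝ)
    (h : ¬ kc.2.Meets (dataHull x (cell P T kc.1))) :
    hullCuts P x (nextTree T kc t ab).1 (nextTree T kc t ab).2 = hullCuts P x T.1 T.2 :=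
  if_neg h

theorem measurableSet_noDroppedCuts :
    MeasurableSet {T : Tree d | (restrictToHulls P x T).1.length = T.2.length} := by
  have h : Measurable fun T : Tree d => ((restrictToHulls P x T).1.length, T.2.length) :=
    (measurable_list_length.comp (measurable_hullCuts x)).prodMk
      (measurable_list_length.comp measurable_snd)
  exact h (Set.to_countable {q : ℕ × ℕ | q.1 = q.2}).measurableSet

/-- In the hull scheme the restriction to the hulls drops no cut. -/
theorem ae_grow_hull_noDroppedCuts (hP : IsPolyhedron P) (hμ : ∀ S, IsProbabilityMeasure (μ S))
    {t₀ t₁ : ℝ} (ht : t₀ ≤ t₁) {T : Tree d} (hT : (restrictToHulls P x T).1.length = T.2.length) :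
    ∀ᵐ T' ∂grow .hull P x μ T t₀ t₁, (restrictToHulls P x T').1.length = T'.2.length := by
  refine ae_grow_of_jump hP hμ measurableSet_noDroppedCuts ht ?_ hT
  intro T' hT' t' _ _
  filter_upwards [ae_cutIntensity_hull_meets (P := P) (x := x) T'] with kc hkc ab
  change (restrictToHulls P x T').1.length = T'.2.length at hT'
  have h := hullCuts_nextTree_of_meets (P := P) (x := x) t' ab hkc
  simp only [restrictToHulls] at hT' ⊢
  rw [h]
  simpa [nextTree] using hT'

/-! The change of measure from posterior to prior mean parameters. -/

theorem postVar_pos {v : ℝ≥0} (hv : 0 < v) {σ2 : ℝ} (hσ : 0 < σ2) (S : Finset (Fin N)) :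
    0 < postVar v σ2 S := by
  have : (0 : ℝ) < v := hv
  unfold postVar
  positivity

theorem priorOverPost_pos {v : ℝ≥0} (hv : 0 < v) {σ2 : ℝ} (hσ : 0 < σ2) (R : Fin N → ℝ)
    (S : Finset (Fin N)) (a : ℝ) : 0 < priorOverPost v σ2 R S a := by
  have h := postVar_pos hv hσ S
  exact div_pos (gaussianPDFReal_pos _ _ _ hv.ne')
    (gaussianPDFReal_pos _ _ _ (Real.toNNReal_pos.2 h).ne')

theorem measurable_priorOverPost_right (v : ℝ≥0) (σ2 : ℝ) (R : Fin N → ℝ) (S : Finset (Fin N)) :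
    Measurable fun a => priorOverPost v σ2 R S a := by
  unfold priorOverPost
  fun_prop

theorem isProbabilityMeasure_postLaw (v : ℝ≥0) (σ2 : ℝ) (R : Fin N → ℝ) (S : Finset (Fin N)) :
    IsProbabilityMeasure (postLaw v σ2 R S) := by
  unfold postLaw; infer_instance

theorem postLaw_withDensity {v : ℝ≥0} (hv : 0 < v) {σ2 : ℝ} (hσ : 0 < σ2) (R : Fin N → ℝ)
    (S : Finset (Fin N)) :
    (postLaw v σ2 R S).withDensity (fun a => ENNReal.ofReal (priorOverPost v σ2 R S a)) =
      gaussianReal 0 v := by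
  have h := (Real.toNNReal_pos.2 (postVar_pos hv hσ S)).ne'
  rw [postLaw, gaussianReal_of_var_ne_zero _ h, gaussianReal_of_var_ne_zero _ hv.ne',
    ← withDensity_mul _ (measurable_gaussianPDF _ _)
      (measurable_priorOverPost_right v σ2 R S).ennreal_ofReal]
  congr 1
  ext a
  rw [Pi.mul_apply, gaussianPDF, gaussianPDF, ← ENNReal.ofReal_mul (gaussianPDFReal_nonneg _ _ _),
    priorOverPost, mul_div_cancel₀ _ (gaussianPDFReal_pos _ _ _ h).ne']

theorem newMeansRatio_pos {v : ℝ≥0} (hv : 0 < v) {σ2 : ℝ} (hσ : 0 < σ2) (R : Fin N → ℝ)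
    (t a₀ : ℝ) (es : List (Event d)) : 0 < newMeansRatio P x v σ2 R t a₀ es := by
  induction es with
  | nil => simp [newMeansRatio]
  | cons ev es ih =>
    simp only [newMeansRatio]
    refine mul_pos ?_ ih
    split_ifs
    · exact mul_pos (priorOverPost_pos hv hσ _ _ _) (priorOverPost_pos hv hσ _ _ _)
    · exact one_pos

theorem newMeansRatio_nextTree (v : ℝ≥0) (σ2 : ℝ) (R : Fin N → ℝ) {t u : ℝ} (h : t < u)
    (T : Tree d) (kc : ℕ × Cut d) (ab : ℝ × ℝ) :
    newMeansRatio P x v σ2 R t (nextTree T kc u ab).1 (nextTree T kc u ab).2 =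
      priorOverPost v σ2 R (dataIn x (cell P T kc.1 ∩ kc.2.below)) ab.1 *
        priorOverPost v σ2 R (dataIn x (cell P T kc.1 ∩ kc.2.above)) ab.2 *
        newMeansRatio P x v σ2 R t T.1 T.2 := by
  simp only [nextTree, newMeansRatio, if_pos h]

theorem childLaw_withDensity {v : ℝ≥0} (hv : 0 < v) {σ2 : ℝ} (hσ : 0 < σ2) (R : Fin N → ℝ)
    (T : Tree d) (kc : ℕ × Cut d) :
    (childLaw P x (postLaw v σ2 R) T kc).withDensity (fun ab =>
      ENNReal.ofReal (priorOverPost v σ2 R (dataIn x (cell P T kc.1 ∩ kc.2.below)) ab.1) *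
        ENNReal.ofReal (priorOverPost v σ2 R (dataIn x (cell P T kc.1 ∩ kc.2.above)) ab.2)) =
      childLaw P x (fun _ => gaussianReal 0 v) T kc := by
  have := isProbabilityMeasure_postLaw v σ2 R
  unfold childLaw
  rw [← prod_withDensity (measurable_priorOverPost_right _ _ _ _).ennreal_ofReal
    (measurable_priorOverPost_right _ _ _ _).ennreal_ofReal, postLaw_withDensity hv hσ,
    postLaw_withDensity hv hσ]

theorem measurable_newMeansRatio_right (v : ℝ≥0) (σ2 : ℝ) (R : Fin N → ℝ) (t : ℝ) :
    Measurable fun T : Tree d => newMeansRatio P x v σ2 R t T.1 T.2 :=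
  (measurable_newMeansRatio x v t).comp (f := fun T : Tree d => ((σ2, R), T)) measurable_prodMk_left

/-- Sampling the two new means from their posteriors and correcting by the ratio of prior to
posterior densities amounts to sampling them from the prior. -/
theorem jump_postLaw {v : ℝ≥0} (hv : 0 < v) {σ2 : ℝ} (hσ : 0 < σ2) (R : Fin N → ℝ) {t u : ℝ}
    (h : t < u) {g : Tree d → ℝ≥0∞} (hg : Measurable g) (T : Tree d) :
    jump s P x (postLaw v σ2 R)
        (fun T' => ENNReal.ofReal (newMeansRatio P x v σ2 R t T'.1 T'.2) * g T') T u =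
      ENNReal.ofReal (newMeansRatio P x v σ2 R t T.1 T.2) *
        jump s P x (fun _ => gaussianReal 0 v) g T u := by
  rw [← jump_const_mul (fun _ => inferInstance) hg]
  unfold jump
  refine lintegral_congr fun kc => ?_
  have hn : Measurable fun ab : ℝ × ℝ => nextTree T kc u ab :=
    (measurable_nextTree' T u).comp (f := fun ab : ℝ × ℝ => (kc, ab)) measurable_prodMk_left
  have h1 : Measurable fun ab : ℝ × ℝ =>
      ENNReal.ofReal (newMeansRatio P x v σ2 R t T.1 T.2) * g (nextTree T kc u ab) :=
    (hg.comp hn).const_mul _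
  rw [← childLaw_withDensity hv hσ R T kc, lintegral_withDensity_eq_lintegral_mul _ ?_ h1]
  · refine lintegral_congr fun ab => ?_
    simp only [newMeansRatio_nextTree _ _ _ h, Pi.mul_apply]
    rw [ENNReal.ofReal_mul (mul_pos (priorOverPost_pos hv hσ _ _ _)
        (priorOverPost_pos hv hσ _ _ _)).le,
      ENNReal.ofReal_mul (priorOverPost_pos hv hσ _ _ _).le]
    simp only [mul_assoc]
  · exact ((measurable_priorOverPost_right _ _ _ _).comp measurable_fst).ennreal_ofReal.mul
      ((measurable_priorOverPost_right _ _ _ _).comp measurable_snd).ennreal_ofReal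

theorem partialGrow_postLaw (hP : IsPolyhedron P) {v : ℝ≥0} (hv : 0 < v) {σ2 : ℝ} (hσ : 0 < σ2)
    (R : Fin N → ℝ) {t t₀ t₁ : ℝ} (h : t ≤ t₀) (ht : t₀ ≤ t₁) {f : Tree d → ℝ≥0∞}
    (hf : Measurable f) (n : ℕ) (T : Tree d) :
    partialGrow s P x (postLaw v σ2 R)
        (fun T' => ENNReal.ofReal (newMeansRatio P x v σ2 R t T'.1 T'.2) * f T') t₁ n (T, t₀) =
      ENNReal.ofReal (newMeansRatio P x v σ2 R t T.1 T.2) *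
        partialGrow s P x (fun _ => gaussianReal 0 v) f t₁ n (T, t₀) := by
  have hpost := isProbabilityMeasure_postLaw v σ2 R
  have hprior : ∀ S : Finset (Fin N), IsProbabilityMeasure (gaussianReal 0 v) := fun _ =>
    inferInstance
  have hrf : Measurable fun T' : Tree d =>
      ENNReal.ofReal (newMeansRatio P x v σ2 R t T'.1 T'.2) * f T' :=
    (measurable_newMeansRatio_right v σ2 R t).ennreal_ofReal.mul hf
  induction n generalizing T t₀ with
  | zero => simp [partialGrow]
  | succ n ih =>
    rw [partialGrow_succ hP hpost hrf ht, partialGrow_succ hP hprior hf ht, renewal, renewal,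
      mul_add, ← lintegral_const_mul _ (measurable_renewal_integrand hP hprior
        (measurable_partialGrow hP hprior hf t₁ n) T t₀)]
    congr 1
    · ring
    · refine setLIntegral_congr_fun measurableSet_Ioc fun u hu => ?_
      have e : (fun T' => partialGrow s P x (postLaw v σ2 R)
          (fun T' => ENNReal.ofReal (newMeansRatio P x v σ2 R t T'.1 T'.2) * f T') t₁ n
            (T', t₀ + u)) = fun T' => ENNReal.ofReal (newMeansRatio P x v σ2 R t T'.1 T'.2) *
              partialGrow s P x (fun _ => gaussianReal 0 v) f t₁ n (T', t₀ + u) := by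
        funext T'
        exact ih (by linarith [hu.1]) (by linarith [hu.2]) T'
      have hm : Measurable fun T' : Tree d =>
          partialGrow s P x (fun _ => gaussianReal 0 v) f t₁ n (T', t₀ + u) :=
        (measurable_partialGrow hP hprior hf t₁ n).comp
          (f := fun T' : Tree d => (T', t₀ + u)) measurable_prodMk_right
      simp only [e, jump_postLaw hv hσ R (by linarith [hu.1] : t < t₀ + u) hm]
      ring

/-- Weighting the new mean parameters with prior over posterior turns the growth with posterior
mean parameters into the growth with prior mean parameters. -/
theorem lintegral_grow_postLaw (hP : IsPolyhedron P) {v : ℝ≥0} (hv : 0 < v) {σ2 : ℝ}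
    (hσ : 0 < σ2) (R : Fin N → ℝ) {t t₀ t₁ : ℝ} (h : t ≤ t₀) (ht : t₀ ≤ t₁) {f : Tree d → ℝ≥0∞}
    (hf : Measurable f) (T : Tree d) :
    ∫⁻ T', ENNReal.ofReal (newMeansRatio P x v σ2 R t T'.1 T'.2) * f T'
        ∂grow s P x (postLaw v σ2 R) T t₀ t₁ =
      ENNReal.ofReal (newMeansRatio P x v σ2 R t T.1 T.2) *
        ∫⁻ T', f T' ∂grow s P x (fun _ => gaussianReal 0 v) T t₀ t₁ := by
  rw [iSup_partialGrow, iSup_partialGrow, ENNReal.mul_iSup]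
  exact iSup_congr fun n => partialGrow_postLaw hP hv hσ R h ht hf n T

end Markov

/-! ### Resampling the mean parameters -/

section Resample

variable {d N : ℕ} {P : Set (Pt d)} {x : Fin N → Pt d} {s : Scheme}

/-- The cuts and times of a list of events, without the mean parameters. -/
def skeleton (es : List (Event d)) : List (ℕ × Cut d × ℝ) :=
  es.map fun ev => (ev.1, ev.2.1, ev.2.2.1)

theorem measurable_skeleton : Measurable (skeleton : List (Event d) → _) := by
  refine measurable_list_rec' (g := fun p : Event d × List (Event d) × List (ℕ × Cut d × ℝ) =>
    (p.1.1, p.1.2.1, p.1.2.2.1) :: p.2.2) ?_ fun _ _ => rfl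
  exact measurable_cons.comp (f := fun p : Event d × List (Event d) × List (ℕ × Cut d × ℝ) =>
    ((p.1.1, p.1.2.1, p.1.2.2.1), p.2.2)) (by fun_prop)

theorem numLeaves_eq_of_skeleton {es es' : List (Event d)} (h : skeleton es = skeleton es') :
    numLeaves es = numLeaves es' := by
  induction es generalizing es' with
  | nil => cases es' with
    | nil => rfl
    | cons => simp [skeleton] at h
  | cons ev es ih => cases es' with
    | nil => simp [skeleton] at h
    | cons ev' es' =>
      simp only [skeleton, List.map_cons, List.cons.injEq, Prod.mk.injEq] at h
      simp only [numLeaves, ih h.2, h.1.1]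

theorem cellOf_eq_of_skeleton {es es' : List (Event d)} (h : skeleton es = skeleton es') (k : ℕ) :
    cellOf P es k = cellOf P es' k := by
  induction es generalizing es' k with
  | nil => cases es' with
    | nil => rfl
    | cons => simp [skeleton] at h
  | cons ev es ih => cases es' with
    | nil => simp [skeleton] at h
    | cons ev' es' =>
      simp only [skeleton, List.map_cons, List.cons.injEq, Prod.mk.injEq] at h
      rw [cellOf_cons, cellOf_cons, numLeaves_eq_of_skeleton h.2, h.1.1, h.1.2.1]
      simp only [ih h.2]

theorem cell_eq_of_skeleton {T T' : Tree d} (h : skeleton T.2 = skeleton T'.2) (k : ℕ) :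
    cell P T k = cell P T' k := by
  rw [cell_eq_cellOf, cell_eq_cellOf, cellOf_eq_of_skeleton h]

theorem cutIntensity_eq_of_skeleton {T T' : Tree d} (h : skeleton T.2 = skeleton T'.2) :
    cutIntensity s P x T = cutIntensity s P x T' := by
  simp only [cutIntensity, cell_eq_of_skeleton h]

theorem rate_eq_of_skeleton {T T' : Tree d} (h : skeleton T.2 = skeleton T'.2) :
    rate (regions s P x T) = rate (regions s P x T') := by
  simp only [rate_regions, cell_eq_of_skeleton h, numLeaves_eq_of_skeleton h]

theorem hullCuts_eq_of_skeleton {a a' : ℝ} {es es' : List (Event d)}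
    (h : skeleton es = skeleton es') : hullCuts P x a es = hullCuts P x a' es' := by
  classical
  induction es generalizing es' with
  | nil => cases es' with
    | nil => rfl
    | cons => simp [skeleton] at h
  | cons ev es ih => cases es' with
    | nil => simp [skeleton] at h
    | cons ev' es' =>
      obtain ⟨k, c, t, ab⟩ := ev
      obtain ⟨k', c', t', ab'⟩ := ev'
      simp only [skeleton, List.map_cons, List.cons.injEq, Prod.mk.injEq] at h
      obtain ⟨⟨rfl, rfl, rfl⟩, h2⟩ := h
      simp only [hullCuts, ih h2, cell_eq_of_skeleton (T := (a, es)) (T' := (a', es')) h2]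

variable (γ : Measure ℝ)

/-- The law of a list of events with i.i.d. mean parameters in place of the given ones. -/
noncomputable def resampleEvents : List (Event d) → Measure (List (Event d))
  | [] => Measure.dirac []
  | ev :: es => ((γ.prod γ).prod (resampleEvents es)).map fun p =>
      ((ev.1, ev.2.1, ev.2.2.1, p.1) : Event d) :: p.2

/-- The law of a tree with i.i.d. mean parameters in place of the given ones. -/
noncomputable def resample (T : Tree d) : Measure (Tree d) := γ.prod (resampleEvents γ T.2)

theorem measurable_consMeans (ev : Event d) : Measurable fun p : (ℝ × ℝ) × List (Event d) =>
    ((ev.1, ev.2.1, ev.2.2.1, p.1) : Event d) :: p.2 :=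
  measurable_cons.comp (f := fun p : (ℝ × ℝ) × List (Event d) =>
    (((ev.1, ev.2.1, ev.2.2.1, p.1) : Event d), p.2)) (by fun_prop)

variable [IsProbabilityMeasure γ]

instance isProbabilityMeasure_resampleEvents (es : List (Event d)) :
    IsProbabilityMeasure (resampleEvents γ es) := by
  induction es with
  | nil => rw [resampleEvents]; infer_instance
  | cons ev es ih =>
    rw [resampleEvents]
    exact Measure.isProbabilityMeasure_map (measurable_consMeans ev).aemeasurable

instance isProbabilityMeasure_resample (T : Tree d) : IsProbabilityMeasure (resample γ T) := by
  unfold resample; infer_instance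

theorem measurable_resampleEvents :
    Measurable (resampleEvents γ : List (Event d) → Measure (List (Event d))) := by
  refine measurable_of_ofFn fun n => ?_
  induction n with
  | zero => simp only [List.ofFn_zero]; exact measurable_const
  | succ n ih =>
    simp only [List.ofFn_succ, resampleEvents]
    have h1 : Measurable fun u : Fin (n + 1) → Event d =>
        resampleEvents γ (List.ofFn fun i => u i.succ) :=
      ih.comp (f := fun (u : Fin (n + 1) → Event d) (i : Fin n) => u i.succ)
        (measurable_pi_lambda _ fun i => measurable_pi_apply _)
    have h2 : Measurable fun u : Fin (n + 1) → Event d =>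
        (γ.prod γ).prod (resampleEvents γ (List.ofFn fun i => u i.succ)) :=
      measurable_prod_param measurable_const h1 (fun _ => inferInstance) fun _ => inferInstance
    refine measurable_map_param h2 (fun _ => prob_le_one)
      (f := fun q : (Fin (n + 1) → Event d) × ((ℝ × ℝ) × List (Event d)) =>
        (((q.1 0).1, (q.1 0).2.1, (q.1 0).2.2.1, q.2.1) : Event d) :: q.2.2) ?_
    exact measurable_cons.comp (f := fun q : (Fin (n + 1) → Event d) × ((ℝ × ℝ) × List (Event d)) =>
      ((((q.1 0).1, (q.1 0).2.1, (q.1 0).2.2.1, q.2.1) : Event d), q.2.2)) (by fun_prop)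

theorem measurable_resample : Measurable (resample γ : Tree d → Measure (Tree d)) :=
  measurable_prod_param measurable_const ((measurable_resampleEvents γ).comp measurable_snd)
    (fun _ => inferInstance) fun _ => inferInstance

theorem ae_resampleEvents_skeleton (es : List (Event d)) :
    ∀ᵐ es' ∂resampleEvents γ es, skeleton es' = skeleton es := by
  have hm : ∀ es : List (Event d), MeasurableSet {es' : List (Event d) | skeleton es' = skeleton es} :=
    fun es => measurable_skeleton (measurableSet_singleton (skeleton es))
  induction es with
  | nil => rw [resampleEvents, ae_dirac_iff (hm [])]
  | cons ev es ih =>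
    rw [resampleEvents, ae_map_iff (measurable_consMeans ev).aemeasurable (hm _)]
    have h := Measure.quasiMeasurePreserving_snd (μ := γ.prod γ) (ν := resampleEvents γ es)|>.ae ih
    filter_upwards [h] with p hp
    simp only [skeleton, List.map_cons, List.cons.injEq, true_and] at hp ⊢
    exact hp

theorem ae_resample_skeleton (T : Tree d) :
    ∀ᵐ T' ∂resample γ T, skeleton T'.2 = skeleton T.2 :=
  (Measure.quasiMeasurePreserving_snd (μ := γ) (ν := resampleEvents γ T.2)).ae
    (ae_resampleEvents_skeleton γ T.2)

theorem lintegral_resample_nextTree {f : Tree d → ℝ≥0∞} (hf : Measurable f) (T : Tree d)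
    (kc : ℕ × Cut d) (t : ℝ) (ab : ℝ × ℝ) :
    ∫⁻ T', f T' ∂resample γ (nextTree T kc t ab) =
      ∫⁻ T', ∫⁻ ab', f (nextTree T' kc t ab') ∂(γ.prod γ) ∂resample γ T := by
  have hn : Measurable fun p : Tree d × (ℝ × ℝ) => nextTree p.1 kc t p.2 :=
    measurable_nextTree.comp (f := fun p : Tree d × (ℝ × ℝ) => (p.1, kc, t, p.2)) (by fun_prop)
  have h2 : Measurable fun T' : Tree d => ∫⁻ ab', f (nextTree T' kc t ab') ∂(γ.prod γ) :=
    Measurable.lintegral_prod_right' (hf.comp hn)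
  rw [resample, resample, lintegral_prod _ hf.aemeasurable, lintegral_prod _ h2.aemeasurable]
  refine lintegral_congr fun a => ?_
  have h3 : Measurable fun es : List (Event d) => f (a, es) := hf.comp measurable_prodMk_left
  simp only [nextTree, resampleEvents]
  have h4 : Measurable fun p : (ℝ × ℝ) × List (Event d) =>
      ((kc.1, kc.2, t, p.1) : Event d) :: p.2 := measurable_consMeans (kc.1, kc.2, t, ab)
  rw [lintegral_map h3 h4]
  exact lintegral_prod_symm' _ (h3.comp h4)

attribute [local irreducible] cell dataIn rate cutLaw cutIntensity regions growExactly nextTree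
  resample

/-- Resampling commutes with a jump, because the intensity of cuts does not depend on the mean
parameters. -/
theorem lintegral_resample_jump (hP : IsPolyhedron P) {g : Tree d → ℝ≥0∞} (hg : Measurable g)
    (T : Tree d) (t : ℝ) :
    ∫⁻ T', jump s P x (fun _ => γ) g T' t ∂resample γ T =
      jump s P x (fun _ => γ) (fun T' => ∫⁻ T'', g T'' ∂resample γ T') T t := by
  have hfin : IsFiniteMeasure (cutIntensity s P x T) :=
    ⟨by rw [cutIntensity_univ x hP]; exact ENNReal.ofReal_lt_top⟩
  have h1 : ∀ᵐ T' ∂resample γ T, jump s P x (fun _ => γ) g T' t =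
      ∫⁻ kc, ∫⁻ ab, g (nextTree T' kc t ab) ∂(γ.prod γ) ∂cutIntensity s P x T := by
    filter_upwards [ae_resample_skeleton γ T] with T' hT'
    rw [jump, cutIntensity_eq_of_skeleton hT']
    rfl
  rw [lintegral_congr_ae h1, lintegral_lintegral_swap]
  · simp only [jump, lintegral_resample_nextTree γ hg]
    refine lintegral_congr fun kc => ?_
    simp [childLaw]
  · have hn : Measurable fun p : (Tree d × (ℕ × Cut d)) × (ℝ × ℝ) =>
        nextTree p.1.1 p.1.2 t p.2 := measurable_nextTree.comp
      (f := fun p : (Tree d × (ℕ × Cut d)) × (ℝ × ℝ) => (p.1.1, p.1.2, t, p.2)) (by fun_prop)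
    exact (Measurable.lintegral_prod_right' (hg.comp hn)).aemeasurable

/-- Resampling all mean parameters commutes with growing a tree. -/
theorem lintegral_resample_grow (hP : IsPolyhedron P) {f : Tree d → ℝ≥0∞} (hf : Measurable f)
    (hf1 : ∀ T, f T ≤ 1) {t₀ t₁ : ℝ} (ht : t₀ ≤ t₁) (T : Tree d) :
    ∫⁻ T', ∫⁻ T'', f T'' ∂grow s P x (fun _ => γ) T' t₀ t₁ ∂resample γ T =
      ∫⁻ T', ∫⁻ T'', f T'' ∂resample γ T' ∂grow s P x (fun _ => γ) T t₀ t₁ := by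
  have hγ : ∀ S : Finset (Fin N), IsProbabilityMeasure γ := fun _ => inferInstance
  have hw := measurable_lintegral_grow (x := x) (s := s) hP hγ hf t₁
  have hres : Measurable fun p : Tree d × ℝ => resample γ p.1 :=
    (measurable_resample γ).comp measurable_fst
  refine (lintegral_grow_unique hP hγ
    (f := fun T' => ∫⁻ T'', f T'' ∂resample γ T')
    (w := fun p : Tree d × ℝ =>
      ∫⁻ T', ∫⁻ T'', f T'' ∂grow s P x (fun _ => γ) T' p.2 t₁ ∂resample γ p.1)
    ((Measure.measurable_lintegral hf).comp (measurable_resample γ)) ?_ ?_ T ht).symm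
  · intro p
    calc _ ≤ ∫⁻ T', 1 ∂resample γ p.1 := by
          refine lintegral_mono fun T' => ?_
          have := isProbabilityMeasure_grow' (x := x) (s := s) hP hγ T' p.2 t₁
          calc _ ≤ ∫⁻ _, 1 ∂grow s P x (fun _ => γ) T' p.2 t₁ := lintegral_mono hf1
            _ = 1 := by simp
      _ = 1 := by simp
  · intro T t₀ ht
    have h1 : ∀ᵐ T' ∂resample γ T, ∫⁻ T'', f T'' ∂grow s P x (fun _ => γ) T' t₀ t₁ =
        ENNReal.ofReal (Real.exp (-(rate (regions s P x T) * (t₁ - t₀)))) * f T' +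
        ∫⁻ u in Set.Ioc 0 (t₁ - t₀), ENNReal.ofReal (Real.exp (-(rate (regions s P x T) * u))) *
          jump s P x (fun _ => γ)
            (fun T'' => ∫⁻ T''', f T''' ∂grow s P x (fun _ => γ) T'' (t₀ + u) t₁) T' (t₀ + u) := by
      filter_upwards [ae_resample_skeleton γ T] with T' hT'
      rw [lintegral_grow_eq_renewal hP hγ hf ht, renewal, rate_eq_of_skeleton hT']
    have hj : Measurable fun q : Tree d × ℝ =>
        ENNReal.ofReal (Real.exp (-(rate (regions s P x T) * q.2))) * jump s P x (fun _ => γ)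
          (fun T'' => ∫⁻ T''', f T''' ∂grow s P x (fun _ => γ) T'' (t₀ + q.2) t₁) q.1
            (t₀ + q.2) := by
      have h2 : Measurable fun q : Tree d × ℝ => jump s P x (fun _ => γ)
          (fun T'' => ∫⁻ T''', f T''' ∂grow s P x (fun _ => γ) T'' (t₀ + q.2) t₁) q.1
            (t₀ + q.2) :=
        (measurable_jump (x := x) (s := s) hP hγ hw).comp
          (f := fun q : Tree d × ℝ => (q.1, t₀ + q.2)) (by fun_prop)
      exact Measurable.mul (by fun_prop) h2
    simp only
    rw [lintegral_congr_ae h1, lintegral_add_left (hf.const_mul _), lintegral_const_mul _ hf,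
      renewal, lintegral_lintegral_swap hj.aemeasurable]
    congr 1
    refine lintegral_congr fun u => ?_
    have h3 : Measurable fun T' : Tree d =>
        ∫⁻ T'', f T'' ∂grow s P x (fun _ => γ) T' (t₀ + u) t₁ :=
      hw.comp (f := fun T' : Tree d => (T', t₀ + u)) measurable_prodMk_right
    have h4 : Measurable fun T' : Tree d => jump s P x (fun _ => γ)
          (fun T'' => ∫⁻ T''', f T''' ∂grow s P x (fun _ => γ) T'' (t₀ + u) t₁) T' (t₀ + u) :=
      (measurable_jump (x := x) (s := s) hP hγ (hw.comp
        (f := fun p : Tree d × ℝ => (p.1, t₀ + u)) (by fun_prop))).comp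
          (f := fun T' : Tree d => (T', t₀ + u)) measurable_prodMk_right
    rw [lintegral_const_mul _ h4, lintegral_resample_jump γ hP h3]

theorem measurable_growFrom (hP : IsPolyhedron P) {ν : Finset (Fin N) → Measure ℝ}
    (hν : ∀ S, IsProbabilityMeasure (ν S)) (t₀ t₁ : ℝ) :
    Measurable fun T : Tree d => grow s P x ν T t₀ t₁ :=
  (measurable_grow_right (x := x) (s := s) hP hν t₁).comp
    (f := fun T : Tree d => (T, t₀)) measurable_prodMk_right

theorem measurable_mkRoot : Measurable fun a : ℝ => ((a, []) : Tree d) := measurable_prodMk_right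

theorem lintegral_growRoot (hP : IsPolyhedron P) {ν : Finset (Fin N) → Measure ℝ}
    (hν : ∀ S, IsProbabilityMeasure (ν S)) {f : Tree d → ℝ≥0∞} (hf : Measurable f) (t₁ : ℝ) :
    ∫⁻ T, f T ∂growRoot s P x ν t₁ =
      ∫⁻ a, ∫⁻ T, f T ∂grow s P x ν (a, []) 0 t₁ ∂ν (dataIn x P) := by
  rw [growRoot]
  exact Measure.lintegral_bind ((measurable_growFrom hP hν 0 t₁).comp
    (f := fun a : ℝ => ((a, []) : Tree d)) measurable_mkRoot).aemeasurable hf.aemeasurable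

theorem isProbabilityMeasure_growRoot (hP : IsPolyhedron P) {ν : Finset (Fin N) → Measure ℝ}
    (hν : ∀ S, IsProbabilityMeasure (ν S)) (t₁ : ℝ) :
    IsProbabilityMeasure (growRoot s P x ν t₁) := by
  constructor
  have h : ∀ a : ℝ, grow s P x ν (a, []) 0 t₁ Set.univ = 1 := fun a =>
    (isProbabilityMeasure_grow' (x := x) (s := s) hP hν (a, []) 0 t₁).measure_univ
  have := lintegral_growRoot (x := x) (s := s) hP hν (f := fun _ => 1) measurable_const t₁
  simpa [h] using this

/-- The mean parameters can be sampled after the cuts. -/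
theorem lintegral_growRoot_const (hP : IsPolyhedron P) {f : Tree d → ℝ≥0∞} (hf : Measurable f)
    (hf1 : ∀ T, f T ≤ 1) {t₁ : ℝ} (ht : 0 ≤ t₁) :
    ∫⁻ T, f T ∂growRoot s P x (fun _ => γ) t₁ =
      ∫⁻ T, ∫⁻ T', f T' ∂resample γ T ∂grow s P x (fun _ => γ) (0, []) 0 t₁ := by
  have hγ : ∀ S : Finset (Fin N), IsProbabilityMeasure γ := fun _ => inferInstance
  rw [lintegral_growRoot hP hγ hf, ← lintegral_resample_grow γ hP hf hf1 ht]
  unfold resample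
  have hm : Measurable fun T : Tree d => ∫⁻ T', f T' ∂grow s P x (fun _ => γ) T 0 t₁ :=
    (measurable_lintegral_grow (x := x) (s := s) hP hγ hf t₁).comp
      (f := fun T : Tree d => (T, (0 : ℝ))) measurable_prodMk_right
  rw [lintegral_prod _ hm.aemeasurable]
  refine lintegral_congr fun a => ?_
  have h5 : Measurable fun es : List (Event d) =>
      ∫⁻ T', f T' ∂grow s P x (fun _ => γ) (a, es) 0 t₁ := hm.comp measurable_prodMk_left
  rw [resampleEvents, lintegral_dirac' _ h5]

end Resample

/-! ### Thinning of exponential clocks -/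

section Thinning

theorem lintegral_triangle {φ ψ : ℝ → ℝ≥0∞} (hφ : Measurable φ) (hψ : Measurable ψ) (s : ℝ) :
    ∫⁻ u in Set.Ioc 0 s, φ u * ∫⁻ w in Set.Ioc u s, ψ w =
      ∫⁻ w in Set.Ioc 0 s, (∫⁻ u in Set.Ioc 0 w, φ u) * ψ w := by
  have hm : MeasurableSet {q : ℝ × ℝ | q.1 < q.2} := measurableSet_lt measurable_fst measurable_snd
  have h1 : ∀ u ∈ Set.Ioc 0 s, φ u * ∫⁻ w in Set.Ioc u s, ψ w =
      ∫⁻ w in Set.Ioc 0 s, {q : ℝ × ℝ | q.1 < q.2}.indicator (fun q => φ q.1 * ψ q.2) (u, w) := by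
    intro u hu
    rw [← lintegral_const_mul _ hψ]
    have e : Set.Ioc u s = Set.Ioi u ∩ Set.Ioc 0 s := by
      ext w
      simp only [Set.mem_Ioc, Set.mem_inter_iff, Set.mem_Ioi]
      constructor
      · rintro ⟨h1, h2⟩
        exact ⟨h1, hu.1.trans h1, h2⟩
      · rintro ⟨h1, _, h2⟩
        exact ⟨h1, h2⟩
    rw [e, ← Measure.restrict_restrict measurableSet_Ioi, ← lintegral_indicator measurableSet_Ioi]
    rfl
  have h2 : ∀ w ∈ Set.Ioc 0 s, (∫⁻ u in Set.Ioc 0 w, φ u) * ψ w =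
      ∫⁻ u in Set.Ioc 0 s, {q : ℝ × ℝ | q.1 < q.2}.indicator (fun q => φ q.1 * ψ q.2) (u, w) := by
    intro w hw
    rw [← lintegral_mul_const _ hφ, ← setLIntegral_congr Ioo_ae_eq_Ioc]
    have e : Set.Ioo 0 w = Set.Iio w ∩ Set.Ioc 0 s := by
      ext u
      simp only [Set.mem_Ioo, Set.mem_inter_iff, Set.mem_Iio, Set.mem_Ioc]
      constructor
      · rintro ⟨h1, h2⟩
        exact ⟨h2, h1, h2.le.trans hw.2⟩
      · rintro ⟨h1, h2, _⟩
        exact ⟨h2, h1⟩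
    rw [e, ← Measure.restrict_restrict measurableSet_Iio, ← lintegral_indicator measurableSet_Iio]
    rfl
  rw [setLIntegral_congr_fun measurableSet_Ioc h1, setLIntegral_congr_fun measurableSet_Ioc h2]
  refine lintegral_lintegral_swap (Measurable.aemeasurable ?_)
  exact Measurable.indicator (by fun_prop) hm

/-- If a clock of rate `ρ` is refreshed by the ticks of a further clock of rate `κ` at which nothing
changes, the renewal equation of the clock of rate `ρ` turns into that of the joint clock. -/
theorem renewal_thinning {ρ κ s : ℝ} (hκ : 0 ≤ κ) (hs : 0 ≤ s) (a : ℝ≥0∞) {g : ℝ → ℝ≥0∞}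
    (hg : Measurable g) {v : ℝ → ℝ≥0∞}
    (h : ∀ u, u ≤ s → v u = ENNReal.ofReal (Real.exp (-(ρ * (s - u)))) * a +
      ∫⁻ w in Set.Ioc 0 (s - u), ENNReal.ofReal (Real.exp (-(ρ * w))) * g (u + w)) :
    v 0 = ENNReal.ofReal (Real.exp (-((ρ + κ) * s))) * a +
      ∫⁻ u in Set.Ioc 0 s, ENNReal.ofReal (Real.exp (-((ρ + κ) * u))) *
        (g u + ENNReal.ofReal κ * v u) := by
  set E : ℝ → ℝ → ℝ≥0∞ := fun c u => ENNReal.ofReal (Real.exp (-(c * u))) with hE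
  have hEm : ∀ c, Measurable (E c) := fun c => by simp only [hE]; fun_prop
  have hEadd : ∀ u, E (ρ + κ) u = E κ u * E ρ u := by
    intro u
    simp only [hE]
    rw [← ENNReal.ofReal_mul (Real.exp_nonneg _), ← Real.exp_add]
    congr 2; ring
  have hEsub : ∀ u w, E ρ u * E ρ (w - u) = E ρ w := by
    intro u w
    simp only [hE]
    rw [← ENNReal.ofReal_mul (Real.exp_nonneg _), ← Real.exp_add]
    congr 2; ring
  have hone : ∀ w, 0 ≤ w → E κ w + ∫⁻ u in Set.Ioc 0 w, E κ u * ENNReal.ofReal κ = 1 :=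
    fun w hw => lintegral_Ioc_exp hκ hw
  have hv' : ∀ u ∈ Set.Ioc 0 s, E (ρ + κ) u * (ENNReal.ofReal κ * v u) =
      (E κ u * ENNReal.ofReal κ) * (E ρ s * a) +
        (E κ u * ENNReal.ofReal κ) * ∫⁻ w in Set.Ioc u s, E ρ w * g w := by
    intro u hu
    have h1 : E ρ u * ∫⁻ w in Set.Ioc 0 (s - u), E ρ w * g (u + w) =
        ∫⁻ w in Set.Ioc u s, E ρ w * g w := by
      have h3 : Measurable fun w => E ρ w * g (u + w) :=
        (hEm ρ).mul (hg.comp (measurable_const_add u))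
      rw [← lintegral_const_mul _ h3]
      have h2 : ∀ w, E ρ u * (E ρ w * g (u + w)) = E ρ (u + w) * g (u + w) := by
        intro w
        rw [← mul_assoc]
        have := hEsub u (u + w)
        rw [add_sub_cancel_left] at this
        rw [this]
      simp only [h2]
      rw [setLIntegral_Ioc_add (h := fun w => E ρ w * g w) u (s - u), add_sub_cancel]
    rw [h u hu.2, ← h1, ← hEsub u s, hEadd]
    ring
  have m1 : Measurable fun u => E κ u * ENNReal.ofReal κ := (hEm κ).mul_const _
  have m2 : Measurable fun u => E ρ u * g u := (hEm ρ).mul hg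
  have m3 : Measurable fun u => E κ u * (E ρ u * g u) := (hEm κ).mul m2
  calc v 0 = E ρ s * a + ∫⁻ w in Set.Ioc 0 s, E ρ w * g w := by
        have := h 0 hs
        simpa using this
    _ = (E κ s + ∫⁻ u in Set.Ioc 0 s, E κ u * ENNReal.ofReal κ) * (E ρ s * a) +
        ∫⁻ w in Set.Ioc 0 s, (E κ w + ∫⁻ u in Set.Ioc 0 w, E κ u * ENNReal.ofReal κ) *
          (E ρ w * g w) := by
        rw [hone s hs, one_mul]
        congr 1
        refine setLIntegral_congr_fun measurableSet_Ioc fun w hw => ?_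
        simp only [hone w hw.1.le, one_mul]
    _ = E κ s * (E ρ s * a) + (∫⁻ u in Set.Ioc 0 s, (E κ u * ENNReal.ofReal κ) * (E ρ s * a)) +
        ((∫⁻ w in Set.Ioc 0 s, E κ w * (E ρ w * g w)) +
          ∫⁻ w in Set.Ioc 0 s, (∫⁻ u in Set.Ioc 0 w, E κ u * ENNReal.ofReal κ) *
            (E ρ w * g w)) := by
        rw [add_mul, lintegral_mul_const _ m1, ← lintegral_add_left m3]
        simp only [add_mul]
    _ = E κ s * (E ρ s * a) + ((∫⁻ w in Set.Ioc 0 s, E κ w * (E ρ w * g w)) +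
          ∫⁻ u in Set.Ioc 0 s, ((E κ u * ENNReal.ofReal κ) * (E ρ s * a) +
          (E κ u * ENNReal.ofReal κ) * ∫⁻ w in Set.Ioc u s, E ρ w * g w)) := by
        rw [← lintegral_triangle m1 m2, lintegral_add_left (m1.mul_const _)]
        ring
    _ = E κ s * (E ρ s * a) + ∫⁻ u in Set.Ioc 0 s, E (ρ + κ) u * (g u + ENNReal.ofReal κ * v u) := by
        rw [← setLIntegral_congr_fun measurableSet_Ioc hv',
          ← lintegral_add_left m3]
        simp only [mul_add, hEadd, mul_assoc]
    _ = E (ρ + κ) s * a + ∫⁻ u in Set.Ioc 0 s, E (ρ + κ) u * (g u + ENNReal.ofReal κ * v u) := by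
        rw [hEadd s, mul_assoc]

end Thinning

/-! ### The blocks of data of a tree -/

section Blocks

variable {d N : ℕ} {P : Set (Pt d)} {x : Fin N → Pt d} {s : Scheme}

open scoped Classical in
/-- The indices of the data in the leaf that contains the `i`-th data point; empty if that point
lies in no leaf. -/
noncomputable def blocks (P : Set (Pt d)) (x : Fin N → Pt d) (T : Tree d) (i : Fin N) :
    Finset (Fin N) := {j | ∃ k, x i ∈ cell P T k ∧ x j ∈ cell P T k}

open scoped Classical in
/-- The indices of the data with indices in `S` below a cut. -/
noncomputable def sideBelow (x : Fin N → Pt d) (S : Finset (Fin N)) (c : Cut d) : Finset (Fin N) :=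
  S.filter fun j => x j ∈ c.below

open scoped Classical in
/-- The indices of the data with indices in `S` above a cut. -/
noncomputable def sideAbove (x : Fin N → Pt d) (S : Finset (Fin N)) (c : Cut d) : Finset (Fin N) :=
  S.filter fun j => x j ∈ c.above

open scoped Classical in
/-- The effect of a cut of the block `S` on something that is attached to the data points: `p` below
the cut, `q` above it, `z` on it, and no change outside the block. -/
noncomputable def onSides {α : Type*} (x : Fin N → Pt d) (S : Finset (Fin N)) (c : Cut d)
    (p q z : α) (b : Fin N → α) (i : Fin N) : α :=
  if i ∈ S then if x i ∈ c.below then p else if x i ∈ c.above then q else z else b i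

theorem notMem_above_of_below {c : Cut d} {z : Pt d} (h : z ∈ c.below) : z ∉ c.above :=
  fun h' => lt_asymm (show c.form z < c.2.2 from h) h'

theorem cell_unique {T : Tree d} {k k' : ℕ} {z : Pt d} (h : z ∈ cell P T k)
    (h' : z ∈ cell P T k') : k = k' := by
  rw [cell_eq_cellOf] at h h'
  exact cellOf_unique h h'

theorem dataIn_below (C : Set (Pt d)) (c : Cut d) :
    dataIn x (C ∩ c.below) = sideBelow x (dataIn x C) c := by
  ext i; simp [mem_dataIn, sideBelow]

theorem dataIn_above (C : Set (Pt d)) (c : Cut d) :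
    dataIn x (C ∩ c.above) = sideAbove x (dataIn x C) c := by
  ext i; simp [mem_dataIn, sideAbove]

theorem blocks_of_mem {T : Tree d} {k : ℕ} {i : Fin N} (h : x i ∈ cell P T k) :
    blocks P x T i = dataIn x (cell P T k) := by
  classical
  ext j
  simp only [blocks, Finset.mem_filter, Finset.mem_univ, true_and, mem_dataIn]
  constructor
  · rintro ⟨k', h1, h2⟩
    rwa [cell_unique h h1]
  · exact fun hj => ⟨k, h, hj⟩

theorem blocks_of_notMem {T : Tree d} {i : Fin N} (h : ∀ k, x i ∉ cell P T k) :
    blocks P x T i = ∅ := by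
  classical
  ext j
  simp [blocks, h]

theorem cell_nextTree (T : Tree d) (kc : ℕ × Cut d) (t : ℝ) (ab : ℝ × ℝ) (k : ℕ) :
    cell P (nextTree T kc t ab) k = if kc.1 < numLeaves T.2 then
      (if k = kc.1 then cell P T kc.1 ∩ kc.2.below
      else if k = numLeaves T.2 then cell P T kc.1 ∩ kc.2.above
      else cell P T k) else cell P T k := cell_cons T.1 _ T.2 k

theorem leafMean_nextTree (T : Tree d) (kc : ℕ × Cut d) (t : ℝ) (ab : ℝ × ℝ) (k : ℕ) :
    leafMean P (nextTree T kc t ab) k = if kc.1 < numLeaves T.2 then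
      (if k = kc.1 then ab.1 else if k = numLeaves T.2 then ab.2 else leafMean P T k)
      else leafMean P T k := leafMean_cons T.1 _ T.2 k

/-- Where a data point is after a cut. -/
theorem mem_cell_nextTree_cases (T : Tree d) (kc : ℕ × Cut d) (t : ℝ) (ab : ℝ × ℝ) (i : Fin N) :
    (i ∈ dataIn x (cell P T kc.1) ∧ x i ∈ kc.2.below ∧
      ∃ k, x i ∈ cell P (nextTree T kc t ab) k ∧
        cell P (nextTree T kc t ab) k = cell P T kc.1 ∩ kc.2.below ∧
        leafMean P (nextTree T kc t ab) k = ab.1) ∨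
    (i ∈ dataIn x (cell P T kc.1) ∧ x i ∉ kc.2.below ∧ x i ∈ kc.2.above ∧
      ∃ k, x i ∈ cell P (nextTree T kc t ab) k ∧
        cell P (nextTree T kc t ab) k = cell P T kc.1 ∩ kc.2.above ∧
        leafMean P (nextTree T kc t ab) k = ab.2) ∨
    (i ∈ dataIn x (cell P T kc.1) ∧ x i ∉ kc.2.below ∧ x i ∉ kc.2.above ∧
      ∀ k, x i ∉ cell P (nextTree T kc t ab) k) ∨
    (i ∉ dataIn x (cell P T kc.1) ∧ ∃ k, x i ∈ cell P (nextTree T kc t ab) k ∧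
        x i ∈ cell P T k ∧ cell P (nextTree T kc t ab) k = cell P T k ∧
        leafMean P (nextTree T kc t ab) k = leafMean P T k) ∨
    (i ∉ dataIn x (cell P T kc.1) ∧ (∀ k, x i ∉ cell P (nextTree T kc t ab) k) ∧
      ∀ k, x i ∉ cell P T k) := by
  rw [mem_dataIn]
  by_cases hi : x i ∈ cell P T kc.1
  · have hlt := lt_numLeaves_of_mem hi
    by_cases hb : x i ∈ kc.2.below
    · have e : cell P (nextTree T kc t ab) kc.1 = cell P T kc.1 ∩ kc.2.below := by
        rw [cell_nextTree, if_pos hlt, if_pos rfl]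
      refine Or.inl ⟨hi, hb, kc.1, ?_, e, ?_⟩
      · rw [e]; exact ⟨hi, hb⟩
      · rw [leafMean_nextTree, if_pos hlt, if_pos rfl]
    · by_cases ha : x i ∈ kc.2.above
      · have e : cell P (nextTree T kc t ab) (numLeaves T.2) = cell P T kc.1 ∩ kc.2.above := by
          rw [cell_nextTree, if_pos hlt, if_neg hlt.ne', if_pos rfl]
        refine Or.inr (Or.inl ⟨hi, hb, ha, numLeaves T.2, ?_, e, ?_⟩)
        · rw [e]; exact ⟨hi, ha⟩
        · rw [leafMean_nextTree, if_pos hlt, if_neg hlt.ne', if_pos rfl]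
      · refine Or.inr (Or.inr (Or.inl ⟨hi, hb, ha, fun k hk => ?_⟩))
        rw [cell_nextTree, if_pos hlt] at hk
        split_ifs at hk with h1 h2
        · exact hb hk.2
        · exact ha hk.2
        · exact h1 (cell_unique hk hi)
  · by_cases hk : ∃ k, x i ∈ cell P T k
    · obtain ⟨k, hk⟩ := hk
      have h1 : k ≠ kc.1 := by rintro rfl; exact hi hk
      have h2 : k ≠ numLeaves T.2 := (lt_numLeaves_of_mem hk).ne
      have e : cell P (nextTree T kc t ab) k = cell P T k := by
        rw [cell_nextTree, if_neg h1, if_neg h2, ite_self]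
      refine Or.inr (Or.inr (Or.inr (Or.inl ⟨hi, k, by rwa [e], hk, e, ?_⟩)))
      rw [leafMean_nextTree, if_neg h1, if_neg h2, ite_self]
    · push Not at hk
      refine Or.inr (Or.inr (Or.inr (Or.inr ⟨hi, fun k hk' => ?_, hk⟩)))
      rw [cell_nextTree] at hk'
      split_ifs at hk' with _ h1 h2
      · exact hi hk'.1
      · exact hi hk'.1
      · exact hk k hk'
      · exact hk k hk'

theorem blocks_nextTree (T : Tree d) (kc : ℕ × Cut d) (t : ℝ) (ab : ℝ × ℝ) :
    blocks P x (nextTree T kc t ab) = onSides x (dataIn x (cell P T kc.1)) kc.2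
      (sideBelow x (dataIn x (cell P T kc.1)) kc.2)
      (sideAbove x (dataIn x (cell P T kc.1)) kc.2) ∅ (blocks P x T) := by
  funext i
  unfold onSides
  rcases mem_cell_nextTree_cases (x := x) T kc t ab i with ⟨h1, h2, k, h3, h4, -⟩ |
    ⟨h1, h2, h3, k, h4, h5, -⟩ | ⟨h1, h2, h3, h4⟩ | ⟨h1, k, h2, h3, h4, -⟩ | ⟨h1, h2, h3⟩
  · rw [if_pos h1, if_pos h2, blocks_of_mem h3, h4, dataIn_below]
  · rw [if_pos h1, if_neg h2, if_pos h3, blocks_of_mem h4, h5, dataIn_above]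
  · rw [if_pos h1, if_neg h2, if_neg h3, blocks_of_notMem h4]
  · rw [if_neg h1, blocks_of_mem h2, blocks_of_mem h3, h4]
  · rw [if_neg h1, blocks_of_notMem h2, blocks_of_notMem h3]

theorem treeValue_nextTree (T : Tree d) (kc : ℕ × Cut d) (t : ℝ) (ab : ℝ × ℝ) :
    (fun i => treeValue P (nextTree T kc t ab) (x i)) =
      onSides x (dataIn x (cell P T kc.1)) kc.2 ab.1 ab.2 0 fun i => treeValue P T (x i) := by
  funext i
  unfold onSides
  rcases mem_cell_nextTree_cases (x := x) T kc t ab i with ⟨h1, h2, k, h3, -, h4⟩ |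
    ⟨h1, h2, h3, k, h4, -, h5⟩ | ⟨h1, h2, h3, h4⟩ | ⟨h1, k, h2, h3, -, h4⟩ | ⟨h1, h2, h3⟩
  · rw [if_pos h1, if_pos h2, treeValue_of_mem h3, h4]
  · rw [if_pos h1, if_neg h2, if_pos h3, treeValue_of_mem h4, h5]
  · rw [if_pos h1, if_neg h2, if_neg h3, treeValue_of_notMem h4]
  · rw [if_neg h1, treeValue_of_mem h2, h4]
    exact (treeValue_of_mem h3).symm
  · rw [if_neg h1, treeValue_of_notMem h2]
    exact (treeValue_of_notMem h3).symm

theorem notMem_of_mem_blocks {T : Tree d} {k : ℕ} {i j : Fin N}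
    (hi : i ∉ dataIn x (cell P T k)) (hj : j ∈ blocks P x T i) : j ∉ dataIn x (cell P T k) := by
  classical
  simp only [blocks, Finset.mem_filter, Finset.mem_univ, true_and, mem_dataIn] at hi hj ⊢
  obtain ⟨k', h1, h2⟩ := hj
  intro h
  exact hi (cell_unique h2 h ▸ h1)

/-- The values of the data points, if the value of each block is `b` at its first element. -/
noncomputable def blockValues (β : Fin N → Finset (Fin N)) (b : Fin N → ℝ) (i : Fin N) : ℝ :=
  if h : (β i).Nonempty then b ((β i).min' h) else 0

/-- The vector `b` with the value `a` at the first element of `S`. -/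
noncomputable def updateMin (S : Finset (Fin N)) (b : Fin N → ℝ) (a : ℝ) : Fin N → ℝ :=
  if h : S.Nonempty then Function.update b (S.min' h) a else b

theorem updateMin_of_notMem {S : Finset (Fin N)} {b : Fin N → ℝ} {a : ℝ} {j : Fin N} (h : j ∉ S) :
    updateMin S b a j = b j := by
  unfold updateMin
  split_ifs with hS
  · refine Function.update_of_ne ?_ _ _
    rintro rfl
    exact h (S.min'_mem hS)
  · rfl

theorem updateMin_min' {S : Finset (Fin N)} {b : Fin N → ℝ} {a : ℝ} (h : S.Nonempty) :
    updateMin S b a (S.min' h) = a := by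
  rw [updateMin, dif_pos h, Function.update_self]

theorem onSides_blockValues (T : Tree d) (kc : ℕ × Cut d) (t : ℝ) (ab ab' : ℝ × ℝ)
    (b : Fin N → ℝ) :
    onSides x (dataIn x (cell P T kc.1)) kc.2 ab.1 ab.2 0 (blockValues (blocks P x T) b) =
      blockValues (blocks P x (nextTree T kc t ab'))
        (updateMin (sideAbove x (dataIn x (cell P T kc.1)) kc.2)
          (updateMin (sideBelow x (dataIn x (cell P T kc.1)) kc.2) b ab.1) ab.2) := by
  classical
  set S := dataIn x (cell P T kc.1) with hS
  funext i
  rw [blocks_nextTree, ← hS]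
  unfold blockValues
  have hb : ∀ j ∈ sideBelow x S kc.2, j ∈ S ∧ x j ∈ kc.2.below := fun j hj =>
    Finset.mem_filter.1 hj
  have ha : ∀ j ∈ sideAbove x S kc.2, j ∈ S ∧ x j ∈ kc.2.above := fun j hj =>
    Finset.mem_filter.1 hj
  by_cases h1 : i ∈ S
  · by_cases h2 : x i ∈ kc.2.below
    · have hne : (sideBelow x S kc.2).Nonempty := ⟨i, Finset.mem_filter.2 ⟨h1, h2⟩⟩
      simp only [onSides, if_pos h1, if_pos h2, dif_pos hne]
      rw [updateMin_of_notMem, updateMin_min']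
      intro h
      exact notMem_above_of_below (hb _ (Finset.min'_mem _ hne)).2 (ha _ h).2
    · by_cases h3 : x i ∈ kc.2.above
      · have hne : (sideAbove x S kc.2).Nonempty := ⟨i, Finset.mem_filter.2 ⟨h1, h3⟩⟩
        simp only [onSides, if_pos h1, if_neg h2, if_pos h3, dif_pos hne]
        rw [updateMin_min']
      · simp [onSides, h1, h2, h3]
  · simp only [onSides, if_neg h1]
    by_cases hne : (blocks P x T i).Nonempty
    · rw [dif_pos hne, dif_pos hne]
      have h4 : (blocks P x T i).min' hne ∉ S := notMem_of_mem_blocks h1 (Finset.min'_mem _ hne)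
      rw [updateMin_of_notMem fun h => h4 (ha _ h).1, updateMin_of_notMem fun h => h4 (hb _ h).1]
    · rw [dif_neg hne, dif_neg hne]

variable (γ : Measure ℝ) [IsProbabilityMeasure γ]

theorem measurable_updateMin (S : Finset (Fin N)) :
    Measurable fun p : (Fin N → ℝ) × ℝ => updateMin S p.1 p.2 := by
  unfold updateMin
  split_ifs with h
  · refine measurable_pi_lambda _ fun i => ?_
    by_cases hi : i = S.min' h
    · subst hi; simpa using measurable_snd
    · simp only [Function.update_of_ne hi]
      fun_prop
  · exact measurable_fst

theorem lintegral_updateMin (S : Finset (Fin N)) {G : (Fin N → ℝ) → ℝ≥0∞} (hG : Measurable G) :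
    ∫⁻ b, ∫⁻ a, G (updateMin S b a) ∂γ ∂(Measure.pi fun _ : Fin N => γ) =
      ∫⁻ b, G b ∂(Measure.pi fun _ : Fin N => γ) := by
  have hm := hG.comp (measurable_updateMin S)
  by_cases h : S.Nonempty
  · have h1 : ∀ p : (Fin N → ℝ) × ℝ, updateMin S p.1 p.2 =
        Function.update p.1 (S.min' h) p.2 := fun p => dif_pos h
    conv_rhs => rw [← map_update_pi (fun _ : Fin N => γ) (S.min' h)]
    rw [← lintegral_prod (fun p : (Fin N → ℝ) × ℝ => G (updateMin S p.1 p.2)) hm.aemeasurable]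
    have hu := measurable_updateMin S
    simp only [h1] at hu ⊢
    rw [lintegral_map hG hu]
  · have h1 : ∀ b a, updateMin S b a = b := fun b a => dif_neg h
    simp [h1]

theorem measurable_onSides (S : Finset (Fin N)) (c : Cut d) :
    Measurable fun p : (Fin N → ℝ) × (ℝ × ℝ) => onSides x S c p.2.1 p.2.2 0 p.1 := by
  refine measurable_pi_lambda _ fun i => ?_
  unfold onSides
  split_ifs <;> fun_prop

theorem measurable_blockValues (β : Fin N → Finset (Fin N)) : Measurable (blockValues β) := by
  refine measurable_pi_lambda _ fun i => ?_
  unfold blockValues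
  split_ifs <;> fun_prop

theorem treeValue_root (a : ℝ) (z : Pt d) [Decidable (z ∈ P)] :
    treeValue P (a, []) z = if z ∈ P then a else 0 := by
  split_ifs with h
  · rw [treeValue_of_mem (k := 0) (by rw [cell_nil, if_pos rfl]; exact h), leafMean_nil, if_pos rfl]
  · refine treeValue_of_notMem fun k hk => h ?_
    rw [cell_nil] at hk
    split_ifs at hk
    · exact hk
    · exact absurd hk (Set.notMem_empty _)

attribute [local irreducible] cell dataIn nextTree treeValue resample

theorem measurable_values : Measurable fun (T : Tree d) (i : Fin N) => treeValue P T (x i) :=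
  measurable_pi_lambda _ fun i => measurable_treeValue (x i)

/-- Under i.i.d. mean parameters, the values of different blocks are i.i.d. -/
theorem lintegral_resample_values {h : (Fin N → ℝ) → ℝ≥0∞} (hh : Measurable h) (T : Tree d) :
    ∫⁻ T', h (fun i => treeValue P T' (x i)) ∂resample γ T =
      ∫⁻ b, h (blockValues (blocks P x T) b) ∂(Measure.pi fun _ : Fin N => γ) := by
  classical
  obtain ⟨a₀, es⟩ := T
  induction es generalizing h with
  | nil =>
    have hm : Measurable fun T' : Tree d => h fun i => treeValue P T' (x i) :=
      hh.comp measurable_values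
    have hm2 : ∀ a, Measurable fun es : List (Event d) => h fun i => treeValue P (a, es) (x i) :=
      fun a => hm.comp (f := fun es : List (Event d) => ((a, es) : Tree d)) measurable_prodMk_left
    unfold resample
    rw [lintegral_prod _ hm.aemeasurable]
    have e1 : ∀ a, ∫⁻ es, h (fun i => treeValue P (a, es) (x i))
        ∂resampleEvents γ ([] : List (Event d)) = h fun i => if x i ∈ P then a else 0 := by
      intro a
      rw [resampleEvents, lintegral_dirac' _ (hm2 a)]
      simp only [treeValue_root]
    simp only [e1]
    have e2 : ∀ i, x i ∈ P → blocks P x (a₀, []) i = dataIn x P := by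
      intro i hi
      have : x i ∈ cell P ((a₀, []) : Tree d) 0 := by rwa [cell_nil, if_pos rfl]
      rw [blocks_of_mem this, cell_nil, if_pos rfl]
    have e3 : ∀ i, x i ∉ P → blocks P x (a₀, []) i = ∅ := by
      refine fun i hi => blocks_of_notMem fun k hk => hi ?_
      rw [cell_nil] at hk
      split_ifs at hk
      · exact hk
      · exact absurd hk (Set.notMem_empty _)
    have hm3 : Measurable fun a : ℝ => h fun i => if x i ∈ P then a else 0 := by
      refine hh.comp (f := fun (a : ℝ) (i : Fin N) => if x i ∈ P then a else 0)
        (measurable_pi_lambda _ fun i => ?_)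
      split_ifs <;> fun_prop
    by_cases hD : (dataIn x P).Nonempty
    · have hmp := measurePreserving_eval (fun _ : Fin N => γ) ((dataIn x P).min' hD)
      rw [← hmp.lintegral_comp hm3]
      refine lintegral_congr fun b => ?_
      congr 1
      funext i
      unfold blockValues
      by_cases hi : x i ∈ P
      · simp only [e2 i hi, dif_pos hD, if_pos hi, Function.eval]
      · simp [e3 i hi, hi]
    · have h0 : ∀ i, x i ∉ P := fun i hi => hD ⟨i, (mem_dataIn x P i).2 hi⟩
      have e4 : ∀ b, blockValues (blocks P x (a₀, [])) b = fun _ => 0 := by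
        intro b
        funext i
        simp [blockValues, e3 i (h0 i)]
      simp only [e4, h0, if_false]
      simp
  | cons ev es ih =>
    set kc : ℕ × Cut d := (ev.1, ev.2.1)
    set S := dataIn x (cell P ((a₀, es) : Tree d) kc.1) with hS
    have hev : ((a₀, ev :: es) : Tree d) = nextTree (a₀, es) kc ev.2.2.1 ev.2.2.2 := by
      unfold nextTree; rfl
    have hm : Measurable fun T' : Tree d => h fun i => treeValue P T' (x i) :=
      hh.comp measurable_values
    have hm2 : Measurable fun p : (Fin N → ℝ) × (ℝ × ℝ) =>
        h (onSides x S kc.2 p.2.1 p.2.2 0 p.1) := hh.comp (measurable_onSides S kc.2)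
    rw [hev, lintegral_resample_nextTree γ hm]
    have h1 : ∀ᵐ T' ∂resample γ ((a₀, es) : Tree d),
        ∫⁻ ab', h (fun i => treeValue P (nextTree T' kc ev.2.2.1 ab') (x i)) ∂(γ.prod γ) =
        ∫⁻ ab', h (onSides x S kc.2 ab'.1 ab'.2 0 fun i => treeValue P T' (x i)) ∂(γ.prod γ) := by
      filter_upwards [ae_resample_skeleton γ ((a₀, es) : Tree d)] with T' hT'
      refine lintegral_congr fun ab' => ?_
      rw [treeValue_nextTree, cell_eq_of_skeleton (T' := (a₀, es)) hT', hS]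
    rw [lintegral_congr_ae h1, ih (h := fun b => ∫⁻ ab', h (onSides x S kc.2 ab'.1 ab'.2 0 b)
      ∂(γ.prod γ)) (Measurable.lintegral_prod_right' hm2)]
    set B := sideBelow x S kc.2
    set A := sideAbove x S kc.2
    set H : (Fin N → ℝ) → ℝ≥0∞ := fun b =>
      h (blockValues (blocks P x (nextTree (a₀, es) kc ev.2.2.1 ev.2.2.2)) b) with hH
    have hHm : Measurable H := hh.comp (measurable_blockValues _)
    have h2 : ∀ b, ∫⁻ ab', h (onSides x S kc.2 ab'.1 ab'.2 0
        (blockValues (blocks P x ((a₀, es) : Tree d)) b)) ∂(γ.prod γ) =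
        ∫⁻ a, ∫⁻ a', H (updateMin A (updateMin B b a) a') ∂γ ∂γ := by
      intro b
      have h3 : ∀ ab' : ℝ × ℝ, h (onSides x S kc.2 ab'.1 ab'.2 0
          (blockValues (blocks P x ((a₀, es) : Tree d)) b)) =
          H (updateMin A (updateMin B b ab'.1) ab'.2) := by
        intro ab'
        rw [hH, hS, onSides_blockValues (a₀, es) kc ev.2.2.1 ab' ev.2.2.2]
      simp only [h3]
      refine lintegral_prod (fun ab' : ℝ × ℝ => H (updateMin A (updateMin B b ab'.1) ab'.2))
        (Measurable.aemeasurable ?_)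
      have h4 : Measurable fun ab' : ℝ × ℝ => updateMin B b ab'.1 :=
        (measurable_updateMin B).comp (f := fun ab' : ℝ × ℝ => (b, ab'.1)) (by fun_prop)
      exact hHm.comp ((measurable_updateMin A).comp (h4.prodMk measurable_snd))
    simp only [h2]
    have h5 : Measurable fun b : Fin N → ℝ => ∫⁻ a', H (updateMin A b a') ∂γ :=
      Measurable.lintegral_prod_right' (hHm.comp (measurable_updateMin A))
    rw [lintegral_updateMin γ B h5, lintegral_updateMin γ A hHm]

end Blocks

/-! ### The two schemes agree on the hulls -/

section Restriction

variable {d N : ℕ} {P : Set (Pt d)} {x : Fin N → Pt d} {s : Scheme}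

/-- The part of the state of a tree on which the growth in the hull scheme depends: the cuts that
meet the hulls, and the blocks of data. -/
noncomputable def hullState (P : Set (Pt d)) (x : Fin N → Pt d) (T : Tree d) :
    List (Finset (Fin N) × Cut d × ℝ) × (Fin N → Finset (Fin N)) :=
  (hullCuts P x T.1 T.2, blocks P x T)

/-- Sums over the leaves that contain data are sums over the blocks. -/
theorem tsum_eq_of_blocks {T T' : Tree d} (h : blocks P x T = blocks P x T') {J J' : ℕ → ℝ≥0∞}
    (hJ : ∀ k, dataIn x (cell P T k) = ∅ → J k = 0)
    (hJ' : ∀ k, dataIn x (cell P T' k) = ∅ → J' k = 0)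
    (hJJ : ∀ k k', dataIn x (cell P T k) = dataIn x (cell P T' k') → J k = J' k') :
    ∑' k, J k = ∑' k, J' k := by
  have key : ∀ {T T' : Tree d}, blocks P x T = blocks P x T' → ∀ k,
      dataIn x (cell P T k) ≠ ∅ → ∃ k', dataIn x (cell P T k) = dataIn x (cell P T' k') := by
    intro T T' h k hk
    obtain ⟨i, hi⟩ := Finset.nonempty_iff_ne_empty.2 hk
    have h1 := blocks_of_mem ((mem_dataIn x _ i).1 hi)
    by_cases h2 : ∃ k', x i ∈ cell P T' k'
    · obtain ⟨k', hk'⟩ := h2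
      exact ⟨k', by rw [← h1, h, blocks_of_mem hk']⟩
    · push Not at h2
      rw [h, blocks_of_notMem h2] at h1
      exact absurd h1.symm hk
  have hne : ∀ k : Function.support J', dataIn x (cell P T' k) ≠ ∅ := fun k h0 => k.2 (hJ' k h0)
  choose i hi using fun k : Function.support J' => key h.symm k (hne k)
  refine tsum_eq_tsum_of_ne_zero_bij i ?_ ?_ ?_
  · intro k k' hkk
    obtain ⟨j, hj⟩ := Finset.nonempty_iff_ne_empty.2 (hne k)
    have h1 : j ∈ dataIn x (cell P T' k') := by rw [hi k', ← hkk, ← hi k]; exact hj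
    exact Subtype.ext (cell_unique ((mem_dataIn x _ j).1 hj) ((mem_dataIn x _ j).1 h1))
  · intro k hk
    have hk1 : dataIn x (cell P T k) ≠ ∅ := fun h0 => hk (hJ k h0)
    obtain ⟨k', hk'⟩ := key h k hk1
    have hsup : k' ∈ Function.support J' := by
      rw [Function.mem_support, ← hJJ k k' hk']
      exact hk
    refine ⟨⟨k', hsup⟩, ?_⟩
    obtain ⟨j, hj⟩ := Finset.nonempty_iff_ne_empty.2 hk1
    have h1 : j ∈ dataIn x (cell P T (i ⟨k', hsup⟩)) := by rw [← hi, ← hk']; exact hj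
    exact cell_unique ((mem_dataIn x _ j).1 h1) ((mem_dataIn x _ j).1 hj)
  · intro k
    exact hJJ _ _ (hi k).symm

theorem hullOf_empty : hullOf x ∅ = ∅ := by simp [hullOf]

theorem hullState_nextTree_congr {T T' : Tree d} (h : hullState P x T = hullState P x T')
    {kc kc' : ℕ × Cut d} (hk : dataIn x (cell P T kc.1) = dataIn x (cell P T' kc'.1))
    (hc : kc.2 = kc'.2) (t : ℝ) (ab ab' : ℝ × ℝ) :
    hullState P x (nextTree T kc t ab) = hullState P x (nextTree T' kc' t ab') := by
  obtain ⟨h1, h2⟩ := Prod.ext_iff.1 h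
  have e : dataHull x (cell P T kc.1) = dataHull x (cell P T' kc'.1) := by
    rw [dataHull_eq, dataHull_eq, hk]
  refine Prod.ext ?_ ?_
  · simp only [hullState] at h1 ⊢
    by_cases hm : kc.2.Meets (dataHull x (cell P T kc.1))
    · have hm' := hm
      rw [e, hc] at hm'
      rw [hullCuts_nextTree_of_meets t ab hm, hullCuts_nextTree_of_meets t ab' hm', h1, hk, hc]
    · have hm' := hm
      rw [e, hc] at hm'
      rw [hullCuts_nextTree_of_not_meets t ab hm, hullCuts_nextTree_of_not_meets t ab' hm', h1]
  · simp only [hullState] at h2 ⊢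
    rw [blocks_nextTree, blocks_nextTree, hk, hc, h2]

/-- A hyperplane that misses the hull of the data has all the data on one side. -/
theorem sides_of_not_meets {S : Finset (Fin N)} {c : Cut d} (h : ¬ c.Meets (hullOf x S)) :
    (∀ j ∈ S, x j ∈ c.below) ∨ ∀ j ∈ S, x j ∈ c.above := by
  by_contra! hcon
  obtain ⟨⟨i, hi, hib⟩, j, hj, hja⟩ := hcon
  have hsub : ∀ l ∈ S, x l ∈ hullOf x S := fun l hl => subset_convexHull ℝ _ ⟨l, hl, rfl⟩
  have hcont : Continuous c.form := by unfold Cut.form; fun_prop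
  have h1 := ((convex_convexHull ℝ (x '' (S : Set (Fin N)))).isPreconnected).intermediate_value
    (hsub j hj) (hsub i hi) hcont.continuousOn
  have hib' : c.2.2 ≤ c.form (x i) := not_lt.1 hib
  have hja' : c.form (x j) ≤ c.2.2 := not_lt.1 hja
  obtain ⟨z, hz, hz'⟩ := h1 ⟨hja', hib'⟩
  exact h ⟨z, hz, hz'⟩

/-- A cut which misses the hull of the data in its leaf changes nothing on the hulls. -/
theorem hullState_nextTree_of_not_meets {T : Tree d} {kc : ℕ × Cut d}
    (h : ¬ kc.2.Meets (dataHull x (cell P T kc.1))) (t : ℝ) (ab : ℝ × ℝ) :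
    hullState P x (nextTree T kc t ab) = hullState P x T := by
  classical
  refine Prod.ext (hullCuts_nextTree_of_not_meets t ab h) ?_
  simp only [hullState]
  rw [blocks_nextTree]
  funext i
  unfold onSides
  split_ifs with h1 h2 h3
  · rw [blocks_of_mem ((mem_dataIn x _ i).1 h1)]
    refine Finset.filter_true_of_mem ?_
    rw [dataHull_eq] at h
    rcases sides_of_not_meets h with h4 | h4
    · exact h4
    · exact absurd (h4 i h1) (notMem_above_of_below h2)
  · rw [blocks_of_mem ((mem_dataIn x _ i).1 h1)]
    refine Finset.filter_true_of_mem ?_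
    rw [dataHull_eq] at h
    rcases sides_of_not_meets h with h4 | h4
    · exact absurd (h4 i h1) h2
    · exact h4
  · rw [dataHull_eq] at h
    rcases sides_of_not_meets h with h4 | h4
    · exact absurd (h4 i h1) h2
    · exact absurd (h4 i h1) h3
  · rfl

theorem lintegral_cutIntensity {g : ℕ × Cut d → ℝ≥0∞} (hg : Measurable g) (T : Tree d) :
    ∫⁻ kc, g kc ∂cutIntensity s P x T =
      ∑' k, ∫⁻ c, g (k, c) ∂hitMeasure (s.region x (cell P T k)) := by
  rw [cutIntensity, lintegral_sum_measure]
  exact tsum_congr fun k => lintegral_map hg measurable_prodMk_left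

theorem rate_hull_congr (hP : IsPolyhedron P) {T T' : Tree d}
    (h : blocks P x T = blocks P x T') :
    rate (regions .hull P x T) = rate (regions .hull P x T') := by
  have h1 := cutIntensity_univ x hP .hull T
  have h2 := cutIntensity_univ x hP .hull T'
  have e : cutIntensity .hull P x T Set.univ = cutIntensity .hull P x T' Set.univ := by
    rw [← lintegral_one, ← lintegral_one, lintegral_cutIntensity measurable_const,
      lintegral_cutIntensity measurable_const]
    refine tsum_eq_of_blocks h ?_ ?_ ?_
    · intro k hk
      simp [Scheme.region, dataHull_eq, hk, hullOf_empty, hitMeasure_empty]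
    · intro k hk
      simp [Scheme.region, dataHull_eq, hk, hullOf_empty, hitMeasure_empty]
    · intro k k' hk
      simp only [Scheme.region, dataHull_eq, hk]
  rw [h1, h2] at e
  exact (ENNReal.ofReal_eq_ofReal_iff (rate_nonneg x _ T) (rate_nonneg x _ T')).1 e

variable {γ : Measure ℝ} [IsProbabilityMeasure γ]

theorem jump_hull_congr {T T' : Tree d} (h : hullState P x T = hullState P x T')
    {g : Tree d → ℝ≥0∞} (hg : Measurable g)
    (hgc : ∀ T T' : Tree d, hullState P x T = hullState P x T' → g T = g T') (t : ℝ) :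
    jump .hull P x (fun _ => γ) g T t = jump .hull P x (fun _ => γ) g T' t := by
  have hm := fun T => measurable_child_integral_right (P := P) (x := x) (μ := fun _ => γ)
    (fun _ => inferInstance) hg T t
  unfold jump
  rw [lintegral_cutIntensity (hm T), lintegral_cutIntensity (hm T')]
  refine tsum_eq_of_blocks (Prod.ext_iff.1 h).2 ?_ ?_ ?_
  · intro k hk
    simp [Scheme.region, dataHull_eq, hk, hullOf_empty, hitMeasure_empty]
  · intro k hk
    simp [Scheme.region, dataHull_eq, hk, hullOf_empty, hitMeasure_empty]
  · intro k k' hk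
    simp only [Scheme.region, dataHull_eq, hk]
    refine lintegral_congr fun c => lintegral_congr fun ab => ?_
    exact hgc _ _ (hullState_nextTree_congr h (kc := (k, c)) (kc' := (k', c)) hk rfl t ab ab)

/-- In the hull scheme, the law of the restriction to the hulls depends only on the restriction. -/
theorem lintegral_grow_hull_congr (hP : IsPolyhedron P) {f : Tree d → ℝ≥0∞} (hf : Measurable f)
    (hfc : ∀ T T' : Tree d, hullState P x T = hullState P x T' → f T = f T') {t₀ t₁ : ℝ}
    (ht : t₀ ≤ t₁) {T T' : Tree d} (h : hullState P x T = hullState P x T') :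
    ∫⁻ T'', f T'' ∂grow .hull P x (fun _ => γ) T t₀ t₁ =
      ∫⁻ T'', f T'' ∂grow .hull P x (fun _ => γ) T' t₀ t₁ := by
  have hγ : ∀ S : Finset (Fin N), IsProbabilityMeasure γ := fun _ => inferInstance
  rw [iSup_partialGrow, iSup_partialGrow]
  refine iSup_congr fun n => ?_
  induction n generalizing T T' t₀ with
  | zero => simp [partialGrow]
  | succ n ih =>
    rw [partialGrow_succ hP hγ hf ht, partialGrow_succ hP hγ hf ht, renewal, renewal,
      rate_hull_congr hP (Prod.ext_iff.1 h).2, hfc _ _ h]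
    congr 1
    refine setLIntegral_congr_fun measurableSet_Ioc fun u hu => ?_
    have hm : Measurable fun T' : Tree d =>
        partialGrow .hull P x (fun _ => γ) f t₁ n (T', t₀ + u) :=
      (measurable_partialGrow hP hγ hf t₁ n).comp
        (f := fun T' : Tree d => (T', t₀ + u)) measurable_prodMk_right
    rw [jump_hull_congr h hm fun T T' hTT => ih (by linarith [hu.2]) hTT]

/-- The jumps of the full scheme are those of the hull scheme, together with jumps that change
nothing on the hulls. -/
theorem jump_full_eq (hP : IsPolyhedron P) {g : Tree d → ℝ≥0∞}
    (hgc : ∀ T T' : Tree d, hullState P x T = hullState P x T' → g T = g T') (T : Tree d) (t : ℝ) :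
    jump .full P x (fun _ => γ) g T t = jump .hull P x (fun _ => γ) g T t +
      ENNReal.ofReal (rate (regions .full P x T) - rate (regions .hull P x T)) * g T := by
  have hM := measurableSet_meets_dataHull (P := P) x T
  have hfin : IsFiniteMeasure (cutIntensity .full P x T) :=
    ⟨by rw [cutIntensity_univ x hP]; exact ENNReal.ofReal_lt_top⟩
  set M := {kc : ℕ × Cut d | kc.2.Meets (dataHull x (cell P T kc.1))} with hM_def
  have h1 : cutIntensity .full P x T Mᶜ =
      ENNReal.ofReal (rate (regions .full P x T) - rate (regions .hull P x T)) := by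
    rw [measure_compl hM (measure_ne_top _ _), cutIntensity_univ x hP,
      ENNReal.ofReal_sub _ (rate_nonneg x _ T), ← cutIntensity_univ x hP .hull T,
      ← cutIntensity_restrict x hP .full T, Measure.restrict_apply_univ]
  unfold jump
  rw [← lintegral_add_compl _ hM, ← h1]
  congr 1
  · rw [← cutIntensity_restrict x hP .full T]
  · have h2 : ∀ kc ∈ Mᶜ, ∫⁻ ab, g (nextTree T kc t ab) ∂childLaw P x (fun _ => γ) T kc = g T := by
      intro kc hkc
      have := isProbabilityMeasure_childLaw (P := P) (x := x) (ν := fun _ => γ)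
        (fun _ => inferInstance) T kc
      have h3 : ∀ ab, g (nextTree T kc t ab) = g T := fun ab =>
        hgc _ _ (hullState_nextTree_of_not_meets hkc t ab)
      simp [h3]
    rw [setLIntegral_congr_fun hM.compl h2, setLIntegral_const, mul_comm]

theorem rate_hull_le_full (hP : IsPolyhedron P) (T : Tree d) :
    rate (regions .hull P x T) ≤ rate (regions .full P x T) := by
  rw [← ENNReal.ofReal_le_ofReal_iff (rate_nonneg x _ T), ← cutIntensity_univ x hP,
    ← cutIntensity_univ x hP, ← cutIntensity_restrict x hP .full T, Measure.restrict_apply_univ]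
  exact measure_mono (Set.subset_univ _)

/-- What the two schemes do to the hulls has the same law. -/
theorem lintegral_grow_full_eq_hull (hP : IsPolyhedron P) {f : Tree d → ℝ≥0∞} (hf : Measurable f)
    (hf1 : ∀ T, f T ≤ 1)
    (hfc : ∀ T T' : Tree d, hullState P x T = hullState P x T' → f T = f T') {t₀ t₁ : ℝ}
    (ht : t₀ ≤ t₁) (T : Tree d) :
    ∫⁻ T', f T' ∂grow .full P x (fun _ => γ) T t₀ t₁ =
      ∫⁻ T', f T' ∂grow .hull P x (fun _ => γ) T t₀ t₁ := by
  have hγ : ∀ S : Finset (Fin N), IsProbabilityMeasure γ := fun _ => inferInstance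
  have hw := measurable_lintegral_grow (x := x) (s := .hull) hP hγ hf t₁
  refine lintegral_grow_unique hP hγ hf
    (w := fun p : Tree d × ℝ => ∫⁻ T', f T' ∂grow .hull P x (fun _ => γ) p.1 p.2 t₁) ?_ ?_ T ht
  · intro p
    have := isProbabilityMeasure_grow' (x := x) (s := .hull) hP hγ p.1 p.2 t₁
    calc _ ≤ ∫⁻ _, 1 ∂grow .hull P x (fun _ => γ) p.1 p.2 t₁ := lintegral_mono hf1
      _ = 1 := by simp
  · intro T t₀ ht
    have hκ : 0 ≤ rate (regions .full P x T) - rate (regions .hull P x T) :=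
      sub_nonneg.2 (rate_hull_le_full hP T)
    have hg : Measurable fun u : ℝ => jump .hull P x (fun _ => γ)
        (fun T' => ∫⁻ T'', f T'' ∂grow .hull P x (fun _ => γ) T' (t₀ + u) t₁) T (t₀ + u) :=
      (measurable_jump (x := x) (s := .hull) hP hγ hw).comp
        (f := fun u : ℝ => (T, t₀ + u)) (by fun_prop)
    have h := renewal_thinning (ρ := rate (regions .hull P x T)) hκ (sub_nonneg.2 ht) (f T) hg
      (v := fun u => ∫⁻ T', f T' ∂grow .hull P x (fun _ => γ) T (t₀ + u) t₁) ?_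
    · simp only [add_zero, add_sub_cancel] at h
      simp only
      rw [h, renewal]
      congr 1
      refine setLIntegral_congr_fun measurableSet_Ioc fun u hu => ?_
      simp only
      rw [jump_full_eq hP (g := fun T' =>
        ∫⁻ T'', f T'' ∂grow .hull P x (fun _ => γ) T' (t₀ + u) t₁)
        fun T T' hTT => lintegral_grow_hull_congr hP hf hfc (by linarith [hu.2]) hTT]
    · intro u hu
      rw [lintegral_grow_eq_renewal hP hγ hf (by linarith), renewal, sub_add_eq_sub_sub]
      simp only [add_assoc]

/-- The restriction to the hulls has the same law under both schemes. -/
theorem map_restrictToHulls_growRoot (hP : IsPolyhedron P) {t₁ : ℝ} (ht : 0 ≤ t₁) :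
    (growRoot .full P x (fun _ => γ) t₁).map (restrictToHulls P x) =
      (growRoot .hull P x (fun _ => γ) t₁).map (restrictToHulls P x) := by
  have hγ : ∀ S : Finset (Fin N), IsProbabilityMeasure γ := fun _ => inferInstance
  refine Measure.ext fun A hA => ?_
  have hr := measurable_restrictToHulls (P := P) x
  have hf : Measurable (((restrictToHulls P x) ⁻¹' A).indicator (1 : Tree d → ℝ≥0∞)) :=
    measurable_one.indicator (hr hA)
  have hf1 : ∀ T, ((restrictToHulls P x) ⁻¹' A).indicator (1 : Tree d → ℝ≥0∞) T ≤ 1 := fun T =>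
    Set.indicator_le_self' (fun _ _ => zero_le) T
  rw [Measure.map_apply hr hA, Measure.map_apply hr hA, ← lintegral_indicator_one (hr hA),
    ← lintegral_indicator_one (hr hA), lintegral_growRoot_const γ hP hf hf1 ht,
    lintegral_growRoot_const γ hP hf hf1 ht]
  have hA1 : ∀ hc : List (Finset (Fin N) × Cut d × ℝ),
      Measurable fun z : Fin N → ℝ => A.indicator (1 : HullTree d N → ℝ≥0∞) (hc, z) := fun hc =>
    (measurable_one.indicator hA).comp measurable_prodMk_left
  -- after averaging over the mean parameters, only cuts and blocks are left
  have key : ∀ T : Tree d,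
      ∫⁻ T', ((restrictToHulls P x) ⁻¹' A).indicator (1 : Tree d → ℝ≥0∞) T' ∂resample γ T =
        ∫⁻ b, A.indicator 1 ((hullState P x T).1, blockValues (hullState P x T).2 b)
          ∂(Measure.pi fun _ : Fin N => γ) := by
    intro T
    rw [hullState, ← lintegral_resample_values γ (hA1 _) T]
    refine lintegral_congr_ae ?_
    filter_upwards [ae_resample_skeleton γ T] with T' hT'
    have e : restrictToHulls P x T' = (hullCuts P x T.1 T.2, fun i => treeValue P T' (x i)) := by
      rw [restrictToHulls, hullCuts_eq_of_skeleton (a' := T.1) hT']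
    rw [← e]
    rfl
  have hm : Measurable fun T : Tree d =>
      ∫⁻ T', ((restrictToHulls P x) ⁻¹' A).indicator (1 : Tree d → ℝ≥0∞) T' ∂resample γ T :=
    (Measure.measurable_lintegral hf).comp (measurable_resample γ)
  refine lintegral_grow_full_eq_hull hP hm (fun T => ?_) (fun T T' h => ?_) ht _
  · calc _ ≤ ∫⁻ _, 1 ∂resample γ T := lintegral_mono hf1
      _ = 1 := by simp
  · rw [key, key, h]

theorem ae_growRoot_hull_noDroppedCuts (hP : IsPolyhedron P) {t₁ : ℝ} (ht : 0 ≤ t₁) :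
    ∀ᵐ T ∂growRoot .hull P x (fun _ => γ) t₁, (restrictToHulls P x T).1.length = T.2.length := by
  have hγ : ∀ S : Finset (Fin N), IsProbabilityMeasure γ := fun _ => inferInstance
  have hQ := measurableSet_noDroppedCuts (P := P) (x := x)
  have hQc : MeasurableSet {T : Tree d | ¬ (restrictToHulls P x T).1.length = T.2.length} :=
    hQ.compl
  rw [ae_iff, ← lintegral_indicator_one hQc,
    lintegral_growRoot hP hγ (measurable_one.indicator hQc)]
  refine (lintegral_congr fun a => ?_).trans lintegral_zero
  rw [lintegral_indicator_one hQc]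
  exact ae_iff.1 (ae_grow_hull_noDroppedCuts hP hγ ht rfl)

end Restriction

/-! ### Targets and proposals of sequential Monte Carlo -/

section Targets

variable {d N : ℕ} {P : Set (Pt d)} {x : Fin N → Pt d} {s : Scheme} {v : ℝ≥0} {t : ℕ → ℝ}
  {σ2 : ℝ} {R : Fin N → ℝ}

attribute [local irreducible] grow cell dataIn

theorem likelihood_pos (hσ : 0 < σ2) (R : Fin N → ℝ) (T : Tree d) : 0 < likelihood P x σ2 R T :=
  Finset.prod_pos fun _ _ => gaussianPDFReal_pos _ _ _ (Real.toNNReal_pos.2 hσ).ne'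

theorem weight_pos (hv : 0 < v) (hσ : 0 < σ2) (R : Fin N → ℝ) (j : ℕ) (T : Tree d) :
    0 < weight P x v t σ2 R j T := by
  cases j with
  | zero =>
    exact mul_pos (mul_pos (priorOverPost_pos hv hσ R _ _) (newMeansRatio_pos hv hσ R _ _ _))
      (likelihood_pos hσ R T)
  | succ j =>
    exact div_pos (mul_pos (newMeansRatio_pos hv hσ R _ _ _) (likelihood_pos hσ R T))
      (likelihood_pos hσ R _)

theorem upTo_upTo (T : Tree d) {a b : ℝ} (h : a ≤ b) : upTo (upTo T b) a = upTo T a := by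
  classical
  simp only [upTo, List.filter_filter, Prod.mk.injEq, true_and]
  refine List.filter_congr fun ev _ => ?_
  simp only [← Bool.decide_and, decide_eq_decide]
  exact ⟨fun h' => h'.1, fun h' => ⟨h', h'.trans h⟩⟩

theorem upTo_eq_self_mono {T : Tree d} {a b : ℝ} (h : upTo T a = T) (hab : a ≤ b) :
    upTo T b = T := by
  rw [upTo_eq_self_iff] at h ⊢
  exact fun ev hev => (h ev hev).trans hab

theorem newMeansRatio_of_upTo_eq {T : Tree d} {a : ℝ} (h : upTo T a = T) (v : ℝ≥0) (σ2 : ℝ)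
    (R : Fin N → ℝ) : newMeansRatio P x v σ2 R a T.1 T.2 = 1 := by
  rw [upTo_eq_self_iff] at h
  obtain ⟨a₀, es⟩ := T
  simp only at h ⊢
  induction es with
  | nil => rfl
  | cons ev es ih =>
    simp only [newMeansRatio]
    rw [if_neg (not_lt.2 (h ev List.mem_cons_self)), one_mul]
    exact ih fun ev' h' => h ev' (List.mem_cons_of_mem _ h')

theorem measurable_likelihood_right (σ2 : ℝ) (R : Fin N → ℝ) :
    Measurable fun T : Tree d => likelihood P x σ2 R T :=
  (measurable_likelihood x).comp (f := fun T : Tree d => ((σ2, R), T)) measurable_prodMk_left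

theorem measurable_weight_right (v : ℝ≥0) (t : ℕ → ℝ) (σ2 : ℝ) (R : Fin N → ℝ) (j : ℕ) :
    Measurable fun T : Tree d => weight P x v t σ2 R j T :=
  (measurable_weight x v t j).comp (f := fun T : Tree d => ((σ2, R), T)) measurable_prodMk_left

theorem ae_growRoot_of_grow (hP : IsPolyhedron P) {ν : Finset (Fin N) → Measure ℝ}
    (hν : ∀ S, IsProbabilityMeasure (ν S)) {Q : Set (Tree d)} (hQ : MeasurableSet Q) {t₁ : ℝ}
    (h : ∀ a : ℝ, ∀ᵐ T ∂grow s P x ν (a, []) 0 t₁, T ∈ Q) : ∀ᵐ T ∂growRoot s P x ν t₁, T ∈ Q := by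
  have hQc : MeasurableSet {T : Tree d | T ∉ Q} := hQ.compl
  rw [ae_iff, ← lintegral_indicator_one hQc,
    lintegral_growRoot hP hν (measurable_one.indicator hQc)]
  refine (lintegral_congr fun a => ?_).trans lintegral_zero
  rw [lintegral_indicator_one hQc]
  exact ae_iff.1 (h a)

theorem ae_growRoot_upTo_eq_self (hP : IsPolyhedron P) {ν : Finset (Fin N) → Measure ℝ}
    (hν : ∀ S, IsProbabilityMeasure (ν S)) {t₁ : ℝ} (ht : 0 ≤ t₁) :
    ∀ᵐ T ∂growRoot s P x ν t₁, upTo T t₁ = T :=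
  ae_growRoot_of_grow hP hν (measurableSet_upTo_eq_self t₁) fun _ =>
    ae_grow_upTo_eq_self hP hν ht rfl

theorem ae_grow_rootMean (hP : IsPolyhedron P) {ν : Finset (Fin N) → Measure ℝ}
    (hν : ∀ S, IsProbabilityMeasure (ν S)) {t₀ t₁ : ℝ} (ht : t₀ ≤ t₁) (T : Tree d) :
    ∀ᵐ T' ∂grow s P x ν T t₀ t₁, T'.1 = T.1 :=
  ae_grow_of_jump hP hν (Q := {T' : Tree d | T'.1 = T.1})
    (measurable_fst (measurableSet_singleton T.1)) ht
    (fun _ hT' _ _ _ => Filter.Eventually.of_forall fun _ _ => hT') rfl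

/-- Weighting all mean parameters with prior over posterior. -/
theorem lintegral_growRoot_postLaw (hP : IsPolyhedron P) (hv : 0 < v) (hσ : 0 < σ2)
    (R : Fin N → ℝ) {t₁ : ℝ} (ht : 0 ≤ t₁) {f : Tree d → ℝ≥0∞} (hf : Measurable f) :
    ∫⁻ T, ENNReal.ofReal (priorOverPost v σ2 R (dataIn x P) T.1 *
        newMeansRatio P x v σ2 R 0 T.1 T.2) * f T ∂growRoot s P x (postLaw v σ2 R) t₁ =
      ∫⁻ T, f T ∂growRoot s P x (fun _ => gaussianReal 0 v) t₁ := by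
  have hpost := isProbabilityMeasure_postLaw (N := N) v σ2 R
  have hprior : ∀ S : Finset (Fin N), IsProbabilityMeasure (gaussianReal 0 v) := fun _ =>
    inferInstance
  have hp : Measurable fun T : Tree d =>
      ENNReal.ofReal (priorOverPost v σ2 R (dataIn x P) T.1) :=
    ((measurable_priorOverPost_right v σ2 R _).comp measurable_fst).ennreal_ofReal
  have hr : Measurable fun T : Tree d => ENNReal.ofReal (newMeansRatio P x v σ2 R 0 T.1 T.2) :=
    (measurable_newMeansRatio_right v σ2 R 0).ennreal_ofReal
  have e : ∀ T : Tree d, ENNReal.ofReal (priorOverPost v σ2 R (dataIn x P) T.1 *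
      newMeansRatio P x v σ2 R 0 T.1 T.2) * f T =
      ENNReal.ofReal (newMeansRatio P x v σ2 R 0 T.1 T.2) *
        (ENNReal.ofReal (priorOverPost v σ2 R (dataIn x P) T.1) * f T) := by
    intro T
    rw [ENNReal.ofReal_mul (priorOverPost_pos hv hσ _ _ _).le]
    ring
  simp only [e]
  have hpf : Measurable fun T : Tree d =>
    ENNReal.ofReal (priorOverPost v σ2 R (dataIn x P) T.1) * f T := hp.mul hf
  have hrpf : Measurable fun T : Tree d => ENNReal.ofReal (newMeansRatio P x v σ2 R 0 T.1 T.2) *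
    (ENNReal.ofReal (priorOverPost v σ2 R (dataIn x P) T.1) * f T) := hr.mul hpf
  rw [lintegral_growRoot hP hpost hrpf, lintegral_growRoot hP hprior hf]
  have e2 : ∀ a : ℝ, ∫⁻ T, ENNReal.ofReal (newMeansRatio P x v σ2 R 0 T.1 T.2) *
        (ENNReal.ofReal (priorOverPost v σ2 R (dataIn x P) T.1) * f T)
        ∂grow s P x (postLaw v σ2 R) (a, []) 0 t₁ =
      ENNReal.ofReal (priorOverPost v σ2 R (dataIn x P) a) *
        ∫⁻ T, f T ∂grow s P x (fun _ => gaussianReal 0 v) (a, []) 0 t₁ := by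
    intro a
    rw [lintegral_grow_postLaw hP hv hσ R le_rfl ht hpf (a, []),
      ← lintegral_const_mul _ hf]
    simp only [newMeansRatio, ENNReal.ofReal_one, one_mul]
    refine lintegral_congr_ae ?_
    filter_upwards [ae_grow_rootMean (s := s) (x := x) hP hprior ht ((a, []) : Tree d)] with T hT
    rw [hT]
  simp only [e2]
  have hg : Measurable fun T : Tree d =>
      ∫⁻ T', f T' ∂grow s P x (fun _ => gaussianReal 0 v) T 0 t₁ :=
    (Measure.measurable_lintegral hf).comp (measurable_growFrom hP hprior 0 t₁)
  have hg' : Measurable fun a : ℝ =>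
      ∫⁻ T', f T' ∂grow s P x (fun _ => gaussianReal 0 v) (a, []) 0 t₁ :=
    hg.comp (f := fun a : ℝ => ((a, []) : Tree d)) measurable_mkRoot
  refine Eq.trans ?_ (congrArg (fun μ : Measure ℝ => ∫⁻ a,
    ∫⁻ T', f T' ∂grow s P x (fun _ => gaussianReal 0 v) (a, []) 0 t₁ ∂μ)
      (postLaw_withDensity hv hσ R (dataIn x P)))
  exact (lintegral_withDensity_eq_lintegral_mul _
    (measurable_priorOverPost_right v σ2 R _).ennreal_ofReal hg').symm

/-- The unnormalized target law of the trees at the end of a segment. -/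
noncomputable def target (s : Scheme) (P : Set (Pt d)) (x : Fin N → Pt d) (v : ℝ≥0) (σ2 : ℝ)
    (R : Fin N → ℝ) (t₁ : ℝ) : Measure (Tree d) :=
  (growRoot s P x (fun _ => gaussianReal 0 v) t₁).withDensity fun T =>
    ENNReal.ofReal (likelihood P x σ2 R T)

/-- The law of the trees that are proposed for a segment, if those at its beginning have their
target law. -/
noncomputable def proposal (s : Scheme) (P : Set (Pt d)) (x : Fin N → Pt d) (v : ℝ≥0) (t : ℕ → ℝ)
    (σ2 : ℝ) (R : Fin N → ℝ) : ℕ → Measure (Tree d)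
  | 0 => growRoot s P x (postLaw v σ2 R) (t 1)
  | j + 1 => (target s P x v σ2 R (t (j + 1))).bind fun T =>
      grow s P x (postLaw v σ2 R) T (t (j + 1)) (t (j + 2))

theorem lintegral_target {f : Tree d → ℝ≥0∞} (hf : Measurable f) (t₁ : ℝ) :
    ∫⁻ T, f T ∂target s P x v σ2 R t₁ =
      ∫⁻ T, ENNReal.ofReal (likelihood P x σ2 R T) * f T
        ∂growRoot s P x (fun _ => gaussianReal 0 v) t₁ :=
  lintegral_withDensity_eq_lintegral_mul _ (measurable_likelihood_right σ2 R).ennreal_ofReal hf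

theorem ae_target_upTo_eq_self (hP : IsPolyhedron P) {t₁ : ℝ} (ht : 0 ≤ t₁) :
    ∀ᵐ T ∂target s P x v σ2 R t₁, upTo T t₁ = T :=
  (withDensity_absolutelyContinuous _ _).ae_le
    (ae_growRoot_upTo_eq_self hP (fun _ => inferInstance) ht)

theorem lintegral_proposal_succ (hP : IsPolyhedron P) {f : Tree d → ℝ≥0∞} (hf : Measurable f)
    (j : ℕ) : ∫⁻ T, f T ∂proposal s P x v t σ2 R (j + 1) =
      ∫⁻ T, ∫⁻ T', f T' ∂grow s P x (postLaw v σ2 R) T (t (j + 1)) (t (j + 2))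
        ∂target s P x v σ2 R (t (j + 1)) :=
  Measure.lintegral_bind (measurable_growFrom hP
    (isProbabilityMeasure_postLaw v σ2 R) _ _).aemeasurable hf.aemeasurable

theorem lintegral_growRoot_markov (hP : IsPolyhedron P) {ν : Finset (Fin N) → Measure ℝ}
    (hν : ∀ S, IsProbabilityMeasure (ν S)) {f : Tree d → ℝ≥0∞} (hf : Measurable f) {t₁ t₂ : ℝ}
    (h0 : 0 ≤ t₁) (h : t₁ ≤ t₂) :
    ∫⁻ T, ∫⁻ T', f T' ∂grow s P x ν T t₁ t₂ ∂growRoot s P x ν t₁ =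
      ∫⁻ T, f T ∂growRoot s P x ν t₂ := by
  have hm : Measurable fun T : Tree d => ∫⁻ T', f T' ∂grow s P x ν T t₁ t₂ :=
    (Measure.measurable_lintegral hf).comp (measurable_growFrom hP hν t₁ t₂)
  rw [lintegral_growRoot hP hν hm, lintegral_growRoot hP hν hf]
  refine lintegral_congr fun a => ?_
  rw [← grow_bind_grow hP hν h0 h, Measure.lintegral_bind
    (measurable_growFrom hP hν t₁ t₂).aemeasurable hf.aemeasurable]

theorem ae_proposal_upTo_eq_self (hP : IsPolyhedron P) (ht0 : t 0 = 0) (ht : StrictMono t)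
    (j : ℕ) :
    ∀ᵐ T ∂proposal s P x v t σ2 R j, upTo T (t (j + 1)) = T := by
  have hpost := isProbabilityMeasure_postLaw (N := N) v σ2 R
  have hpos : ∀ j, 0 ≤ t j := fun j => ht0 ▸ ht.monotone (Nat.zero_le j)
  cases j with
  | zero => exact ae_growRoot_upTo_eq_self hP hpost (hpos 1)
  | succ j =>
    have hle : t (j + 1) ≤ t (j + 2) := ht.monotone (by omega)
    have hQc : MeasurableSet {T : Tree d | ¬ upTo T (t (j + 2)) = T} :=
      (measurableSet_upTo_eq_self (t (j + 2))).compl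
    rw [ae_iff, ← lintegral_indicator_one hQc,
      lintegral_proposal_succ hP (measurable_one.indicator hQc)]
    refine (lintegral_congr_ae ?_).trans lintegral_zero
    filter_upwards [ae_target_upTo_eq_self hP (hpos (j + 1))] with T hT
    rw [lintegral_indicator_one hQc]
    refine ae_iff.1 (ae_grow_upTo_eq_self hP hpost hle (upTo_eq_self_mono hT hle))

/-- The weights turn the law of the proposals into the target law. -/
theorem lintegral_target_eq_weight (hP : IsPolyhedron P) (hv : 0 < v) (hσ : 0 < σ2)
    (ht0 : t 0 = 0) (ht : StrictMono t) (j : ℕ) {f : Tree d → ℝ≥0∞} (hf : Measurable f) :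
    ∫⁻ T, f T ∂target s P x v σ2 R (t (j + 1)) =
      ∫⁻ T, ENNReal.ofReal (weight P x v t σ2 R j T) * f T ∂proposal s P x v t σ2 R j := by
  have hpost := isProbabilityMeasure_postLaw (N := N) v σ2 R
  have hprior : ∀ S : Finset (Fin N), IsProbabilityMeasure (gaussianReal 0 v) := fun _ =>
    inferInstance
  have hpos : ∀ j, 0 ≤ t j := fun j => ht0 ▸ ht.monotone (Nat.zero_le j)
  have hL : Measurable fun T : Tree d => ENNReal.ofReal (likelihood P x σ2 R T) :=
    (measurable_likelihood_right σ2 R).ennreal_ofReal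
  have hLf : Measurable fun T : Tree d => ENNReal.ofReal (likelihood P x σ2 R T) * f T :=
    hL.mul hf
  rw [lintegral_target hf]
  cases j with
  | zero =>
    rw [← lintegral_growRoot_postLaw hP hv hσ R (hpos _) hLf, proposal]
    refine lintegral_congr fun T => ?_
    rw [weight, ht0, ENNReal.ofReal_mul (mul_pos (priorOverPost_pos hv hσ R _ _)
      (newMeansRatio_pos hv hσ R _ _ _)).le, mul_assoc]
  | succ j =>
    have hle : t (j + 1) ≤ t (j + 2) := ht.monotone (by omega)
    have hw : Measurable fun T : Tree d => ENNReal.ofReal (weight P x v t σ2 R (j + 1) T) :=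
      (measurable_weight_right v t σ2 R (j + 1)).ennreal_ofReal
    have hwf : Measurable fun T : Tree d =>
        ENNReal.ofReal (weight P x v t σ2 R (j + 1) T) * f T := hw.mul hf
    have hm : Measurable fun T : Tree d =>
        ∫⁻ T', ENNReal.ofReal (weight P x v t σ2 R (j + 1) T') * f T'
          ∂grow s P x (postLaw v σ2 R) T (t (j + 1)) (t (j + 2)) :=
      (Measure.measurable_lintegral hwf).comp (measurable_growFrom hP hpost _ _)
    rw [lintegral_proposal_succ hP hwf, lintegral_target hm,
      ← lintegral_growRoot_markov hP hprior hLf (hpos (j + 1)) hle]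
    refine lintegral_congr_ae ?_
    filter_upwards [ae_growRoot_upTo_eq_self (s := s) (x := x) hP hprior (hpos (j + 1))] with T hT
    have h1 := lintegral_grow_postLaw (s := s) (x := x) hP hv hσ R (le_refl (t (j + 1))) hle
      hLf T
    rw [newMeansRatio_of_upTo_eq hT, ENNReal.ofReal_one, one_mul] at h1
    rw [← h1, ← lintegral_const_mul _ hwf]
    refine lintegral_congr_ae ?_
    filter_upwards [ae_grow_upTo_eq (s := s) (x := x) hP hpost (le_refl (t (j + 1))) hle T]
      with T' hT'
    rw [weight, hT', hT, ← mul_assoc, ← mul_assoc,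
      ← ENNReal.ofReal_mul (newMeansRatio_pos hv hσ R _ _ _).le,
      ← ENNReal.ofReal_mul (likelihood_pos hσ R T).le,
      mul_div_cancel₀ _ (likelihood_pos hσ R T).ne']

end Targets

/-! ### The particle system -/

section Particles

variable {d N Q : ℕ} {P : Set (Pt d)} {x : Fin N → Pt d} {s : Scheme} {v : ℝ≥0} {t : ℕ → ℝ}
  {σ2 : ℝ} {R : Fin N → ℝ}

attribute [local irreducible] grow growRoot cell dataIn upTo weight

theorem newMeansRatio_nonneg (v : ℝ≥0) (σ2 : ℝ) (R : Fin N → ℝ) (b a₀ : ℝ) (es : List (Event d)) :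
    0 ≤ newMeansRatio P x v σ2 R b a₀ es := by
  have h : ∀ S a, 0 ≤ priorOverPost v σ2 R S a := fun S a =>
    div_nonneg (gaussianPDFReal_nonneg _ _ _) (gaussianPDFReal_nonneg _ _ _)
  induction es with
  | nil => simp [newMeansRatio]
  | cons ev es ih =>
    simp only [newMeansRatio]
    refine mul_nonneg ?_ ih
    split_ifs
    · exact mul_nonneg (h _ _) (h _ _)
    · exact zero_le_one

theorem likelihood_nonneg (σ2 : ℝ) (R : Fin N → ℝ) (T : Tree d) : 0 ≤ likelihood P x σ2 R T :=
  Finset.prod_nonneg fun _ _ => gaussianPDFReal_nonneg _ _ _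

theorem weight_nonneg (v : ℝ≥0) (t : ℕ → ℝ) (σ2 : ℝ) (R : Fin N → ℝ) (j : ℕ) (T : Tree d) :
    0 ≤ weight P x v t σ2 R j T := by
  cases j with
  | zero =>
    rw [weight]
    exact mul_nonneg (mul_nonneg (div_nonneg (gaussianPDFReal_nonneg _ _ _)
      (gaussianPDFReal_nonneg _ _ _)) (newMeansRatio_nonneg _ _ _ _ _ _)) (likelihood_nonneg _ _ _)
  | succ j =>
    rw [weight]
    exact div_nonneg (mul_nonneg (newMeansRatio_nonneg _ _ _ _ _ _) (likelihood_nonneg _ _ _))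
      (likelihood_nonneg _ _ _)

theorem sum_normWeight_le (v : ℝ≥0) (t : ℕ → ℝ) (σ2 : ℝ) (R : Fin N → ℝ) (j : ℕ)
    (z : Fin (Q + 1) → Tree d) : ∑ n, normWeight P x v t σ2 R j z n ≤ 1 := by
  unfold normWeight
  rw [← ENNReal.ofReal_sum_of_nonneg fun n _ => div_nonneg (weight_nonneg _ _ _ _ _ _)
    (Finset.sum_nonneg fun _ _ => weight_nonneg _ _ _ _ _ _), ← Finset.sum_div,
    ← ENNReal.ofReal_one]
  exact ENNReal.ofReal_le_ofReal (div_self_le_one _)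

theorem measurable_normWeight (v : ℝ≥0) (t : ℕ → ℝ) (j : ℕ) (n : Fin (Q + 1)) :
    Measurable fun p : (ℝ × (Fin N → ℝ)) × (Fin (Q + 1) → Tree d) =>
      normWeight P x v t p.1.1 p.1.2 j p.2 n := by
  have h : ∀ n, Measurable fun p : (ℝ × (Fin N → ℝ)) × (Fin (Q + 1) → Tree d) =>
      weight P x v t p.1.1 p.1.2 j (p.2 n) := fun n =>
    (measurable_weight (P := P) x v t j).comp
      (f := fun p : (ℝ × (Fin N → ℝ)) × (Fin (Q + 1) → Tree d) => (p.1, p.2 n)) (by fun_prop)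
  unfold normWeight
  exact ((h n).div (Finset.measurable_fun_sum _ fun n' _ => h n')).ennreal_ofReal

/-- The law of a particle that is grown from a resampled ancestor. -/
noncomputable def offspring (s : Scheme) (P : Set (Pt d)) (x : Fin N → Pt d) (v : ℝ≥0)
    (t : ℕ → ℝ) (σ2 : ℝ) (R : Fin N → ℝ) (j : ℕ) (z : Fin (Q + 1) → Tree d) :
    Measure (Tree d) :=
  ∑ n, normWeight P x v t σ2 R j z n • grow s P x (postLaw v σ2 R) (z n) (t (j + 1)) (t (j + 2))

theorem measurable_offspring (hP : IsPolyhedron P) (v : ℝ≥0) (t : ℕ → ℝ) (j : ℕ) :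
    Measurable fun p : (ℝ × (Fin N → ℝ)) × (Fin (Q + 1) → Tree d) =>
      offspring s P x v t p.1.1 p.1.2 j p.2 := by
  unfold offspring
  refine measurable_finset_sum_param _ fun n => measurable_smul_param
    (measurable_normWeight v t j n) ?_
  exact (measurable_grow (x := x) (s := s) (ν := fun q : ℝ × (Fin N → ℝ) => postLaw v q.1 q.2) hP
    (fun S => measurable_postLaw S v) (fun q => isProbabilityMeasure_postLaw v q.1 q.2)
    (t (j + 2))).comp
    (f := fun p : (ℝ × (Fin N → ℝ)) × (Fin (Q + 1) → Tree d) => (p.1, p.2 n, t (j + 1)))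
    (by fun_prop)

theorem offspring_univ (hP : IsPolyhedron P) (v : ℝ≥0) (t : ℕ → ℝ) (σ2 : ℝ) (R : Fin N → ℝ)
    (j : ℕ) (z : Fin (Q + 1) → Tree d) :
    offspring s P x v t σ2 R j z Set.univ = ∑ n, normWeight P x v t σ2 R j z n := by
  unfold offspring
  rw [Measure.finsetSum_apply]
  refine Finset.sum_congr rfl fun n _ => ?_
  have := isProbabilityMeasure_grow' (s := s) (x := x) hP (isProbabilityMeasure_postLaw v σ2 R)
    (z n) (t (j + 1)) (t (j + 2))
  simp

theorem measurable_growRoot_post (hP : IsPolyhedron P) (v : ℝ≥0) (t₁ : ℝ) :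
    Measurable fun p : ℝ × (Fin N → ℝ) => growRoot s P x (postLaw v p.1 p.2) t₁ := by
  unfold growRoot
  refine measurable_bind_param (μ := fun p : ℝ × (Fin N → ℝ) => postLaw v p.1 p.2 (dataIn x P))
    (κ := fun q : (ℝ × (Fin N → ℝ)) × ℝ => grow s P x (postLaw v q.1.1 q.1.2) (q.2, []) 0 t₁)
    (measurable_postLaw _ v) (fun p => ?_) ?_
  · have := isProbabilityMeasure_postLaw v p.1 p.2 (dataIn x P)
    exact prob_le_one
  · exact (measurable_grow (x := x) (s := s) (ν := fun q : ℝ × (Fin N → ℝ) => postLaw v q.1 q.2)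
      hP (fun S => measurable_postLaw S v) (fun q => isProbabilityMeasure_postLaw v q.1 q.2)
      t₁).comp (f := fun q : (ℝ × (Fin N → ℝ)) × ℝ => (q.1, ((q.2, []) : Tree d), (0 : ℝ)))
      (by fun_prop)

theorem particles_succ (T : Tree d) (j : ℕ) : particles s P x v t Q σ2 R T (j + 1) =
    (particles s P x v t Q σ2 R T j).bind fun z => Measure.pi fun n =>
      if n = 0 then Measure.dirac (upTo T (t (j + 2))) else offspring s P x v t σ2 R j z := rfl

theorem pi_univ_le_one {ι B : Type*} [Fintype ι] [MeasurableSpace B] {μ : ι → Measure B}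
    (h : ∀ i, μ i Set.univ ≤ 1) : Measure.pi μ Set.univ ≤ 1 := by
  have : ∀ i, IsFiniteMeasure (μ i) := fun i => ⟨(h i).trans_lt ENNReal.one_lt_top⟩
  rw [Measure.pi_univ]
  exact Finset.prod_le_one' fun i _ => h i

theorem newParticle_univ_le (hP : IsPolyhedron P) (T : Tree d) (j : ℕ)
    (z : Fin (Q + 1) → Tree d) (n : Fin (Q + 1)) :
    (if n = 0 then Measure.dirac (upTo T (t (j + 2))) else offspring s P x v t σ2 R j z)
      Set.univ ≤ 1 := by
  split_ifs
  · simp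
  · rw [offspring_univ hP]
    exact sum_normWeight_le _ _ _ _ _ _

theorem measurable_newParticles (hP : IsPolyhedron P) (v : ℝ≥0) (t : ℕ → ℝ) (j : ℕ) :
    Measurable fun q : ((ℝ × (Fin N → ℝ)) × Tree d) × (Fin (Q + 1) → Tree d) =>
      Measure.pi fun n : Fin (Q + 1) => if n = 0 then Measure.dirac (upTo q.1.2 (t (j + 2))) else
        offspring s P x v t q.1.1.1 q.1.1.2 j q.2 := by
  refine measurable_pi_param (μ := fun (n : Fin (Q + 1))
    (q : ((ℝ × (Fin N → ℝ)) × Tree d) × (Fin (Q + 1) → Tree d)) =>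
      if n = 0 then Measure.dirac (upTo q.1.2 (t (j + 2))) else
        offspring s P x v t q.1.1.1 q.1.1.2 j q.2) (fun n => ?_)
    fun n q => newParticle_univ_le hP _ _ _ _
  split_ifs
  · exact Measure.measurable_dirac.comp ((measurable_upTo _).comp
      (f := fun q : ((ℝ × (Fin N → ℝ)) × Tree d) × (Fin (Q + 1) → Tree d) => q.1.2) (by fun_prop))
  · exact (measurable_offspring hP v t j).comp
      (f := fun q : ((ℝ × (Fin N → ℝ)) × Tree d) × (Fin (Q + 1) → Tree d) => (q.1.1, q.2))
      (by fun_prop)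

theorem particles_univ_le (hP : IsPolyhedron P) (T : Tree d) (j : ℕ) :
    particles s P x v t Q σ2 R T j Set.univ ≤ 1 := by
  induction j with
  | zero =>
    refine pi_univ_le_one fun n => ?_
    have := isProbabilityMeasure_growRoot (s := s) (x := x) hP
      (isProbabilityMeasure_postLaw v σ2 R) (t 1)
    split_ifs <;> exact prob_le_one
  | succ j ih =>
    have hm : Measurable fun z : Fin (Q + 1) → Tree d => Measure.pi fun n : Fin (Q + 1) =>
        if n = 0 then Measure.dirac (upTo T (t (j + 2))) else offspring s P x v t σ2 R j z :=
      (measurable_newParticles hP v t j).comp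
        (f := fun z : Fin (Q + 1) → Tree d => (((σ2, R), T), z)) measurable_prodMk_left
    rw [particles_succ, Measure.bind_apply MeasurableSet.univ hm.aemeasurable]
    calc _ ≤ ∫⁻ _, 1 ∂particles s P x v t Q σ2 R T j :=
          lintegral_mono fun z => pi_univ_le_one (newParticle_univ_le hP T j z)
      _ ≤ 1 := by simpa using ih

theorem measurable_particles (hP : IsPolyhedron P) (v : ℝ≥0) (t : ℕ → ℝ) (j : ℕ) :
    Measurable fun p : (ℝ × (Fin N → ℝ)) × Tree d =>
      particles s P x v t Q p.1.1 p.1.2 p.2 j := by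
  induction j with
  | zero =>
    refine measurable_pi_param (μ := fun (n : Fin (Q + 1)) (p : (ℝ × (Fin N → ℝ)) × Tree d) =>
      if n = 0 then Measure.dirac (upTo p.2 (t 1)) else
        growRoot s P x (postLaw v p.1.1 p.1.2) (t 1)) (fun n => ?_) fun n p => ?_
    · split_ifs
      · exact Measure.measurable_dirac.comp ((measurable_upTo _).comp measurable_snd)
      · exact (measurable_growRoot_post hP v _).comp measurable_fst
    · have := isProbabilityMeasure_growRoot (s := s) (x := x) hP
        (isProbabilityMeasure_postLaw v p.1.1 p.1.2) (t 1)
      split_ifs <;> exact prob_le_one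
  | succ j ih =>
    simp only [particles_succ]
    exact measurable_bind_param (μ := fun p : (ℝ × (Fin N → ℝ)) × Tree d =>
      particles s P x v t Q p.1.1 p.1.2 p.2 j)
      (κ := fun q : ((ℝ × (Fin N → ℝ)) × Tree d) × (Fin (Q + 1) → Tree d) =>
      Measure.pi fun n : Fin (Q + 1) => if n = 0 then Measure.dirac (upTo q.1.2 (t (j + 2))) else
        offspring s P x v t q.1.1.1 q.1.1.2 j q.2) ih (fun p => particles_univ_le hP p.2 j)
      (measurable_newParticles hP v t j)

/-- The law of a particle drawn according to the normalized weights. -/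
noncomputable def selection (P : Set (Pt d)) (x : Fin N → Pt d) (v : ℝ≥0)
    (t : ℕ → ℝ) (σ2 : ℝ) (R : Fin N → ℝ) (j : ℕ) (z : Fin (Q + 1) → Tree d) :
    Measure (Tree d) :=
  ∑ n, normWeight P x v t σ2 R j z n • Measure.dirac (z n)

theorem csmc_eq (S : ℕ) (T : Tree d) : csmc s P x v t Q S σ2 R T =
    (particles s P x v t Q σ2 R T S).bind (selection P x v t σ2 R S) := rfl

theorem measurable_selection (v : ℝ≥0) (t : ℕ → ℝ) (j : ℕ) :
    Measurable fun p : (ℝ × (Fin N → ℝ)) × (Fin (Q + 1) → Tree d) =>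
      selection P x v t p.1.1 p.1.2 j p.2 := by
  unfold selection
  exact measurable_finset_sum_param _ fun n => measurable_smul_param
    (measurable_normWeight v t j n) (Measure.measurable_dirac.comp (by fun_prop))

theorem measurable_csmc (hP : IsPolyhedron P) (v : ℝ≥0) (t : ℕ → ℝ) (S : ℕ) :
    Measurable fun p : (ℝ × (Fin N → ℝ)) × Tree d => csmc s P x v t Q S p.1.1 p.1.2 p.2 := by
  simp only [csmc_eq]
  exact measurable_bind_param (μ := fun p : (ℝ × (Fin N → ℝ)) × Tree d =>
      particles s P x v t Q p.1.1 p.1.2 p.2 S)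
    (κ := fun q : ((ℝ × (Fin N → ℝ)) × Tree d) × (Fin (Q + 1) → Tree d) =>
      selection P x v t q.1.1.1 q.1.1.2 S q.2) (measurable_particles hP v t S)
    (fun p => particles_univ_le hP p.2 S)
    ((measurable_selection v t S).comp
      (f := fun q : ((ℝ × (Fin N → ℝ)) × Tree d) × (Fin (Q + 1) → Tree d) => (q.1.1, q.2))
      (by fun_prop))

theorem measurable_selection_right (v : ℝ≥0) (t : ℕ → ℝ) (σ2 : ℝ) (R : Fin N → ℝ) (j : ℕ) :
    Measurable fun z : Fin (Q + 1) → Tree d => selection P x v t σ2 R j z :=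
  (measurable_selection v t j).comp
    (f := fun z : Fin (Q + 1) → Tree d => ((σ2, R), z)) measurable_prodMk_left

theorem csmc_univ_le (hP : IsPolyhedron P) (S : ℕ) (T : Tree d) :
    csmc s P x v t Q S σ2 R T Set.univ ≤ 1 := by
  rw [csmc_eq, Measure.bind_apply MeasurableSet.univ
    (measurable_selection_right v t σ2 R S).aemeasurable]
  calc _ ≤ ∫⁻ _, 1 ∂particles s P x v t Q σ2 R T S := by
        refine lintegral_mono fun z => ?_
        rw [selection, Measure.finsetSum_apply]
        simpa using sum_normWeight_le v t σ2 R S z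
    _ ≤ 1 := by simpa using particles_univ_le hP T S

/-! Integrals with respect to the particles; particle `0` follows the given tree. -/

theorem pi_ite_eq {B : Type*} [MeasurableSpace B] (α β : Measure B) [IsProbabilityMeasure α]
    [IsProbabilityMeasure β] {f : (Fin (Q + 1) → B) → ℝ≥0∞} (hf : Measurable f) :
    ∫⁻ z, f z ∂(Measure.pi fun n : Fin (Q + 1) => if n = 0 then α else β) =
      ∫⁻ z, ∫⁻ a, f (Function.update z 0 a) ∂α ∂(Measure.pi fun _ : Fin (Q + 1) => β) := by
  have e : (fun n : Fin (Q + 1) => if n = 0 then α else β) =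
      Function.update (fun _ => β) 0 α := by
    funext n
    by_cases hn : n = 0
    · subst hn; simp
    · rw [if_neg hn, Function.update_of_ne hn]
  have hm := measurable_update_param (B := B) (0 : Fin (Q + 1))
  rw [e, ← map_update_pi_eq, lintegral_map hf hm]
  exact lintegral_prod _ (hf.comp hm).aemeasurable

theorem sum_normWeight (hv : 0 < v) (hσ : 0 < σ2) (j : ℕ) (z : Fin (Q + 1) → Tree d) :
    ∑ n, normWeight P x v t σ2 R j z n = 1 := by
  have hpos : 0 < ∑ n, weight P x v t σ2 R j (z n) :=
    Finset.sum_pos (fun n _ => weight_pos hv hσ R j (z n)) Finset.univ_nonempty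
  unfold normWeight
  rw [← ENNReal.ofReal_sum_of_nonneg fun n _ => div_nonneg (weight_nonneg _ _ _ _ _ _) hpos.le,
    ← Finset.sum_div, div_self hpos.ne', ENNReal.ofReal_one]

theorem isProbabilityMeasure_offspring (hP : IsPolyhedron P) (hv : 0 < v) (hσ : 0 < σ2) (j : ℕ)
    (z : Fin (Q + 1) → Tree d) : IsProbabilityMeasure (offspring s P x v t σ2 R j z) :=
  ⟨by rw [offspring_univ hP, sum_normWeight hv hσ]⟩

theorem measurable_offspring_right (hP : IsPolyhedron P) (v : ℝ≥0) (t : ℕ → ℝ) (σ2 : ℝ)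
    (R : Fin N → ℝ) (j : ℕ) :
    Measurable fun z : Fin (Q + 1) → Tree d => offspring s P x v t σ2 R j z :=
  (measurable_offspring hP v t j).comp
    (f := fun z : Fin (Q + 1) → Tree d => ((σ2, R), z)) measurable_prodMk_left

/-- The expectation of `f` after a step of the particle system, if the conditional particle is
put at `a`. -/
noncomputable def afterStep (s : Scheme) (P : Set (Pt d)) (x : Fin N → Pt d) (v : ℝ≥0)
    (t : ℕ → ℝ) (σ2 : ℝ) (R : Fin N → ℝ) (j : ℕ) (f : (Fin (Q + 1) → Tree d) → ℝ≥0∞)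
    (z : Fin (Q + 1) → Tree d) (a : Tree d) : ℝ≥0∞ :=
  ∫⁻ z', f (Function.update z' 0 a) ∂(Measure.pi fun _ : Fin (Q + 1) =>
    offspring s P x v t σ2 R j z)

theorem measurable_afterStep (hP : IsPolyhedron P) (v : ℝ≥0) (t : ℕ → ℝ) (σ2 : ℝ) (R : Fin N → ℝ)
    (j : ℕ) {f : (Fin (Q + 1) → Tree d) → ℝ≥0∞} (hf : Measurable f) :
    Measurable fun p : (Fin (Q + 1) → Tree d) × Tree d =>
      afterStep s P x v t σ2 R j f p.1 p.2 := by
  have h1 : ∀ z : Fin (Q + 1) → Tree d, offspring s P x v t σ2 R j z Set.univ ≤ 1 := fun z => by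
    rw [offspring_univ hP]
    exact sum_normWeight_le _ _ _ _ _ _
  have hpi : Measurable fun p : (Fin (Q + 1) → Tree d) × Tree d =>
      Measure.pi fun _ : Fin (Q + 1) => offspring s P x v t σ2 R j p.1 :=
    measurable_pi_param (fun _ => (measurable_offspring_right hP v t σ2 R j).comp measurable_fst)
      fun _ p => h1 p.1
  refine measurable_lintegral_param hpi (fun p => pi_univ_le_one fun _ => h1 p.1)
    (f := fun q : ((Fin (Q + 1) → Tree d) × Tree d) × (Fin (Q + 1) → Tree d) =>
      f (Function.update q.2 0 q.1.2)) (hf.comp ?_)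
  exact (measurable_update_param (B := Tree d) (0 : Fin (Q + 1))).comp
    (f := fun q : ((Fin (Q + 1) → Tree d) × Tree d) × (Fin (Q + 1) → Tree d) => (q.2, q.1.2))
    (by fun_prop)

theorem lintegral_particles_zero (hP : IsPolyhedron P) (T : Tree d)
    {f : (Fin (Q + 1) → Tree d) → ℝ≥0∞} (hf : Measurable f) :
    ∫⁻ z, f z ∂particles s P x v t Q σ2 R T 0 =
      ∫⁻ z, f (Function.update z 0 (upTo T (t 1)))
        ∂(Measure.pi fun _ : Fin (Q + 1) => growRoot s P x (postLaw v σ2 R) (t 1)) := by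
  have := isProbabilityMeasure_growRoot (s := s) (x := x) hP
    (isProbabilityMeasure_postLaw v σ2 R) (t 1)
  refine (pi_ite_eq (Measure.dirac (upTo T (t 1))) (growRoot s P x (postLaw v σ2 R) (t 1))
    hf).trans (lintegral_congr fun z => ?_)
  exact lintegral_dirac' _ (hf.comp ((measurable_update_param (B := Tree d)
    (0 : Fin (Q + 1))).comp (f := fun a : Tree d => (z, a)) measurable_prodMk_left))

theorem lintegral_particles_succ (hP : IsPolyhedron P) (hv : 0 < v) (hσ : 0 < σ2) (T : Tree d)
    (j : ℕ) {f : (Fin (Q + 1) → Tree d) → ℝ≥0∞} (hf : Measurable f) :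
    ∫⁻ z, f z ∂particles s P x v t Q σ2 R T (j + 1) =
      ∫⁻ z, afterStep s P x v t σ2 R j f z (upTo T (t (j + 2)))
        ∂particles s P x v t Q σ2 R T j := by
  have hm : Measurable fun z : Fin (Q + 1) → Tree d => Measure.pi fun n : Fin (Q + 1) =>
      if n = 0 then Measure.dirac (upTo T (t (j + 2))) else offspring s P x v t σ2 R j z :=
    (measurable_newParticles hP v t j).comp
      (f := fun z : Fin (Q + 1) → Tree d => (((σ2, R), T), z)) measurable_prodMk_left
  rw [particles_succ, Measure.lintegral_bind hm.aemeasurable hf.aemeasurable]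
  refine lintegral_congr fun z => ?_
  have := isProbabilityMeasure_offspring (s := s) (x := x) (t := t) (R := R) hP hv hσ j z
  refine (pi_ite_eq (Measure.dirac (upTo T (t (j + 2)))) (offspring s P x v t σ2 R j z)
    hf).trans (lintegral_congr fun z' => ?_)
  exact lintegral_dirac' _ (hf.comp ((measurable_update_param (B := Tree d)
    (0 : Fin (Q + 1))).comp (f := fun a : Tree d => (z', a)) measurable_prodMk_left))

/-- Particle `0` is the conditional particle. -/
theorem ae_particles_zero (hP : IsPolyhedron P) (hv : 0 < v) (hσ : 0 < σ2) (T : Tree d) (j : ℕ) :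
    ∀ᵐ z ∂particles s P x v t Q σ2 R T j, z 0 = upTo T (t (j + 1)) := by
  have h0 : MeasurableSet {z : Fin (Q + 1) → Tree d | z 0 = upTo T (t (j + 1))} :=
    (measurable_pi_apply 0 : Measurable fun z : Fin (Q + 1) → Tree d => z 0)
      (measurableSet_singleton (upTo T (t (j + 1))))
  have hQ : MeasurableSet {z : Fin (Q + 1) → Tree d | ¬ z 0 = upTo T (t (j + 1))} := h0.compl
  have hf : Measurable ({z : Fin (Q + 1) → Tree d | ¬ z 0 = upTo T (t (j + 1))}.indicator
    (1 : (Fin (Q + 1) → Tree d) → ℝ≥0∞)) := measurable_one.indicator hQ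
  rw [ae_iff, ← lintegral_indicator_one hQ]
  cases j with
  | zero =>
    rw [lintegral_particles_zero hP T hf]
    refine (lintegral_congr fun z => ?_).trans lintegral_zero
    exact Set.indicator_of_notMem (by simp) _
  | succ j =>
    rw [lintegral_particles_succ hP hv hσ T j hf]
    refine (lintegral_congr fun z => ?_).trans lintegral_zero
    refine (lintegral_congr fun z' => ?_).trans lintegral_zero
    exact Set.indicator_of_notMem (by simp) _

/-- The particles depend on the past of the conditional particle only. -/
theorem particles_congr (ht : StrictMono t) {T T' : Tree d} (j : ℕ)
    (h : upTo T (t (j + 1)) = upTo T' (t (j + 1))) :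
    particles s P x v t Q σ2 R T j = particles s P x v t Q σ2 R T' j := by
  induction j with
  | zero => rw [particles, particles, h]
  | succ j ih =>
    have hle : t (j + 1) ≤ t (j + 2) := ht.monotone (by omega)
    have h1 : upTo T (t (j + 1)) = upTo T' (t (j + 1)) := by
      rw [← upTo_upTo T hle, ← upTo_upTo T' hle, h]
    rw [particles_succ, particles_succ, ih h1, h]

end Particles

/-! ### Invariance of conditional sequential Monte Carlo -/

section Invariance

variable {d N Q : ℕ} {P : Set (Pt d)} {x : Fin N → Pt d} {s : Scheme} {v : ℝ≥0} {t : ℕ → ℝ}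
  {σ2 : ℝ} {R : Fin N → ℝ}

attribute [local irreducible] grow growRoot cell dataIn upTo weight particles target proposal

/-- Exchangeability of a finite family of random elements. -/
def Exchangeable {ι B : Type*} [MeasurableSpace B] (μ : Measure (ι → B)) : Prop :=
  ∀ (e : Equiv.Perm ι) ⦃f : (ι → B) → ℝ≥0∞⦄, Measurable f →
    ∫⁻ z, f (z ∘ e) ∂μ = ∫⁻ z, f z ∂μ

theorem exchangeable_pi {ι B : Type*} [Fintype ι] [MeasurableSpace B] (α : Measure B)
    [IsFiniteMeasure α] : Exchangeable (Measure.pi fun _ : ι => α) := by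
  intro e f hf
  conv_rhs => rw [← map_comp_perm_pi α e]
  exact (lintegral_map hf (measurable_pi_lambda _ fun i => measurable_pi_apply _)).symm

/-- In an exchangeable family every index plays the role of `0` equally often. -/
theorem Exchangeable.lintegral_zero {B : Type*} [MeasurableSpace B]
    {μ : Measure (Fin (Q + 1) → B)} (h : Exchangeable μ) {F : (Fin (Q + 1) → B) → B → ℝ≥0∞}
    (hF : Measurable fun p : (Fin (Q + 1) → B) × B => F p.1 p.2)
    (hs : ∀ (e : Equiv.Perm (Fin (Q + 1))) z a, F (z ∘ e) a = F z a) :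
    ((Q + 1 : ℕ) : ℝ≥0∞) * ∫⁻ z, F z (z 0) ∂μ = ∫⁻ z, ∑ n, F z (z n) ∂μ := by
  have hm : ∀ n, Measurable fun z : Fin (Q + 1) → B => F z (z n) := fun n =>
    hF.comp (f := fun z : Fin (Q + 1) → B => (z, z n)) (by fun_prop)
  rw [lintegral_finsetSum _ fun n _ => hm n]
  have e : ∀ n, ∫⁻ z, F z (z n) ∂μ = ∫⁻ z, F z (z 0) ∂μ := fun n => by
    rw [← h (Equiv.swap 0 n) (hm 0)]
    simp [hs]
  simp [e]

theorem lintegral_pi_update {B : Type*} [MeasurableSpace B] (α : Measure B)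
    [IsProbabilityMeasure α] {f : (Fin (Q + 1) → B) → ℝ≥0∞} (hf : Measurable f) :
    ∫⁻ a, ∫⁻ z, f (Function.update z 0 a) ∂(Measure.pi fun _ : Fin (Q + 1) => α) ∂α =
      ∫⁻ z, f z ∂(Measure.pi fun _ : Fin (Q + 1) => α) := by
  have hm := measurable_update_param (B := B) (0 : Fin (Q + 1))
  conv_rhs => rw [← map_update_pi (fun _ : Fin (Q + 1) => α) 0, lintegral_map hf hm]
  exact (lintegral_prod_symm _ (hf.comp hm).aemeasurable).symm

theorem measurable_particles_right (hP : IsPolyhedron P) (v : ℝ≥0) (t : ℕ → ℝ) (σ2 : ℝ)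
    (R : Fin N → ℝ) (j : ℕ) :
    Measurable fun T : Tree d => particles s P x v t Q σ2 R T j :=
  (measurable_particles hP v t j).comp
    (f := fun T : Tree d => ((σ2, R), T)) measurable_prodMk_left

theorem isProbabilityMeasure_particles (hP : IsPolyhedron P) (hv : 0 < v) (hσ : 0 < σ2)
    (T : Tree d) (j : ℕ) : IsProbabilityMeasure (particles s P x v t Q σ2 R T j) := by
  constructor
  rw [← lintegral_one]
  induction j with
  | zero =>
    have := isProbabilityMeasure_growRoot (s := s) (x := x) hP
      (isProbabilityMeasure_postLaw v σ2 R) (t 1)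
    rw [lintegral_particles_zero hP T measurable_const]
    simp
  | succ j ih =>
    rw [lintegral_particles_succ hP hv hσ T j measurable_const]
    refine Eq.trans (lintegral_congr fun z => ?_) ih
    have := isProbabilityMeasure_offspring (s := s) (x := x) (t := t) (R := R) hP hv hσ j z
    simp [afterStep]

/-- The joint law of the particles, if the conditional particle is a proposal and its past has
the target law. -/
noncomputable def extendedLaw (s : Scheme) (P : Set (Pt d)) (x : Fin N → Pt d) (v : ℝ≥0)
    (t : ℕ → ℝ) (Q : ℕ) (σ2 : ℝ) (R : Fin N → ℝ) (j : ℕ) : Measure (Fin (Q + 1) → Tree d) :=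
  (proposal s P x v t σ2 R j).bind fun T => particles s P x v t Q σ2 R T j

theorem lintegral_extendedLaw (hP : IsPolyhedron P) (j : ℕ) {f : (Fin (Q + 1) → Tree d) → ℝ≥0∞}
    (hf : Measurable f) : ∫⁻ z, f z ∂extendedLaw s P x v t Q σ2 R j =
      ∫⁻ T, ∫⁻ z, f z ∂particles s P x v t Q σ2 R T j ∂proposal s P x v t σ2 R j :=
  Measure.lintegral_bind (measurable_particles_right hP v t σ2 R j).aemeasurable hf.aemeasurable

/-- If the conditional particle has the target law, the particles have the extended law, reweighted
by the weight of the conditional particle. -/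
theorem lintegral_target_particles (hP : IsPolyhedron P) (hv : 0 < v) (hσ : 0 < σ2)
    (ht0 : t 0 = 0) (ht : StrictMono t) (j : ℕ) {F : (Fin (Q + 1) → Tree d) → Tree d → ℝ≥0∞}
    (hF : Measurable fun p : (Fin (Q + 1) → Tree d) × Tree d => F p.1 p.2) :
    ∫⁻ T, ∫⁻ z, F z T ∂particles s P x v t Q σ2 R T j ∂target s P x v σ2 R (t (j + 1)) =
      ∫⁻ z, ENNReal.ofReal (weight P x v t σ2 R j (z 0)) * F z (z 0)
        ∂extendedLaw s P x v t Q σ2 R j := by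
  have hw := (measurable_weight_right (P := P) (x := x) v t σ2 R j).ennreal_ofReal
  have hf : Measurable fun T : Tree d => ∫⁻ z, F z T ∂particles s P x v t Q σ2 R T j :=
    measurable_lintegral_param (μ := fun T : Tree d => particles s P x v t Q σ2 R T j)
      (measurable_particles_right hP v t σ2 R j)
      (fun T => particles_univ_le hP T j) (f := fun p : Tree d × (Fin (Q + 1) → Tree d) =>
        F p.2 p.1) (hF.comp measurable_swap)
  have h0 : Measurable fun z : Fin (Q + 1) → Tree d => z 0 := measurable_pi_apply 0
  have hF0 : Measurable fun z : Fin (Q + 1) → Tree d => F z (z 0) :=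
    hF.comp (f := fun z : Fin (Q + 1) → Tree d => (z, z 0)) (by fun_prop)
  have hg : Measurable fun z : Fin (Q + 1) → Tree d =>
      ENNReal.ofReal (weight P x v t σ2 R j (z 0)) * F z (z 0) := (hw.comp h0).mul hF0
  rw [lintegral_target_eq_weight hP hv hσ ht0 ht j hf, lintegral_extendedLaw hP j hg]
  refine lintegral_congr_ae ?_
  filter_upwards [ae_proposal_upTo_eq_self (s := s) (x := x) (v := v) (σ2 := σ2) (R := R)
    hP ht0 ht j] with T hT
  have hFT : Measurable fun z : Fin (Q + 1) → Tree d => F z T :=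
    hF.comp (f := fun z : Fin (Q + 1) → Tree d => (z, T)) measurable_prodMk_right
  rw [← lintegral_const_mul _ hFT]
  refine lintegral_congr_ae ?_
  filter_upwards [ae_particles_zero (s := s) (x := x) (t := t) (R := R) hP hv hσ T j] with z hz
  rw [hz, hT]

theorem ofReal_weight (hv : 0 < v) (hσ : 0 < σ2) (j : ℕ) (z : Fin (Q + 1) → Tree d)
    (n : Fin (Q + 1)) : ENNReal.ofReal (weight P x v t σ2 R j (z n)) =
      ENNReal.ofReal (∑ n', weight P x v t σ2 R j (z n')) * normWeight P x v t σ2 R j z n := by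
  have hpos : 0 < ∑ n, weight P x v t σ2 R j (z n) :=
    Finset.sum_pos (fun n _ => weight_pos hv hσ R j (z n)) Finset.univ_nonempty
  rw [normWeight, ← ENNReal.ofReal_mul hpos.le, mul_div_cancel₀ _ hpos.ne']

theorem normWeight_comp (j : ℕ) (z : Fin (Q + 1) → Tree d) (e : Equiv.Perm (Fin (Q + 1)))
    (n : Fin (Q + 1)) : normWeight P x v t σ2 R j (z ∘ e) n = normWeight P x v t σ2 R j z (e n) := by
  unfold normWeight
  simp only [Function.comp_apply]
  rw [Equiv.sum_comp e fun n => weight P x v t σ2 R j (z n)]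

theorem offspring_comp (j : ℕ) (z : Fin (Q + 1) → Tree d) (e : Equiv.Perm (Fin (Q + 1))) :
    offspring s P x v t σ2 R j (z ∘ e) = offspring s P x v t σ2 R j z := by
  unfold offspring
  simp only [normWeight_comp, Function.comp_apply]
  exact Equiv.sum_comp e fun n => normWeight P x v t σ2 R j z n •
    grow s P x (postLaw v σ2 R) (z n) (t (j + 1)) (t (j + 2))

/-- One step of the extended law: the conditional particle is reweighted and extended by a proposal,
and the other particles are offspring of the system. -/
theorem lintegral_extendedLaw_succ (hP : IsPolyhedron P) (hv : 0 < v) (hσ : 0 < σ2)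
    (ht0 : t 0 = 0) (ht : StrictMono t) (j : ℕ) {f : (Fin (Q + 1) → Tree d) → ℝ≥0∞}
    (hf : Measurable f) : ∫⁻ z, f z ∂extendedLaw s P x v t Q σ2 R (j + 1) =
      ∫⁻ z, ENNReal.ofReal (weight P x v t σ2 R j (z 0)) *
        ∫⁻ T, afterStep s P x v t σ2 R j f z T
          ∂grow s P x (postLaw v σ2 R) (z 0) (t (j + 1)) (t (j + 2))
        ∂extendedLaw s P x v t Q σ2 R j := by
  have hpost := isProbabilityMeasure_postLaw (N := N) v σ2 R
  have hpos : ∀ j, 0 ≤ t j := fun j => ht0 ▸ ht.monotone (Nat.zero_le j)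
  have hle : t (j + 1) ≤ t (j + 2) := ht.monotone (by omega)
  have hA := measurable_afterStep (s := s) (x := x) hP v t σ2 R j hf
  have hH : Measurable fun p : (Fin (Q + 1) → Tree d) × Tree d =>
      ∫⁻ T, afterStep s P x v t σ2 R j f p.1 T
        ∂grow s P x (postLaw v σ2 R) p.2 (t (j + 1)) (t (j + 2)) := by
    refine measurable_lintegral_param (μ := fun p : (Fin (Q + 1) → Tree d) × Tree d =>
      grow s P x (postLaw v σ2 R) p.2 (t (j + 1)) (t (j + 2)))
      ((measurable_growFrom hP hpost _ _).comp measurable_snd) (fun p => ?_)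
      (f := fun q : ((Fin (Q + 1) → Tree d) × Tree d) × Tree d =>
        afterStep s P x v t σ2 R j f q.1.1 q.2)
      (hA.comp (f := fun q : ((Fin (Q + 1) → Tree d) × Tree d) × Tree d => (q.1.1, q.2))
        (by fun_prop))
    have := isProbabilityMeasure_grow' (s := s) (x := x) hP hpost p.2 (t (j + 1)) (t (j + 2))
    exact prob_le_one
  have hpart : Measurable fun T : Tree d => ∫⁻ z, f z ∂particles s P x v t Q σ2 R T (j + 1) :=
    (Measure.measurable_lintegral hf).comp (measurable_particles_right hP v t σ2 R (j + 1))
  rw [← lintegral_target_particles hP hv hσ ht0 ht j (F := fun z a =>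
      ∫⁻ T, afterStep s P x v t σ2 R j f z T
        ∂grow s P x (postLaw v σ2 R) a (t (j + 1)) (t (j + 2))) hH,
    lintegral_extendedLaw hP _ hf, lintegral_proposal_succ hP hpart]
  refine lintegral_congr_ae ?_
  filter_upwards [ae_target_upTo_eq_self (s := s) (x := x) (v := v) (σ2 := σ2) (R := R) hP
    (hpos (j + 1))] with T₀ hT₀
  have := isProbabilityMeasure_particles (s := s) (x := x) (t := t) (R := R) (Q := Q) hP hv hσ T₀ j
  have := isProbabilityMeasure_grow' (s := s) (x := x) hP hpost T₀ (t (j + 1)) (t (j + 2))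
  have hsw := lintegral_lintegral_swap (μ := grow s P x (postLaw v σ2 R) T₀ (t (j + 1)) (t (j + 2)))
    (ν := particles s P x v t Q σ2 R T₀ j)
    (f := fun T z => afterStep s P x v t σ2 R j f z T) (hA.comp measurable_swap).aemeasurable
  rw [← hsw]
  refine lintegral_congr_ae ?_
  filter_upwards [ae_grow_upTo_eq (s := s) (x := x) hP hpost (le_refl (t (j + 1))) hle T₀,
    ae_grow_upTo_eq_self (s := s) (x := x) hP hpost hle (upTo_eq_self_mono hT₀ hle)] with T h1 h2
  rw [lintegral_particles_succ hP hv hσ T j hf, h2, particles_congr ht j h1]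

/-- The particles of the extended law are exchangeable: the conditional particle is
indistinguishable from the others. -/
theorem exchangeable_extendedLaw (hP : IsPolyhedron P) (hv : 0 < v) (hσ : 0 < σ2)
    (ht0 : t 0 = 0) (ht : StrictMono t) (j : ℕ) :
    Exchangeable (extendedLaw s P x v t Q σ2 R j) := by
  have hpost := isProbabilityMeasure_postLaw (N := N) v σ2 R
  induction j with
  | zero =>
    have := isProbabilityMeasure_growRoot (s := s) (x := x) hP hpost (t 1)
    have key : ∀ ⦃f : (Fin (Q + 1) → Tree d) → ℝ≥0∞⦄, Measurable f →
        ∫⁻ z, f z ∂extendedLaw s P x v t Q σ2 R 0 =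
          ∫⁻ z, f z ∂(Measure.pi fun _ : Fin (Q + 1) => growRoot s P x (postLaw v σ2 R) (t 1)) := by
      intro f hf
      rw [lintegral_extendedLaw hP 0 hf, ← lintegral_pi_update _ hf]
      have h0 : proposal s P x v t σ2 R 0 = growRoot s P x (postLaw v σ2 R) (t 1) := by
        rw [proposal]
      rw [← h0]
      refine lintegral_congr_ae ?_
      filter_upwards [ae_proposal_upTo_eq_self (s := s) (x := x) (v := v) (σ2 := σ2) (R := R)
        hP ht0 ht 0] with T hT
      rw [lintegral_particles_zero hP T hf, hT, h0]
    intro e f hf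
    have hfe : Measurable fun z : Fin (Q + 1) → Tree d => f (z ∘ e) :=
      hf.comp (measurable_pi_lambda _ fun i => measurable_pi_apply _)
    rw [key hf, key hfe, exchangeable_pi _ e hf]
  | succ j ih =>
    have key : ∀ ⦃f : (Fin (Q + 1) → Tree d) → ℝ≥0∞⦄, Measurable f →
        ((Q + 1 : ℕ) : ℝ≥0∞) * ∫⁻ z, f z ∂extendedLaw s P x v t Q σ2 R (j + 1) =
          ∫⁻ z, ENNReal.ofReal (∑ n, weight P x v t σ2 R j (z n)) *
            ∫⁻ z', f z' ∂(Measure.pi fun _ : Fin (Q + 1) => offspring s P x v t σ2 R j z)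
            ∂extendedLaw s P x v t Q σ2 R j := by
      intro f hf
      have hA := measurable_afterStep (s := s) (x := x) hP v t σ2 R j hf
      have hw := (measurable_weight_right (P := P) (x := x) v t σ2 R j).ennreal_ofReal
      have hF : Measurable fun p : (Fin (Q + 1) → Tree d) × Tree d =>
          ENNReal.ofReal (weight P x v t σ2 R j p.2) *
          ∫⁻ T, afterStep s P x v t σ2 R j f p.1 T
            ∂grow s P x (postLaw v σ2 R) p.2 (t (j + 1)) (t (j + 2)) := by
        refine (hw.comp measurable_snd).mul ?_
        refine measurable_lintegral_param (μ := fun p : (Fin (Q + 1) → Tree d) × Tree d =>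
          grow s P x (postLaw v σ2 R) p.2 (t (j + 1)) (t (j + 2)))
          ((measurable_growFrom hP hpost _ _).comp measurable_snd) (fun p => ?_)
          (f := fun q : ((Fin (Q + 1) → Tree d) × Tree d) × Tree d =>
            afterStep s P x v t σ2 R j f q.1.1 q.2)
          (hA.comp (f := fun q : ((Fin (Q + 1) → Tree d) × Tree d) × Tree d => (q.1.1, q.2))
            (by fun_prop))
        have := isProbabilityMeasure_grow' (s := s) (x := x) hP hpost p.2 (t (j + 1)) (t (j + 2))
        exact prob_le_one
      rw [lintegral_extendedLaw_succ hP hv hσ ht0 ht j hf, ih.lintegral_zero (F := fun z a =>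
        ENNReal.ofReal (weight P x v t σ2 R j a) * ∫⁻ T, afterStep s P x v t σ2 R j f z T
            ∂grow s P x (postLaw v σ2 R) a (t (j + 1)) (t (j + 2))) hF
        fun e z a => by simp only [afterStep, offspring_comp]]
      refine lintegral_congr fun z => ?_
      have := isProbabilityMeasure_offspring (s := s) (x := x) (t := t) (R := R) hP hv hσ j z
      rw [← lintegral_pi_update _ hf]
      simp only [ofReal_weight hv hσ j z, mul_assoc]
      rw [← Finset.mul_sum]
      congr 1
      conv_rhs => rw [offspring, lintegral_finsetSum_measure]
      simp only [lintegral_smul_measure, smul_eq_mul]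
      rfl
    intro e f hf
    have hfe : Measurable fun z : Fin (Q + 1) → Tree d => f (z ∘ e) :=
      hf.comp (measurable_pi_lambda _ fun i => measurable_pi_apply _)
    have h1 := key hf
    have h2 := key hfe
    have h3 : ∀ z : Fin (Q + 1) → Tree d,
        ∫⁻ z', f (z' ∘ e) ∂(Measure.pi fun _ : Fin (Q + 1) => offspring s P x v t σ2 R j z) =
        ∫⁻ z', f z' ∂(Measure.pi fun _ : Fin (Q + 1) => offspring s P x v t σ2 R j z) := by
      intro z
      have := isProbabilityMeasure_offspring (s := s) (x := x) (t := t) (R := R) hP hv hσ j z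
      exact exchangeable_pi _ e hf
    simp only [h3] at h2
    exact (ENNReal.mul_right_inj (Nat.cast_ne_zero.2 (Nat.succ_ne_zero Q))
      (ENNReal.natCast_ne_top _)).1 (h2.trans h1.symm)

theorem measurable_csmc_right (hP : IsPolyhedron P) (v : ℝ≥0) (t : ℕ → ℝ) (S : ℕ) (σ2 : ℝ)
    (R : Fin N → ℝ) : Measurable fun T : Tree d => csmc s P x v t Q S σ2 R T :=
  (measurable_csmc hP v t S).comp (f := fun T : Tree d => ((σ2, R), T)) measurable_prodMk_left

theorem lintegral_csmc (S : ℕ) (T : Tree d) {f : Tree d → ℝ≥0∞} (hf : Measurable f) :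
    ∫⁻ T', f T' ∂csmc s P x v t Q S σ2 R T =
      ∫⁻ z, ∑ n, normWeight P x v t σ2 R S z n * f (z n) ∂particles s P x v t Q σ2 R T S := by
  rw [csmc_eq, Measure.lintegral_bind (measurable_selection_right v t σ2 R S).aemeasurable
    hf.aemeasurable]
  refine lintegral_congr fun z => ?_
  rw [selection, lintegral_finsetSum_measure]
  simp only [lintegral_smul_measure, lintegral_dirac' _ hf, smul_eq_mul]

theorem measurable_normWeight_right (v : ℝ≥0) (t : ℕ → ℝ) (σ2 : ℝ) (R : Fin N → ℝ) (j : ℕ)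
    (n : Fin (Q + 1)) : Measurable fun z : Fin (Q + 1) → Tree d => normWeight P x v t σ2 R j z n :=
  (measurable_normWeight v t j n).comp
    (f := fun z : Fin (Q + 1) → Tree d => ((σ2, R), z)) measurable_prodMk_left

/-- Conditional sequential Monte Carlo leaves the target law invariant. -/
theorem lintegral_target_csmc (hP : IsPolyhedron P) (hv : 0 < v) (hσ : 0 < σ2) (ht0 : t 0 = 0)
    (ht : StrictMono t) (S : ℕ) {f : Tree d → ℝ≥0∞} (hf : Measurable f) :
    ∫⁻ T, ∫⁻ T', f T' ∂csmc s P x v t Q S σ2 R T ∂target s P x v σ2 R (t (S + 1)) =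
      ∫⁻ T, f T ∂target s P x v σ2 R (t (S + 1)) := by
  have hex := exchangeable_extendedLaw (s := s) (x := x) (R := R) (Q := Q) hP hv hσ ht0 ht S
  have hw : Measurable fun T => ENNReal.ofReal (weight P x v t σ2 R S T) :=
    (measurable_weight_right (P := P) (x := x) v t σ2 R S).ennreal_ofReal
  have hG : Measurable fun z : Fin (Q + 1) → Tree d =>
      ∑ n, normWeight P x v t σ2 R S z n * f (z n) :=
    Finset.measurable_fun_sum _ fun n _ => (measurable_normWeight_right v t σ2 R S n).mul
      (hf.comp (measurable_pi_apply n))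
  have hG2 : Measurable fun p : (Fin (Q + 1) → Tree d) × Tree d =>
      ∑ n, normWeight P x v t σ2 R S p.1 n * f (p.1 n) := hG.comp measurable_fst
  have hf2 : Measurable fun p : (Fin (Q + 1) → Tree d) × Tree d => f p.2 := hf.comp measurable_snd
  have hw2 : Measurable fun p : (Fin (Q + 1) → Tree d) × Tree d =>
    ENNReal.ofReal (weight P x v t σ2 R S p.2) := hw.comp measurable_snd
  have e1 := lintegral_target_particles (s := s) (x := x) (R := R) hP hv hσ ht0 ht S
    (F := fun z _ => ∑ n, normWeight P x v t σ2 R S z n * f (z n)) hG2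
  have e2 := lintegral_target_particles (s := s) (x := x) (R := R) (Q := Q) hP hv hσ ht0 ht S
    (F := fun _ T => f T) hf2
  have h1 : ∀ T : Tree d, ∫⁻ _, f T ∂particles s P x v t Q σ2 R T S = f T := fun T => by
    have := isProbabilityMeasure_particles (s := s) (x := x) (t := t) (R := R) (Q := Q) hP hv hσ T S
    simp
  simp only [h1] at e2
  simp only [lintegral_csmc S _ hf]
  rw [e1, e2]
  refine (ENNReal.mul_right_inj (Nat.cast_ne_zero.2 (Nat.succ_ne_zero Q))
    (ENNReal.natCast_ne_top _)).1 ?_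
  rw [hex.lintegral_zero (F := fun z a => ENNReal.ofReal (weight P x v t σ2 R S a) *
      ∑ n, normWeight P x v t σ2 R S z n * f (z n)) (hw2.mul hG2) ?_,
    hex.lintegral_zero (F := fun z a => ENNReal.ofReal (weight P x v t σ2 R S a) * f a)
      (hw2.mul hf2) fun _ _ _ => rfl]
  · refine lintegral_congr fun z => ?_
    simp only [ofReal_weight hv hσ S z, mul_assoc, ← Finset.mul_sum, ← Finset.sum_mul]
    rw [sum_normWeight hv hσ, one_mul]
  · intro e z a
    simp only [normWeight_comp, Function.comp_apply]
    rw [Equiv.sum_comp e fun n => normWeight P x v t σ2 R S z n * f (z n)]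

end Invariance

/-! ### Trees without cuts are reached in one step -/

section Irreducible

variable {d N Q : ℕ} {P : Set (Pt d)} {x : Fin N → Pt d} {s : Scheme} {v : ℝ≥0} {t : ℕ → ℝ}
  {σ2 : ℝ} {R : Fin N → ℝ}

attribute [local irreducible] cell dataIn upTo weight growExactly particles

/-- With positive probability there is no cut, so what holds almost surely after the growth holds
before it. -/
theorem mem_of_ae_grow {ν : Finset (Fin N) → Measure ℝ} {t₀ t₁ : ℝ} (ht : t₀ ≤ t₁)
    {T : Tree d}
    {A : Set (Tree d)} (hA : MeasurableSet A) (h : ∀ᵐ T' ∂grow s P x ν T t₀ t₁, T' ∈ A) :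
    T ∈ A := by
  by_contra hT
  have hAc : MeasurableSet {T : Tree d | T ∉ A} := hA.compl
  have h0 : ∀ᵐ T' ∂growExactly s P x ν t₁ 0 T t₀, T' ∈ A :=
    Measure.absolutelyContinuous_of_le (Measure.le_sum _ 0) h
  have h1 := ae_iff.1 h0
  rw [← lintegral_indicator_one hAc, lintegral_growExactly_zero (measurable_one.indicator hAc) ht,
    Set.indicator_of_mem (show T ∈ {T : Tree d | T ∉ A} from hT)] at h1
  simp [not_le.2 (Real.exp_pos _)] at h1

theorem ae_rootMean_of_growRoot (hP : IsPolyhedron P) {ν : Finset (Fin N) → Measure ℝ}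
    (hν : ∀ S, IsProbabilityMeasure (ν S)) {t₁ : ℝ} (ht : 0 ≤ t₁) {A : Set (Tree d)}
    (hA : MeasurableSet A) (h : ∀ᵐ T ∂growRoot s P x ν t₁, T ∈ A) :
    ∀ᵐ a ∂ν (dataIn x P), ((a, []) : Tree d) ∈ A := by
  have hAc : MeasurableSet {T : Tree d | T ∉ A} := hA.compl
  have h1 := ae_iff.1 h
  have hm : Measurable fun a : ℝ => ∫⁻ T, {T : Tree d | T ∉ A}.indicator 1 T
      ∂grow s P x ν (a, []) 0 t₁ :=
    ((Measure.measurable_lintegral (measurable_one.indicator hAc)).comp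
      (measurable_growFrom hP hν 0 t₁)).comp
      (f := fun a : ℝ => ((a, []) : Tree d)) measurable_mkRoot
  rw [← lintegral_indicator_one hAc, lintegral_growRoot hP hν (measurable_one.indicator hAc),
    lintegral_eq_zero_iff hm] at h1
  filter_upwards [h1] with a ha
  rw [lintegral_indicator_one hAc] at ha
  exact mem_of_ae_grow ht hA (ae_iff.2 ha)

theorem gaussianReal_absolutelyContinuous_gaussianReal {v w : ℝ≥0} (hv : v ≠ 0) (hw : w ≠ 0)
    (a b : ℝ) :
    gaussianReal a v ≪ gaussianReal b w :=
  (gaussianReal_absolutelyContinuous a hv).trans (gaussianReal_absolutelyContinuous' b hw)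

theorem ae_eval_pi {B : Type*} [MeasurableSpace B] {α : Measure B} [IsProbabilityMeasure α]
    {A : Set B} (hA : MeasurableSet A) (n : Fin (Q + 1))
    (h : ∀ᵐ z ∂(Measure.pi fun _ : Fin (Q + 1) => α), z n ∈ A) : ∀ᵐ a ∂α, a ∈ A := by
  have hm := measurePreserving_eval (fun _ : Fin (Q + 1) => α) n
  rw [ae_iff] at h ⊢
  rwa [← hm.measure_preimage (show MeasurableSet {a | a ∉ A} from hA.compl).nullMeasurableSet]

theorem normWeight_ne_zero (hv : 0 < v) (hσ : 0 < σ2) (j : ℕ) (z : Fin (Q + 1) → Tree d)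
    (n : Fin (Q + 1)) : normWeight P x v t σ2 R j z n ≠ 0 := by
  rw [normWeight, Ne, ENNReal.ofReal_eq_zero, not_le]
  exact div_pos (weight_pos hv hσ R j _)
    (Finset.sum_pos (fun n _ => weight_pos hv hσ R j (z n)) Finset.univ_nonempty)

/-- Every particle but the conditional one may stay uncut. -/
theorem ae_rootMean_of_particles (hP : IsPolyhedron P) (hv : 0 < v) (hσ : 0 < σ2)
    (ht0 : t 0 = 0) (ht : StrictMono t) (T₀ : Tree d) {n : Fin (Q + 1)} (hn : n ≠ 0) (j : ℕ)
    {A : Set (Tree d)} (hA : MeasurableSet A)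
    (h : ∀ᵐ z ∂particles s P x v t Q σ2 R T₀ j, z n ∈ A) :
    ∀ᵐ a ∂gaussianReal 0 1, ((a, []) : Tree d) ∈ A := by
  have hpost := isProbabilityMeasure_postLaw (N := N) v σ2 R
  have hAn : MeasurableSet {z : Fin (Q + 1) → Tree d | z n ∈ A} :=
    (measurable_pi_apply n : Measurable fun z : Fin (Q + 1) → Tree d => z n) hA
  have hAc : MeasurableSet {z : Fin (Q + 1) → Tree d | ¬ z n ∈ A} := hAn.compl
  have hf : Measurable ({z : Fin (Q + 1) → Tree d | ¬ z n ∈ A}.indicator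
    (1 : (Fin (Q + 1) → Tree d) → ℝ≥0∞)) := measurable_one.indicator hAc
  have hup : ∀ (z : Fin (Q + 1) → Tree d) a,
      {z : Fin (Q + 1) → Tree d | ¬ z n ∈ A}.indicator (1 : (Fin (Q + 1) → Tree d) → ℝ≥0∞)
        (Function.update z 0 a) = {z : Fin (Q + 1) → Tree d | ¬ z n ∈ A}.indicator 1 z := by
    intro z a
    have e : Function.update z 0 a n = z n := Function.update_of_ne hn _ _
    by_cases hz : z n ∈ A
    · rw [Set.indicator_of_notMem, Set.indicator_of_notMem] <;> simp [hz, e]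
    · rw [Set.indicator_of_mem, Set.indicator_of_mem] <;> simp [hz, e]
  induction j with
  | zero =>
    have := isProbabilityMeasure_growRoot (s := s) (x := x) hP hpost (t 1)
    have h1 := ae_iff.1 h
    rw [← lintegral_indicator_one hAc, lintegral_particles_zero hP T₀ hf] at h1
    simp only [hup] at h1
    rw [lintegral_indicator_one hAc] at h1
    have h2 := ae_rootMean_of_growRoot hP hpost (ht0 ▸ ht.monotone (Nat.zero_le 1)) hA
      (ae_eval_pi hA n (ae_iff.2 h1))
    exact (gaussianReal_absolutelyContinuous_gaussianReal one_ne_zero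
      (Real.toNNReal_pos.2 (postVar_pos hv hσ _)).ne' _ _).ae_le h2
  | succ j ih =>
    refine ih ?_
    have h1 := ae_iff.1 h
    have hm : Measurable fun z : Fin (Q + 1) → Tree d => afterStep s P x v t σ2 R j
        ({z : Fin (Q + 1) → Tree d | ¬ z n ∈ A}.indicator 1) z (upTo T₀ (t (j + 2))) :=
      (measurable_afterStep (s := s) (x := x) hP v t σ2 R j hf).comp
        (f := fun z : Fin (Q + 1) → Tree d => (z, upTo T₀ (t (j + 2)))) measurable_prodMk_right
    rw [← lintegral_indicator_one hAc, lintegral_particles_succ hP hv hσ T₀ j hf,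
      lintegral_eq_zero_iff hm] at h1
    filter_upwards [h1] with z hz
    have := isProbabilityMeasure_offspring (s := s) (x := x) (t := t) (R := R) hP hv hσ j z
    simp only [afterStep, hup] at hz
    rw [lintegral_indicator_one hAc] at hz
    have h2 := ae_iff.1 (ae_eval_pi hA n (ae_iff.2 hz))
    rw [offspring, Measure.finsetSum_apply, Finset.sum_eq_zero_iff] at h2
    have h3 := h2 n (Finset.mem_univ n)
    rw [Measure.smul_apply, smul_eq_mul, mul_eq_zero] at h3
    exact mem_of_ae_grow (ht.monotone (by omega)) hA
      (ae_iff.2 (h3.resolve_left (normWeight_ne_zero hv hσ j z n)))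

/-- The sampler may return an uncut tree with any root mean, whatever the current tree is. -/
theorem map_mkRoot_absolutelyContinuous_csmc (hP : IsPolyhedron P) (hv : 0 < v) (hσ : 0 < σ2)
    (ht0 : t 0 = 0) (ht : StrictMono t) (hQ : 1 ≤ Q) (S : ℕ) (T₀ : Tree d) :
    (gaussianReal 0 1).map (fun a => ((a, []) : Tree d)) ≪ csmc s P x v t Q S σ2 R T₀ := by
  refine Measure.AbsolutelyContinuous.mk fun A hA h => ?_
  have hm : Measurable fun z : Fin (Q + 1) → Tree d => selection P x v t σ2 R S z A :=
    (Measure.measurable_coe hA).comp (measurable_selection_right v t σ2 R S)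
  rw [csmc_eq, Measure.bind_apply hA (measurable_selection_right v t σ2 R S).aemeasurable,
    lintegral_eq_zero_iff hm] at h
  have hn : Fin.last Q ≠ 0 := by
    rw [Ne, Fin.ext_iff, Fin.val_last, Fin.val_zero]
    omega
  have h2 := ae_rootMean_of_particles (s := s) (x := x) (R := R) hP hv hσ ht0 ht T₀ hn S hA.compl ?_
  · rw [Measure.map_apply measurable_mkRoot hA]
    simpa [ae_iff, Set.preimage] using h2
  · filter_upwards [h] with z hz
    have hz' : selection P x v t σ2 R S z A = 0 := hz
    rw [selection, Measure.finsetSum_apply, Finset.sum_eq_zero_iff] at hz'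
    have h3 := hz' (Fin.last Q) (Finset.mem_univ _)
    rw [Measure.smul_apply, smul_eq_mul, mul_eq_zero] at h3
    have h4 := h3.resolve_left (normWeight_ne_zero hv hσ S z _)
    intro hmem
    rw [Measure.dirac_apply_of_mem hmem] at h4
    exact one_ne_zero h4

end Irreducible

/-! ### The inverse Gamma law -/

section InvGamma

theorem measurable_invGamma (a : ℝ) : Measurable fun b => invGamma a b := by
  refine (Measure.measurable_map _ measurable_inv).comp ?_
  refine Measure.measurable_of_measurable_coe _ fun s hs => ?_
  simp only [gammaMeasure, withDensity_apply _ hs]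
  have h : Measurable fun p : ℝ × ℝ => gammaPDF a p.1 p.2 := by
    unfold gammaPDF gammaPDFReal
    refine (Measurable.ite (measurableSet_le (by fun_prop) (by fun_prop)) ?_ (by fun_prop)).ennreal_ofReal
    fun_prop
  exact h.lintegral_prod_right' (ν := volume.restrict s)

theorem isProbabilityMeasure_invGamma {a b : ℝ} (ha : 0 < a) (hb : 0 < b) :
    IsProbabilityMeasure (invGamma a b) := by
  have := isProbabilityMeasure_gammaMeasure ha hb
  exact Measure.isProbabilityMeasure_map measurable_inv.aemeasurable

theorem lintegral_invGamma (a b : ℝ) {f : ℝ → ℝ≥0∞} (hf : Measurable f) :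
    ∫⁻ z, f z ∂invGamma a b = ∫⁻ z, gammaPDF a b z * f z⁻¹ := by
  rw [invGamma, lintegral_map hf measurable_inv, gammaMeasure]
  exact lintegral_withDensity_eq_lintegral_mul _ (measurable_gammaPDFReal a b).ennreal_ofReal
    (hf.comp measurable_inv)

theorem ae_invGamma_iff {a b : ℝ} (ha : 0 < a) (hb : 0 < b) {A : Set ℝ} (hA : MeasurableSet A) :
    (∀ᵐ z ∂invGamma a b, z ∈ A) ↔ ∀ᵐ z : ℝ, 0 < z → z⁻¹ ∈ A := by
  rw [invGamma, ae_map_iff (f := fun z : ℝ => z⁻¹) (p := fun z => z ∈ A) measurable_inv.aemeasurable hA, gammaMeasure,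
    ae_withDensity_iff (f := gammaPDF a b) (measurable_gammaPDFReal a b).ennreal_ofReal]
  refine Filter.eventually_congr ?_
  filter_upwards [Measure.ae_ne volume (0 : ℝ)] with z hz
  refine imp_congr_left ?_
  rcases lt_or_gt_of_ne hz with h | h
  · simp [gammaPDF_of_neg h, h.not_gt]
  · simp [gammaPDF, gammaPDFReal_pos ha hb h, h]

theorem ae_invGamma_pos {a b : ℝ} (ha : 0 < a) (hb : 0 < b) : ∀ᵐ z ∂invGamma a b, 0 < z :=
  (ae_invGamma_iff ha hb measurableSet_Ioi).2 (Filter.Eventually.of_forall fun _ => inv_pos.2)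

theorem invGamma_absolutelyContinuous {a b a' b' : ℝ} (ha : 0 < a) (hb : 0 < b) (ha' : 0 < a')
    (hb' : 0 < b') : invGamma a b ≪ invGamma a' b' := by
  refine Measure.AbsolutelyContinuous.mk fun A hA h => ?_
  have h1 : ∀ᵐ z ∂invGamma a' b', z ∈ Aᶜ := by rw [ae_iff]; simpa using h
  have h2 := (ae_invGamma_iff ha hb hA.compl).2 ((ae_invGamma_iff ha' hb' hA.compl).1 h1)
  rw [ae_iff] at h2
  simpa using h2

/-- The constant which relates prior times likelihood to the posterior of the variance. -/
noncomputable def evidence (a b : ℝ) (N : ℕ) (r : ℝ) : ℝ :=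
  b ^ a / Real.Gamma a * (√(2 * Real.pi))⁻¹ ^ N *
    (Real.Gamma (a + N / 2) / (b + r) ^ (a + N / 2))

theorem evidence_pos {a b r : ℝ} (ha : 0 < a) (hb : 0 < b) (hr : 0 ≤ r) (N : ℕ) :
    0 < evidence a b N r := by
  have h1 := Real.Gamma_pos_of_pos ha
  have h2 : 0 < Real.Gamma (a + N / 2) := Real.Gamma_pos_of_pos (by positivity)
  have := Real.pi_pos
  unfold evidence
  positivity

theorem evidence_le {a b r : ℝ} (ha : 0 < a) (hb : 0 < b) (hr : 0 ≤ r) (N : ℕ) :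
    evidence a b N r ≤ evidence a b N 0 := by
  have h1 := Real.Gamma_pos_of_pos ha
  have h2 : 0 < Real.Gamma (a + N / 2) := Real.Gamma_pos_of_pos (by positivity)
  have := Real.pi_pos
  unfold evidence
  gcongr

theorem measurable_evidence (a b : ℝ) (N : ℕ) : Measurable fun r => evidence a b N r := by
  unfold evidence
  fun_prop

theorem prod_gaussianPDFReal {N : ℕ} (μ y : Fin N → ℝ) {z : ℝ} (hz : 0 < z) :
    ∏ i, gaussianPDFReal (μ i) z⁻¹.toNNReal (y i) =
      (√(2 * Real.pi))⁻¹ ^ N * z ^ ((N : ℝ) / 2) * Real.exp (-((∑ i, (y i - μ i) ^ 2) / 2 * z)) := by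
  have h : ∀ i, gaussianPDFReal (μ i) z⁻¹.toNNReal (y i) =
      (√(2 * Real.pi))⁻¹ * √z * Real.exp (-((y i - μ i) ^ 2 / 2 * z)) := by
    intro i
    rw [gaussianPDFReal, Real.coe_toNNReal _ (inv_nonneg.2 hz.le), Real.sqrt_mul (by positivity),
      Real.sqrt_inv, mul_inv, inv_inv]
    congr 2
    field_simp
  simp only [h]
  rw [Finset.prod_mul_distrib, Finset.prod_const, ← Real.exp_sum, mul_pow, Finset.card_univ,
    Fintype.card_fin]
  congr 2
  · rw [Real.sqrt_eq_rpow z, ← Real.rpow_natCast, ← Real.rpow_mul hz.le]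
    congr 1
    ring
  · rw [Finset.sum_neg_distrib, ← Finset.sum_mul, ← Finset.sum_div]

/-- The inverse Gamma law is conjugate to the Gaussian likelihood. -/
theorem lintegral_gaussian_invGamma {N : ℕ} {a b : ℝ} (ha : 0 < a) (hb : 0 < b)
    (μ y : Fin N → ℝ) {f : ℝ → ℝ≥0∞} (hf : Measurable f) :
    ∫⁻ z, ENNReal.ofReal (∏ i, gaussianPDFReal (μ i) z.toNNReal (y i)) * f z ∂invGamma a b =
      ENNReal.ofReal (evidence a b N ((∑ i, (y i - μ i) ^ 2) / 2)) *
        ∫⁻ z, f z ∂invGamma (a + N / 2) (b + (∑ i, (y i - μ i) ^ 2) / 2) := by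
  set r := (∑ i, (y i - μ i) ^ 2) / 2 with hr
  have hr0 : 0 ≤ r := by positivity
  have hg : Measurable fun z : ℝ => ENNReal.ofReal (∏ i, gaussianPDFReal (μ i) z.toNNReal (y i)) := by
    refine Measurable.ennreal_ofReal (Finset.measurable_fun_prod _ fun i _ => ?_)
    unfold gaussianPDFReal
    fun_prop
  have hgf : Measurable fun z : ℝ =>
    ENNReal.ofReal (∏ i, gaussianPDFReal (μ i) z.toNNReal (y i)) * f z := hg.mul hf
  have hpf : Measurable fun z : ℝ => gammaPDF (a + N / 2) (b + r) z * f z⁻¹ :=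
    (measurable_gammaPDFReal _ _).ennreal_ofReal.mul (hf.comp measurable_inv)
  rw [lintegral_invGamma _ _ hgf, lintegral_invGamma _ _ hf, ← lintegral_const_mul _ hpf]
  refine lintegral_congr_ae ?_
  filter_upwards [Measure.ae_ne volume (0 : ℝ)] with z hz
  rcases lt_or_gt_of_ne hz with h | h
  · simp [gammaPDF_of_neg h]
  rw [← mul_assoc, ← mul_assoc]
  congr 1
  rw [gammaPDF, gammaPDF, ← ENNReal.ofReal_mul (gammaPDFReal_pos ha hb h).le,
    ← ENNReal.ofReal_mul (evidence_pos ha hb hr0 N).le]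
  congr 1
  rw [prod_gaussianPDFReal μ y h, ← hr, gammaPDFReal, gammaPDFReal, if_pos h.le, if_pos h.le,
    evidence]
  have h1 : 0 < Real.Gamma (a + N / 2) := Real.Gamma_pos_of_pos (by positivity)
  have h2 : 0 < (b + r) ^ (a + N / 2) := by positivity
  have h3 : z ^ (a + N / 2 - 1) = z ^ ((N : ℝ) / 2) * z ^ (a - 1) := by
    rw [← Real.rpow_add h]; congr 1; ring
  have h4 : Real.exp (-((b + r) * z)) = Real.exp (-(b * z)) * Real.exp (-(r * z)) := by
    rw [← Real.exp_add]; congr 1; ring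
  rw [h3, h4]
  field_simp

end InvGamma

/-! ### The posterior law of the variance and the forest -/

section Posterior

variable {d N Q m : ℕ} {P : Set (Pt d)} {x : Fin N → Pt d} {y : Fin N → ℝ} {s : Scheme} {v : ℝ≥0}
  {lam τ : ℝ} {t : ℕ → ℝ}

attribute [local irreducible] treePrior csmc treeValue restrictToHulls

/-- Half of the sum of the squared residuals. -/
noncomputable def misfit (P : Set (Pt d)) (x : Fin N → Pt d) (y : Fin N → ℝ)
    (θ : Fin m → Tree d) : ℝ :=
  (∑ i, (y i - ∑ j, treeValue P (θ j) (x i)) ^ 2) / 2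

/-- The likelihood of the labels. -/
noncomputable def forestLikelihood (P : Set (Pt d)) (x : Fin N → Pt d) (y : Fin N → ℝ)
    (st : State d m) : ℝ :=
  ∏ i, gaussianPDFReal (∑ j, treeValue P (st.2 j) (x i)) st.1.toNNReal (y i)

/-- The prior law of the variance and the forest. -/
noncomputable def jointPrior (s : Scheme) (P : Set (Pt d)) (x : Fin N → Pt d) (v : ℝ≥0)
    (lam τ : ℝ) (m : ℕ) : Measure (State d m) :=
  (invGamma (3 / 2) lam).prod (Measure.pi fun _ : Fin m => treePrior s P x v τ)

/-- Prior times likelihood: the posterior law up to its normalization. -/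
noncomputable def posterior (s : Scheme) (P : Set (Pt d)) (x : Fin N → Pt d) (y : Fin N → ℝ)
    (v : ℝ≥0) (lam τ : ℝ) (m : ℕ) : Measure (State d m) :=
  (jointPrior s P x v lam τ m).withDensity fun st => ENNReal.ofReal (forestLikelihood P x y st)

theorem isProbabilityMeasure_treePrior (hP : IsPolyhedron P) (v : ℝ≥0) (τ : ℝ) :
    IsProbabilityMeasure (treePrior s P x v τ) := by
  unfold treePrior
  exact isProbabilityMeasure_growRoot hP (fun _ => inferInstance) τ

theorem misfit_nonneg (θ : Fin m → Tree d) : 0 ≤ misfit P x y θ := by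
  unfold misfit
  positivity

theorem measurable_sum_treeValue (J : Finset (Fin m)) (z : Pt d) :
    Measurable fun θ : Fin m → Tree d => ∑ j ∈ J, treeValue P (θ j) z :=
  Finset.measurable_fun_sum _ fun j _ => (measurable_treeValue z).comp (measurable_pi_apply j)

theorem measurable_misfit : Measurable fun θ : Fin m → Tree d => misfit P x y θ := by
  unfold misfit
  exact (Finset.measurable_fun_sum _ fun i _ =>
    ((measurable_sum_treeValue _ (x i)).const_sub (y i)).pow_const 2).div_const 2

theorem measurable_gaussianPDFReal_comp {A : Type*} [MeasurableSpace A] {μ σ2 : A → ℝ}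
    (hμ : Measurable μ) (hσ : Measurable σ2) (r : ℝ) :
    Measurable fun a => gaussianPDFReal (μ a) (σ2 a).toNNReal r := by
  unfold gaussianPDFReal
  fun_prop

theorem measurable_forestLikelihood :
    Measurable fun st : State d m => forestLikelihood P x y st := by
  unfold forestLikelihood
  exact Finset.measurable_fun_prod _ fun i _ => measurable_gaussianPDFReal_comp
    ((measurable_sum_treeValue _ (x i)).comp measurable_snd) measurable_fst (y i)

theorem lintegral_posterior (hP : IsPolyhedron P) {f : State d m → ℝ≥0∞}
    (hf : Measurable f) : ∫⁻ st, f st ∂posterior s P x y v lam τ m =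
      ∫⁻ σ2, ∫⁻ θ, ENNReal.ofReal (forestLikelihood P x y (σ2, θ)) * f (σ2, θ)
        ∂(Measure.pi fun _ : Fin m => treePrior s P x v τ) ∂invGamma (3 / 2) lam := by
  have := isProbabilityMeasure_treePrior (s := s) (x := x) hP v τ
  have hL := (measurable_forestLikelihood (P := P) (x := x) (y := y) (m := m)).ennreal_ofReal
  rw [posterior, jointPrior]
  exact (lintegral_withDensity_eq_lintegral_mul _ hL hf).trans
    (lintegral_prod _ (hL.mul hf).aemeasurable)

/-- Given the forest, the posterior law of the variance is inverse Gamma. -/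
theorem lintegral_posterior_invGamma (hP : IsPolyhedron P) (hl : 0 < lam)
    {f : State d m → ℝ≥0∞} (hf : Measurable f) : ∫⁻ st, f st ∂posterior s P x y v lam τ m =
      ∫⁻ θ, ENNReal.ofReal (evidence (3 / 2) lam N (misfit P x y θ)) *
          ∫⁻ σ2, f (σ2, θ) ∂invGamma ((3 + N) / 2) (lam + misfit P x y θ)
        ∂(Measure.pi fun _ : Fin m => treePrior s P x v τ) := by
  have := isProbabilityMeasure_treePrior (s := s) (x := x) hP v τ
  have := isProbabilityMeasure_invGamma (by norm_num : (0 : ℝ) < 3 / 2) hl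
  have hL := (measurable_forestLikelihood (P := P) (x := x) (y := y) (m := m)).ennreal_ofReal
  have hLf : Measurable fun st : State d m =>
    ENNReal.ofReal (forestLikelihood P x y st) * f st := hL.mul hf
  rw [lintegral_posterior hP hf, lintegral_lintegral_swap hLf.aemeasurable]
  refine lintegral_congr fun θ => ?_
  have h := lintegral_gaussian_invGamma (by norm_num : (0 : ℝ) < 3 / 2) hl
    (fun i => ∑ j, treeValue P (θ j) (x i)) y
    (hf.comp (f := fun σ2 : ℝ => ((σ2, θ) : State d m)) measurable_prodMk_right)
  rw [show ((3 + N : ℝ)) / 2 = 3 / 2 + N / 2 by ring]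
  exact h

theorem posterior_univ_lt_top (hP : IsPolyhedron P) (hl : 0 < lam) :
    posterior s P x y v lam τ m Set.univ < ∞ := by
  have := isProbabilityMeasure_treePrior (s := s) (x := x) hP v τ
  have h := lintegral_posterior_invGamma (s := s) (x := x) (y := y) (v := v) (τ := τ) (m := m)
    hP hl (measurable_const (a := 1))
  rw [lintegral_one] at h
  rw [h]
  refine (lintegral_mono (g := fun _ => ENNReal.ofReal (evidence (3 / 2) lam N 0))
    fun θ => ?_).trans_lt (by simp)
  have := isProbabilityMeasure_invGamma (a := (3 + N) / 2) (by positivity)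
    (add_pos_of_pos_of_nonneg hl (misfit_nonneg (P := P) (x := x) (y := y) θ))
  rw [lintegral_one, measure_univ, mul_one]
  exact ENNReal.ofReal_le_ofReal (evidence_le (by norm_num) hl (misfit_nonneg θ) N)

theorem posterior_univ_ne_zero (hP : IsPolyhedron P) (hl : 0 < lam) :
    posterior s P x y v lam τ m Set.univ ≠ 0 := by
  have := isProbabilityMeasure_treePrior (s := s) (x := x) hP v τ
  have h := lintegral_posterior_invGamma (s := s) (x := x) (y := y) (v := v) (τ := τ) (m := m)
    hP hl (measurable_const (a := 1))
  rw [lintegral_one] at h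
  have h1 : ∀ θ : Fin m → Tree d, ENNReal.ofReal (evidence (3 / 2) lam N (misfit P x y θ)) *
      ∫⁻ _, 1 ∂invGamma ((3 + N) / 2) (lam + misfit P x y θ) =
      ENNReal.ofReal (evidence (3 / 2) lam N (misfit P x y θ)) := by
    intro θ
    have := isProbabilityMeasure_invGamma (a := (3 + N) / 2) (by positivity)
      (add_pos_of_pos_of_nonneg hl (misfit_nonneg (P := P) (x := x) (y := y) θ))
    simp
  simp only [h1] at h
  have hm : Measurable fun θ : Fin m → Tree d =>
      ENNReal.ofReal (evidence (3 / 2) lam N (misfit P x y θ)) :=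
    ((measurable_evidence _ _ N).comp measurable_misfit).ennreal_ofReal
  rw [h, Ne, lintegral_eq_zero_iff hm]
  intro h0
  have : ∀ᵐ _ ∂(Measure.pi fun _ : Fin m => treePrior s P x v τ), False := by
    filter_upwards [h0] with θ hθ
    have := evidence_pos (a := 3 / 2) (by norm_num) hl (misfit_nonneg (P := P) (x := x) (y := y) θ) N
    rw [Pi.zero_apply, ENNReal.ofReal_eq_zero] at hθ
    linarith
  exact IsProbabilityMeasure.ne_zero _ (by simpa using this)

/-! The restriction to the hulls. -/

theorem measurable_restrictState : Measurable (restrictState (m := m) P x) :=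
  measurable_fst.prodMk (measurable_pi_lambda _ fun j =>
    (measurable_restrictToHulls x).comp ((measurable_pi_apply j).comp measurable_snd))

/-- The likelihood of the labels, in terms of the restriction to the hulls. -/
noncomputable def hullLikelihood (y : Fin N → ℝ) (h : ℝ × (Fin m → HullTree d N)) : ℝ :=
  ∏ i, gaussianPDFReal (∑ j, (h.2 j).2 i) h.1.toNNReal (y i)

theorem forestLikelihood_eq (st : State d m) :
    forestLikelihood P x y st = hullLikelihood y (restrictState P x st) := by
  unfold forestLikelihood hullLikelihood restrictState restrictToHulls
  rfl

theorem measurable_hullLikelihood :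
    Measurable fun h : ℝ × (Fin m → HullTree d N) => hullLikelihood y h := by
  unfold hullLikelihood
  exact Finset.measurable_fun_prod _ fun i _ => measurable_gaussianPDFReal_comp
    (by fun_prop) measurable_fst (y i)

theorem map_restrictState_jointPrior (hP : IsPolyhedron P) (hl : 0 < lam) (hτ : 0 ≤ τ) :
    (jointPrior .full P x v lam τ m).map (restrictState P x) =
      (jointPrior .hull P x v lam τ m).map (restrictState P x) := by
  have := isProbabilityMeasure_invGamma (by norm_num : (0 : ℝ) < 3 / 2) hl
  have hr := measurable_restrictToHulls (P := P) x
  have h : ∀ s : Scheme, (jointPrior s P x v lam τ m).map (restrictState P x) =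
      (invGamma (3 / 2) lam).prod (Measure.pi fun _ : Fin m =>
        (treePrior s P x v τ).map (restrictToHulls P x)) := by
    intro s
    have := isProbabilityMeasure_treePrior (s := s) (x := x) hP v τ
    have := Measure.isProbabilityMeasure_map (μ := treePrior s P x v τ) hr.aemeasurable
    rw [jointPrior, ← Measure.pi_map_pi fun _ => hr.aemeasurable]
    have h2 := Measure.map_prod_map (invGamma (3 / 2) lam)
      (Measure.pi fun _ : Fin m => treePrior s P x v τ) measurable_id
      (measurable_pi_lambda (fun (θ : Fin m → Tree d) j => restrictToHulls P x (θ j))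
        fun j => hr.comp (measurable_pi_apply j))
    rw [Measure.map_id] at h2
    exact h2.symm
  rw [h, h]
  have e : (treePrior .full P x v τ).map (restrictToHulls P x) =
      (treePrior .hull P x v τ).map (restrictToHulls P x) := by
    unfold treePrior
    exact map_restrictToHulls_growRoot hP hτ
  rw [e]

theorem map_restrictState_posterior (hP : IsPolyhedron P) (hl : 0 < lam) (hτ : 0 ≤ τ) :
    (posterior .full P x y v lam τ m).map (restrictState P x) =
      (posterior .hull P x y v lam τ m).map (restrictState P x) := by
  have hr := measurable_restrictState (m := m) (P := P) (x := x)
  have hL := (measurable_hullLikelihood (m := m) (d := d) (y := y)).ennreal_ofReal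
  have h : ∀ s : Scheme, (posterior s P x y v lam τ m).map (restrictState P x) =
      ((jointPrior s P x v lam τ m).map (restrictState P x)).withDensity
        fun h => ENNReal.ofReal (hullLikelihood y h) := by
    intro s
    refine Measure.ext fun A hA => ?_
    rw [Measure.map_apply hr hA, withDensity_apply _ hA, posterior,
      withDensity_apply _ (hr hA), setLIntegral_map hA hL hr]
    simp only [forestLikelihood_eq]
  rw [h, h, map_restrictState_jointPrior hP hl hτ]

theorem ae_posterior_hull_noDroppedCuts (hP : IsPolyhedron P) (hl : 0 < lam) (hτ : 0 ≤ τ) :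
    ∀ᵐ st ∂posterior .hull P x y v lam τ m,
      ∀ j, (restrictToHulls P x (st.2 j)).1.length = (st.2 j).2.length := by
  have := isProbabilityMeasure_invGamma (by norm_num : (0 : ℝ) < 3 / 2) hl
  have := isProbabilityMeasure_treePrior (s := .hull) (x := x) hP v τ
  refine (withDensity_absolutelyContinuous _ _).ae_le ?_
  refine (Measure.quasiMeasurePreserving_snd (μ := invGamma (3 / 2) lam)
    (ν := Measure.pi fun _ : Fin m => treePrior .hull P x v τ)).ae
    (p := fun θ => ∀ j, (restrictToHulls P x (θ j)).1.length = (θ j).2.length) ?_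
  refine ae_all_iff.2 fun j => ?_
  refine (measurePreserving_eval (fun _ : Fin m => treePrior .hull P x v τ)
    j).quasiMeasurePreserving.ae
    (p := fun T => (restrictToHulls P x T).1.length = T.2.length) ?_
  unfold treePrior
  exact ae_growRoot_hull_noDroppedCuts hP hτ

end Posterior

/-! ### The Markov chain -/

section Chain

variable {d N Q m : ℕ} {P : Set (Pt d)} {x : Fin N → Pt d} {y : Fin N → ℝ} {s : Scheme} {v : ℝ≥0}
  {lam : ℝ} {t : ℕ → ℝ}

attribute [local irreducible] treePrior csmc treeValue restrictToHulls

/-- The labels minus the contributions of all trees but the `j`-th. -/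
noncomputable def residual (P : Set (Pt d)) (x : Fin N → Pt d) (y : Fin N → ℝ) (j : Fin m)
    (θ : Fin m → Tree d) (i : Fin N) : ℝ :=
  y i - ∑ j' ∈ Finset.univ.erase j, treeValue P (θ j') (x i)

theorem treeStep_eq (S : ℕ) (j : Fin m) (st : State d m) : treeStep s P x y v t Q S j st =
    (csmc s P x v t Q S st.1 (residual P x y j st.2) (st.2 j)).map
      fun T => (st.1, Function.update st.2 j T) := rfl

theorem residual_update (j : Fin m) (θ : Fin m → Tree d) (T : Tree d) :
    residual P x y j (Function.update θ j T) = residual P x y j θ := by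
  funext i
  unfold residual
  congr 1
  refine Finset.sum_congr rfl fun j' hj' => ?_
  rw [Function.update_of_ne (Finset.ne_of_mem_erase hj')]

theorem forestLikelihood_update (j : Fin m) (σ2 : ℝ) (θ : Fin m → Tree d) (T : Tree d) :
    forestLikelihood P x y (σ2, Function.update θ j T) =
      likelihood P x σ2 (residual P x y j θ) T := by
  unfold forestLikelihood likelihood
  refine Finset.prod_congr rfl fun i _ => ?_
  rw [← residual_update j θ T, residual, gaussianPDFReal, gaussianPDFReal,
    ← Finset.add_sum_erase _ _ (Finset.mem_univ j)]
  simp only [Function.update_self]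
  congr 3
  ring

theorem measurable_residual (j : Fin m) :
    Measurable fun θ : Fin m → Tree d => residual P x y j θ :=
  measurable_pi_lambda _ fun i => (measurable_sum_treeValue _ (x i)).const_sub (y i)

theorem measurable_updateState (j : Fin m) :
    Measurable fun p : State d m × Tree d =>
      ((p.1.1, Function.update p.1.2 j p.2) : State d m) :=
  (measurable_fst.comp measurable_fst).prodMk ((measurable_update_param (B := Tree d) j).comp
    (f := fun p : State d m × Tree d => (p.1.2, p.2)) (by fun_prop))

theorem measurable_treeStep (hP : IsPolyhedron P) (v : ℝ≥0) (t : ℕ → ℝ) (S : ℕ) (j : Fin m) :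
    Measurable fun st : State d m => treeStep s P x y v t Q S j st := by
  refine measurable_map_param (μ := fun st : State d m =>
    csmc s P x v t Q S st.1 (residual P x y j st.2) (st.2 j)) ?_ (fun st => csmc_univ_le hP S _)
    (measurable_updateState j)
  exact (measurable_csmc hP v t S).comp
    (f := fun st : State d m => ((st.1, residual P x y j st.2), st.2 j))
    ((measurable_fst.prodMk ((measurable_residual j).comp measurable_snd)).prodMk
      ((measurable_pi_apply j).comp measurable_snd))

theorem measurable_updateState_right (j : Fin m) (st : State d m) :
    Measurable fun T : Tree d => ((st.1, Function.update st.2 j T) : State d m) :=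
  (measurable_updateState j).comp (f := fun T : Tree d => (st, T)) measurable_prodMk_left

theorem treeStep_univ_le (hP : IsPolyhedron P) (S : ℕ) (j : Fin m) (st : State d m) :
    treeStep s P x y v t Q S j st Set.univ ≤ 1 := by
  rw [treeStep_eq, Measure.map_apply (measurable_updateState_right j st) MeasurableSet.univ,
    Set.preimage_univ]
  exact csmc_univ_le hP S _

theorem isProbabilityMeasure_fullConditional (hl : 0 < lam) (θ : Fin m → Tree d) :
    IsProbabilityMeasure (invGamma ((3 + N) / 2) (lam + misfit P x y θ)) :=
  isProbabilityMeasure_invGamma (by positivity)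
    (add_pos_of_pos_of_nonneg hl (misfit_nonneg θ))

theorem varianceStep_eq (st : State d m) : varianceStep P x y lam st =
    (invGamma ((3 + N) / 2) (lam + misfit P x y st.2)).map fun σ2 => (σ2, st.2) := rfl

theorem measurable_varianceStep (hl : 0 < lam) :
    Measurable fun st : State d m => varianceStep P x y lam st := by
  refine measurable_map_param (μ := fun st : State d m =>
    invGamma ((3 + N) / 2) (lam + misfit P x y st.2)) ?_ (fun st => ?_)
    (f := fun q : State d m × ℝ => (q.2, q.1.2)) (by fun_prop)
  · exact (measurable_invGamma _).comp ((measurable_misfit.comp measurable_snd).const_add lam)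
  · have := isProbabilityMeasure_fullConditional (P := P) (x := x) (y := y) hl st.2
    exact prob_le_one

theorem varianceStep_univ (hl : 0 < lam) (st : State d m) :
    varianceStep P x y lam st Set.univ = 1 := by
  have := isProbabilityMeasure_fullConditional (P := P) (x := x) (y := y) hl st.2
  rw [varianceStep_eq, Measure.map_apply measurable_prodMk_right MeasurableSet.univ,
    Set.preimage_univ, measure_univ]

theorem posterior_bind_varianceStep (hP : IsPolyhedron P) (hl : 0 < lam) (τ : ℝ) :
    (posterior s P x y v lam τ m).bind (varianceStep P x y lam) = posterior s P x y v lam τ m := by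
  refine Measure.ext_of_lintegral _ fun f hf => ?_
  have hK := measurable_varianceStep (P := P) (x := x) (y := y) (m := m) hl
  have hKf : Measurable fun st : State d m => ∫⁻ st', f st' ∂varianceStep P x y lam st :=
    (Measure.measurable_lintegral hf).comp hK
  rw [Measure.lintegral_bind hK.aemeasurable hf.aemeasurable,
    lintegral_posterior_invGamma hP hl hf, lintegral_posterior_invGamma hP hl hKf]
  refine lintegral_congr fun θ => ?_
  have := isProbabilityMeasure_fullConditional (P := P) (x := x) (y := y) hl θ
  simp only [varianceStep_eq]
  rw [lintegral_const, measure_univ, mul_one, lintegral_map hf measurable_prodMk_right]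

/-- The law of a forest does not change if one tree is replaced by an independent copy. -/
theorem lintegral_pi_update' {B : Type*} [MeasurableSpace B] (α : Measure B)
    [IsProbabilityMeasure α] (j : Fin m) {f : (Fin m → B) → ℝ≥0∞} (hf : Measurable f) :
    ∫⁻ z, ∫⁻ a, f (Function.update z j a) ∂α ∂(Measure.pi fun _ : Fin m => α) =
      ∫⁻ z, f z ∂(Measure.pi fun _ : Fin m => α) := by
  have hm := measurable_update_param (B := B) j
  conv_rhs => rw [← map_update_pi (fun _ : Fin m => α) j, lintegral_map hf hm]
  exact (lintegral_prod _ (hf.comp hm).aemeasurable).symm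

theorem posterior_bind_treeStep (hP : IsPolyhedron P) (hv : 0 < v) (hl : 0 < lam) (ht0 : t 0 = 0)
    (ht : StrictMono t) (S : ℕ) (j : Fin m) :
    (posterior s P x y v lam (t (S + 1)) m).bind (treeStep s P x y v t Q S j) =
      posterior s P x y v lam (t (S + 1)) m := by
  have := isProbabilityMeasure_treePrior (s := s) (x := x) hP v (t (S + 1))
  refine Measure.ext_of_lintegral _ fun f hf => ?_
  have hK := measurable_treeStep (s := s) (x := x) (y := y) (Q := Q) hP v t S j
  have hL := (measurable_forestLikelihood (P := P) (x := x) (y := y) (m := m)).ennreal_ofReal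
  have hKf : Measurable fun st : State d m => ∫⁻ st', f st' ∂treeStep s P x y v t Q S j st :=
    (Measure.measurable_lintegral hf).comp hK
  have hLf : Measurable fun st : State d m =>
    ENNReal.ofReal (forestLikelihood P x y st) * f st := hL.mul hf
  have hLKf : Measurable fun st : State d m => ENNReal.ofReal (forestLikelihood P x y st) *
    ∫⁻ st', f st' ∂treeStep s P x y v t Q S j st := hL.mul hKf
  rw [Measure.lintegral_bind hK.aemeasurable hf.aemeasurable,
    lintegral_posterior hP hf, lintegral_posterior hP hKf]
  refine lintegral_congr_ae ?_
  filter_upwards [ae_invGamma_pos (by norm_num : (0 : ℝ) < 3 / 2) hl] with σ2 hσ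
  refine (lintegral_pi_update' (treePrior s P x v (t (S + 1))) j (hLKf.comp
    (f := fun θ : Fin m → Tree d => ((σ2, θ) : State d m)) measurable_prodMk_left)).symm.trans
    (Eq.trans ?_ (lintegral_pi_update' (treePrior s P x v (t (S + 1))) j (hLf.comp
      (f := fun θ : Fin m → Tree d => ((σ2, θ) : State d m)) measurable_prodMk_left)))
  refine lintegral_congr fun θ => ?_
  have hfθ : Measurable fun T : Tree d => f (σ2, Function.update θ j T) :=
    hf.comp (measurable_updateState_right j (σ2, θ))
  have h := lintegral_target_csmc (s := s) (x := x) (R := residual P x y j θ) (Q := Q) hP hv hσ ht0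
    ht S hfθ
  have hcf : Measurable fun T : Tree d => ∫⁻ T', f (σ2, Function.update θ j T')
      ∂csmc s P x v t Q S σ2 (residual P x y j θ) T :=
    (Measure.measurable_lintegral hfθ).comp (measurable_csmc_right hP v t S σ2 _)
  rw [lintegral_target hfθ, lintegral_target hcf] at h
  have e : treePrior s P x v (t (S + 1)) = growRoot s P x (fun _ => gaussianReal 0 v) (t (S + 1)) :=
    by rw [treePrior]
  rw [e]
  refine Eq.trans (lintegral_congr fun T => ?_) (h.trans (lintegral_congr fun T => ?_))
  · simp only [Function.comp_apply]
    rw [forestLikelihood_update, treeStep_eq,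
      lintegral_map hf (measurable_updateState_right j _)]
    simp only [residual_update, Function.update_self, Function.update_idem]
  · rw [forestLikelihood_update]

/-- Carrying out several steps of a chain one after the other. -/
noncomputable def steps {E ι : Type*} [MeasurableSpace E] (K : ι → E → Measure E) (l : List ι)
    (μ : Measure E) : Measure E :=
  l.foldl (fun μ j => μ.bind (K j)) μ

theorem steps_nil {E ι : Type*} [MeasurableSpace E] (K : ι → E → Measure E) (μ : Measure E) :
    steps K [] μ = μ := rfl

theorem steps_cons {E ι : Type*} [MeasurableSpace E] (K : ι → E → Measure E) (j : ι) (l : List ι)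
    (μ : Measure E) : steps K (j :: l) μ = steps K l (μ.bind (K j)) := rfl

theorem measurable_bind_of_le {E : Type*} [MeasurableSpace E] {κ K : E → Measure E}
    (hκ : Measurable κ) (hκ1 : ∀ a, κ a Set.univ ≤ 1) (hK : Measurable K)
    (h1 : ∀ a, K a Set.univ ≤ 1) :
    (Measurable fun a => (κ a).bind K) ∧ ∀ a, (κ a).bind K Set.univ ≤ 1 := by
  refine ⟨measurable_bind_param (μ := κ) (κ := fun q : E × E => K q.2) hκ hκ1
    (hK.comp measurable_snd), fun a => ?_⟩
  rw [Measure.bind_apply MeasurableSet.univ hK.aemeasurable]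
  calc _ ≤ ∫⁻ _, 1 ∂κ a := lintegral_mono fun b => h1 b
    _ ≤ 1 := by rw [lintegral_one]; exact hκ1 a

theorem measurable_steps {E ι : Type*} [MeasurableSpace E] {K : ι → E → Measure E}
    (hK : ∀ j, Measurable (K j)) (h1 : ∀ j a, K j a Set.univ ≤ 1) (l : List ι)
    {κ : E → Measure E} (hκ : Measurable κ) (hκ1 : ∀ a, κ a Set.univ ≤ 1) :
    (Measurable fun a => steps K l (κ a)) ∧ ∀ a, steps K l (κ a) Set.univ ≤ 1 := by
  induction l generalizing κ with
  | nil => exact ⟨hκ, hκ1⟩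
  | cons j l ih =>
    have h := measurable_bind_of_le hκ hκ1 (hK j) (h1 j)
    exact ih h.1 h.2

theorem bind_steps {E ι : Type*} [MeasurableSpace E] {K : ι → E → Measure E}
    (hK : ∀ j, Measurable (K j)) (h1 : ∀ j a, K j a Set.univ ≤ 1) (l : List ι)
    {κ : E → Measure E} (hκ : Measurable κ) (hκ1 : ∀ a, κ a Set.univ ≤ 1) (μ : Measure E) :
    (μ.bind fun a => steps K l (κ a)) = steps K l (μ.bind κ) := by
  induction l generalizing κ with
  | nil =>
    rw [steps_nil]
    exact congrArg μ.bind (funext fun a => steps_nil K (κ a))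
  | cons j l ih =>
    have h := measurable_bind_of_le hκ hκ1 (hK j) (h1 j)
    have e : (fun a => steps K (j :: l) (κ a)) = fun a => steps K l ((κ a).bind (K j)) :=
      funext fun a => steps_cons K j l (κ a)
    rw [e, steps_cons, ih h.1 h.2, Measure.bind_bind hκ.aemeasurable (hK j).aemeasurable]

theorem steps_eq_self {E ι : Type*} [MeasurableSpace E] {K : ι → E → Measure E} {μ : Measure E}
    (h : ∀ j, μ.bind (K j) = μ) (l : List ι) : steps K l μ = μ := by
  induction l with
  | nil => rfl
  | cons j l ih =>
    rw [steps_cons, h, ih]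

theorem sweep_eq (S : ℕ) (st : State d m) : sweep s P x y v lam t Q S st =
    steps (treeStep s P x y v t Q S) (List.finRange m) (varianceStep P x y lam st) := rfl

theorem posterior_bind_sweep (hP : IsPolyhedron P) (hv : 0 < v) (hl : 0 < lam) (ht0 : t 0 = 0)
    (ht : StrictMono t) (S : ℕ) :
    (posterior s P x y v lam (t (S + 1)) m).bind (sweep s P x y v lam t Q S) =
      posterior s P x y v lam (t (S + 1)) m := by
  have h := bind_steps (fun j : Fin m => measurable_treeStep (s := s) (x := x) (y := y)
    (Q := Q) hP v t S j) (fun j => treeStep_univ_le hP S j) (List.finRange m)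
    (measurable_varianceStep (P := P) (x := x) (y := y) hl)
    (fun st => (varianceStep_univ hl st).le) (posterior s P x y v lam (t (S + 1)) m)
  refine h.trans ?_
  rw [posterior_bind_varianceStep hP hl]
  exact steps_eq_self (fun j => posterior_bind_treeStep hP hv hl ht0 ht S j) _

/-- If the trees of a forest may be anything that is distributed according to `μ`, then they may
still be so after an update of the `j`-th tree, which moreover may be any tree without cuts. -/
theorem absolutelyContinuous_bind_treeStep (hP : IsPolyhedron P) (hv : 0 < v) (ht0 : t 0 = 0)
    (ht : StrictMono t) (hQ : 1 ≤ Q) (S : ℕ) (j : Fin m) {α : Measure ℝ} [IsProbabilityMeasure α]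
    (hα : ∀ᵐ σ2 ∂α, 0 < σ2) {μ : Fin m → Measure (Tree d)} [∀ i, IsProbabilityMeasure (μ i)]
    {κ : Measure (State d m)} (h : α.prod (Measure.pi μ) ≪ κ) :
    α.prod (Measure.pi (Function.update μ j ((gaussianReal 0 1).map fun a => ((a, []) : Tree d)))) ≪
      κ.bind (treeStep s P x y v t Q S j) := by
  have hK := measurable_treeStep (s := s) (x := x) (y := y) (Q := Q) hP v t S j
  have hρ : IsProbabilityMeasure ((gaussianReal 0 1).map fun a => ((a, []) : Tree d)) :=
    Measure.isProbabilityMeasure_map measurable_mkRoot.aemeasurable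
  set ρ := (gaussianReal 0 1).map fun a => ((a, []) : Tree d) with hρdef
  refine Measure.AbsolutelyContinuous.mk fun A hA h0 => ?_
  have hKA : Measurable fun st => treeStep s P x y v t Q S j st A :=
    (Measure.measurable_coe hA).comp hK
  rw [Measure.bind_apply hA hK.aemeasurable, lintegral_eq_zero_iff hKA] at h0
  have h1 := h.ae_le h0
  have hm := measurable_update_param (B := Tree d) j
  have hf : Measurable (A.indicator (1 : State d m → ℝ≥0∞)) := measurable_one.indicator hA
  have hfσ : ∀ σ2 : ℝ, Measurable fun θ : Fin m → Tree d =>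
      A.indicator (1 : State d m → ℝ≥0∞) (σ2, θ) := fun σ2 => hf.comp measurable_prodMk_left
  rw [← map_update_pi_eq, ← lintegral_indicator_one hA, lintegral_prod _ (by
    exact hf.aemeasurable)]
  have h2 : ∀ᵐ σ2 ∂α, ∀ᵐ θ ∂Measure.pi μ, treeStep s P x y v t Q S j (σ2, θ) A = 0 :=
    Measure.ae_ae_of_ae_prod h1
  refine (lintegral_congr_ae ?_).trans lintegral_zero
  filter_upwards [h2, hα] with σ2 h3 hσ
  rw [lintegral_map (hfσ σ2) hm]
  refine (lintegral_prod _ ((hfσ σ2).comp hm).aemeasurable).trans ?_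
  refine (lintegral_congr_ae ?_).trans lintegral_zero
  filter_upwards [h3] with θ hθ
  have hu := measurable_updateState_right j ((σ2, θ) : State d m)
  rw [treeStep_eq, Measure.map_apply hu hA] at hθ
  have h4 := map_mkRoot_absolutelyContinuous_csmc hP hv hσ ht0 ht hQ S (θ j) hθ
  rw [← hρdef, ← lintegral_indicator_one (hu hA)] at h4
  exact h4

theorem foldl_update_eq {ι B : Type*} [DecidableEq ι] (b : B) (l : List ι) (f : ι → B) (i : ι)
    (h : f i = b ∨ i ∈ l) : l.foldl (fun f j => Function.update f j b) f i = b := by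
  induction l generalizing f with
  | nil => simpa using h
  | cons j l ih =>
    refine ih _ ?_
    beta_reduce
    by_cases hij : i = j
    · subst hij; exact Or.inl (Function.update_self _ _ _)
    · rw [Function.update_of_ne hij]
      simpa [hij] using h

theorem absolutelyContinuous_steps_treeStep (hP : IsPolyhedron P) (hv : 0 < v) (ht0 : t 0 = 0)
    (ht : StrictMono t) (hQ : 1 ≤ Q) (S : ℕ) (l : List (Fin m)) {α : Measure ℝ}
    [IsProbabilityMeasure α] (hα : ∀ᵐ σ2 ∂α, 0 < σ2) {μ : Fin m → Measure (Tree d)}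
    (hμ : ∀ i, IsProbabilityMeasure (μ i)) {κ : Measure (State d m)}
    (h : α.prod (Measure.pi μ) ≪ κ) :
    α.prod (Measure.pi (l.foldl (fun μ j => Function.update μ j
        ((gaussianReal 0 1).map fun a => ((a, []) : Tree d))) μ)) ≪
      steps (treeStep s P x y v t Q S) l κ := by
  induction l generalizing μ κ with
  | nil => exact h
  | cons j l ih =>
    refine ih (fun i => ?_) (absolutelyContinuous_bind_treeStep hP hv ht0 ht hQ S j hα h)
    beta_reduce
    by_cases hij : i = j
    · subst hij
      rw [Function.update_self]
      exact Measure.isProbabilityMeasure_map measurable_mkRoot.aemeasurable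
    · rw [Function.update_of_ne hij]
      exact hμ i

/-- From every state, one iteration of the chain reaches all states without cuts. -/
theorem absolutelyContinuous_sweep (hP : IsPolyhedron P) (hv : 0 < v) (hl : 0 < lam)
    (ht0 : t 0 = 0) (ht : StrictMono t) (hQ : 1 ≤ Q) (S : ℕ) (st : State d m) :
    (invGamma 1 1).prod (Measure.pi fun _ : Fin m =>
      (gaussianReal 0 1).map fun a => ((a, []) : Tree d)) ≪ sweep s P x y v lam t Q S st := by
  have := isProbabilityMeasure_invGamma one_pos one_pos
  have h0 : (invGamma 1 1).prod (Measure.pi fun j => Measure.dirac (st.2 j)) ≪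
      varianceStep P x y lam st := by
    have e : Measure.pi (fun j => Measure.dirac (st.2 j)) = Measure.dirac st.2 := by
      refine (Measure.pi_eq fun A hA => ?_)
      rw [Measure.dirac_apply' _ (MeasurableSet.univ_pi hA)]
      by_cases h : ∀ j, st.2 j ∈ A j
      · rw [Set.indicator_of_mem (Set.mem_univ_pi.2 h), Finset.prod_congr rfl fun j _ =>
          Measure.dirac_apply_of_mem (h j), Finset.prod_const_one, Pi.one_apply]
      · rw [Set.indicator_of_notMem (mt Set.mem_univ_pi.1 h)]
        obtain ⟨j, hj⟩ := not_forall.1 h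
        refine (Finset.prod_eq_zero (Finset.mem_univ j) ?_).symm
        rw [Measure.dirac_apply' _ (hA j), Set.indicator_of_notMem hj]
    rw [e, Measure.prod_dirac, varianceStep_eq]
    exact (invGamma_absolutelyContinuous one_pos one_pos (by positivity)
      (add_pos_of_pos_of_nonneg hl (misfit_nonneg st.2))).map measurable_prodMk_right
  have h1 := absolutelyContinuous_steps_treeStep (s := s) (x := x) (y := y) hP hv ht0 ht hQ S
    (List.finRange m) (ae_invGamma_pos one_pos one_pos) (fun _ => inferInstance) h0
  rw [sweep_eq]
  rwa [show (List.finRange m).foldl (fun μ j => Function.update μ j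
      ((gaussianReal 0 1).map fun a => ((a, []) : Tree d))) (fun j => Measure.dirac (st.2 j)) =
      fun _ => (gaussianReal 0 1).map fun a => ((a, []) : Tree d) from
    funext fun j => foldl_update_eq _ _ _ _ (Or.inr (List.mem_finRange j))] at h1

/-- The posterior law is the only equilibrium distribution of the chain. -/
theorem isEquilibrium_sweep_iff (hP : IsPolyhedron P) (hv : 0 < v) (hl : 0 < lam)
    (ht0 : t 0 = 0) (ht : StrictMono t) (hQ : 1 ≤ Q) (S : ℕ) (π : Measure (State d m)) :
    IsEquilibrium (sweep s P x y v lam t Q S) π ↔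
      π = (posterior s P x y v lam (t (S + 1)) m Set.univ)⁻¹ •
        posterior s P x y v lam (t (S + 1)) m := by
  have hz := posterior_univ_ne_zero (s := s) (x := x) (y := y) (v := v) (τ := t (S + 1)) (m := m)
    hP hl
  have hz' := (posterior_univ_lt_top (s := s) (x := x) (y := y) (v := v) (τ := t (S + 1)) (m := m)
    hP hl).ne
  have hK := measurable_steps (fun j : Fin m => measurable_treeStep (s := s) (x := x) (y := y)
    (Q := Q) hP v t S j) (fun j => treeStep_univ_le hP S j) (List.finRange m)
    (measurable_varianceStep (P := P) (x := x) (y := y) hl)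
    fun st => (varianceStep_univ hl st).le
  have hsweep : Measurable (sweep s P x y v lam t Q S) := hK.1
  have heq : IsEquilibrium (sweep s P x y v lam t Q S)
      ((posterior s P x y v lam (t (S + 1)) m Set.univ)⁻¹ •
        posterior s P x y v lam (t (S + 1)) m) := by
    refine ⟨⟨?_⟩, ?_⟩
    · rw [Measure.smul_apply, smul_eq_mul, ENNReal.inv_mul_cancel hz hz']
    · rw [Measure.bind_smul, posterior_bind_sweep hP hv hl ht0 ht S]
  refine ⟨fun h => ?_, fun h => h ▸ heq⟩
  have := isProbabilityMeasure_invGamma one_pos one_pos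
  have hρ : IsProbabilityMeasure ((gaussianReal 0 1).map fun a => ((a, []) : Tree d)) :=
    Measure.isProbabilityMeasure_map measurable_mkRoot.aemeasurable
  exact IsEquilibrium.unique hsweep hK.2 (IsProbabilityMeasure.ne_zero _)
    (absolutelyContinuous_sweep hP hv hl ht0 ht hQ S) h heq

end Chain

end BSP

theorem proposition2 {d N m : ℕ} (hd : 2 ≤ d)
    (P : Set (BSP.Pt d)) (hP : BSP.IsPolyhedron P)
    (x : Fin N → BSP.Pt d) (hx : ∀ i, x i ∈ P) (y : Fin N → ℝ)
    (v : ℝ≥0) (hv : 0 < v) :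
    -- one cut, given the current partition
    (∀ T : BSP.Tree d,
      (∃ l ∈ BSP.leaves P T, ∃ i j, x i ∈ l.1 ∧ x j ∈ l.1 ∧ x i ≠ x j) →
        IsProbabilityMeasure (BSP.cutLaw (BSP.regions .full P x T)) ∧
        IsProbabilityMeasure (BSP.cutLaw (BSP.regions .hull P x T)) ∧
        ProbabilityTheory.cond (BSP.cutLaw (BSP.regions .full P x T))
            {kc | kc.2.Meets (BSP.dataHull x (BSP.cell P T kc.1))} =
          BSP.cutLaw (BSP.regions .hull P x T)) ∧
    -- the whole tree
    (∀ τ : ℝ, 0 < τ →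
      IsProbabilityMeasure
        ((BSP.treePrior .full P x v τ).map (BSP.restrictToHulls P x)) ∧
      (BSP.treePrior .full P x v τ).map (BSP.restrictToHulls P x) =
        (BSP.treePrior .hull P x v τ).map (BSP.restrictToHulls P x) ∧
      ∀ᵐ T ∂(BSP.treePrior .hull P x v τ),
        (BSP.restrictToHulls P x T).1.length = T.2.length) ∧
    -- the equilibrium distributions of the sampler
    (∀ lam : ℝ, 0 < lam → ∀ t : ℕ → ℝ, t 0 = 0 → StrictMono t → ∀ Q S : ℕ, 1 ≤ Q →
      ∃ πfull πhull : Measure (BSP.State d m),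
        (∀ π, BSP.IsEquilibrium (BSP.sweep .full P x y v lam t Q S) π ↔ π = πfull) ∧
        (∀ π, BSP.IsEquilibrium (BSP.sweep .hull P x y v lam t Q S) π ↔ π = πhull) ∧
        IsProbabilityMeasure (πfull.map (BSP.restrictState P x)) ∧
        πfull.map (BSP.restrictState P x) = πhull.map (BSP.restrictState P x) ∧
        ∀ᵐ st ∂πhull, ∀ j, (BSP.restrictToHulls P x (st.2 j)).1.length = (st.2 j).2.length) := by
  refine ⟨fun T h => ?_, fun τ hτ => ?_, fun lam hl t ht0 ht Q S hQ => ?_⟩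
  · have hf := BSP.rate_pos x hd hP .full T h
    exact ⟨BSP.isProbabilityMeasure_cutLaw x hP .full T hf,
      BSP.isProbabilityMeasure_cutLaw x hP .hull T (BSP.rate_pos x hd hP .hull T h),
      BSP.cond_cutLaw x hP T hf⟩
  · have := BSP.isProbabilityMeasure_treePrior (s := .full) (x := x) hP v τ
    exact ⟨Measure.isProbabilityMeasure_map (BSP.measurable_restrictToHulls x).aemeasurable,
      BSP.map_restrictToHulls_growRoot hP hτ.le, BSP.ae_growRoot_hull_noDroppedCuts hP hτ.le⟩
  · have hτ : 0 ≤ t (S + 1) := ht0 ▸ ht.monotone (Nat.zero_le _)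
    have hr := BSP.measurable_restrictState (m := m) (P := P) (x := x)
    have hmap := BSP.map_restrictState_posterior (y := y) (v := v) (m := m) (x := x) hP hl hτ
    -- The two posteriors have the same normalizing constant.
    have hz : BSP.posterior .full P x y v lam (t (S + 1)) m Set.univ =
        BSP.posterior .hull P x y v lam (t (S + 1)) m Set.univ := by
      have h := congrArg (fun μ => μ Set.univ) hmap
      simpa only [Measure.map_apply hr MeasurableSet.univ, Set.preimage_univ] using h
    have hfull := BSP.isEquilibrium_sweep_iff (s := .full) (x := x) (y := y) (m := m) hP hv hl ht0
      ht hQ S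
    have hhull := BSP.isEquilibrium_sweep_iff (s := .hull) (x := x) (y := y) (m := m) hP hv hl ht0
      ht hQ S
    refine ⟨_, _, hfull, hhull, ?_, ?_, ?_⟩
    · have := ((hfull _).2 rfl).1
      exact Measure.isProbabilityMeasure_map hr.aemeasurable
    · rw [Measure.map_smul, Measure.map_smul, hmap, hz]
    · exact Measure.ae_smul_measure (BSP.ae_posterior_hull_noDroppedCuts hP hl hτ) _
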